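/- Let $\mathrm{pos}(t)=1$ if $t>0$ and $\mathrm{pos}(t)=0$ otherwise; let $\Phi$ be the standard Gaussian distribution function, and let $\lambda_{\max},\lambda_{\min}$ be the largest and smallest eigenvalue of $\Sigma$. For a distribution $\mathcal D$ on $\mathbb R^d$, a function $f:\mathbb R^d\to\{0,1\}$ and integers $1\le k\le q-1$, the bag oracle $\mathrm{Ex}(f,\mathcal D,q,k)$ returns an unordered bag of $q$ independent vectors, $k$ of them distributed as $\mathcal D$ conditioned on $f=1$ and $q-k$ of them as $\mathcal D$ conditioned on $f=0$. There are a single algorithm (a fixed program of a real random access machine with exact unit-cost arithmetic, whose input is $d,q,k,m$ and $m$ bags, each presented in arbitrary order, and whose output is a pair $(\hat r,\hat c)\in\mathbb R^d\times\mathbb R$), an absolute constant $C>0$ and a fixed polynomial $P$ such that the following holds. Let $q>2$, $k\in\{1,\dots,q-1\}$, $\mu\in\mathbb R^d$, let $\Sigma\in\mathbb R^{d\times d}$ be positive definite, $\mathcal D=N(\mu,\Sigma)$, $r_*\in\mathbb R^d\setminus\{0\}$, $c_*\in\mathbb R$, $f(x)=\mathrm{pos}(r_*^{\mathsf T}x+c_*)$,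 $\varepsilon,\delta\in(0,1)$, and $$\ell=-\frac{c_*+r_*^{\mathsf T}\mu}{\|\Sigma^{1/2}r_*\|_2}.$$ If $$m\ \ge\ C\,\frac{d}{\varepsilon^4}\cdot\frac{\max(1,\ell^2)}{(\Phi(\ell)(1-\Phi(\ell)))^2}\cdot\log\frac{2d}{\delta}\cdot\Big(\frac{\lambda_{\max}}{\lambda_{\min}}\Big)^4\Big(\frac{\sqrt{\lambda_{\max}}+\|\mu\|_2}{\sqrt{\lambda_{\min}}}\Big)^4 q^8,$$ then on every input of $m$ bags the algorithm stops after at most $P(m)$ steps, and if the $m$ bags are drawn independently from $\mathrm{Ex}(f,\mathcal D,q,k)$, then with probability at least $1-\delta$ the hypothesis $h(x)=\mathrm{pos}(\hat r^{\mathsf T}x+\hat c)$ satisfies - if $k\ne q/2$: $\Pr_{\mathcal D}[f(x)\ne h(x)]\le\varepsilon$; - if $k=q/2$: $\min\{\Pr_{\mathcal D}[f(x)\ne h(x)],\ \Pr_{\mathcal D}[f(x)\ne\tilde h(x)]\}\le\varepsilon$, where $\tilde h(x)=\mathrm{pos}(-\hat r^{\mathsf T}x-\hat c)$. -/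

import Mathlib

open MeasureTheory ProbabilityTheory

noncomputable section

namespace LLP

/-! ### Linear threshold functions and the bag oracle -/

/-- The space of feature vectors, with the Euclidean norm. -/
abbrev Vec (d : ℕ) : Type := EuclideanSpace ℝ (Fin d)

/-- `pos t = 1` if `t > 0`, and `pos t = 0` otherwise. -/
def pos (t : ℝ) : Fin 2 := if 0 < t then 1 else 0

/-- The linear threshold function `x ↦ pos (rᵀ x + c)`. -/
def ltf {d : ℕ} (r : Vec d) (c : ℝ) (x : Vec d) : Fin 2 := pos (inner ℝ r x + c)

/-- The law of one bag of the oracle `Ex(f, D, q, k)`: independent vectors, the first `k` of them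
from `D` conditioned on `f = 1`, the remaining `q - k` from `D` conditioned on `f = 0`. -/
def bagOracle {d : ℕ} (f : Vec d → Fin 2) (D : Measure (Vec d)) (q k : ℕ) :
    Measure (Fin q → Vec d) :=
  Measure.pi fun i => if (i : ℕ) < k then D[|{x | f x = 1}] else D[|{x | f x = 0}]

/-- The law of `m` independent bags of the oracle. -/
def bagSample {d : ℕ} (f : Vec d → Fin 2) (D : Measure (Vec d)) (q k m : ℕ) :
    Measure (Fin m → Fin q → Vec d) :=
  Measure.pi fun _ => bagOracle f D q k

/-! ### Real random access machines

Programs in a small imperative language over natural-number registers and arrays of real numbers.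
Arithmetic on reals is exact and has unit cost. A program is a finite piece of syntax, and its only
built-in constants are natural numbers. All loops are counted, so every program halts. -/

/-- A machine state: the natural-number registers, and the real arrays (`real a i j l` is the entry
with index `(i, j, l)` of the array named `a`). -/
structure Store where
  nat : ℕ → ℕ
  real : ℕ → ℕ → ℕ → ℕ → ℝ

def Store.setNat (s : Store) (v n : ℕ) : Store :=
  { s with nat := fun w => if w = v then n else s.nat w }

def Store.setReal (s : Store) (a i j l : ℕ) (t : ℝ) : Store :=
  { s with real := fun a' i' j' l' =>
      if a' = a ∧ i' = i ∧ j' = j ∧ l' = l then t else s.real a' i' j' l' }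

/-- Expressions for natural numbers; `sub` is truncated subtraction. -/
inductive NatExpr where
  | lit (n : ℕ)
  | reg (v : ℕ)
  | add (e₁ e₂ : NatExpr)
  | sub (e₁ e₂ : NatExpr)

def NatExpr.eval (s : Store) : NatExpr → ℕ
  | lit n => n
  | reg v => s.nat v
  | add e₁ e₂ => e₁.eval s + e₂.eval s
  | sub e₁ e₂ => e₁.eval s - e₂.eval s

/-- The number of operations needed to evaluate an expression. -/
def NatExpr.cost : NatExpr → ℕ
  | lit _ => 1
  | reg _ => 1
  | add e₁ e₂ => e₁.cost + e₂.cost + 1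
  | sub e₁ e₂ => e₁.cost + e₂.cost + 1

/-- Expressions for real numbers: the four arithmetic operations (a division by zero returns
zero), array entries, and natural numbers. -/
inductive RealExpr where
  | ofNat (e : NatExpr)
  | read (a : ℕ) (i j l : NatExpr)
  | add (e₁ e₂ : RealExpr)
  | sub (e₁ e₂ : RealExpr)
  | mul (e₁ e₂ : RealExpr)
  | div (e₁ e₂ : RealExpr)

def RealExpr.eval (s : Store) : RealExpr → ℝ
  | ofNat e => (e.eval s : ℝ)
  | read a i j l => s.real a (i.eval s) (j.eval s) (l.eval s)
  | add e₁ e₂ => e₁.eval s + e₂.eval s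
  | sub e₁ e₂ => e₁.eval s - e₂.eval s
  | mul e₁ e₂ => e₁.eval s * e₂.eval s
  | div e₁ e₂ => e₁.eval s / e₂.eval s

/-- The number of operations needed to evaluate an expression. -/
def RealExpr.cost : RealExpr → ℕ
  | ofNat e => e.cost + 1
  | read _ i j l => i.cost + j.cost + l.cost + 1
  | add e₁ e₂ => e₁.cost + e₂.cost + 1
  | sub e₁ e₂ => e₁.cost + e₂.cost + 1
  | mul e₁ e₂ => e₁.cost + e₂.cost + 1
  | div e₁ e₂ => e₁.cost + e₂.cost + 1

/-- Comparisons. -/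
inductive Test where
  | natLt (e₁ e₂ : NatExpr)
  | realLt (e₁ e₂ : RealExpr)

def Test.holds (s : Store) : Test → Prop
  | natLt e₁ e₂ => e₁.eval s < e₂.eval s
  | realLt e₁ e₂ => e₁.eval s < e₂.eval s

def Test.cost : Test → ℕ
  | natLt e₁ e₂ => e₁.cost + e₂.cost + 1
  | realLt e₁ e₂ => e₁.cost + e₂.cost + 1

/-- Programs. `loop v e p` evaluates `e` once, to `n` say, and then runs `p` with register `v` set
to `0, 1, …, n - 1` in turn. -/
inductive Prog where
  | skip
  | setNat (v : ℕ) (e : NatExpr)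
  | setReal (a : ℕ) (i j l : NatExpr) (e : RealExpr)
  | seq (p₁ p₂ : Prog)
  | ite (t : Test) (p₁ p₂ : Prog)
  | loop (v : ℕ) (e : NatExpr) (p : Prog)

open Classical in
/-- The final state of a program together with the number of steps it takes. -/
def Prog.run : Prog → Store → Store × ℕ
  | skip, s => (s, 1)
  | setNat v e, s => (s.setNat v (e.eval s), e.cost + 1)
  | setReal a i j l e, s =>
      (s.setReal a (i.eval s) (j.eval s) (l.eval s) (e.eval s),
        i.cost + j.cost + l.cost + e.cost + 1)
  | seq p₁ p₂, s =>
      ((p₂.run (p₁.run s).1).1, (p₁.run s).2 + (p₂.run (p₁.run s).1).2)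
  | ite t p₁ p₂, s =>
      if t.holds s then ((p₁.run s).1, t.cost + (p₁.run s).2 + 1)
      else ((p₂.run s).1, t.cost + (p₂.run s).2 + 1)
  | loop v e p, s =>
      Nat.rec (motive := fun _ => Store × ℕ) (s, e.cost + 1)
        (fun i st =>
          ((p.run (st.1.setNat v i)).1, st.2 + (p.run (st.1.setNat v i)).2 + 1))
        (e.eval s)

/-- The initial state of a learner: registers `0, 1, 2, 3` hold `d, q, k, m`, array `0` holds the
bags (entry `(j, i, l)` is coordinate `l` of vector `i` of bag `j`), all else is zero. -/
def inputStore {d q m : ℕ} (k : ℕ) (bags : Fin m → Fin q → Vec d) : Store where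
  nat v := if v = 0 then d else if v = 1 then q else if v = 2 then k else if v = 3 then m else 0
  real a j i l :=
    if h : a = 0 ∧ j < m ∧ i < q ∧ l < d then
      bags ⟨j, h.2.1⟩ ⟨i, h.2.2.1⟩ ⟨l, h.2.2.2⟩
    else 0

/-- The number of steps of the program on the given bags. -/
def Prog.steps (A : Prog) {d q m : ℕ} (k : ℕ) (bags : Fin m → Fin q → Vec d) : ℕ :=
  (A.run (inputStore k bags)).2

/-- The normal vector that the program outputs, in array `1`. -/
def Prog.outVec (A : Prog) {d q m : ℕ} (k : ℕ) (bags : Fin m → Fin q → Vec d) : Vec d :=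
  WithLp.toLp 2 fun l => (A.run (inputStore k bags)).1.real 1 l 0 0

/-- The offset that the program outputs, in array `2`. -/
def Prog.outOffset (A : Prog) {d q m : ℕ} (k : ℕ) (bags : Fin m → Fin q → Vec d) : ℝ :=
  (A.run (inputStore k bags)).1.real 2 0 0 0

/-! ### The guarantee and the sample complexity -/

/-- The hypothesis `pos (rᵀ x + c)` has error at most `ε` with respect to `f`; for balanced bags,
it or `pos (-rᵀ x - c)` has. -/
def Accurate {d : ℕ} (f : Vec d → Fin 2) (D : Measure (Vec d)) (q k : ℕ) (ε : ℝ)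
    (r : Vec d) (c : ℝ) : Prop :=
  (2 * k ≠ q → D {x | f x ≠ ltf r c x} ≤ ENNReal.ofReal ε) ∧
  (2 * k = q →
    min (D {x | f x ≠ ltf r c x}) (D {x | f x ≠ ltf (-r) (-c) x}) ≤ ENNReal.ofReal ε)

/-- The largest eigenvalue. -/
def lamMax {d : ℕ} {S : Matrix (Fin d) (Fin d) ℝ} (hS : S.PosDef) : ℝ :=
  ⨆ i, hS.isHermitian.eigenvalues i

/-- The smallest eigenvalue. -/
def lamMin {d : ℕ} {S : Matrix (Fin d) (Fin d) ℝ} (hS : S.PosDef) : ℝ :=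
  ⨅ i, hS.isHermitian.eigenvalues i

/-- The standard Gaussian distribution function. -/
def Phi (t : ℝ) : ℝ := cdf (gaussianReal 0 1) t

open scoped MatrixOrder in
/-- The normalized offset `ℓ = -(c + rᵀ μ) / ‖S ^ (1/2) r‖`. -/
def normOffset {d : ℕ} (μ : Vec d) (S : Matrix (Fin d) (Fin d) ℝ) (r : Vec d) (c : ℝ) : ℝ :=
  -(c + inner ℝ r μ) / ‖Matrix.toEuclideanCLM (𝕜 := ℝ) (CFC.sqrt S) r‖

/-- The sample complexity, up to an absolute constant factor. -/
def sampleBound {d : ℕ} (q : ℕ) (μ : Vec d) {S : Matrix (Fin d) (Fin d) ℝ} (hS : S.PosDef)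
    (ℓ ε δ : ℝ) : ℝ :=
  (d / ε ^ 4) * (max 1 (ℓ ^ 2) / (Phi ℓ * (1 - Phi ℓ)) ^ 2) * Real.log (2 * d / δ)
    * (lamMax hS / lamMin hS) ^ 4
    * ((√(lamMax hS) + ‖μ‖) / √(lamMin hS)) ^ 4 * (q : ℝ) ^ 8

end LLP

end

/-!
The learner estimates the direction of the normal vector from second moments, guesses the
threshold from data points, and selects among the resulting hypotheses the one whose counts in
fresh bags fit the prescribed count `k` best. The bags are split by index into four quarters: two
for the moments, one for the thresholds, one for the selection. Everything it computes is symmetric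
in the vectors of a bag, up to the order of its list of candidates, so the order in which the
vectors of a bag are presented does not affect the guarantee (`learner_output_perm`).

*The direction.* Write `T = Σ^(1/2)` and let `e` be the unit vector in the direction of `T r`. A
pair of bags gives the operator `covOp`, the sum of the squares `(x - x') ⊗ (x - x')` over all `x`
in one bag and `x'` in the other, and the operator `gapOp`, which subtracts from it `q` times the
square of the difference of the two bag sums. The mean of `covOp` is a multiple of
`T² + (β - 1) Te ⊗ Te` with `β` bounded below in terms of `q` alone. In `gapOp` the within-class
variances cancel, because every bag contains exactly `k` positive vectors: its mean is the rank one
operator `2k(q-k)g² Te ⊗ Te`, where `g`, the normalized distance of the two class means, is at least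
`1/2` (`half_le_gap`). Hence the range of the second mean is spanned by `Te`, and the inverse of the
first one takes this vector to a multiple of `r`.

The empirical operators are close to their means: a Bernstein inequality (`sum_deviation`)
controls the quadratic form in a fixed direction, since the Gaussian law conditioned on a
half-space has moments bounded through the logarithm of the mass of that half-space, and a finite
norming set (`exists_norming_set`) makes the bound uniform over all directions
(`operator_concentration`). A program with field operations only cannot compute eigenvectors or
square roots exactly, so the top direction of `gapOp` is found by power iteration from the basis
vectors, one of which overlaps with it sufficiently (`exists_power_iteration`), and `covOp` is
inverted on it by a Neumann series normalized by the trace (`neumann_approx`). Some candidate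
direction is then close to `±r` (`exists_dirVec_near`), and a polynomial number of steps suffices
(`learner_steps_le`).

*The threshold.* For the estimated direction `w` there is an ideal threshold `θ`, at which the
half-space orthogonal to `w` has small error because a Gaussian law puts little mass near a
hyperplane (`halfspace_error`). Some vector of the third quarter gives a threshold between which and
`θ` the two classes have little mass (`exists_threshold`), so the half-space through that data
point has small error as well.

*The selection.* If `N` is the number of vectors in a bag on which a hypothesis is `1`, then the
mean of `N² - 2kN + k²` is the mean square deviation of the count from `k`, called `bagErr`. On the
last quarter the empirical version concentrates for all candidates simultaneously
(`score_deviation`), so the candidate of least score has a small `bagErr`. The mean and the variance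
of `N` are explicit in the error probabilities of the hypothesis on the two classes, so a small
`bagErr` forces these to be both close to `0`, or, when `k = q/2`, possibly both close to `1`, in
which case the complementary hypothesis is accurate (`small_of_countErr`,
`accurate_of_bagErr_le`).

The sample size pays for the powers of the logarithm of the mass of the smaller class, because
these are bounded by `(Φ(ℓ)(1 - Φ(ℓ)))⁻²` up to a constant (`logMass_pow_le`).
-/

open MeasureTheory ProbabilityTheory

noncomputable section

namespace LLP

/-! ### Reasoning about programs -/

/-- The final state of a program. -/
noncomputable def Prog.exec (p : Prog) (s : Store) : Store := (p.run s).1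

theorem exec_seq (p₁ p₂ : Prog) (s : Store) :
    (Prog.seq p₁ p₂).exec s = p₂.exec (p₁.exec s) := rfl

theorem exec_setReal (a : ℕ) (i j l : NatExpr) (e : RealExpr) (s : Store) :
    (Prog.setReal a i j l e).exec s
      = s.setReal a (i.eval s) (j.eval s) (l.eval s) (e.eval s) := rfl

theorem exec_setNat (v : ℕ) (e : NatExpr) (s : Store) :
    (Prog.setNat v e).exec s = s.setNat v (e.eval s) := rfl

open Classical in
theorem exec_ite (t : Test) (p₁ p₂ : Prog) (s : Store) :
    (Prog.ite t p₁ p₂).exec s = if t.holds s then p₁.exec s else p₂.exec s := by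
  simp only [Prog.exec, Prog.run]; split_ifs <;> rfl

theorem exec_loop (v : ℕ) (e : NatExpr) (p : Prog) (s : Store) :
    (Prog.loop v e p).exec s
      = Nat.rec (motive := fun _ => Store) s (fun i t => p.exec (t.setNat v i)) (e.eval s) := by
  simp only [Prog.exec, Prog.run]
  induction e.eval s with
  | zero => rfl
  | succ n ih => simp only [ih]

/-- Loop invariants. -/
theorem exec_loop_induction {v : ℕ} {e : NatExpr} {p : Prog} {s : Store} (I : ℕ → Store → Prop)
    (h0 : I 0 s) (hs : ∀ i < e.eval s, ∀ t, I i t → I (i + 1) (p.exec (t.setNat v i))) :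
    I (e.eval s) ((Prog.loop v e p).exec s) := by
  rw [exec_loop]
  have key : ∀ n ≤ e.eval s, I n
      (Nat.rec (motive := fun _ => Store) s (fun i t => p.exec (t.setNat v i)) n) := by
    intro n
    induction n with
    | zero => intro _; exact h0
    | succ n ih => intro hn; exact hs n (by omega) _ (ih (by omega))
  exact key _ le_rfl

@[simp] theorem setNat_real (s : Store) (v n : ℕ) : (s.setNat v n).real = s.real := rfl

@[simp] theorem setNat_nat (s : Store) (v n w : ℕ) :
    (s.setNat v n).nat w = if w = v then n else s.nat w := rfl

@[simp] theorem setReal_nat (s : Store) (a i j l : ℕ) (t : ℝ) :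
    (s.setReal a i j l t).nat = s.nat := rfl

/-- The expression mentions no register of the list `R`. -/
def NatExpr.Avoids (R : List ℕ) : NatExpr → Prop
  | lit _ => True
  | reg v => v ∉ R
  | add e₁ e₂ => e₁.Avoids R ∧ e₂.Avoids R
  | sub e₁ e₂ => e₁.Avoids R ∧ e₂.Avoids R

/-- The expression mentions neither a register of the list `R` nor the array `a`. -/
def RealExpr.Avoids (R : List ℕ) (a : ℕ) : RealExpr → Prop
  | ofNat e => e.Avoids R
  | read b i j l => b ≠ a ∧ i.Avoids R ∧ j.Avoids R ∧ l.Avoids R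
  | add e₁ e₂ => e₁.Avoids R a ∧ e₂.Avoids R a
  | sub e₁ e₂ => e₁.Avoids R a ∧ e₂.Avoids R a
  | mul e₁ e₂ => e₁.Avoids R a ∧ e₂.Avoids R a
  | div e₁ e₂ => e₁.Avoids R a ∧ e₂.Avoids R a

/-- The test mentions neither a register of the list `R` nor the array `a`. -/
def Test.Avoids (R : List ℕ) (a : ℕ) : Test → Prop
  | natLt e₁ e₂ => e₁.Avoids R ∧ e₂.Avoids R
  | realLt e₁ e₂ => e₁.Avoids R a ∧ e₂.Avoids R a

theorem NatExpr.Avoids.eval_congr {R : List ℕ} {e : NatExpr} (he : e.Avoids R) {s t : Store}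
    (h : ∀ v ∉ R, s.nat v = t.nat v) : e.eval s = e.eval t := by
  induction e with
  | lit n => rfl
  | reg v => exact h v he
  | add e₁ e₂ h₁ h₂ => simp only [NatExpr.eval, h₁ he.1, h₂ he.2]
  | sub e₁ e₂ h₁ h₂ => simp only [NatExpr.eval, h₁ he.1, h₂ he.2]

theorem RealExpr.Avoids.eval_congr {R : List ℕ} {a : ℕ} {e : RealExpr} (he : e.Avoids R a)
    {s t : Store} (h : ∀ v ∉ R, s.nat v = t.nat v) (hr : ∀ b ≠ a, s.real b = t.real b) :
    e.eval s = e.eval t := by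
  induction e with
  | ofNat e => simp only [RealExpr.eval, NatExpr.Avoids.eval_congr he h]
  | read b i j l =>
    obtain ⟨h0, h1, h2, h3⟩ := he
    simp only [RealExpr.eval, h1.eval_congr h, h2.eval_congr h, h3.eval_congr h, hr b h0]
  | add e₁ e₂ h₁ h₂ => simp only [RealExpr.eval, h₁ he.1, h₂ he.2]
  | sub e₁ e₂ h₁ h₂ => simp only [RealExpr.eval, h₁ he.1, h₂ he.2]
  | mul e₁ e₂ h₁ h₂ => simp only [RealExpr.eval, h₁ he.1, h₂ he.2]
  | div e₁ e₂ h₁ h₂ => simp only [RealExpr.eval, h₁ he.1, h₂ he.2]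

theorem Test.Avoids.holds_congr {R : List ℕ} {a : ℕ} {c : Test} (hc : c.Avoids R a)
    {s t : Store} (h : ∀ v ∉ R, s.nat v = t.nat v) (hr : ∀ b ≠ a, s.real b = t.real b) :
    c.holds s ↔ c.holds t := by
  cases c with
  | natLt e₁ e₂ => simp only [Test.holds, hc.1.eval_congr h, hc.2.eval_congr h]
  | realLt e₁ e₂ => simp only [Test.holds, hc.1.eval_congr h hr, hc.2.eval_congr h hr]

/-- The program `p` adds the value of `Δ`, taken at its initial state, to the array `a`, changes
no other array, and changes no register outside `R`; and `Δ` itself depends neither on `a` nor on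
the registers in `R`. -/
structure Adds (p : Prog) (a : ℕ) (R : List ℕ) (Δ : Store → ℕ → ℕ → ℕ → ℝ) : Prop where
  real_same : ∀ s x y z, (p.exec s).real a x y z = s.real a x y z + Δ s x y z
  real_ne : ∀ s, ∀ b ≠ a, (p.exec s).real b = s.real b
  nat_eq : ∀ s, ∀ v ∉ R, (p.exec s).nat v = s.nat v
  congr : ∀ s t, (∀ v ∉ R, s.nat v = t.nat v) → (∀ b ≠ a, s.real b = t.real b) → Δ s = Δ t

/-- The assignment `a[i, j, l] += e`. -/
def accum (a : ℕ) (i j l : NatExpr) (e : RealExpr) : Prog :=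
  .setReal a i j l (.add (.read a i j l) e)

theorem Adds.accum {a : ℕ} {R : List ℕ} {i j l : NatExpr} {e : RealExpr} (hi : i.Avoids R)
    (hj : j.Avoids R) (hl : l.Avoids R) (he : e.Avoids R a) :
    Adds (accum a i j l e) a R
      (fun s x y z => if x = i.eval s ∧ y = j.eval s ∧ z = l.eval s then e.eval s else 0) where
  real_same s x y z := by
    simp only [LLP.accum, exec_setReal, Store.setReal, RealExpr.eval, true_and]
    split_ifs with h
    · rw [h.1, h.2.1, h.2.2]
    · simp
  real_ne s b hb := by
    funext x y z
    simp [LLP.accum, exec_setReal, Store.setReal, hb]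
  nat_eq s v _ := rfl
  congr s t h hr := by
    funext x y z
    rw [hi.eval_congr h, hj.eval_congr h, hl.eval_congr h, he.eval_congr h hr]

theorem Adds.seq {p₁ p₂ : Prog} {a : ℕ} {R : List ℕ} {Δ₁ Δ₂ : Store → ℕ → ℕ → ℕ → ℝ}
    (h₁ : Adds p₁ a R Δ₁) (h₂ : Adds p₂ a R Δ₂) :
    Adds (.seq p₁ p₂) a R (fun s x y z => Δ₁ s x y z + Δ₂ s x y z) where
  real_same s x y z := by
    rw [exec_seq, h₂.real_same, h₁.real_same,
      h₂.congr (p₁.exec s) s (h₁.nat_eq s) (h₁.real_ne s)]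
    ring
  real_ne s b hb := by rw [exec_seq, h₂.real_ne _ b hb, h₁.real_ne _ b hb]
  nat_eq s v hv := by rw [exec_seq, h₂.nat_eq _ v hv, h₁.nat_eq _ v hv]
  congr s t h hr := by rw [h₁.congr s t h hr, h₂.congr s t h hr]

open Classical in
theorem Adds.guard {p : Prog} {a : ℕ} {R : List ℕ} {Δ : Store → ℕ → ℕ → ℕ → ℝ}
    (h : Adds p a R Δ) {c : Test} (hc : c.Avoids R a) :
    Adds (.ite c p .skip) a R (fun s x y z => if c.holds s then Δ s x y z else 0) where
  real_same s x y z := by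
    rw [exec_ite]
    split_ifs with h1
    · exact h.real_same s x y z
    · simp [Prog.exec, Prog.run]
  real_ne s b hb := by
    rw [exec_ite]
    split_ifs with h1
    · exact h.real_ne s b hb
    · rfl
  nat_eq s v hv := by
    rw [exec_ite]
    split_ifs with h1
    · exact h.nat_eq s v hv
    · rfl
  congr s t h1 hr := by
    funext x y z
    simp only [hc.holds_congr h1 hr, h.congr s t h1 hr]

/-- A counted loop around a program that adds `Δ` adds the sum of the `Δ`. The loop register
becomes one of those that may change, so it must not occur in the bound `e`. -/
theorem Adds.loop {p : Prog} {a : ℕ} {R : List ℕ} {Δ : Store → ℕ → ℕ → ℕ → ℝ}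
    (h : Adds p a R Δ) (v : ℕ) {e : NatExpr} (he : e.Avoids (v :: R)) :
    Adds (.loop v e p) a (v :: R)
      (fun s x y z => ∑ i ∈ Finset.range (e.eval s), Δ (s.setNat v i) x y z) := by
  have cong : ∀ s t : Store, (∀ w ∉ v :: R, s.nat w = t.nat w) → (∀ b ≠ a, s.real b = t.real b) →
      ∀ i, Δ (s.setNat v i) = Δ (t.setNat v i) := by
    intro s t h1 h2 i
    refine h.congr _ _ (fun w hw => ?_) h2
    simp only [setNat_nat]
    split_ifs with hwv
    · rfl
    · exact h1 w (by simp [hwv, hw])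
  have main : ∀ s, (∀ x y z, ((Prog.loop v e p).exec s).real a x y z
        = s.real a x y z + ∑ i ∈ Finset.range (e.eval s), Δ (s.setNat v i) x y z) ∧
      (∀ b ≠ a, ((Prog.loop v e p).exec s).real b = s.real b) ∧
      (∀ w ∉ v :: R, ((Prog.loop v e p).exec s).nat w = s.nat w) := by
    intro s
    refine exec_loop_induction (fun n t => (∀ x y z, t.real a x y z
        = s.real a x y z + ∑ i ∈ Finset.range n, Δ (s.setNat v i) x y z) ∧
      (∀ b ≠ a, t.real b = s.real b) ∧ (∀ w ∉ v :: R, t.nat w = s.nat w))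
      ⟨by simp, by simp, by simp⟩ ?_
    rintro i - t ⟨h1, h2, h3⟩
    refine ⟨fun x y z => ?_, fun b hb => ?_, fun w hw => ?_⟩
    · rw [h.real_same, setNat_real, h1, Finset.sum_range_succ, cong t s h3 h2]
      ring
    · rw [h.real_ne _ b hb, setNat_real, h2 b hb]
    · rw [List.mem_cons, not_or] at hw
      rw [h.nat_eq _ w hw.2, setNat_nat, if_neg hw.1, h3 w (by simp [hw])]
  exact
    { real_same := fun s => (main s).1
      real_ne := fun s => (main s).2.1
      nat_eq := fun s => (main s).2.2
      congr := fun s t h1 h2 => by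
        funext x y z
        rw [he.eval_congr h1]
        exact Finset.sum_congr rfl fun i _ => by rw [cong s t h1 h2 i] }

/-! ### Polynomial running time -/

/-- Only the input registers `0, …, 3` are mentioned. -/
def NatExpr.InputOnly : NatExpr → Prop
  | lit _ => True
  | reg v => v < 4
  | add e₁ e₂ => e₁.InputOnly ∧ e₂.InputOnly
  | sub e₁ e₂ => e₁.InputOnly ∧ e₂.InputOnly

/-- The program does not assign to the input registers, and the numbers of iterations of its loops
are expressions in the input registers. -/
def Prog.InputBounded : Prog → Prop
  | skip => True
  | setNat v _ => 4 ≤ v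
  | setReal _ _ _ _ _ => True
  | seq p₁ p₂ => p₁.InputBounded ∧ p₂.InputBounded
  | ite _ p₁ p₂ => p₁.InputBounded ∧ p₂.InputBounded
  | loop v e p => 4 ≤ v ∧ e.InputOnly ∧ p.InputBounded

theorem Prog.InputBounded.nat_eq {p : Prog} (hp : p.InputBounded) (s : Store) {v : ℕ}
    (hv : v < 4) : (p.exec s).nat v = s.nat v := by
  induction p generalizing s with
  | skip => rfl
  | setNat w e =>
    have : 4 ≤ w := hp
    rw [exec_setNat, setNat_nat, if_neg (by omega)]
  | setReal a i j l e => rfl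
  | seq p₁ p₂ h₁ h₂ => rw [exec_seq, h₂ hp.2, h₁ hp.1]
  | ite t p₁ p₂ h₁ h₂ =>
    rw [exec_ite]
    split_ifs
    · exact h₁ hp.1 s
    · exact h₂ hp.2 s
  | loop w e p h =>
    have hw : 4 ≤ w := hp.1
    refine exec_loop_induction (fun _ t => t.nat v = s.nat v) rfl fun i _ t ht => ?_
    rw [h hp.2.2, setNat_nat, if_neg (by omega), ht]

/-- The expressions are sums and differences, without products, so their values are at most linear
in the input. -/
theorem NatExpr.InputOnly.eval_le {e : NatExpr} (he : e.InputOnly) :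
    ∃ c : ℕ, ∀ (M : ℕ) (s : Store), (∀ v < 4, s.nat v ≤ M) → e.eval s ≤ c * (M + 1) := by
  induction e with
  | lit n =>
    refine ⟨n, fun M s _ => ?_⟩
    simp only [NatExpr.eval]
    nlinarith
  | reg v =>
    refine ⟨1, fun M s h => ?_⟩
    have := h v he
    simp only [NatExpr.eval]
    omega
  | add e₁ e₂ h₁ h₂ =>
    obtain ⟨c₁, h₁⟩ := h₁ he.1
    obtain ⟨c₂, h₂⟩ := h₂ he.2
    refine ⟨c₁ + c₂, fun M s h => ?_⟩
    have := h₁ M s h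
    have := h₂ M s h
    simp only [NatExpr.eval]
    nlinarith
  | sub e₁ e₂ h₁ h₂ =>
    obtain ⟨c₁, h₁⟩ := h₁ he.1
    refine ⟨c₁, fun M s h => ?_⟩
    have := h₁ M s h
    simp only [NatExpr.eval]
    omega

/-- A program whose loop bounds depend only on the input runs in polynomial time: each level of
nesting of the loops raises the degree by at most one. -/
theorem Prog.InputBounded.steps_le {p : Prog} (hp : p.InputBounded) :
    ∃ c r : ℕ, ∀ (M : ℕ) (s : Store), (∀ v < 4, s.nat v ≤ M) → (p.run s).2 ≤ c * (M + 1) ^ r := by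
  induction p with
  | skip => exact ⟨1, 0, fun M s _ => by simp [Prog.run]⟩
  | setNat v e => exact ⟨e.cost + 1, 0, fun M s _ => by simp [Prog.run]⟩
  | setReal a i j l e =>
    exact ⟨i.cost + j.cost + l.cost + e.cost + 1, 0, fun M s _ => by simp [Prog.run]⟩
  | seq p₁ p₂ h₁ h₂ =>
    obtain ⟨c₁, r₁, h₁⟩ := h₁ hp.1
    obtain ⟨c₂, r₂, h₂⟩ := h₂ hp.2
    refine ⟨c₁ + c₂, r₁ + r₂, fun M s h => ?_⟩
    have a₁ := h₁ M s h
    have a₂ := h₂ M (p₁.exec s) fun v hv => by rw [hp.1.nat_eq s hv]; exact h v hv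
    have b₁ : (M + 1) ^ r₁ ≤ (M + 1) ^ (r₁ + r₂) := Nat.pow_le_pow_right (by omega) (by omega)
    have b₂ : (M + 1) ^ r₂ ≤ (M + 1) ^ (r₁ + r₂) := Nat.pow_le_pow_right (by omega) (by omega)
    have e₁ := Nat.mul_le_mul_left c₁ b₁
    have e₂ := Nat.mul_le_mul_left c₂ b₂
    change (p₁.run s).2 + (p₂.run (p₁.exec s)).2 ≤ _
    rw [add_mul]
    omega
  | ite t p₁ p₂ h₁ h₂ =>
    obtain ⟨c₁, r₁, h₁⟩ := h₁ hp.1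
    obtain ⟨c₂, r₂, h₂⟩ := h₂ hp.2
    refine ⟨c₁ + c₂ + (t.cost + 1), r₁ + r₂, fun M s h => ?_⟩
    have a₁ := h₁ M s h
    have a₂ := h₂ M s h
    have b₁ : (M + 1) ^ r₁ ≤ (M + 1) ^ (r₁ + r₂) := Nat.pow_le_pow_right (by omega) (by omega)
    have b₂ : (M + 1) ^ r₂ ≤ (M + 1) ^ (r₁ + r₂) := Nat.pow_le_pow_right (by omega) (by omega)
    have e₁ := Nat.mul_le_mul_left c₁ b₁
    have e₂ := Nat.mul_le_mul_left c₂ b₂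
    have e₃ := Nat.mul_le_mul_left (t.cost + 1)
      (Nat.one_le_pow (r₁ + r₂) (M + 1) (by omega))
    simp only [Prog.run]
    rw [add_mul, add_mul]
    split_ifs <;> simp only <;> omega
  | loop v e p h =>
    obtain ⟨c, r, h⟩ := h hp.2.2
    obtain ⟨c', he⟩ := hp.2.1.eval_le
    refine ⟨e.cost + 1 + c' * (c + 1), r + 1, fun M s hs => ?_⟩
    -- the bodies leave the input registers unchanged, so each of the `n` passes obeys the same bound
    have key : ∀ n, (∀ u < 4, (Nat.rec (motive := fun _ => Store × ℕ) (s, e.cost + 1)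
        (fun i st => ((p.run (st.1.setNat v i)).1, st.2 + (p.run (st.1.setNat v i)).2 + 1))
          n).1.nat u ≤ M) ∧ (Nat.rec (motive := fun _ => Store × ℕ) (s, e.cost + 1)
        (fun i st => ((p.run (st.1.setNat v i)).1, st.2 + (p.run (st.1.setNat v i)).2 + 1))
          n).2 ≤ e.cost + 1 + n * ((c + 1) * (M + 1) ^ r) := by
      intro n
      induction n with
      | zero => exact ⟨hs, by simp⟩
      | succ n ih =>
        obtain ⟨ih₁, ih₂⟩ := ih
        set st := (Nat.rec (motive := fun _ => Store × ℕ) (s, e.cost + 1)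
          (fun i st => ((p.run (st.1.setNat v i)).1, st.2 + (p.run (st.1.setNat v i)).2 + 1)) n)
        have hv : 4 ≤ v := hp.1
        have h4 : ∀ w < 4, (st.1.setNat v n).nat w ≤ M := fun w hw => by
          rw [setNat_nat, if_neg (by omega)]; exact ih₁ w hw
        refine ⟨fun w hw => ?_, ?_⟩
        · change (p.exec (st.1.setNat v n)).nat w ≤ M
          rw [hp.2.2.nat_eq _ hw]
          exact h4 w hw
        · have a := h M _ h4
          have b := Nat.one_le_pow r (M + 1) (by omega)
          change st.2 + (p.run (st.1.setNat v n)).2 + 1 ≤ _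
          rw [add_mul n 1]
          have : (c + 1) * (M + 1) ^ r = c * (M + 1) ^ r + (M + 1) ^ r := by ring
          omega
    have a := (key (e.eval s)).2
    have b := he M s hs
    have c1 := Nat.mul_le_mul_right ((c + 1) * (M + 1) ^ r) b
    have d := Nat.mul_le_mul_left (e.cost + 1) (Nat.one_le_pow (r + 1) (M + 1) (by omega))
    have e1 : c' * (M + 1) * ((c + 1) * (M + 1) ^ r) = c' * (c + 1) * (M + 1) ^ (r + 1) := by ring
    change (Nat.rec (motive := fun _ => Store × ℕ) (s, e.cost + 1)
        (fun i st => ((p.run (st.1.setNat v i)).1, st.2 + (p.run (st.1.setNat v i)).2 + 1))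
          (e.eval s)).2 ≤ _
    rw [add_mul]
    omega

/-! ### The learning program -/

/-- Four times the value of a register, plus a constant. -/
def quad (v n : ℕ) : NatExpr :=
  .add (.add (.add (.reg v) (.reg v)) (.add (.reg v) (.reg v))) (.lit n)

/-- The test that `4 v + 3` is the index of a bag, so that the bags `4 v, …, 4 v + 3` exist. -/
def inBlock (v : ℕ) : Test := .natLt (quad v 3) (.reg 3)

/-- Coordinate `l` of `x - x'`, for the vector `x` with index `i` in the bag `4 j` and the vector `x'`
with index `i'` in the bag `4 j + 1`; here `l`, `i` and `i'` name registers, and `j` is the content of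
register `4`. -/
def vecDiff (l : ℕ) (i i' : ℕ) : RealExpr :=
  .sub (.read 0 (quad 4 0) (.reg i) (.reg l)) (.read 0 (quad 4 1) (.reg i') (.reg l))

/-- Array `3`: the matrix `∑ (x - x') (x - x')ᵀ`, over all vectors `x` of a bag `4 j` and `x'` of
the bag `4 j + 1`. -/
def progN : Prog :=
  .loop 4 (.reg 3) <| .ite (inBlock 4)
    (.loop 5 (.reg 1) <| .loop 6 (.reg 1) <| .loop 7 (.reg 0) <| .loop 8 (.reg 0) <|
      accum 3 (.reg 7) (.reg 8) (.lit 0) (.mul (vecDiff 7 5 6) (vecDiff 8 5 6))) .skip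

/-- Array `4`: the matrix of array `3`, minus `q` times the sum of the `D Dᵀ`, where `D` is the
difference of the sums of the bags `4 j` and `4 j + 1`. -/
def progA : Prog :=
  .loop 4 (.reg 3) <| .ite (inBlock 4)
    (.loop 5 (.reg 1) <| .loop 6 (.reg 1) <| .loop 7 (.reg 0) <| .loop 8 (.reg 0) <|
      accum 4 (.reg 7) (.reg 8) (.lit 0) (.sub (.mul (vecDiff 7 5 6) (vecDiff 8 5 6))
        (.mul (.ofNat (.reg 1)) (.mul (vecDiff 7 5 5) (vecDiff 8 6 6))))) .skip

/-- Array `5`: the trace of array `3`. -/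
def progTr : Prog :=
  .loop 7 (.reg 0) <| accum 5 (.lit 0) (.lit 0) (.lit 0) (.read 3 (.reg 7) (.reg 7) (.lit 0))

/-- Array `6`: the identity matrix. -/
def progOne : Prog :=
  .loop 7 (.reg 0) <| accum 6 (.reg 7) (.reg 7) (.lit 0) (.ofNat (.lit 1))

/-- Array `6`: subtract array `3` divided by its trace. -/
def progB : Prog :=
  .loop 7 (.reg 0) <| .loop 8 (.reg 0) <| accum 6 (.reg 7) (.reg 8) (.lit 0)
    (.sub (.ofNat (.lit 0)) (.div (.read 3 (.reg 7) (.reg 8) (.lit 0))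
      (.read 5 (.lit 0) (.lit 0) (.lit 0))))

/-- Array `7`: the standard basis vectors, at time `0`. -/
def progBasis : Prog :=
  .loop 7 (.reg 0) <| accum 7 (.lit 0) (.reg 7) (.reg 7) (.ofNat (.lit 1))

/-- One application of the matrix in array `b` to all vectors that array `y` holds at the time in
register `9`, with the result first written to array `t`. -/
def progStep (b y t : ℕ) : Prog :=
  .seq (.loop 4 (.reg 0) <| .loop 7 (.reg 0) <| .loop 8 (.reg 0) <|
      accum t (.reg 9) (.reg 4) (.reg 7)
        (.mul (.read b (.reg 7) (.reg 8) (.lit 0)) (.read y (.reg 9) (.reg 4) (.reg 8))))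
    (.loop 4 (.reg 0) <| .loop 7 (.reg 0) <|
      accum y (.add (.reg 9) (.lit 1)) (.reg 4) (.reg 7) (.read t (.reg 9) (.reg 4) (.reg 7)))

/-- Apply the matrix in array `b` as many times as there are bags, starting from the vectors that
array `y` holds at time `0`; array `y` receives all iterates. -/
def progIter (b y t : ℕ) : Prog := .loop 9 (.reg 3) (progStep b y t)

/-- Array `9`: the result of the iteration in array `7`, at time `0`. -/
def progCopy : Prog :=
  .loop 4 (.reg 0) <| .loop 7 (.reg 0) <|
    accum 9 (.lit 0) (.reg 4) (.reg 7) (.read 7 (.reg 3) (.reg 4) (.reg 7))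

/-- Array `11`: the sums over time of the vectors in array `9`, and their opposites. -/
def progDir : Prog :=
  .loop 9 (.reg 3) <| .loop 4 (.reg 0) <| .loop 7 (.reg 0) <|
    .seq (accum 11 (.reg 4) (.reg 7) (.lit 0) (.read 9 (.reg 9) (.reg 4) (.reg 7)))
      (accum 11 (.add (.reg 0) (.reg 4)) (.reg 7) (.lit 0)
        (.sub (.ofNat (.lit 0)) (.read 9 (.reg 9) (.reg 4) (.reg 7))))

/-- Array `12`: the inner products of the directions in array `11` with all vectors. -/
def progProj : Prog :=
  .loop 4 (.add (.reg 0) (.reg 0)) <| .loop 5 (.reg 3) <| .loop 6 (.reg 1) <| .loop 7 (.reg 0) <|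
    accum 12 (.reg 4) (.reg 5) (.reg 6)
      (.mul (.read 11 (.reg 4) (.reg 7) (.lit 0)) (.read 0 (.reg 5) (.reg 6) (.reg 7)))

/-- The test that the vector with index `i` of the bag `4 b' + 3` lies above the threshold that is
given by vector `6` of the bag `4 b + 2`, in the direction `4`. -/
def aboveTest (i : ℕ) : Test :=
  .realLt (.read 12 (.reg 4) (quad 5 2) (.reg 6)) (.read 12 (.reg 4) (quad 7 3) (.reg i))

/-- Array `13`: for each candidate, the sum of `N ^ 2 - 2 k N` over the bags `4 b + 3`, where `N`
is the number of vectors of the bag that the candidate classifies as positive. -/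
def progScore : Prog :=
  .loop 4 (.add (.reg 0) (.reg 0)) <| .loop 5 (.reg 3) <| .loop 6 (.reg 1) <|
    .loop 7 (.reg 3) <| .ite (inBlock 7)
      (.loop 8 (.reg 1) <| .ite (aboveTest 8)
        (.seq
          (accum 13 (.reg 4) (.reg 5) (.reg 6) (.sub (.ofNat (.lit 0))
            (.ofNat (.add (.reg 2) (.reg 2)))))
          (.loop 9 (.reg 1) <| .ite (aboveTest 9)
            (accum 13 (.reg 4) (.reg 5) (.reg 6) (.ofNat (.lit 1))) .skip)) .skip) .skip

/-- Array `14`: larger than all scores. -/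
def progInit : Prog :=
  accum 14 (.lit 0) (.lit 0) (.lit 0) (.add (.mul (.mul (.ofNat (.reg 1)) (.ofNat (.reg 1)))
    (.ofNat (.reg 3))) (.ofNat (.lit 1)))

/-- Compare the candidate in registers `4, 5, 6` with the best one so far. -/
def progUpdate : Prog :=
  .ite (.realLt (.read 13 (.reg 4) (.reg 5) (.reg 6)) (.read 14 (.lit 0) (.lit 0) (.lit 0)))
    (.seq (.setReal 14 (.lit 0) (.lit 0) (.lit 0) (.read 13 (.reg 4) (.reg 5) (.reg 6)))
      (.seq (.setNat 20 (.reg 4)) (.seq (.setNat 21 (.reg 5)) (.setNat 22 (.reg 6))))) .skip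

/-- Registers `20, 21, 22`: a candidate of least score. -/
def progSelect : Prog :=
  .loop 4 (.add (.reg 0) (.reg 0)) <| .loop 5 (.reg 3) <| .ite (inBlock 5)
    (.loop 6 (.reg 1) progUpdate) .skip

/-- The output array `1`: the direction of the selected candidate. -/
def progOutVec : Prog :=
  .loop 7 (.reg 0) <| accum 1 (.reg 7) (.lit 0) (.lit 0) (.read 11 (.reg 20) (.reg 7) (.lit 0))

/-- The output array `2`: the offset that puts the data point of the selected candidate on the
boundary of the half-space. -/
def progOutOffset : Prog :=
  accum 2 (.lit 0) (.lit 0) (.lit 0) (.sub (.ofNat (.lit 0)) (.read 12 (.reg 20) (quad 21 2)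
    (.reg 22)))

/-- The learning program. -/
def learner : Prog :=
  .seq progN <| .seq progA <| .seq progTr <| .seq progOne <| .seq progB <| .seq progBasis <|
  .seq (progIter 4 7 8) <| .seq progCopy <| .seq (progIter 6 9 10) <| .seq progDir <|
  .seq progProj <| .seq progScore <| .seq progInit <| .seq progSelect <|
  .seq progOutVec progOutOffset

theorem learner_inputBounded : learner.InputBounded := by
  simp [learner, progN, progA, progTr, progOne, progB, progBasis, progIter, progStep, progCopy,
    progDir, progProj, progScore, progInit, progSelect, progUpdate, progOutVec, progOutOffset,
    Prog.InputBounded, NatExpr.InputOnly, accum]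

/-- The running time of the learning program is polynomial in the size of the input. -/
theorem learner_steps_le : ∃ c r : ℕ, ∀ (d q k m M : ℕ) (bags : Fin m → Fin q → Vec d),
    d ≤ M → q ≤ M → k ≤ M → m ≤ M → learner.steps k bags ≤ c * (M + 1) ^ r := by
  obtain ⟨c, r, h⟩ := learner_inputBounded.steps_le
  refine ⟨c, r, fun d q k m M bags hd hq hk hm => h M _ fun v hv => ?_⟩
  simp only [inputStore]
  split_ifs <;> omega

section

/-! ### What the learning program computes -/

attribute [local simp] NatExpr.Avoids RealExpr.Avoids Test.Avoids NatExpr.eval RealExpr.eval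

theorem quad_eval (s : Store) (v n : ℕ) : (quad v n).eval s = 4 * s.nat v + n := by
  simp only [quad, NatExpr.eval]; ring

theorem quad_avoids {R : List ℕ} {v n : ℕ} : (quad v n).Avoids R ↔ v ∉ R := by
  simp [quad]

attribute [local simp] quad_eval quad_avoids

theorem inBlock_holds (s : Store) (v : ℕ) : (inBlock v).holds s ↔ 4 * s.nat v + 3 < s.nat 3 := by
  simp [inBlock, Test.holds]

theorem aboveTest_holds (s : Store) (i : ℕ) : (aboveTest i).holds s ↔
    s.real 12 (s.nat 4) (4 * s.nat 5 + 2) (s.nat 6)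
      < s.real 12 (s.nat 4) (4 * s.nat 7 + 3) (s.nat i) := by
  simp [aboveTest, Test.holds]

attribute [local simp] inBlock_holds aboveTest_holds

/-- The entries of `∑ (x - x') (x - x')ᵀ`, in terms of the input array. -/
def specN (q m : ℕ) (x : ℕ → ℕ → ℕ → ℝ) (l l' : ℕ) : ℝ :=
  ∑ j ∈ Finset.range m, if 4 * j + 3 < m then
    ∑ i ∈ Finset.range q, ∑ i' ∈ Finset.range q,
      (x (4 * j) i l - x (4 * j + 1) i' l) * (x (4 * j) i l' - x (4 * j + 1) i' l') else 0

/-- The entries of the matrix of `progA`, in terms of the input array. -/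
def specA (q m : ℕ) (x : ℕ → ℕ → ℕ → ℝ) (l l' : ℕ) : ℝ :=
  ∑ j ∈ Finset.range m, if 4 * j + 3 < m then
    ∑ i ∈ Finset.range q, ∑ i' ∈ Finset.range q,
      ((x (4 * j) i l - x (4 * j + 1) i' l) * (x (4 * j) i l' - x (4 * j + 1) i' l')
        - q * ((x (4 * j) i l - x (4 * j + 1) i l) * (x (4 * j) i' l' - x (4 * j + 1) i' l')))
    else 0

/-- The trace of the matrix `specN`. -/
def specTr (d q m : ℕ) (x : ℕ → ℕ → ℕ → ℝ) : ℝ := ∑ l ∈ Finset.range d, specN q m x l l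

/-- The identity minus the matrix `specN` divided by its trace. -/
def specB (d q m : ℕ) (x : ℕ → ℕ → ℕ → ℝ) (l l' : ℕ) : ℝ :=
  (if l = l' then 1 else 0) - specN q m x l l' / specTr d q m x

/-- Repeated application of the `d × d` matrix `B` to the vector `y`. -/
def iterMat (d : ℕ) (B : ℕ → ℕ → ℝ) (y : ℕ → ℝ) : ℕ → ℕ → ℝ
  | 0 => y
  | t + 1 => fun l => ∑ l' ∈ Finset.range d, B l l' * iterMat d B y t l'

theorem iterMat_congr {d : ℕ} {B B' : ℕ → ℕ → ℝ} {y y' : ℕ → ℝ}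
    (hB : ∀ l < d, ∀ l' < d, B l l' = B' l l') (hy : ∀ l < d, y l = y' l) (t : ℕ) :
    ∀ l < d, iterMat d B y t l = iterMat d B' y' t l := by
  induction t with
  | zero => exact hy
  | succ t ih =>
    intro l hl
    refine Finset.sum_congr rfl fun l' hl' => ?_
    rw [hB l hl l' (Finset.mem_range.1 hl'), ih l' (Finset.mem_range.1 hl')]

/-- The power iteration, started at the basis vector with index `j`. -/
def specPow (d q m : ℕ) (x : ℕ → ℕ → ℕ → ℝ) (j : ℕ) : ℕ → ℝ :=
  iterMat d (specA q m x) (fun l => if l = j then 1 else 0) m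

/-- The terms of the Neumann series for the inverse of `specN`, summed, applied to the outcome of the
power iteration that starts at the basis vector with index `j`. -/
def specDir (d q m : ℕ) (x : ℕ → ℕ → ℕ → ℝ) (j l : ℕ) : ℝ :=
  ∑ t ∈ Finset.range m, iterMat d (specB d q m x) (specPow d q m x j) t l

/-- The candidate directions: the computed ones and their opposites. -/
def specRow (d q m : ℕ) (x : ℕ → ℕ → ℕ → ℝ) (j l : ℕ) : ℝ :=
  if j < d then specDir d q m x j l else -specDir d q m x (j - d) l

/-- The inner product of the candidate direction `j` with vector `i` of bag `b`. -/
def specProj (d q m : ℕ) (x : ℕ → ℕ → ℕ → ℝ) (j b i : ℕ) : ℝ :=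
  ∑ l ∈ Finset.range d, specRow d q m x j l * x b i l

open Classical in
/-- The score of the candidate with direction `j` and threshold at vector `i` of bag `4 b + 2`. -/
def specScore (d q k m : ℕ) (x : ℕ → ℕ → ℕ → ℝ) (j b i : ℕ) : ℝ :=
  ∑ b' ∈ Finset.range m, if 4 * b' + 3 < m then
    ∑ i₁ ∈ Finset.range q,
      if specProj d q m x j (4 * b + 2) i < specProj d q m x j (4 * b' + 3) i₁ then
        0 - ((k : ℝ) + k) + ∑ i₂ ∈ Finset.range q,
          if specProj d q m x j (4 * b + 2) i < specProj d q m x j (4 * b' + 3) i₂ then 1 else 0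
      else 0
  else 0

theorem progN_spec (s : Store) : (∀ b ≠ 3, (progN.exec s).real b = s.real b) ∧
    (∀ v < 4, (progN.exec s).nat v = s.nat v) ∧
    ∀ l < s.nat 0, ∀ l' < s.nat 0, (progN.exec s).real 3 l l' 0
      = s.real 3 l l' 0 + specN (s.nat 1) (s.nat 3) (s.real 0) l l' := by
  have h : Adds progN 3 _ _ := (((((Adds.accum (R := []) (by simp) (by simp) (by simp)
    (by simp [vecDiff])).loop 8 (by simp)).loop 7 (by simp)).loop 6 (by simp)).loop 5
    (by simp)).guard (by simp [inBlock]) |>.loop 4 (by simp)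
  refine ⟨h.real_ne s, fun v hv => h.nat_eq s v (by simp; omega), fun l hl l' hl' => ?_⟩
  rw [h.real_same]
  simp [specN, vecDiff, ite_and, hl, hl']

theorem progA_spec (s : Store) : (∀ b ≠ 4, (progA.exec s).real b = s.real b) ∧
    (∀ v < 4, (progA.exec s).nat v = s.nat v) ∧
    ∀ l < s.nat 0, ∀ l' < s.nat 0, (progA.exec s).real 4 l l' 0
      = s.real 4 l l' 0 + specA (s.nat 1) (s.nat 3) (s.real 0) l l' := by
  have h : Adds progA 4 _ _ := (((((Adds.accum (R := []) (by simp) (by simp) (by simp)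
    (by simp [vecDiff])).loop 8 (by simp)).loop 7 (by simp)).loop 6 (by simp)).loop 5
    (by simp)).guard (by simp [inBlock]) |>.loop 4 (by simp)
  refine ⟨h.real_ne s, fun v hv => h.nat_eq s v (by simp; omega), fun l hl l' hl' => ?_⟩
  rw [h.real_same]
  simp [specA, vecDiff, ite_and, hl, hl']

theorem progTr_spec (s : Store) : (∀ b ≠ 5, (progTr.exec s).real b = s.real b) ∧
    (∀ v < 4, (progTr.exec s).nat v = s.nat v) ∧
    (progTr.exec s).real 5 0 0 0
      = s.real 5 0 0 0 + ∑ l ∈ Finset.range (s.nat 0), s.real 3 l l 0 := by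
  have h : Adds progTr 5 _ _ := (Adds.accum (R := []) (by simp) (by simp) (by simp)
    (by simp)).loop 7 (by simp)
  refine ⟨h.real_ne s, fun v hv => h.nat_eq s v (by simp; omega), ?_⟩
  rw [h.real_same]
  simp

theorem progOne_spec (s : Store) : (∀ b ≠ 6, (progOne.exec s).real b = s.real b) ∧
    (∀ v < 4, (progOne.exec s).nat v = s.nat v) ∧
    ∀ l < s.nat 0, ∀ l' < s.nat 0, (progOne.exec s).real 6 l l' 0
      = s.real 6 l l' 0 + if l = l' then 1 else 0 := by
  have h : Adds progOne 6 _ _ := (Adds.accum (R := []) (by simp) (by simp) (by simp)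
    (by simp)).loop 7 (by simp)
  refine ⟨h.real_ne s, fun v hv => h.nat_eq s v (by simp; omega), fun l hl l' hl' => ?_⟩
  rw [h.real_same]
  simp [ite_and, hl, eq_comm]

theorem progB_spec (s : Store) : (∀ b ≠ 6, (progB.exec s).real b = s.real b) ∧
    (∀ v < 4, (progB.exec s).nat v = s.nat v) ∧
    ∀ l < s.nat 0, ∀ l' < s.nat 0, (progB.exec s).real 6 l l' 0
      = s.real 6 l l' 0 - s.real 3 l l' 0 / s.real 5 0 0 0 := by
  have h : Adds progB 6 _ _ := ((Adds.accum (R := []) (by simp) (by simp) (by simp)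
    (by simp)).loop 8 (by simp)).loop 7 (by simp)
  refine ⟨h.real_ne s, fun v hv => h.nat_eq s v (by simp; omega), fun l hl l' hl' => ?_⟩
  rw [h.real_same]
  simp [ite_and, hl, hl', sub_eq_add_neg]

theorem progBasis_spec (s : Store) : (∀ b ≠ 7, (progBasis.exec s).real b = s.real b) ∧
    (∀ v < 4, (progBasis.exec s).nat v = s.nat v) ∧
    (∀ t j l, 0 < t → (progBasis.exec s).real 7 t j l = s.real 7 t j l) ∧
    ∀ l < s.nat 0, ∀ l' < s.nat 0, (progBasis.exec s).real 7 0 l l'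
      = s.real 7 0 l l' + if l' = l then 1 else 0 := by
  have h : Adds progBasis 7 _ _ := (Adds.accum (R := []) (by simp) (by simp) (by simp)
    (by simp)).loop 7 (by simp)
  refine ⟨h.real_ne s, fun v hv => h.nat_eq s v (by simp; omega), fun t j l ht => ?_,
    fun l hl l' hl' => ?_⟩
  · rw [h.real_same]
    simp [ht.ne']
  · rw [h.real_same]
    simp [ite_and, hl]

theorem progStep_spec {b y t : ℕ} (hyt : y ≠ t) (hbt : b ≠ t) (s : Store) :
    (∀ a, a ≠ y → a ≠ t → ((progStep b y t).exec s).real a = s.real a) ∧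
    (∀ v < 4, ((progStep b y t).exec s).nat v = s.nat v) ∧
    (∀ τ, τ ≠ s.nat 9 → ∀ j l, ((progStep b y t).exec s).real t τ j l = s.real t τ j l) ∧
    (∀ τ, τ ≠ s.nat 9 + 1 → ∀ j l, ((progStep b y t).exec s).real y τ j l = s.real y τ j l) ∧
    ∀ j < s.nat 0, ∀ l < s.nat 0, ((progStep b y t).exec s).real y (s.nat 9 + 1) j l
      = s.real y (s.nat 9 + 1) j l + (s.real t (s.nat 9) j l
        + ∑ l' ∈ Finset.range (s.nat 0), s.real b l l' 0 * s.real y (s.nat 9) j l') := by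
  have h₁ := (((Adds.accum (R := []) (a := t) (i := .reg 9) (j := .reg 4) (l := .reg 7)
    (e := .mul (.read b (.reg 7) (.reg 8) (.lit 0)) (.read y (.reg 9) (.reg 4) (.reg 8)))
    (by simp) (by simp) (by simp) (by simp [hyt, hbt])).loop 8 (e := .reg 0) (by simp)).loop 7
    (e := .reg 0) (by simp)).loop 4 (e := .reg 0) (by simp)
  have h₂ := ((Adds.accum (R := []) (a := y) (i := .add (.reg 9) (.lit 1)) (j := .reg 4)
    (l := .reg 7) (e := .read t (.reg 9) (.reg 4) (.reg 7))
    (by simp) (by simp) (by simp) (by simp [hyt.symm])).loop 7 (e := .reg 0) (by simp)).loop 4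
    (e := .reg 0) (by simp)
  simp only [progStep, exec_seq]
  set s' := (Prog.loop 4 (.reg 0) <| .loop 7 (.reg 0) <| .loop 8 (.reg 0) <|
      accum t (.reg 9) (.reg 4) (.reg 7)
        (.mul (.read b (.reg 7) (.reg 8) (.lit 0)) (.read y (.reg 9) (.reg 4) (.reg 8)))).exec s
  have n9 : s'.nat 9 = s.nat 9 := h₁.nat_eq s 9 (by simp)
  have n0 : s'.nat 0 = s.nat 0 := h₁.nat_eq s 0 (by simp)
  refine ⟨fun a hy ht => ?_, fun v hv => ?_, fun τ hτ j l => ?_, fun τ hτ j l => ?_,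
    fun j hj l hl => ?_⟩
  · rw [h₂.real_ne _ a hy, h₁.real_ne _ a ht]
  · rw [h₂.nat_eq _ v (by simp; omega), h₁.nat_eq _ v (by simp; omega)]
  · rw [h₂.real_ne _ t hyt.symm, h₁.real_same]
    simp [hτ]
  · rw [h₂.real_same, h₁.real_ne _ y hyt]
    simp [n9, hτ]
  · rw [h₂.real_same, h₁.real_ne _ y hyt]
    simp only [NatExpr.eval, RealExpr.eval, setNat_nat, setNat_real]
    simp only [n9, n0, ite_and]
    simp [hj, hl]
    rw [h₁.real_same]
    simp [ite_and, hj, hl]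

/-- The iteration adds to the cells it visits, so the cells for later times and the array `t` of
intermediate results have to be zero at the start. -/
theorem progIter_spec {b y t : ℕ} (hyt : y ≠ t) (hbt : b ≠ t) (hby : b ≠ y) (s : Store)
    (hy : ∀ τ j l, 0 < τ → s.real y τ j l = 0) (ht : ∀ τ j l, s.real t τ j l = 0) :
    (∀ a, a ≠ y → a ≠ t → ((progIter b y t).exec s).real a = s.real a) ∧
    (∀ v < 4, ((progIter b y t).exec s).nat v = s.nat v) ∧
    ∀ τ ≤ s.nat 3, ∀ j < s.nat 0, ∀ l < s.nat 0, ((progIter b y t).exec s).real y τ j l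
      = iterMat (s.nat 0) (fun l l' => s.real b l l' 0) (s.real y 0 j) τ l := by
  -- invariant: after `n` passes the iterates up to time `n` are in place, and later cells are zero
  have key := exec_loop_induction (v := 9) (e := .reg 3) (p := progStep b y t) (s := s)
    (fun n u => (∀ a, a ≠ y → a ≠ t → u.real a = s.real a) ∧ (∀ v < 4, u.nat v = s.nat v) ∧
      (∀ τ ≥ n, ∀ j l, u.real t τ j l = 0) ∧ (∀ τ > n, ∀ j l, u.real y τ j l = 0) ∧
      ∀ τ ≤ n, ∀ j < s.nat 0, ∀ l < s.nat 0, u.real y τ j l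
        = iterMat (s.nat 0) (fun l l' => s.real b l l' 0) (s.real y 0 j) τ l)
    ⟨fun _ _ _ => rfl, fun _ _ => rfl, fun τ _ j l => ht τ j l, fun τ h j l => hy τ j l h,
      fun τ h j hj l hl => by obtain rfl : τ = 0 := by omega
                              rfl⟩ ?_
  · exact ⟨key.1, key.2.1, key.2.2.2.2⟩
  · rintro n - u ⟨h1, h2, h3, h4, h5⟩
    obtain ⟨g1, g2, g3, g4, g5⟩ := progStep_spec hyt hbt (u.setNat 9 n)
    simp only [setNat_nat, setNat_real, if_true, if_neg (by decide : ¬ 0 = 9), h2 0 (by omega)]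
      at g1 g2 g3 g4 g5
    refine ⟨fun a ha ha' => (g1 a ha ha').trans (h1 a ha ha'), fun v hv => ?_, fun τ hτ j l => ?_,
      fun τ hτ j l => ?_, fun τ hτ j hj l hl => ?_⟩
    · rw [g2 v hv, if_neg (by omega), h2 v hv]
    · rw [g3 τ (by omega), h3 τ (by omega)]
    · rw [g4 τ (by omega), h4 τ (by omega)]
    · rcases Nat.lt_or_ge n τ with h | h
      · obtain rfl : τ = n + 1 := by omega
        rw [g5 j hj l hl, h4 _ (by omega), h3 _ le_rfl, zero_add, zero_add, h1 b hby hbt]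
        refine Finset.sum_congr rfl fun l' hl' => ?_
        rw [h5 n le_rfl j hj l' (Finset.mem_range.1 hl')]
      · rw [g4 τ (by omega), h5 τ h j hj l hl]

theorem progCopy_spec (s : Store) : (∀ b ≠ 9, (progCopy.exec s).real b = s.real b) ∧
    (∀ v < 4, (progCopy.exec s).nat v = s.nat v) ∧
    (∀ t j l, 0 < t → (progCopy.exec s).real 9 t j l = s.real 9 t j l) ∧
    ∀ j < s.nat 0, ∀ l < s.nat 0, (progCopy.exec s).real 9 0 j l
      = s.real 9 0 j l + s.real 7 (s.nat 3) j l := by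
  have h : Adds progCopy 9 _ _ := ((Adds.accum (R := []) (by simp) (by simp) (by simp)
    (by simp)).loop 7 (by simp)).loop 4 (by simp)
  refine ⟨h.real_ne s, fun v hv => h.nat_eq s v (by simp; omega), fun t j l ht => ?_,
    fun l hl l' hl' => ?_⟩
  · rw [h.real_same]
    simp [ht.ne']
  · rw [h.real_same]
    simp [ite_and, hl, hl']

theorem progDir_spec (s : Store) : (∀ b ≠ 11, (progDir.exec s).real b = s.real b) ∧
    (∀ v < 4, (progDir.exec s).nat v = s.nat v) ∧
    ∀ j < s.nat 0 + s.nat 0, ∀ l < s.nat 0, (progDir.exec s).real 11 j l 0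
      = s.real 11 j l 0 + if j < s.nat 0 then ∑ t ∈ Finset.range (s.nat 3), s.real 9 t j l
        else -∑ t ∈ Finset.range (s.nat 3), s.real 9 t (j - s.nat 0) l := by
  have h : Adds progDir 11 _ _ := (((Adds.seq (Adds.accum (R := []) (by simp) (by simp) (by simp)
    (by simp)) (Adds.accum (R := []) (by simp) (by simp) (by simp)
    (by simp))).loop 7 (by simp)).loop 4 (by simp)).loop 9 (by simp)
  refine ⟨h.real_ne s, fun v hv => h.nat_eq s v (by simp; omega), fun j hj l hl => ?_⟩
  rw [h.real_same]
  simp only [NatExpr.eval, RealExpr.eval, setNat_nat, setNat_real]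
  simp only [ite_and, Finset.sum_add_distrib]
  congr 1
  by_cases hjd : j < s.nat 0
  · have : ∀ x, j ≠ s.nat 0 + x := fun x => by omega
    simp [this, hl, hjd]
  · have : ∀ x, (j = s.nat 0 + x) ↔ (j - s.nat 0 = x) := fun x => by omega
    have h2 : j - s.nat 0 < s.nat 0 := by omega
    simp [this, hl, hjd, h2]

theorem progProj_spec (s : Store) : (∀ b ≠ 12, (progProj.exec s).real b = s.real b) ∧
    (∀ v < 4, (progProj.exec s).nat v = s.nat v) ∧
    ∀ j < s.nat 0 + s.nat 0, ∀ b < s.nat 3, ∀ i < s.nat 1, (progProj.exec s).real 12 j b i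
      = s.real 12 j b i
        + ∑ l ∈ Finset.range (s.nat 0), s.real 11 j l 0 * s.real 0 b i l := by
  have h : Adds progProj 12 _ _ := ((((Adds.accum (R := []) (by simp) (by simp) (by simp)
    (by simp)).loop 7 (by simp)).loop 6 (by simp)).loop 5 (by simp)).loop 4 (by simp)
  refine ⟨h.real_ne s, fun v hv => h.nat_eq s v (by simp; omega), fun j hj b hb i hi => ?_⟩
  rw [h.real_same]
  simp [ite_and, hj, hb, hi]

open Classical in
theorem progScore_spec (s : Store) : (∀ b ≠ 13, (progScore.exec s).real b = s.real b) ∧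
    (∀ v < 4, (progScore.exec s).nat v = s.nat v) ∧
    ∀ j < s.nat 0 + s.nat 0, ∀ b < s.nat 3, ∀ i < s.nat 1, (progScore.exec s).real 13 j b i
      = s.real 13 j b i
        + ∑ b' ∈ Finset.range (s.nat 3), if 4 * b' + 3 < s.nat 3 then
          ∑ i₁ ∈ Finset.range (s.nat 1),
            if s.real 12 j (4 * b + 2) i < s.real 12 j (4 * b' + 3) i₁ then
              0 - ((s.nat 2 : ℝ) + s.nat 2) + ∑ i₂ ∈ Finset.range (s.nat 1),
                if s.real 12 j (4 * b + 2) i < s.real 12 j (4 * b' + 3) i₂ then 1 else 0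
            else 0
          else 0 := by
  have h : Adds progScore 13 _ _ := (((((((Adds.seq (Adds.accum (R := [9]) (by simp) (by simp)
    (by simp) (by simp)) (((Adds.accum (R := []) (by simp) (by simp) (by simp)
    (by simp)).guard (by simp [aboveTest])).loop 9 (by simp))).guard
    (by simp [aboveTest])).loop 8 (by simp)).guard (by simp [inBlock])).loop 7 (by simp)).loop 6
    (by simp)).loop 5 (by simp)).loop 4 (by simp)
  refine ⟨h.real_ne s, fun v hv => h.nat_eq s v (by simp; omega), fun j hj b hb i hi => ?_⟩
  rw [h.real_same]
  congr 1
  simp only [NatExpr.eval, RealExpr.eval, setNat_nat, setNat_real, aboveTest_holds,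
    inBlock_holds]
  norm_num
  -- only the passes for the candidate `(j, b, i)` change its score
  rw [Finset.sum_eq_single j, Finset.sum_eq_single b, Finset.sum_eq_single i]
  · simp
  · intro i' _ hi'
    simp [hi'.symm]
  · simp [hi]
  · intro b' _ hb'
    simp [hb'.symm]
  · simp [hb]
  · intro j' _ hj'
    simp [hj'.symm]
  · simp [hj]

theorem progInit_spec (s : Store) : (∀ b ≠ 14, (progInit.exec s).real b = s.real b) ∧
    (∀ v < 4, (progInit.exec s).nat v = s.nat v) ∧
    (progInit.exec s).real 14 0 0 0 = s.real 14 0 0 0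
      + ((s.nat 1 : ℝ) * s.nat 1 * s.nat 3 + 1) := by
  have h : Adds progInit 14 _ _ := Adds.accum (R := []) (by simp) (by simp) (by simp) (by simp)
  refine ⟨h.real_ne s, fun v hv => h.nat_eq s v (by simp), ?_⟩
  rw [h.real_same]
  simp

theorem progOutVec_spec (s : Store) : (∀ b ≠ 1, (progOutVec.exec s).real b = s.real b) ∧
    (∀ v ≠ 7, (progOutVec.exec s).nat v = s.nat v) ∧
    ∀ l < s.nat 0, (progOutVec.exec s).real 1 l 0 0
      = s.real 1 l 0 0 + s.real 11 (s.nat 20) l 0 := by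
  have h : Adds progOutVec 1 _ _ := (Adds.accum (R := []) (by simp) (by simp) (by simp)
    (by simp)).loop 7 (by simp)
  refine ⟨h.real_ne s, fun v hv => h.nat_eq s v (by simp [hv]), fun l hl => ?_⟩
  rw [h.real_same]
  simp [hl]

theorem progOutOffset_spec (s : Store) :
    (∀ b ≠ 2, (progOutOffset.exec s).real b = s.real b) ∧
    (progOutOffset.exec s).real 2 0 0 0
      = s.real 2 0 0 0 - s.real 12 (s.nat 20) (4 * s.nat 21 + 2) (s.nat 22) := by
  have h : Adds progOutOffset 2 _ _ := Adds.accum (R := []) (by simp) (by simp) (by simp)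
    (by simp)
  refine ⟨h.real_ne s, ?_⟩
  rw [h.real_same]
  simp [sub_eq_add_neg]

end

/-! ### Selection of the least score -/

/-- The candidate that is stored in registers `20, 21, 22`. -/
def chosen (s : Store) : ℕ × ℕ × ℕ := (s.nat 20, s.nat 21, s.nat 22)

/-- The score of a candidate, as stored in array `13`. -/
def scoreOf (s : Store) (c : ℕ × ℕ × ℕ) : ℝ := s.real 13 c.1 c.2.1 c.2.2

/-- The program compares the candidates in `C` with the best one so far; it changes only array
`14`, the registers in `R`, and those that hold the best candidate. -/
structure Selects (p : Prog) (R : List ℕ) (C : Store → Set (ℕ × ℕ × ℕ)) : Prop where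
  real_ne : ∀ s, ∀ b ≠ 14, (p.exec s).real b = s.real b
  nat_eq : ∀ s, ∀ v ∉ R, v < 20 → (p.exec s).nat v = s.nat v
  best_le : ∀ s, (p.exec s).real 14 0 0 0 ≤ s.real 14 0 0 0
  le : ∀ s, ∀ c ∈ C s, (p.exec s).real 14 0 0 0 ≤ scoreOf s c
  choice : ∀ s, ((p.exec s).real 14 0 0 0 = s.real 14 0 0 0 ∧ chosen (p.exec s) = chosen s) ∨
    (chosen (p.exec s) ∈ C s ∧ (p.exec s).real 14 0 0 0 = scoreOf s (chosen (p.exec s)))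
  congr : ∀ s t, (∀ v ∉ R, v < 20 → s.nat v = t.nat v) → C s = C t

open Classical in
theorem Selects.guard {p : Prog} {R : List ℕ} {C : Store → Set (ℕ × ℕ × ℕ)} (h : Selects p R C)
    (c : Test) (hc : ∀ s t, (∀ v ∉ R, v < 20 → s.nat v = t.nat v) → (c.holds s ↔ c.holds t)) :
    Selects (.ite c p .skip) R (fun s => {x | c.holds s ∧ x ∈ C s}) where
  real_ne s b hb := by
    rw [exec_ite]
    split_ifs
    · exact h.real_ne s b hb
    · rfl
  nat_eq s v hv hv' := by
    rw [exec_ite]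
    split_ifs
    · exact h.nat_eq s v hv hv'
    · rfl
  best_le s := by
    rw [exec_ite]
    split_ifs
    · exact h.best_le s
    · exact le_rfl
  le s c' hc' := by
    rw [exec_ite]
    rw [if_pos hc'.1]
    exact h.le s c' hc'.2
  choice s := by
    rw [exec_ite]
    split_ifs with h1
    · simpa only [Set.mem_ofPred_eq, h1, true_and] using h.choice s
    · exact Or.inl ⟨rfl, rfl⟩
  congr s t hst := by simp only [hc s t hst, h.congr s t hst]

/-- A counted loop around a selection selects among the union of the sets of candidates. -/
theorem Selects.loop {p : Prog} {R : List ℕ} {C : Store → Set (ℕ × ℕ × ℕ)} (h : Selects p R C)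
    (v : ℕ) (hv : v < 20) (e : NatExpr)
    (he : ∀ s t, (∀ w ∉ v :: R, w < 20 → s.nat w = t.nat w) → e.eval s = e.eval t) :
    Selects (.loop v e p) (v :: R) (fun s => ⋃ i < e.eval s, C (s.setNat v i)) := by
  have cong : ∀ s t : Store, (∀ w ∉ v :: R, w < 20 → s.nat w = t.nat w) →
      ∀ i, C (s.setNat v i) = C (t.setNat v i) := by
    intro s t h1 i
    refine h.congr _ _ fun w hw hw' => ?_
    simp only [setNat_nat]
    split_ifs with hwv
    · rfl
    · exact h1 w (by simp [hwv, hw]) hw'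
  have main : ∀ s, (∀ b ≠ 14, ((Prog.loop v e p).exec s).real b = s.real b) ∧
      (∀ w ∉ v :: R, w < 20 → ((Prog.loop v e p).exec s).nat w = s.nat w) ∧
      (((Prog.loop v e p).exec s).real 14 0 0 0 ≤ s.real 14 0 0 0) ∧
      (∀ c ∈ ⋃ i < e.eval s, C (s.setNat v i),
        ((Prog.loop v e p).exec s).real 14 0 0 0 ≤ scoreOf s c) ∧
      ((((Prog.loop v e p).exec s).real 14 0 0 0 = s.real 14 0 0 0 ∧
          chosen ((Prog.loop v e p).exec s) = chosen s) ∨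
        (chosen ((Prog.loop v e p).exec s) ∈ ⋃ i < e.eval s, C (s.setNat v i) ∧
          ((Prog.loop v e p).exec s).real 14 0 0 0
            = scoreOf s (chosen ((Prog.loop v e p).exec s)))) := by
    intro s
    refine exec_loop_induction (fun n t => (∀ b ≠ 14, t.real b = s.real b) ∧
      (∀ w ∉ v :: R, w < 20 → t.nat w = s.nat w) ∧ (t.real 14 0 0 0 ≤ s.real 14 0 0 0) ∧
      (∀ c ∈ ⋃ i < n, C (s.setNat v i), t.real 14 0 0 0 ≤ scoreOf s c) ∧
      ((t.real 14 0 0 0 = s.real 14 0 0 0 ∧ chosen t = chosen s) ∨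
        (chosen t ∈ ⋃ i < n, C (s.setNat v i) ∧ t.real 14 0 0 0 = scoreOf s (chosen t))))
      ⟨fun _ _ => rfl, fun _ _ _ => rfl, le_rfl, by simp, Or.inl ⟨rfl, rfl⟩⟩ ?_
    rintro n - t ⟨h1, h2, h3, h4, h5⟩
    have hC : C (t.setNat v n) = C (s.setNat v n) := cong t s h2 n
    have hsc : scoreOf (t.setNat v n) = scoreOf s := by
      funext c
      simp only [scoreOf, setNat_real, h1 13 (by decide)]
    have hch : chosen (t.setNat v n) = chosen t := by
      simp only [chosen, setNat_nat, if_neg (by omega : ¬ 20 = v), if_neg (by omega : ¬ 21 = v),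
        if_neg (by omega : ¬ 22 = v)]
    have hU : ∀ c, c ∈ (⋃ i < n + 1, C (s.setNat v i)) ↔
        c ∈ (⋃ i < n, C (s.setNat v i)) ∨ c ∈ C (s.setNat v n) := by
      intro c
      simp only [Set.mem_iUnion, exists_prop, Nat.lt_succ_iff_lt_or_eq]
      constructor
      · rintro ⟨i, hi | rfl, hc⟩
        · exact Or.inl ⟨i, hi, hc⟩
        · exact Or.inr hc
      · rintro (⟨i, hi, hc⟩ | hc)
        · exact ⟨i, Or.inl hi, hc⟩
        · exact ⟨n, Or.inr rfl, hc⟩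
    have hb := h.best_le (t.setNat v n)
    rw [setNat_real] at hb
    refine ⟨fun b hb => ?_, fun w hw hw' => ?_, hb.trans h3, fun c hc => ?_, ?_⟩
    · rw [h.real_ne _ b hb, setNat_real, h1 b hb]
    · have hw2 := hw
      rw [List.mem_cons, not_or] at hw2
      rw [h.nat_eq _ w hw2.2 hw', setNat_nat, if_neg hw2.1, h2 w hw hw']
    · rcases (hU c).1 hc with hc | hc
      · exact hb.trans (h4 c hc)
      · have := h.le (t.setNat v n) c (by rw [hC]; exact hc)
        rwa [hsc] at this
    · rcases h.choice (t.setNat v n) with ⟨g1, g2⟩ | ⟨g1, g2⟩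
      · rw [setNat_real] at g1
        rw [hch] at g2
        rw [g1, g2, hU]
        rcases h5 with h5 | ⟨h5, h6⟩
        · exact Or.inl h5
        · exact Or.inr ⟨Or.inl h5, h6⟩
      · rw [hC] at g1
        rw [hsc] at g2
        exact Or.inr ⟨(hU _).2 (Or.inr g1), g2⟩
  exact
    { real_ne := fun s => (main s).1
      nat_eq := fun s => (main s).2.1
      best_le := fun s => (main s).2.2.1
      le := fun s => (main s).2.2.2.1
      choice := fun s => (main s).2.2.2.2
      congr := fun s t hst => by
        simp only [he s t hst, cong s t hst] }

theorem progUpdate_selects :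
    Selects progUpdate [] (fun s => {(s.nat 4, s.nat 5, s.nat 6)}) := by
  have key : ∀ s, (s.real 13 (s.nat 4) (s.nat 5) (s.nat 6) < s.real 14 0 0 0 ∧
      (∀ b ≠ 14, (progUpdate.exec s).real b = s.real b) ∧
      (∀ v < 20, (progUpdate.exec s).nat v = s.nat v) ∧
      (progUpdate.exec s).real 14 0 0 0 = s.real 13 (s.nat 4) (s.nat 5) (s.nat 6) ∧
      chosen (progUpdate.exec s) = (s.nat 4, s.nat 5, s.nat 6)) ∨
      (¬ s.real 13 (s.nat 4) (s.nat 5) (s.nat 6) < s.real 14 0 0 0 ∧ progUpdate.exec s = s) := by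
    intro s
    by_cases h : s.real 13 (s.nat 4) (s.nat 5) (s.nat 6) < s.real 14 0 0 0
    · left
      have e : progUpdate.exec s = ((((s.setReal 14 0 0 0
          (s.real 13 (s.nat 4) (s.nat 5) (s.nat 6))).setNat 20 (s.nat 4)).setNat 21
          (s.nat 5)).setNat 22 (s.nat 6)) := by
        rw [progUpdate, exec_ite, if_pos (by simpa [Test.holds, RealExpr.eval, NatExpr.eval])]
        simp [exec_seq, exec_setReal, exec_setNat, NatExpr.eval, RealExpr.eval]
      rw [e]
      refine ⟨h, fun b hb => ?_, fun v hv => ?_, ?_, ?_⟩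
      · funext x y z
        simp [Store.setReal, hb]
      · simp [if_neg (by omega : ¬ v = 20), if_neg (by omega : ¬ v = 21),
          if_neg (by omega : ¬ v = 22)]
      · simp [Store.setReal]
      · simp [chosen]
    · right
      refine ⟨h, ?_⟩
      rw [progUpdate, exec_ite, if_neg (by simpa [Test.holds, RealExpr.eval, NatExpr.eval] using h)]
      rfl
  refine
    { real_ne := fun s b hb => ?_
      nat_eq := fun s v _ hv => ?_
      best_le := fun s => ?_
      le := fun s c hc => ?_
      choice := fun s => ?_
      congr := fun s t hst => by
        rw [hst 4 (by simp) (by simp), hst 5 (by simp) (by simp), hst 6 (by simp) (by simp)] }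
  · rcases key s with ⟨-, h, -⟩ | ⟨-, h⟩
    · exact h b hb
    · rw [h]
  · rcases key s with ⟨-, -, h, -⟩ | ⟨-, h⟩
    · exact h v hv
    · rw [h]
  · rcases key s with ⟨h0, -, -, h, -⟩ | ⟨-, h⟩
    · rw [h]; exact h0.le
    · rw [h]
  · rw [Set.mem_singleton_iff.1 hc]
    rcases key s with ⟨h0, -, -, h, -⟩ | ⟨h0, h⟩
    · exact h.le
    · rw [h]; exact not_lt.1 h0
  · rcases key s with ⟨-, -, -, h, h'⟩ | ⟨h0, h⟩
    · right
      rw [h']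
      exact ⟨rfl, h⟩
    · left
      rw [h]
      exact ⟨rfl, rfl⟩

/-- If the initial value of array `14` exceeds all scores, then the candidate that is selected has
the least score. -/
theorem progSelect_spec (s : Store) (h0 : 0 < s.nat 0) (h1 : 0 < s.nat 1) (h3 : 3 < s.nat 3)
    (hb : ∀ j < s.nat 0 + s.nat 0, ∀ b, 4 * b + 3 < s.nat 3 → ∀ i < s.nat 1,
      s.real 13 j b i < s.real 14 0 0 0) :
    (∀ b ≠ 14, (progSelect.exec s).real b = s.real b) ∧
    (∀ v < 4, (progSelect.exec s).nat v = s.nat v) ∧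
    ∃ j < s.nat 0 + s.nat 0, ∃ b, 4 * b + 3 < s.nat 3 ∧ ∃ i < s.nat 1,
      chosen (progSelect.exec s) = (j, b, i) ∧
      ∀ j' < s.nat 0 + s.nat 0, ∀ b', 4 * b' + 3 < s.nat 3 → ∀ i' < s.nat 1,
        s.real 13 j b i ≤ s.real 13 j' b' i' := by
  have h := (((progUpdate_selects.loop 6 (by decide) (.reg 1) (fun s t h => h 1 (by simp)
    (by simp))).guard (inBlock 5) (fun s t h => by
      rw [inBlock_holds, inBlock_holds, h 5 (by simp) (by simp), h 3 (by simp) (by simp)])).loop 5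
    (by decide) (.reg 3) (fun s t h => h 3 (by simp) (by simp))).loop 4
    (by decide) (.add (.reg 0) (.reg 0)) (fun s t h => by
      simp only [NatExpr.eval]; rw [h 0 (by simp) (by simp)])
  change Selects progSelect _ _ at h
  have hC : ∀ j b i, ((j, b, i) ∈ ⋃ i, ⋃ (_ : i < NatExpr.eval s ((NatExpr.reg 0).add
      (NatExpr.reg 0))), ⋃ i_1, ⋃ (_ : i_1 < NatExpr.eval (s.setNat 4 i) (NatExpr.reg 3)),
      {x | Test.holds ((s.setNat 4 i).setNat 5 i_1) (inBlock 5) ∧ x ∈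
        ⋃ i_2, ⋃ (_ : i_2 < NatExpr.eval ((s.setNat 4 i).setNat 5 i_1) (NatExpr.reg 1)),
          ({((((s.setNat 4 i).setNat 5 i_1).setNat 6 i_2).nat 4,
            (((s.setNat 4 i).setNat 5 i_1).setNat 6 i_2).nat 5,
            (((s.setNat 4 i).setNat 5 i_1).setNat 6 i_2).nat 6)} : Set (ℕ × ℕ × ℕ))}) ↔
      j < s.nat 0 + s.nat 0 ∧ 4 * b + 3 < s.nat 3 ∧ i < s.nat 1 := by
    intro j b i
    simp only [Set.mem_iUnion, NatExpr.eval, setNat_nat, inBlock_holds, Set.mem_ofPred_eq]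
    constructor
    · rintro ⟨j', hj', b', hb', h', h⟩
      simp at h h'
      obtain ⟨rfl, rfl, hi'⟩ := h
      exact ⟨hj', h', hi'⟩
    · rintro ⟨h1, h2, h3⟩
      exact ⟨j, h1, b, by simp; omega, by simpa using h2, by simp [h3]⟩
  refine ⟨h.real_ne s, fun v hv => h.nat_eq s v (by simp; omega) (by omega), ?_⟩
  -- if nothing was selected, the initial value would be at most the score of the first candidate
  rcases h.choice s with ⟨g1, -⟩ | ⟨g1, g2⟩
  · have := h.le s (0, 0, 0) ((hC 0 0 0).2 ⟨by omega, by omega, h1⟩)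
    rw [g1] at this
    exact absurd (hb 0 (by omega) 0 (by omega) 0 h1) (not_lt.2 this)
  · obtain ⟨⟨j, b, i⟩, hc⟩ : ∃ c, chosen (progSelect.exec s) = c := ⟨_, rfl⟩
    rw [hc] at g1 g2
    obtain ⟨hj, hb', hi⟩ := (hC j b i).1 g1
    refine ⟨j, hj, b, hb', i, hi, hc, fun j' hj' b' hb' i' hi' => ?_⟩
    have := h.le s (j', b', i') ((hC j' b' i').2 ⟨hj', hb', hi'⟩)
    rw [g2] at this
    exact this

/-- The bound that `progInit` stores exceeds all scores, since each bag contributes at most `q ^ 2`. -/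
theorem specScore_lt {d q k m : ℕ} (x : ℕ → ℕ → ℕ → ℝ) (j b i : ℕ) :
    specScore d q k m x j b i < 0 + ((q : ℝ) * q * m + 1) := by
  have h : specScore d q k m x j b i ≤ ∑ _b ∈ Finset.range m, (q : ℝ) * q := by
    refine Finset.sum_le_sum fun b' _ => ?_
    split_ifs
    · calc _ ≤ ∑ _i ∈ Finset.range q, (q : ℝ) := by
            refine Finset.sum_le_sum fun i₁ _ => ?_
            have : (∑ i₂ ∈ Finset.range q, if specProj d q m x j (4 * b + 2) i
                < specProj d q m x j (4 * b' + 3) i₂ then (1 : ℝ) else 0)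
                ≤ ∑ _i ∈ Finset.range q, (1 : ℝ) :=
              Finset.sum_le_sum fun i₂ _ => by split_ifs <;> norm_num
            rw [Finset.sum_const, Finset.card_range, nsmul_eq_mul, mul_one] at this
            have hk : (0 : ℝ) ≤ k := Nat.cast_nonneg k
            split_ifs
            · linarith
            · exact Nat.cast_nonneg q
        _ = q * q := by simp
    · positivity
  rw [Finset.sum_const, Finset.card_range, nsmul_eq_mul] at h
  linarith

/-- The output of the learning program is a candidate of least score. -/
theorem learner_spec {d q k m : ℕ} (hd : 0 < d) (hq : 0 < q) (hm : 3 < m)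
    (bags : Fin m → Fin q → Vec d) :
    let x := (inputStore k bags).real 0
    ∃ j < d + d, ∃ b, 4 * b + 3 < m ∧ ∃ i < q,
      (∀ l : Fin d, learner.outVec k bags l = specRow d q m x j l) ∧
      learner.outOffset k bags = -specProj d q m x j (4 * b + 2) i ∧
      ∀ j' < d + d, ∀ b', 4 * b' + 3 < m → ∀ i' < q,
        specScore d q k m x j b i ≤ specScore d q k m x j' b' i' := by
  intro x
  set s₀ := inputStore k bags
  have z : ∀ a ≠ 0, ∀ i j l, s₀.real a i j l = 0 := by
    intro a ha i j l
    simp [s₀, inputStore, ha]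
  have n0 : s₀.nat 0 = d := rfl
  have n1 : s₀.nat 1 = q := rfl
  have n2 : s₀.nat 2 = k := rfl
  have n3 : s₀.nat 3 = m := rfl
  -- After each stage: `u` says which arrays are unchanged, `r` that the input registers are, and
  -- `e` what the stage has computed.
  obtain ⟨u₁, r₁, e₁⟩ := progN_spec s₀
  set s₁ := progN.exec s₀
  obtain ⟨u₂, r₂, e₂⟩ := progA_spec s₁
  set s₂ := progA.exec s₁
  obtain ⟨u₃, r₃, e₃⟩ := progTr_spec s₂
  set s₃ := progTr.exec s₂
  obtain ⟨u₄, r₄, e₄⟩ := progOne_spec s₃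
  set s₄ := progOne.exec s₃
  obtain ⟨u₅, r₅, e₅⟩ := progB_spec s₄
  set s₅ := progB.exec s₄
  obtain ⟨u₆, r₆, f₆, e₆⟩ := progBasis_spec s₅
  set s₆ := progBasis.exec s₅
  have R6 : ∀ v < 4, s₆.nat v = s₀.nat v := fun v hv => by
    rw [r₆ v hv, r₅ v hv, r₄ v hv, r₃ v hv, r₂ v hv, r₁ v hv]
  have R5 : ∀ v < 4, s₅.nat v = s₀.nat v := fun v hv => by
    rw [r₅ v hv, r₄ v hv, r₃ v hv, r₂ v hv, r₁ v hv]
  have R4 : ∀ v < 4, s₄.nat v = s₀.nat v := fun v hv => by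
    rw [r₄ v hv, r₃ v hv, r₂ v hv, r₁ v hv]
  have R3 : ∀ v < 4, s₃.nat v = s₀.nat v := fun v hv => by
    rw [r₃ v hv, r₂ v hv, r₁ v hv]
  have R2 : ∀ v < 4, s₂.nat v = s₀.nat v := fun v hv => by rw [r₂ v hv, r₁ v hv]
  have U6 : ∀ a, a ≠ 3 → a ≠ 4 → a ≠ 5 → a ≠ 6 → a ≠ 7 → s₆.real a = s₀.real a :=
    fun a h3 h4 h5 h6 h7 => by
      rw [u₆ a h7, u₅ a h6, u₄ a h6, u₃ a h5, u₂ a h4, u₁ a h3]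
  have N6 : ∀ l < d, ∀ l' < d, s₂.real 3 l l' 0 = specN q m x l l' := fun l hl l' hl' => by
    rw [u₂ 3 (by decide), e₁ l hl l' hl', z 3 (by decide), zero_add, n1, n3]
  have A6 : ∀ l < d, ∀ l' < d, s₆.real 4 l l' 0 = specA q m x l l' := fun l hl l' hl' => by
    rw [u₆ 4 (by decide), u₅ 4 (by decide), u₄ 4 (by decide), u₃ 4 (by decide),
      e₂ l (by rwa [r₁ 0 (by decide)]) l' (by rwa [r₁ 0 (by decide)]), u₁ 4 (by decide),
      z 4 (by decide), zero_add, r₁ 1 (by decide), r₁ 3 (by decide), u₁ 0 (by decide), n1, n3]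
  have T3 : s₃.real 5 0 0 0 = specTr d q m x := by
    rw [e₃, u₂ 5 (by decide), u₁ 5 (by decide), z 5 (by decide), zero_add, R2 0 (by decide), n0]
    exact Finset.sum_congr rfl fun l hl => N6 l (Finset.mem_range.1 hl) l (Finset.mem_range.1 hl)
  have B6 : ∀ l < d, ∀ l' < d, s₆.real 6 l l' 0 = specB d q m x l l' := fun l hl l' hl' => by
    rw [u₆ 6 (by decide), e₅ l (by rwa [R4 0 (by decide)]) l' (by rwa [R4 0 (by decide)]),
      e₄ l (by rwa [R3 0 (by decide)]) l' (by rwa [R3 0 (by decide)]), u₃ 6 (by decide),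
      u₂ 6 (by decide), u₁ 6 (by decide), z 6 (by decide), zero_add, u₄ 3 (by decide),
      u₃ 3 (by decide), N6 l hl l' hl', u₄ 5 (by decide), T3, specB]
  have Y6 : ∀ j < d, ∀ l < d, s₆.real 7 0 j l = if l = j then 1 else 0 := fun j hj l hl => by
    rw [e₆ j (by rwa [R5 0 (by decide)]) l (by rwa [R5 0 (by decide)]), u₅ 7 (by decide),
      u₄ 7 (by decide), u₃ 7 (by decide), u₂ 7 (by decide), u₁ 7 (by decide),
      z 7 (by decide), zero_add]
  -- power iteration with the matrix in array `4`
  obtain ⟨u₇, r₇, e₇⟩ := progIter_spec (b := 4) (y := 7) (t := 8) (by decide) (by decide)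
    (by decide) s₆
    (fun τ j l hτ => by
      rw [f₆ τ j l hτ, u₅ 7 (by decide), u₄ 7 (by decide), u₃ 7 (by decide), u₂ 7 (by decide),
        u₁ 7 (by decide), z 7 (by decide)])
    (fun τ j l => by
      rw [U6 8 (by decide) (by decide) (by decide) (by decide) (by decide), z 8 (by decide)])
  set s₇ := (progIter 4 7 8).exec s₆
  have P7 : ∀ j < d, ∀ l < d, s₇.real 7 m j l = specPow d q m x j l := fun j hj l hl => by
    rw [e₇ m (by rw [R6 3 (by decide), n3]) j (by rwa [R6 0 (by decide)]) l
      (by rwa [R6 0 (by decide)]), R6 0 (by decide), n0]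
    exact iterMat_congr A6 (Y6 j hj) m l hl
  obtain ⟨u₈, r₈, f₈, e₈⟩ := progCopy_spec s₇
  set s₈ := progCopy.exec s₇
  have R7 : ∀ v < 4, s₇.nat v = s₀.nat v := fun v hv => by rw [r₇ v hv, R6 v hv]
  have R8 : ∀ v < 4, s₈.nat v = s₀.nat v := fun v hv => by rw [r₈ v hv, R7 v hv]
  have Y8 : ∀ j < d, ∀ l < d, s₈.real 9 0 j l = specPow d q m x j l := fun j hj l hl => by
    rw [e₈ j (by rwa [R7 0 (by decide)]) l (by rwa [R7 0 (by decide)]),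
      u₇ 9 (by decide) (by decide),
      U6 9 (by decide) (by decide) (by decide) (by decide) (by decide), z 9 (by decide),
      R7 3 (by decide), n3, P7 j hj l hl, zero_add]
  -- the terms of the Neumann series, by iteration with the matrix in array `6`
  obtain ⟨u₉, r₉, e₉⟩ := progIter_spec (b := 6) (y := 9) (t := 10) (by decide) (by decide)
    (by decide) s₈
    (fun τ j l hτ => by
      rw [f₈ τ j l hτ, u₇ 9 (by decide) (by decide),
        U6 9 (by decide) (by decide) (by decide) (by decide) (by decide), z 9 (by decide)])
    (fun τ j l => by
      rw [u₈ 10 (by decide), u₇ 10 (by decide) (by decide),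
        U6 10 (by decide) (by decide) (by decide) (by decide) (by decide), z 10 (by decide)])
  set s₉ := (progIter 6 9 10).exec s₈
  have Y9 : ∀ t < m, ∀ j < d, ∀ l < d, s₉.real 9 t j l
      = iterMat d (specB d q m x) (specPow d q m x j) t l := fun t ht j hj l hl => by
    rw [e₉ t (by rw [R8 3 (by decide), n3]; omega) j (by rwa [R8 0 (by decide)]) l
      (by rwa [R8 0 (by decide)]), R8 0 (by decide), n0]
    refine iterMat_congr (fun l hl l' hl' => ?_) (Y8 j hj) t l hl
    rw [u₈ 6 (by decide), u₇ 6 (by decide) (by decide), B6 l hl l' hl']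
  -- the candidate directions
  obtain ⟨u₁₀, r₁₀, e₁₀⟩ := progDir_spec s₉
  set s₁₀ := progDir.exec s₉
  have R9 : ∀ v < 4, s₉.nat v = s₀.nat v := fun v hv => by rw [r₉ v hv, R8 v hv]
  have R10 : ∀ v < 4, s₁₀.nat v = s₀.nat v := fun v hv => by rw [r₁₀ v hv, R9 v hv]
  have U9 : ∀ a, a ≠ 3 → a ≠ 4 → a ≠ 5 → a ≠ 6 → a ≠ 7 → a ≠ 8 → a ≠ 9 → a ≠ 10 →
      s₉.real a = s₀.real a := fun a h3 h4 h5 h6 h7 h8 h9 h10 => by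
    rw [u₉ a h9 h10, u₈ a h9, u₇ a h7 h8, U6 a h3 h4 h5 h6 h7]
  have X10 : ∀ j < d + d, ∀ l < d, s₁₀.real 11 j l 0 = specRow d q m x j l :=
    fun j hj l hl => by
    rw [e₁₀ j (by rwa [R9 0 (by decide)]) l (by rwa [R9 0 (by decide)]),
      U9 11 (by decide) (by decide) (by decide) (by decide) (by decide) (by decide) (by decide)
        (by decide), z 11 (by decide), zero_add, R9 0 (by decide), R9 3 (by decide), n0, n3,
      specRow]
    split_ifs with hjd
    · exact Finset.sum_congr rfl fun t ht => Y9 t (Finset.mem_range.1 ht) j hjd l hl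
    · rw [specDir]
      congr 1
      exact Finset.sum_congr rfl fun t ht =>
        Y9 t (Finset.mem_range.1 ht) (j - d) (by omega) l hl
  -- their inner products with the data, and the scores
  obtain ⟨u₁₁, r₁₁, e₁₁⟩ := progProj_spec s₁₀
  set s₁₁ := progProj.exec s₁₀
  have U10 : ∀ a, a ≠ 3 → a ≠ 4 → a ≠ 5 → a ≠ 6 → a ≠ 7 → a ≠ 8 → a ≠ 9 → a ≠ 10 → a ≠ 11 →
      s₁₀.real a = s₀.real a := fun a h3 h4 h5 h6 h7 h8 h9 h10 h11 => by
    rw [u₁₀ a h11, U9 a h3 h4 h5 h6 h7 h8 h9 h10]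
  have R11 : ∀ v < 4, s₁₁.nat v = s₀.nat v := fun v hv => by rw [r₁₁ v hv, R10 v hv]
  have P11 : ∀ j < d + d, ∀ b < m, ∀ i < q, s₁₁.real 12 j b i = specProj d q m x j b i :=
    fun j hj b hb i hi => by
    rw [e₁₁ j (by rwa [R10 0 (by decide)]) b (by rwa [R10 3 (by decide)]) i
      (by rwa [R10 1 (by decide)]), U10 12 (by decide) (by decide) (by decide) (by decide)
        (by decide) (by decide) (by decide) (by decide) (by decide), z 12 (by decide), zero_add,
      R10 0 (by decide), n0]
    refine Finset.sum_congr rfl fun l hl => ?_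
    rw [X10 j hj l (Finset.mem_range.1 hl), U10 0 (by decide) (by decide) (by decide) (by decide)
        (by decide) (by decide) (by decide) (by decide) (by decide)]
  obtain ⟨u₁₂, r₁₂, e₁₂⟩ := progScore_spec s₁₁
  set s₁₂ := progScore.exec s₁₁
  have R12 : ∀ v < 4, s₁₂.nat v = s₀.nat v := fun v hv => by rw [r₁₂ v hv, R11 v hv]
  have S12 : ∀ j < d + d, ∀ b, 4 * b + 3 < m → ∀ i < q,
      s₁₂.real 13 j b i = specScore d q k m x j b i := fun j hj b hb i hi => by
    rw [e₁₂ j (by rwa [R11 0 (by decide)]) b (by rw [R11 3 (by decide), n3]; omega) i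
      (by rwa [R11 1 (by decide)]), u₁₁ 13 (by decide), U10 13 (by decide) (by decide) (by decide)
        (by decide) (by decide) (by decide) (by decide) (by decide) (by decide),
      z 13 (by decide), zero_add, R11 3 (by decide), R11 1 (by decide), R11 2 (by decide), n1, n2,
      n3, specScore]
    refine Finset.sum_congr rfl fun b' _ => ?_
    split_ifs with hb'
    · refine Finset.sum_congr rfl fun i₁ hi₁ => ?_
      rw [P11 j hj _ (by omega) i hi, P11 j hj _ hb' i₁ (Finset.mem_range.1 hi₁)]
      congr 2
      refine Finset.sum_congr rfl fun i₂ hi₂ => ?_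
      rw [P11 j hj _ hb' i₂ (Finset.mem_range.1 hi₂)]
    · rfl
  -- selection and output
  obtain ⟨u₁₃, r₁₃, e₁₃⟩ := progInit_spec s₁₂
  set s₁₃ := progInit.exec s₁₂
  have R13 : ∀ v < 4, s₁₃.nat v = s₀.nat v := fun v hv => by rw [r₁₃ v hv, R12 v hv]
  have M13 : s₁₃.real 14 0 0 0 = 0 + ((q : ℝ) * q * m + 1) := by
    rw [e₁₃, u₁₂ 14 (by decide), u₁₁ 14 (by decide), U10 14 (by decide) (by decide) (by decide)
        (by decide) (by decide) (by decide) (by decide) (by decide) (by decide),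
      z 14 (by decide), R12 1 (by decide), R12 3 (by decide), n1, n3]
  have S13 : ∀ j < d + d, ∀ b, 4 * b + 3 < m → ∀ i < q,
      s₁₃.real 13 j b i = specScore d q k m x j b i := fun j hj b hb i hi => by
    rw [u₁₃ 13 (by decide), S12 j hj b hb i hi]
  obtain ⟨u₁₄, r₁₄, j, hj, b, hb, i, hi, hc, hmin⟩ := progSelect_spec s₁₃
    (by rwa [R13 0 (by decide)]) (by rwa [R13 1 (by decide)]) (by rwa [R13 3 (by decide)])
    (by
      rw [R13 0 (by decide), R13 1 (by decide), R13 3 (by decide), n0, n1, n3, M13]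
      intro j hj b hb i hi
      rw [S13 j hj b hb i hi]
      exact specScore_lt x j b i)
  set s₁₄ := progSelect.exec s₁₃
  rw [R13 0 (by decide), n0] at hj
  rw [R13 3 (by decide), n3] at hb
  rw [R13 1 (by decide), n1] at hi
  rw [R13 0 (by decide), R13 3 (by decide), R13 1 (by decide), n0, n1, n3] at hmin
  obtain ⟨u₁₅, r₁₅, e₁₅⟩ := progOutVec_spec s₁₄
  set s₁₅ := progOutVec.exec s₁₄
  obtain ⟨u₁₆, e₁₆⟩ := progOutOffset_spec s₁₅
  have hrun : (learner.run s₀).1 = progOutOffset.exec s₁₅ := rfl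
  simp only [chosen, Prod.mk.injEq] at hc
  have R14 : ∀ v < 4, s₁₄.nat v = s₀.nat v := fun v hv => by rw [r₁₄ v hv, R13 v hv]
  have U14 : ∀ a, a < 3 → a ≠ 0 → s₁₄.real a = s₀.real a := fun a ha h0 => by
    rw [u₁₄ a (by omega), u₁₃ a (by omega), u₁₂ a (by omega), u₁₁ a (by omega),
      U10 a (by omega) (by omega) (by omega) (by omega) (by omega) (by omega) (by omega) (by omega)
        (by omega)]
  refine ⟨j, hj, b, hb, i, hi, fun l => ?_, ?_, fun j' hj' b' hb' i' hi' => ?_⟩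
  · simp only [Prog.outVec]
    rw [hrun, u₁₆ 1 (by decide), e₁₅ l (by rw [R14 0 (by decide)]; exact l.2),
      U14 1 (by decide) (by decide), z 1 (by decide), zero_add, hc.1, u₁₄ 11 (by decide),
      u₁₃ 11 (by decide), u₁₂ 11 (by decide), u₁₁ 11 (by decide), X10 j hj l l.2]
  · simp only [Prog.outOffset]
    rw [hrun, e₁₆, u₁₅ 2 (by decide), U14 2 (by decide) (by decide), z 2 (by decide),
      r₁₅ 20 (by decide), r₁₅ 21 (by decide), r₁₅ 22 (by decide), hc.1, hc.2.1, hc.2.2,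
      u₁₅ 12 (by decide), u₁₄ 12 (by decide), u₁₃ 12 (by decide), u₁₂ 12 (by decide),
      P11 j hj _ (by omega) i hi, zero_sub]
  · have := hmin j' hj' b' hb' i' hi'
    rwa [S13 j hj b hb i hi, S13 j' hj' b' hb' i' hi'] at this

section

/-! ### The learner in coordinate-free terms -/

/-- The operator `y ↦ ⟪v, y⟫ v`. -/
def rankOne {d : ℕ} (v : Vec d) : Vec d →L[ℝ] Vec d := (innerSL ℝ v).smulRight v

theorem rankOne_apply {d : ℕ} (v y : Vec d) : rankOne v y = (inner ℝ v y : ℝ) • v := rfl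

theorem rankOne_coord {d : ℕ} (v y : Vec d) (l : Fin d) :
    rankOne v y l = ∑ l' : Fin d, v l * v l' * y l' := by
  simp only [rankOne_apply, PiLp.smul_apply, PiLp.inner_apply, smul_eq_mul, Finset.sum_mul,
    RCLike.inner_apply, conj_trivial]
  exact Finset.sum_congr rfl fun _ _ => by ring

variable {d q n : ℕ}

/-- The sum of the `(x - x') (x - x')ᵀ`, over all pairs of vectors in two bags. -/
def pairOp (x x' : Fin q → Vec d) : Vec d →L[ℝ] Vec d := ∑ i, ∑ i', rankOne (x i - x' i')

/-- `D Dᵀ`, for the difference `D` of the sums of two bags. -/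
def sumOp (x x' : Fin q → Vec d) : Vec d →L[ℝ] Vec d := rankOne (∑ i, (x i - x' i))

/-- The operator that estimates the covariance within the mixture, up to a scalar. -/
def covOp (X X' : Fin n → Fin q → Vec d) : Vec d →L[ℝ] Vec d := ∑ j, pairOp (X j) (X' j)

/-- The operator that estimates `g gᵀ`, up to a scalar, for the difference `g` of the means of the
two classes. -/
def gapOp (X X' : Fin n → Fin q → Vec d) : Vec d →L[ℝ] Vec d :=
  ∑ j, (pairOp (X j) (X' j) - (q : ℝ) • sumOp (X j) (X' j))

/-- The trace of `covOp X X'`. -/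
def covTrace (X X' : Fin n → Fin q → Vec d) : ℝ := ∑ j, ∑ i, ∑ i', ‖X j i - X' j i'‖ ^ 2

/-- `m` steps of the power iteration for `gapOp`, started at a basis vector, followed by the
approximate inversion of `covOp` by `m` terms of the Neumann series. -/
def dirVec (m : ℕ) (X X' : Fin n → Fin q → Vec d) (j : Fin d) : Vec d :=
  ∑ t ∈ Finset.range m, ((1 - (covTrace X X')⁻¹ • covOp X X') ^ t)
    ((gapOp X X' ^ m) (EuclideanSpace.single j 1))

/-- The candidate directions are the `dirVec` and their opposites. -/
def candDir (m : ℕ) (X X' : Fin n → Fin q → Vec d) (j : Bool × Fin d) : Vec d :=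
  if j.1 then dirVec m X X' j.2 else -dirVec m X X' j.2

/-- The number of vectors in a bag that a threshold function classifies as positive. -/
def posCount (r : Vec d) (c : ℝ) (x : Fin q → Vec d) : ℝ :=
  ∑ i, if ltf r c (x i) = 1 then 1 else 0

/-- The score of a candidate hypothesis: up to a constant, the sum of the `(N - k) ^ 2`. -/
def score (k : ℕ) (r : Vec d) (c : ℝ) (X : Fin n → Fin q → Vec d) : ℝ :=
  ∑ b, (posCount r c (X b) ^ 2 - 2 * k * posCount r c (X b))

/-- The bags with the indices `4 b + a`. -/
def quarter {m : ℕ} (a : Fin 4) (bags : Fin m → Fin q → Vec d) (b : Fin (m / 4)) :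
    Fin q → Vec d :=
  bags ⟨4 * b + a, by have := b.2; have := a.2; omega⟩

/-- The programs run over all `j < m` and test whether `4 j + 3 < m`; this is a sum over the blocks of
four bags. -/
theorem sum_block (m : ℕ) (g : ℕ → ℝ) :
    (∑ j ∈ Finset.range m, if 4 * j + 3 < m then g j else 0) = ∑ b : Fin (m / 4), g b := by
  rw [← Finset.sum_range g, ← Finset.sum_filter]
  refine Finset.sum_congr ?_ fun _ _ => rfl
  ext j
  simp only [Finset.mem_filter, Finset.mem_range]
  omega

theorem input_quarter {m : ℕ} (k : ℕ) (a : Fin 4) (bags : Fin m → Fin q → Vec d)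
    (b : Fin (m / 4)) (i : Fin q) (l : Fin d) :
    (inputStore k bags).real 0 (4 * b + a) i l = quarter a bags b i l := by
  have h : 4 * (b : ℕ) + a < m := by have := b.2; have := a.2; omega
  simp [inputStore, h, quarter]

theorem sum_apply_coord {ι : Type*} (s : Finset ι) (f : ι → Vec d) (l : Fin d) :
    (∑ i ∈ s, f i) l = ∑ i ∈ s, f i l := by
  simp

/-- `iterMat` computes the powers of the operator with the given matrix. -/
theorem iterMat_eq {T : Vec d →L[ℝ] Vec d} {B : ℕ → ℕ → ℝ}
    (hT : ∀ (y : Vec d) (l : Fin d), T y l = ∑ l' : Fin d, B l l' * y l') {y : ℕ → ℝ} {v : Vec d}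
    (hy : ∀ l : Fin d, y l = v l) (t : ℕ) (l : Fin d) : iterMat d B y t l = (T ^ t) v l := by
  induction t generalizing l with
  | zero => exact hy l
  | succ t ih =>
    rw [pow_succ', mul_apply_eq_comp, hT]
    simp only [iterMat]
    rw [Finset.sum_range]
    exact Finset.sum_congr rfl fun l' _ => by rw [ih]

section

variable {m k : ℕ} (bags : Fin m → Fin q → Vec d)

theorem covOp_coord (y : Vec d) (l : Fin d) :
    covOp (quarter 0 bags) (quarter 1 bags) y l
      = ∑ l' : Fin d, specN q m ((inputStore k bags).real 0) l l' * y l' := by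
  simp only [specN]
  simp_rw [sum_block m (fun j => ∑ i ∈ Finset.range q, ∑ i' ∈ Finset.range q,
      (((inputStore k bags).real 0 (4 * j) i _ - (inputStore k bags).real 0 (4 * j + 1) i' _)
      * ((inputStore k bags).real 0 (4 * j) i _ - (inputStore k bags).real 0 (4 * j + 1) i' _))),
    Finset.sum_range]
  have h0 := fun b i l => input_quarter k 0 bags b i l
  have h1 := fun b i l => input_quarter k 1 bags b i l
  simp only [Fin.val_zero, Fin.val_one, add_zero] at h0 h1
  simp only [h0, h1, covOp, pairOp, sum_apply, sum_apply_coord, rankOne_coord,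
    Finset.sum_mul]
  simp only [PiLp.sub_apply]
  symm
  rw [Finset.sum_comm]
  refine Finset.sum_congr rfl fun j _ => ?_
  rw [Finset.sum_comm]
  refine Finset.sum_congr rfl fun i _ => ?_
  rw [Finset.sum_comm]

theorem gapOp_coord (y : Vec d) (l : Fin d) :
    gapOp (quarter 0 bags) (quarter 1 bags) y l
      = ∑ l' : Fin d, specA q m ((inputStore k bags).real 0) l l' * y l' := by
  simp only [specA]
  simp_rw [sum_block m (fun j => ∑ i ∈ Finset.range q, ∑ i' ∈ Finset.range q,
      (((inputStore k bags).real 0 (4 * j) i _ - (inputStore k bags).real 0 (4 * j + 1) i' _)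
      * ((inputStore k bags).real 0 (4 * j) i _ - (inputStore k bags).real 0 (4 * j + 1) i' _)
      - q * (((inputStore k bags).real 0 (4 * j) i _ - (inputStore k bags).real 0 (4 * j + 1) i _)
      * ((inputStore k bags).real 0 (4 * j) i' _
        - (inputStore k bags).real 0 (4 * j + 1) i' _)))),
    Finset.sum_range]
  have h0 := fun b i l => input_quarter k 0 bags b i l
  have h1 := fun b i l => input_quarter k 1 bags b i l
  simp only [Fin.val_zero, Fin.val_one, add_zero] at h0 h1
  simp only [h0, h1, gapOp, sum_apply, sum_apply_coord]
  simp only [Finset.sum_mul (s := (Finset.univ : Finset (Fin (m / 4))))]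
  rw [Finset.sum_comm]
  refine Finset.sum_congr rfl fun j _ => ?_
  have e1 : pairOp (quarter 0 bags j) (quarter 1 bags j) y l = ∑ l' : Fin d, (∑ i, ∑ i',
      (quarter 0 bags j i l - quarter 1 bags j i' l)
        * (quarter 0 bags j i l' - quarter 1 bags j i' l')) * y l' := by
    simp only [pairOp, sum_apply, sum_apply_coord, rankOne_coord, Finset.sum_mul, PiLp.sub_apply]
    symm
    rw [Finset.sum_comm]
    refine Finset.sum_congr rfl fun i _ => ?_
    rw [Finset.sum_comm]
  have e2 : sumOp (quarter 0 bags j) (quarter 1 bags j) y l = ∑ l' : Fin d, (∑ i, ∑ i',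
      (quarter 0 bags j i l - quarter 1 bags j i l)
        * (quarter 0 bags j i' l' - quarter 1 bags j i' l')) * y l' := by
    simp only [sumOp, rankOne_coord, sum_apply_coord, PiLp.sub_apply, ← Finset.sum_mul_sum]
  rw [sub_apply, PiLp.sub_apply, smul_apply, PiLp.smul_apply, e1, e2, smul_eq_mul, Finset.mul_sum,
    ← Finset.sum_sub_distrib]
  refine Finset.sum_congr rfl fun l' _ => ?_
  simp only [Finset.sum_sub_distrib, ← Finset.mul_sum]
  ring

theorem covTrace_eq : covTrace (quarter 0 bags) (quarter 1 bags)
    = specTr d q m ((inputStore k bags).real 0) := by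
  simp only [specTr, specN]
  simp_rw [sum_block m (fun j => ∑ i ∈ Finset.range q, ∑ i' ∈ Finset.range q,
      (((inputStore k bags).real 0 (4 * j) i _ - (inputStore k bags).real 0 (4 * j + 1) i' _)
      * ((inputStore k bags).real 0 (4 * j) i _ - (inputStore k bags).real 0 (4 * j + 1) i' _))),
    Finset.sum_range]
  have h0 := fun b i l => input_quarter k 0 bags b i l
  have h1 := fun b i l => input_quarter k 1 bags b i l
  simp only [Fin.val_zero, Fin.val_one, add_zero] at h0 h1
  simp only [h0, h1, covTrace, EuclideanSpace.real_norm_sq_eq, PiLp.sub_apply]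
  simp only [sq]
  symm
  rw [Finset.sum_comm]
  refine Finset.sum_congr rfl fun j _ => ?_
  rw [Finset.sum_comm]
  refine Finset.sum_congr rfl fun i _ => ?_
  rw [Finset.sum_comm]

theorem dirVec_coord (j l : Fin d) : specDir d q m ((inputStore k bags).real 0) j l
    = dirVec m (quarter 0 bags) (quarter 1 bags) j l := by
  rw [specDir, dirVec, sum_apply_coord]
  refine Finset.sum_congr rfl fun t _ => ?_
  refine iterMat_eq (fun y l => ?_) (fun l => ?_) t l
  · rw [sub_apply, PiLp.sub_apply, smul_apply,
      PiLp.smul_apply, covOp_coord (k := k), one_apply_eq_self]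
    simp only [specB, sub_mul, Finset.sum_sub_distrib, ← covTrace_eq, ite_mul, one_mul, zero_mul,
      Fin.val_inj, Finset.sum_ite_eq, Finset.mem_univ, if_true, smul_eq_mul, Finset.mul_sum]
    congr 1
    exact Finset.sum_congr rfl fun l' _ => by ring
  · refine iterMat_eq (gapOp_coord bags) (fun l => ?_) m l
    simp [Fin.val_inj]

/-- Rows below `d` hold the computed directions, the next `d` rows their opposites. -/
theorem specRow_eq (s : Bool) (j : Fin d) (l : Fin d) :
    specRow d q m ((inputStore k bags).real 0) (if s then j else d + j) l
      = candDir m (quarter 0 bags) (quarter 1 bags) (s, j) l := by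
  cases s
  · simp [specRow, candDir, dirVec_coord]
  · simp [specRow, candDir, dirVec_coord]

theorem specProj_eq (a : Fin 4) (s : Bool) (j : Fin d) (b : Fin (m / 4)) (i : Fin q) :
    specProj d q m ((inputStore k bags).real 0) (if s then j else d + j) (4 * b + a) i
      = inner ℝ (candDir m (quarter 0 bags) (quarter 1 bags) (s, j)) (quarter a bags b i) := by
  rw [specProj, Finset.sum_range, PiLp.inner_apply]
  refine Finset.sum_congr rfl fun l _ => ?_
  rw [specRow_eq, input_quarter, RCLike.inner_apply, conj_trivial, mul_comm]

theorem ltf_eq_one {r : Vec d} {c : ℝ} {x : Vec d} : ltf r c x = 1 ↔ 0 < inner ℝ r x + c := by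
  simp [ltf, pos]

theorem specScore_eq (s : Bool) (j : Fin d) (b : Fin (m / 4)) (i : Fin q) :
    specScore d q k m ((inputStore k bags).real 0) (if s then j else d + j) b i
      = score k (candDir m (quarter 0 bags) (quarter 1 bags) (s, j))
        (-inner ℝ (candDir m (quarter 0 bags) (quarter 1 bags) (s, j)) (quarter 2 bags b i))
        (quarter 3 bags) := by
  have h2 := specProj_eq (k := k) bags 2 s j b i
  have h3 := fun b i => specProj_eq (k := k) bags 3 s j b i
  simp only [show ((2 : Fin 4) : ℕ) = 2 from rfl, show ((3 : Fin 4) : ℕ) = 3 from rfl] at h2 h3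
  rw [specScore, sum_block m (fun b' => ∑ i₁ ∈ Finset.range q, _), score]
  refine Finset.sum_congr rfl fun b' _ => ?_
  have e : ∀ i₁ : Fin q, (inner ℝ (candDir m (quarter 0 bags) (quarter 1 bags) (s, j))
      (quarter 2 bags b i) < inner ℝ (candDir m (quarter 0 bags) (quarter 1 bags) (s, j))
      (quarter 3 bags b' i₁)) ↔ ltf (candDir m (quarter 0 bags) (quarter 1 bags) (s, j))
        (-inner ℝ (candDir m (quarter 0 bags) (quarter 1 bags) (s, j)) (quarter 2 bags b i))
        (quarter 3 bags b' i₁) = 1 := fun i₁ => by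
    rw [ltf_eq_one]
    constructor <;> intro h <;> linarith
  simp only [Finset.sum_range, h2, h3, e]
  set r := candDir m (quarter 0 bags) (quarter 1 bags) (s, j)
  rw [← Finset.sum_filter, Finset.sum_const, nsmul_eq_mul]
  have : (posCount r (-inner ℝ r (quarter 2 bags b i)) (quarter 3 bags b')) =
      ((Finset.univ.filter fun i₁ : Fin q => ltf r (-inner ℝ r (quarter 2 bags b i))
        (quarter 3 bags b' i₁) = 1).card : ℝ) := by
    simp [posCount]
  rw [← this, ← posCount]
  ring

/-- The output of the learning program is a candidate hypothesis of least score. -/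
theorem learner_output (hd : 0 < d) (hq : 0 < q) (hm : 3 < m) :
    ∃ (j : Bool × Fin d) (b : Fin (m / 4)) (i : Fin q),
      learner.outVec k bags = candDir m (quarter 0 bags) (quarter 1 bags) j ∧
      learner.outOffset k bags
        = -inner ℝ (candDir m (quarter 0 bags) (quarter 1 bags) j) (quarter 2 bags b i) ∧
      ∀ (j' : Bool × Fin d) (b' : Fin (m / 4)) (i' : Fin q),
        score k (learner.outVec k bags) (learner.outOffset k bags) (quarter 3 bags)
          ≤ score k (candDir m (quarter 0 bags) (quarter 1 bags) j')
            (-inner ℝ (candDir m (quarter 0 bags) (quarter 1 bags) j') (quarter 2 bags b' i'))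
            (quarter 3 bags) := by
  obtain ⟨j, hj, b, hb, i, hi, h1, h2, h3⟩ := learner_spec (k := k) hd hq hm bags
  obtain ⟨s, j₀, rfl⟩ : ∃ (s : Bool) (j₀ : Fin d), j = if s then (j₀ : ℕ) else d + j₀ := by
    rcases Nat.lt_or_ge j d with h | h
    · exact ⟨true, ⟨j, h⟩, by simp⟩
    · exact ⟨false, ⟨j - d, by omega⟩, by simp; omega⟩
  obtain ⟨b₀, rfl⟩ : ∃ b₀ : Fin (m / 4), b = b₀ := ⟨⟨b, by omega⟩, rfl⟩
  obtain ⟨i₀, rfl⟩ : ∃ i₀ : Fin q, i = i₀ := ⟨⟨i, hi⟩, rfl⟩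
  have e1 : learner.outVec k bags = candDir m (quarter 0 bags) (quarter 1 bags) (s, j₀) := by
    ext l
    rw [h1 l, specRow_eq]
  have e2 : learner.outOffset k bags = -inner ℝ
      (candDir m (quarter 0 bags) (quarter 1 bags) (s, j₀)) (quarter 2 bags b₀ i₀) := by
    rw [h2, ← specProj_eq (k := k) bags 2 s j₀ b₀ i₀]
    rfl
  refine ⟨(s, j₀), b₀, i₀, e1, e2, fun j' b' i' => ?_⟩
  rw [e2, e1, ← specScore_eq, ← specScore_eq]
  refine h3 _ ?_ b' (by have := b'.2; omega) i' i'.2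
  have := j'.2.2
  split_ifs <;> omega

end

/-- The candidate directions do not depend on the order of the vectors in the bags. -/
theorem candDir_perm (m : ℕ) (X X' : Fin n → Fin q → Vec d) (σ σ' : Fin n → Equiv.Perm (Fin q)) :
    candDir m (fun j i => X j (σ j i)) (fun j i => X' j (σ' j i)) = candDir m X X' := by
  have h1 : covOp (fun j i => X j (σ j i)) (fun j i => X' j (σ' j i)) = covOp X X' := by
    refine Finset.sum_congr rfl fun j _ => ?_
    rw [pairOp, Equiv.sum_comp (σ j) (fun i => ∑ i', rankOne (X j i - X' j (σ' j i')))]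
    exact Finset.sum_congr rfl fun i _ =>
      Equiv.sum_comp (σ' j) (fun i' => rankOne (X j i - X' j i'))
  have h2 : gapOp (fun j i => X j (σ j i)) (fun j i => X' j (σ' j i)) = gapOp X X' := by
    refine Finset.sum_congr rfl fun j _ => ?_
    congr 1
    · rw [pairOp, Equiv.sum_comp (σ j) (fun i => ∑ i', rankOne (X j i - X' j (σ' j i')))]
      exact Finset.sum_congr rfl fun i _ =>
        Equiv.sum_comp (σ' j) (fun i' => rankOne (X j i - X' j i'))
    · rw [sumOp, sumOp, Finset.sum_sub_distrib, Finset.sum_sub_distrib,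
        Equiv.sum_comp (σ j) (X j), Equiv.sum_comp (σ' j) (X' j)]
  have h3 : covTrace (fun j i => X j (σ j i)) (fun j i => X' j (σ' j i)) = covTrace X X' := by
    refine Finset.sum_congr rfl fun j _ => ?_
    rw [Equiv.sum_comp (σ j) (fun i => ∑ i', ‖X j i - X' j (σ' j i')‖ ^ 2)]
    exact Finset.sum_congr rfl fun i _ =>
      Equiv.sum_comp (σ' j) (fun i' => ‖X j i - X' j i'‖ ^ 2)
  funext j
  simp only [candDir, dirVec, h1, h2, h3]

theorem score_perm (k : ℕ) (r : Vec d) (c : ℝ) (X : Fin n → Fin q → Vec d)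
    (σ : Fin n → Equiv.Perm (Fin q)) :
    score k r c (fun j i => X j (σ j i)) = score k r c X := by
  refine Finset.sum_congr rfl fun b _ => ?_
  have : posCount r c (fun i => X b (σ b i)) = posCount r c (X b) :=
    Equiv.sum_comp (σ b) (fun i => if ltf r c (X b i) = 1 then (1 : ℝ) else 0)
  rw [this]

end

section

/-! ### Concentration, nets and product measures -/

/-- The second-order bound behind Bernstein's inequality. -/
theorem exp_mul_le_quadratic {s x : ℝ} (hs0 : 0 ≤ s) (hs : s ≤ 1 / 2) :
    Real.exp (s * x) ≤ 1 + s * x + 8 * s ^ 2 * Real.exp |x| := by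
  have h := Complex.norm_exp_sub_sum_le_norm_mul_exp ((s * x : ℝ) : ℂ) 2
  have h1 : Real.exp (s * x) - (1 + s * x) ≤ |s * x| ^ 2 * Real.exp |s * x| := by
    have e : Complex.exp ((s * x : ℝ) : ℂ) - ∑ m ∈ Finset.range 2, ((s * x : ℝ) : ℂ) ^ m / m.factorial
        = ((Real.exp (s * x) - (1 + s * x) : ℝ) : ℂ) := by
      simp [Finset.sum_range_succ]
    rw [e, Complex.norm_real, Complex.norm_real, Real.norm_eq_abs, Real.norm_eq_abs] at h
    exact (le_abs_self _).trans h
  have h2 : |s * x| ≤ |x| / 2 := by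
    rw [abs_mul, abs_of_nonneg hs0]
    nlinarith [abs_nonneg x]
  have h3 : (|x| / 2) ^ 2 / 2 ≤ Real.exp (|x| / 2) := by
    have := Real.quadratic_le_exp_of_nonneg (x := |x| / 2) (by positivity)
    have h0 := abs_nonneg x
    nlinarith
  have h4 : |s * x| ^ 2 * Real.exp |s * x| ≤ 8 * s ^ 2 * Real.exp |x| := by
    have e : Real.exp |x| = Real.exp (|x| / 2) * Real.exp (|x| / 2) := by
      rw [← Real.exp_add]; ring_nf
    have e2 : |s * x| ^ 2 = s ^ 2 * |x| ^ 2 := by rw [abs_mul, abs_of_nonneg hs0]; ring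
    have e3 : Real.exp |s * x| ≤ Real.exp (|x| / 2) := Real.exp_le_exp.2 h2
    rw [e, e2]
    calc s ^ 2 * |x| ^ 2 * Real.exp |s * x|
        ≤ s ^ 2 * (8 * Real.exp (|x| / 2)) * Real.exp (|x| / 2) := by
          gcongr
          linarith
      _ = _ := by ring
  linarith

section

variable {Ω : Type*} [MeasurableSpace Ω] {P : Measure Ω}

theorem integrable_exp_abs {f : Ω → ℝ} (hf : Measurable f) {C : ℝ}
    (h : ∫⁻ x, ENNReal.ofReal (Real.exp |f x|) ∂P ≤ ENNReal.ofReal C) :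
    Integrable (fun x => Real.exp |f x|) P := by
  refine ⟨(by fun_prop : Measurable fun x => Real.exp |f x|).aestronglyMeasurable, ?_⟩
  rw [hasFiniteIntegral_iff_ofReal (ae_of_all _ fun x => (Real.exp_pos _).le)]
  exact h.trans_lt ENNReal.ofReal_lt_top

theorem integrable_of_exp_abs {f : Ω → ℝ} (hf : Measurable f) {C : ℝ}
    (h : ∫⁻ x, ENNReal.ofReal (Real.exp |f x|) ∂P ≤ ENNReal.ofReal C) : Integrable f P :=
  (integrable_exp_abs hf h).mono' hf.aestronglyMeasurable (ae_of_all _ fun x => by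
    rw [Real.norm_eq_abs]
    linarith [Real.add_one_le_exp |f x|])

/-- A variable with `E exp |f| ≤ e` has the moment generating function of a sub-Gaussian variable
near zero. The constant `22` is `8 e`, rounded up. -/
theorem mgf_le_of_exp_abs [IsProbabilityMeasure P] {f : Ω → ℝ} (hf : Measurable f)
    (h : ∫⁻ x, ENNReal.ofReal (Real.exp |f x|) ∂P ≤ ENNReal.ofReal (Real.exp 1)) {s : ℝ}
    (hs0 : 0 ≤ s) (hs : s ≤ 1 / 2) :
    mgf f P s ≤ Real.exp (s * ∫ x, f x ∂P + 22 * s ^ 2) := by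
  have i1 := integrable_exp_abs hf h
  have i2 := integrable_of_exp_abs hf h
  have hE : ∫ x, Real.exp |f x| ∂P ≤ Real.exp 1 := by
    rw [integral_eq_lintegral_of_nonneg_ae (ae_of_all _ fun x => (Real.exp_pos _).le)
      i1.aestronglyMeasurable]
    exact ENNReal.toReal_le_of_le_ofReal (Real.exp_pos 1).le h
  calc mgf f P s ≤ ∫ x, (1 + s * f x + 8 * s ^ 2 * Real.exp |f x|) ∂P := by
        refine integral_mono_of_nonneg (ae_of_all _ fun x => (Real.exp_pos _).le) ?_
          (ae_of_all _ fun x => exp_mul_le_quadratic hs0 hs)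
        exact ((integrable_const _).add (i2.const_mul s)).add (i1.const_mul _)
    _ = 1 + s * ∫ x, f x ∂P + 8 * s ^ 2 * ∫ x, Real.exp |f x| ∂P := by
        have i3 : Integrable (fun x => 1 + s * f x) P := (integrable_const _).add (i2.const_mul s)
        rw [integral_add i3 (i1.const_mul _),
          integral_add (integrable_const _) (i2.const_mul s), integral_const_mul,
          integral_const_mul]
        simp
    _ ≤ 1 + (s * ∫ x, f x ∂P + 22 * s ^ 2) := by
        nlinarith [Real.exp_one_lt_d9, sq_nonneg s]
    _ ≤ _ := by linarith [Real.add_one_le_exp (s * ∫ x, f x ∂P + 22 * s ^ 2)]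

/-- The one-sided Bernstein bound. -/
theorem sum_upper_deviation [IsProbabilityMeasure P] {f : Ω → ℝ} (hf : Measurable f)
    (h : ∫⁻ x, ENNReal.ofReal (Real.exp |f x|) ∂P ≤ ENNReal.ofReal (Real.exp 1)) {t : ℝ}
    (ht0 : 0 ≤ t) (ht : t ≤ 22) (n : ℕ) :
    (Measure.pi fun _ : Fin n => P) {X | n * ∫ x, f x ∂P + n * t ≤ ∑ j, f (X j)}
      ≤ ENNReal.ofReal (Real.exp (-(n * t ^ 2 / 88))) := by
  -- this `s` minimises `- s t + 22 s ^ 2`, and the minimum is `- t ^ 2 / 88`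
  set s := t / 44 with hs
  have ind : iIndepFun (fun (j : Fin n) (X : Fin n → Ω) => f (X j))
      (Measure.pi fun _ : Fin n => P) := iIndepFun_pi (X := fun _ => f) fun _ => hf.aemeasurable
  have hmeas : ∀ j : Fin n, Measurable fun X : Fin n → Ω => f (X j) := fun j => by fun_prop
  have i1 : Integrable (fun x => Real.exp (s * f x)) P := by
    refine (integrable_exp_abs hf h).mono' (by fun_prop) (ae_of_all _ fun x => ?_)
    rw [Real.norm_eq_abs, abs_of_pos (Real.exp_pos _), Real.exp_le_exp]
    have : s * f x ≤ s * |f x| := mul_le_mul_of_nonneg_left (le_abs_self _) (by positivity)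
    nlinarith [abs_nonneg (f x)]
  have i2 : ∀ j : Fin n, Integrable (fun X : Fin n → Ω => Real.exp (s * f (X j)))
      (Measure.pi fun _ : Fin n => P) := fun j =>
    (measurePreserving_eval (fun _ : Fin n => P) j).integrable_comp_of_integrable i1
  have hm : ∀ j : Fin n, mgf (fun X : Fin n → Ω => f (X j)) (Measure.pi fun _ : Fin n => P) s
      = mgf f P s := fun j => by
    have := integral_map (μ := Measure.pi fun _ : Fin n => P) (φ := Function.eval j)
      (f := fun x => Real.exp (s * f x)) (measurable_pi_apply j).aemeasurable
      (by fun_prop)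
    rw [(measurePreserving_eval (fun _ : Fin n => P) j).map_eq] at this
    exact this.symm
  have key := measure_ge_le_exp_mul_mgf (μ := Measure.pi fun _ : Fin n => P)
    (X := ∑ j, fun X : Fin n → Ω => f (X j)) (n * ∫ x, f x ∂P + n * t) (t := s) (by positivity)
    (ind.integrable_exp_mul_sum hmeas fun j _ => i2 j)
  rw [ind.mgf_sum hmeas, Finset.prod_congr rfl fun j _ => hm j, Finset.prod_const,
    Finset.card_univ, Fintype.card_fin] at key
  have h3 : Real.exp (-s * (n * ∫ x, f x ∂P + n * t)) * mgf f P s ^ n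
      ≤ Real.exp (-(n * t ^ 2 / 88)) := by
    calc _ ≤ Real.exp (-s * (n * ∫ x, f x ∂P + n * t))
          * Real.exp (s * ∫ x, f x ∂P + 22 * s ^ 2) ^ n := by
          gcongr
          · exact mgf_nonneg
          · exact mgf_le_of_exp_abs hf h (by positivity) (by rw [hs]; linarith)
      _ = _ := by
          rw [← Real.exp_nat_mul, ← Real.exp_add, hs]
          congr 1
          ring
  have e : {X : Fin n → Ω | n * ∫ x, f x ∂P + n * t ≤ ∑ j, f (X j)}
      = {X | n * ∫ x, f x ∂P + n * t ≤ (∑ j, fun X : Fin n → Ω => f (X j)) X} := by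
    simp [Finset.sum_apply]
  rw [e, ← ENNReal.ofReal_toReal (measure_ne_top _ _)]
  exact ENNReal.ofReal_le_ofReal (key.trans h3)

/-- A Bernstein bound for sums of independent copies of a random variable with an exponential
moment. The variable need not be centred. -/
theorem sum_deviation [IsProbabilityMeasure P] {f : Ω → ℝ} (hf : Measurable f)
    (h : ∫⁻ x, ENNReal.ofReal (Real.exp |f x|) ∂P ≤ ENNReal.ofReal (Real.exp 1)) {t : ℝ}
    (ht0 : 0 ≤ t) (ht : t ≤ 22) (n : ℕ) :
    (Measure.pi fun _ : Fin n => P) {X | n * t < |∑ j, f (X j) - n * ∫ x, f x ∂P|}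
      ≤ ENNReal.ofReal (2 * Real.exp (-(n * t ^ 2 / 88))) := by
  have h1 := sum_upper_deviation hf h ht0 ht n
  have h2 := sum_upper_deviation (f := fun x => -f x) hf.neg (by simpa using h) ht0 ht n
  rw [two_mul, ENNReal.ofReal_add (Real.exp_pos _).le (Real.exp_pos _).le]
  refine le_trans (measure_mono ?_) ((measure_union_le _ _).trans (add_le_add h1 h2))
  intro X hX
  simp only [Set.mem_union, Set.mem_ofPred_eq, integral_neg, Finset.sum_neg_distrib] at hX ⊢
  rcases lt_abs.1 hX with hX | hX
  · left; linarith
  · right; linarith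

end

section

variable {E : Type*} [NormedAddCommGroup E] [InnerProductSpace ℝ E] [FiniteDimensional ℝ E]

/-- A net of the unit ball at distance `1 / 2`: a maximal separated set. Its size is bounded by the
volume argument of the Besicovitch covering theorem. -/
theorem exists_half_net : ∃ s : Finset E, s.card ≤ 5 ^ Module.finrank ℝ E ∧ (∀ u ∈ s, ‖u‖ ≤ 1) ∧
    ∀ x : E, ‖x‖ ≤ 1 → ∃ u ∈ s, ‖x - u‖ ≤ 1 / 2 := by
  classical
  let p : ℕ → Prop := fun k => ∃ s : Finset E, s.card = k ∧ (∀ u ∈ s, ‖u‖ ≤ 1) ∧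
    ∀ u ∈ s, ∀ v ∈ s, u ≠ v → 1 / 2 ≤ ‖u - v‖
  have hcard : ∀ k, p k → k ≤ 5 ^ Module.finrank ℝ E := by
    rintro k ⟨s, rfl, h1, h2⟩
    -- scaled by `2`, the points are at distance at least `1` in a ball of radius `2`
    have hinj : Function.Injective fun u : E => (2 : ℝ) • u :=
      smul_right_injective E two_ne_zero
    rw [← Finset.card_image_of_injective s hinj]
    refine Besicovitch.card_le_of_separated _ ?_ ?_
    · simp only [Finset.mem_image, forall_exists_index, and_imp, forall_apply_eq_imp_iff₂]
      intro u hu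
      rw [norm_smul, Real.norm_ofNat]
      linarith [h1 u hu]
    · simp only [Finset.mem_image, forall_exists_index, and_imp, forall_apply_eq_imp_iff₂]
      intro u hu v hv huv
      rw [← smul_sub, norm_smul, Real.norm_ofNat]
      linarith [h2 u hu v hv fun h => huv (by rw [h])]
  have h0 : p 0 := ⟨∅, by simp⟩
  obtain ⟨s, hs, h1, h2⟩ := Nat.findGreatest_spec (P := p) (Nat.zero_le (5 ^ Module.finrank ℝ E)) h0
  refine ⟨s, hcard _ ⟨s, rfl, h1, h2⟩, h1, fun x hx => ?_⟩
  by_contra! hcon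
  have hxs : x ∉ s := fun h => by
    have := hcon x h
    simp at this
    linarith
  -- a point far from the net could be added to it, against maximality
  have hp : p (s.card + 1) := by
    refine ⟨insert x s, Finset.card_insert_of_notMem hxs, ?_, ?_⟩
    · intro u hu
      rcases Finset.mem_insert.1 hu with rfl | hu
      · exact hx
      · exact h1 u hu
    · intro u hu v hv huv
      rcases Finset.mem_insert.1 hu with rfl | hu' <;> rcases Finset.mem_insert.1 hv with rfl | hv'
      · exact absurd rfl huv
      · exact (hcon v hv').le
      · rw [norm_sub_rev]; exact (hcon u hu').le
      · exact h2 u hu' v hv' huv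
  have := Nat.le_findGreatest (hcard _ hp) hp
  omega

/-- The operator norm of a symmetric operator is controlled by its quadratic form on a finite set
whose size is exponential in the dimension. -/
theorem exists_norming_set : ∃ W : Finset E, W.card ≤ 2 * 25 ^ Module.finrank ℝ E ∧
    (∀ w ∈ W, ‖w‖ ≤ 2) ∧ ∀ T : E →L[ℝ] E, (∀ x y, inner ℝ (T x) y = inner ℝ x (T y)) →
      ∀ B : ℝ, 0 ≤ B → (∀ w ∈ W, |inner ℝ (T w) w| ≤ B) → ‖T‖ ≤ 2 * B := by
  classical
  obtain ⟨s, hs, h1, h2⟩ := exists_half_net (E := E)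
  refine ⟨(s ×ˢ s).image (fun u => u.1 + u.2) ∪ (s ×ˢ s).image (fun u => u.1 - u.2), ?_, ?_, ?_⟩
  · refine (Finset.card_union_le _ _).trans ?_
    have h3 : (s ×ˢ s).card ≤ 25 ^ Module.finrank ℝ E := by
      rw [Finset.card_product, show 25 = 5 * 5 by norm_num, mul_pow]
      exact Nat.mul_le_mul hs hs
    have h4 := (Finset.card_image_le (s := s ×ˢ s) (f := fun u => u.1 + u.2)).trans h3
    have h5 := (Finset.card_image_le (s := s ×ˢ s) (f := fun u => u.1 - u.2)).trans h3
    omega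
  · intro w hw
    simp only [Finset.mem_union, Finset.mem_image, Finset.mem_product, Prod.exists] at hw
    rcases hw with ⟨u, v, ⟨hu, hv⟩, rfl⟩ | ⟨u, v, ⟨hu, hv⟩, rfl⟩
    · linarith [norm_add_le u v, h1 u hu, h1 v hv]
    · linarith [norm_sub_le u v, h1 u hu, h1 v hv]
  · intro T hT B hB hW
    -- polarization: `4 ⟪T u, v⟫` is the form at `u + v` minus the form at `u - v`
    have bil : ∀ u ∈ s, ∀ v ∈ s, inner ℝ (T u) v ≤ B / 2 := by
      intro u hu v hv
      have a := hW (u + v) (Finset.mem_union_left _ (Finset.mem_image.2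
        ⟨(u, v), Finset.mem_product.2 ⟨hu, hv⟩, rfl⟩))
      have b := hW (u - v) (Finset.mem_union_right _ (Finset.mem_image.2
        ⟨(u, v), Finset.mem_product.2 ⟨hu, hv⟩, rfl⟩))
      have c : inner ℝ (T v) u = inner ℝ (T u) v := by rw [hT v u, real_inner_comm]
      simp only [map_add, map_sub, inner_add_left, inner_add_right, inner_sub_left,
        inner_sub_right, c] at a b
      have a' := (abs_le.1 a).2
      have b' := (abs_le.1 b).1
      linarith
    -- test `T u` against a point of the net near its direction
    have hu : ∀ u ∈ s, ‖T u‖ ≤ B := by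
      intro u hu
      rcases eq_or_ne (T u) 0 with h0 | h0
      · rw [h0, norm_zero]; exact hB
      have hpos : 0 < ‖T u‖ := norm_pos_iff.2 h0
      obtain ⟨v, hv, hvy⟩ := h2 (‖T u‖⁻¹ • T u) (by
        rw [norm_smul, norm_inv, norm_norm, inv_mul_cancel₀ hpos.ne'])
      have e : inner ℝ (T u) (‖T u‖⁻¹ • T u) = ‖T u‖ := by
        rw [inner_smul_right, real_inner_self_eq_norm_sq]
        field_simp
      have e2 : inner ℝ (T u) (‖T u‖⁻¹ • T u)
          = inner ℝ (T u) v + inner ℝ (T u) (‖T u‖⁻¹ • T u - v) := by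
        rw [← inner_add_right]; simp
      have e3 := real_inner_le_norm (T u) (‖T u‖⁻¹ • T u - v)
      have e4 := bil u hu v hv
      nlinarith
    -- approximate a unit vector by a point of the net
    have hT2 : ‖T‖ ≤ B + ‖T‖ / 2 := by
      refine ContinuousLinearMap.opNorm_le_of_unit_norm (by positivity) fun x hx => ?_
      obtain ⟨u, hus, hux⟩ := h2 x hx.le
      have e : T x = T u + T (x - u) := by rw [← map_add]; simp
      calc ‖T x‖ ≤ ‖T u‖ + ‖T (x - u)‖ := by rw [e]; exact norm_add_le _ _
        _ ≤ B + ‖T‖ * (1 / 2) := by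
          gcongr
          · exact hu u hus
          · exact (T.le_opNorm _).trans (by gcongr)
        _ = _ := by ring
    linarith

end

section

variable {A R Y : Type*} [MeasurableSpace A] [MeasurableSpace R] [MeasurableSpace Y]

/-- A bad event about an independent `y` that is unlikely for each fixed parameter is unlikely for
a random parameter. -/
theorem prod_measure_le_of_section_le {μ : Measure A} [IsProbabilityMeasure μ] {ν : Measure Y}
    [IsProbabilityMeasure ν] {g : A → R} (hg : Measurable g) {T : Set (R × Y)}
    (hT : MeasurableSet T) (δ : ENNReal) :
    (μ.prod ν) {p | (g p.1, p.2) ∈ T ∧ ν {y | (g p.1, y) ∈ T} ≤ δ} ≤ δ := by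
  have hm : Measurable fun r => ν {y | (r, y) ∈ T} := measurable_measure_prodMk_left hT
  have hS : MeasurableSet {p : A × Y | (g p.1, p.2) ∈ T ∧ ν {y | (g p.1, y) ∈ T} ≤ δ} := by
    refine MeasurableSet.inter ?_ ?_
    · exact (by fun_prop : Measurable fun p : A × Y => (g p.1, p.2)) hT
    · exact measurableSet_le (hm.comp (hg.comp measurable_fst)) measurable_const
  rw [Measure.prod_apply hS]
  calc _ ≤ ∫⁻ _, δ ∂μ := by
        refine lintegral_mono fun a => ?_
        by_cases h : ν {y | (g a, y) ∈ T} ≤ δ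
        · refine (measure_mono ?_).trans h
          intro y hy
          exact hy.1
        · have : (Prod.mk a ⁻¹' {p : A × Y | (g p.1, p.2) ∈ T ∧ ν {y | (g p.1, y) ∈ T} ≤ δ})
              = ∅ := by
            ext y
            simp only [Set.mem_preimage, Set.mem_ofPred_eq, Set.mem_empty_iff_false, iff_false]
            exact fun hy => h hy.2
          rw [this, measure_empty]
          exact zero_le
    _ = δ := by simp

/-- A subfamily of independent copies consists of independent copies. -/
theorem pi_map_injective {Ω ι κ : Type*} [Fintype ι] [Fintype κ] [MeasurableSpace Ω]
    (P : Measure Ω) [IsProbabilityMeasure P] {e : κ → ι} (he : Function.Injective e) :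
    (Measure.pi fun _ : ι => P).map (fun X i => X (e i)) = Measure.pi fun _ : κ => P := by
  have h : iIndepFun (fun (i : ι) (X : ι → Ω) => X i) (Measure.pi fun _ : ι => P) :=
    iIndepFun_pi (X := fun _ => id) fun _ => aemeasurable_id
  have h2 := (iIndepFun_iff_map_fun_eq_pi_map (fun i => (measurable_pi_apply (e i)).aemeasurable)).1
    (h.precomp he)
  have h3 : ∀ i : ι, (Measure.pi fun _ : ι => P).map (fun X => X i) = P := fun i =>
    (measurePreserving_eval (fun _ : ι => P) i).map_eq
  simp only [h3] at h2
  exact h2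

end

variable {d q : ℕ}

/-- The four quarters of the sample are independent. -/
theorem map_quarters {m : ℕ} (P : Measure (Fin q → Vec d)) [IsProbabilityMeasure P] :
    (Measure.pi fun _ : Fin m => P).map (fun bags => (((quarter 0 bags, quarter 1 bags),
        quarter 2 bags), quarter 3 bags))
      = (((Measure.pi fun _ : Fin (m / 4) => P).prod (Measure.pi fun _ : Fin (m / 4) => P)).prod
          (Measure.pi fun _ : Fin (m / 4) => P)).prod (Measure.pi fun _ : Fin (m / 4) => P) := by
  set n := m / 4 with hn
  let e : ((Fin n ⊕ Fin n) ⊕ Fin n) ⊕ Fin n → Fin m :=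
    Sum.elim (Sum.elim (Sum.elim (fun b => ⟨4 * b + 0, by have := b.2; omega⟩)
      (fun b => ⟨4 * b + 1, by have := b.2; omega⟩)) (fun b => ⟨4 * b + 2, by have := b.2; omega⟩))
      (fun b => ⟨4 * b + 3, by have := b.2; omega⟩)
  have he : Function.Injective e := by
    rintro (((a | a) | a) | a) (((b | b) | b) | b) h <;>
      simp only [e, Sum.elim_inl, Sum.elim_inr, Fin.mk.injEq] at h <;>
      first
        | (exfalso; omega)
        | (have : a = b := by ext; omega
           rw [this])
  have h1 := pi_map_injective P he
  have m1 := measurePreserving_sumPiEquivProdPi (X := fun _ : ((Fin n ⊕ Fin n) ⊕ Fin n) ⊕ Fin n => Fin q → Vec d)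
    (fun _ => P)
  have m2 := measurePreserving_sumPiEquivProdPi (X := fun _ : (Fin n ⊕ Fin n) ⊕ Fin n => Fin q → Vec d)
    (fun _ => P)
  have m3 := measurePreserving_sumPiEquivProdPi (X := fun _ : Fin n ⊕ Fin n => Fin q → Vec d)
    (fun _ => P)
  have hid := MeasurePreserving.id (Measure.pi fun _ : Fin n => P)
  have m0 : MeasurePreserving (fun (X : Fin m → Fin q → Vec d) i => X (e i))
      (Measure.pi fun _ => P) (Measure.pi fun _ => P) :=
    ⟨by fun_prop, h1⟩
  have := (((m3.prod hid).prod hid).comp ((m2.prod hid).comp (m1.comp m0))).map_eq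
  exact this

end

/-! ### Power iteration and Neumann series -/

section

variable {E : Type*} [NormedAddCommGroup E] [InnerProductSpace ℝ E]

/-- A symmetric operator has a unit eigenvector whose eigenvalue dominates its quadratic form. -/
theorem exists_top_eigenvector [FiniteDimensional ℝ E] [Nontrivial E] {A : E →L[ℝ] E}
    (hA : ∀ x y, inner ℝ (A x) y = inner ℝ x (A y)) :
    ∃ (lam : ℝ) (v : E), ‖v‖ = 1 ∧ A v = lam • v ∧ ∀ u : E, ‖u‖ = 1 → inner ℝ (A u) u ≤ lam := by
  have hs : (A : E →ₗ[ℝ] E).IsSymmetric := hA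
  have h := hs.hasEigenvalue_iSup_of_finiteDimensional
  obtain ⟨w, hw⟩ := h.exists_hasEigenvector
  have hw0 : w ≠ 0 := hw.2
  have hA1 := hw.apply_eq_smul
  refine ⟨⨆ x : { x : E // x ≠ 0 },
    RCLike.re (inner ℝ ((A : E →ₗ[ℝ] E) x) (x : E)) / ‖(x : E)‖ ^ 2,
    ‖w‖⁻¹ • w, norm_smul_inv_norm hw0, ?_, fun u hu => ?_⟩
  · have h1 : A w = _ := hA1
    rw [map_smul, smul_comm, h1]
    rfl
  · have hu0 : u ≠ 0 := fun h => by simp [h] at hu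
    have hb : BddAbove (Set.range fun x : { x : E // x ≠ 0 } =>
        RCLike.re (inner ℝ ((A : E →ₗ[ℝ] E) x) (x : E)) / ‖(x : E)‖ ^ 2) := by
      refine ⟨‖A‖, ?_⟩
      rintro _ ⟨x, rfl⟩
      have hx : 0 < ‖(x : E)‖ := norm_pos_iff.2 x.2
      simp only [RCLike.re_to_real, ContinuousLinearMap.coe_coe]
      rw [div_le_iff₀ (by positivity)]
      calc inner ℝ (A x) (x : E) ≤ ‖A x‖ * ‖(x : E)‖ := real_inner_le_norm _ _
        _ ≤ ‖A‖ * ‖(x : E)‖ * ‖(x : E)‖ := by gcongr; exact A.le_opNorm _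
        _ = _ := by ring
    have := le_ciSup hb ⟨u, hu0⟩
    simpa [hu] using this

/-- If a symmetric operator is a small perturbation of a multiple of the projection to a line, then
the power iteration from some vector of an orthonormal basis converges to that line. -/
theorem exists_power_iteration [FiniteDimensional ℝ E] {ι : Type*} [Fintype ι]
    (b : OrthonormalBasis ι ℝ E) {A : E →L[ℝ] E} (hA : ∀ x y, inner ℝ (A x) y = inner ℝ x (A y)) {u : E} (hu : ‖u‖ = 1) {G η : ℝ} (hG : 0 < G)
    (hη : η ≤ 1 / 20) (hE : ∀ x, ‖A x - (G * inner ℝ u x) • u‖ ≤ η * G * ‖x‖) {m : ℕ}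
    (hm : √(Fintype.card ι) ≤ 2 ^ m * η) :
    ∃ (j : ι) (α : ℝ), α ≠ 0 ∧ ‖(A ^ m) (b j) - α • u‖ ≤ 6 * η * |α| := by
  have hη0 : 0 ≤ η := by
    have := (norm_nonneg _).trans (hE u)
    rw [hu, mul_one] at this
    exact nonneg_of_mul_nonneg_left this hG
  have hnt : Nontrivial E := ⟨u, 0, fun h => by simp [h] at hu⟩
  obtain ⟨lam, v, hv, hAv, hlam⟩ := exists_top_eigenvector hA
  have hlamG : (1 - η) * G ≤ lam := by
    have h1 := hlam u hu
    have h2 := hE u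
    rw [real_inner_self_eq_norm_sq, hu] at h2
    have h3 := abs_real_inner_le_norm (A u - (G * 1 ^ 2) • u) u
    rw [inner_sub_left, inner_smul_left, real_inner_self_eq_norm_sq, hu] at h3
    simp at h2 h3
    have := (abs_le.1 (h3.trans h2)).1
    linarith
  have hlam0 : 0 < lam := lt_of_lt_of_le (by nlinarith) hlamG
  -- the top eigenvector `v` is nearly parallel to `u`
  set s := G * inner ℝ u v / lam with hs
  have hsv : ‖v - s • u‖ ≤ 2 * η := by
    have h := hE v
    rw [hAv, hv, mul_one] at h
    have e : lam • v - (G * inner ℝ u v) • u = lam • (v - s • u) := by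
      rw [smul_sub, smul_smul, hs, mul_div_cancel₀ _ hlam0.ne']
    rw [e, norm_smul, Real.norm_eq_abs, abs_of_pos hlam0] at h
    have h2 : lam * ‖v - s • u‖ ≤ lam * (2 * η) := by
      have h3 : G ≤ 2 * lam := by nlinarith
      nlinarith [mul_le_mul_of_nonneg_left h3 hη0]
    exact le_of_mul_le_mul_left h2 hlam0
  have hs2 : 1 / 2 ≤ |s| := by
    have h1 : ‖v‖ ≤ ‖v - s • u‖ + ‖s • u‖ := by
      simpa using norm_add_le (v - s • u) (s • u)
    rw [hv, norm_smul, hu, mul_one, Real.norm_eq_abs] at h1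
    linarith
  -- on the orthogonal complement of `v`, which `A` preserves, `A` is small compared to `lam`
  have hperp : ∀ w, inner ℝ v w = 0 → ‖A w‖ ≤ lam / 2 * ‖w‖ := by
    intro w hw
    have h1 : |s| * |inner ℝ u w| ≤ 2 * η * ‖w‖ := by
      have e : inner ℝ (v - s • u) w = -(s * inner ℝ u w) := by
        rw [inner_sub_left, hw, inner_smul_left]
        simp
      rw [← abs_mul, ← abs_neg (s * inner ℝ u w), ← e]
      exact (abs_real_inner_le_norm _ _).trans (by gcongr)
    have h2 : |inner ℝ u w| ≤ 4 * η * ‖w‖ := by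
      have := abs_nonneg (inner ℝ u w : ℝ)
      nlinarith
    calc ‖A w‖ = ‖(A w - (G * inner ℝ u w) • u) + (G * inner ℝ u w) • u‖ := by simp
      _ ≤ η * G * ‖w‖ + G * |inner ℝ u w| := by
        refine (norm_add_le _ _).trans (add_le_add (hE w) ?_)
        rw [norm_smul, hu, mul_one, Real.norm_eq_abs, abs_mul, abs_of_pos hG]
      _ ≤ η * G * ‖w‖ + G * (4 * η * ‖w‖) := by gcongr
      _ = (5 * η * G) * ‖w‖ := by ring
      _ ≤ lam / 2 * ‖w‖ := by
        gcongr
        nlinarith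
  have hpow : ∀ (t : ℕ) (w : E), inner ℝ v w = 0 →
      inner ℝ v ((A ^ t) w) = 0 ∧ ‖(A ^ t) w‖ ≤ (lam / 2) ^ t * ‖w‖ := by
    intro t w hw
    induction t with
    | zero => exact ⟨hw, by simp⟩
    | succ t ih =>
      rw [pow_succ', mul_apply_eq_comp]
      refine ⟨?_, ?_⟩
      · rw [← hA, hAv, inner_smul_left, ih.1, mul_zero]
      · calc _ ≤ lam / 2 * ‖(A ^ t) w‖ := hperp _ ih.1
          _ ≤ lam / 2 * ((lam / 2) ^ t * ‖w‖) := by gcongr; exact ih.2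
          _ = _ := by ring
  have hpowv : ∀ t : ℕ, (A ^ t) v = lam ^ t • v := by
    intro t
    induction t with
    | zero => simp
    | succ t ih => rw [pow_succ', mul_apply_eq_comp, ih, map_smul, hAv, smul_smul, pow_succ]
  -- some basis vector has a component along `v` of at least the average size
  obtain ⟨j, hj⟩ : ∃ j, 1 ≤ √(Fintype.card ι) * |inner ℝ v (b j)| := by
    by_contra! hcon
    have hpos : (0 : ℝ) < Fintype.card ι := by
      have : Nonempty ι := by
        by_contra hne
        rw [not_nonempty_iff] at hne
        have := b.sum_sq_inner_left v
        simp [hv] at this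
      exact_mod_cast Fintype.card_pos
    have h1 := b.sum_sq_inner_left v
    have h2 : ∑ i, inner ℝ v (b i) ^ 2 < ∑ _i : ι, 1 / (Fintype.card ι : ℝ) := by
      have hne : Nonempty ι := Fintype.card_pos_iff.1 (by exact_mod_cast hpos)
      refine Finset.sum_lt_sum_of_nonempty Finset.univ_nonempty fun i _ => ?_
      rw [lt_div_iff₀ hpos]
      have h3 := hcon i
      have h4 : (√(Fintype.card ι) * |inner ℝ v (b i)|) ^ 2 < 1 := by
        have := abs_nonneg (inner ℝ v (b i) : ℝ)
        have h5 : 0 ≤ √(Fintype.card ι : ℝ) * |inner ℝ v (b i)| := by positivity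
        nlinarith
      rw [mul_pow, Real.sq_sqrt hpos.le, sq_abs] at h4
      linarith
    rw [h1, hv] at h2
    simp at h2
    rw [mul_inv_cancel₀ hpos.ne'] at h2
    exact lt_irrefl _ h2
  set α₀ : ℝ := inner ℝ v (b j) with hα₀
  have hα₀0 : α₀ ≠ 0 := fun h => by
    rw [h] at hj
    simp at hj
    linarith
  have hlm : 0 < lam ^ m := pow_pos hlam0 m
  have hs0 : s ≠ 0 := fun h => by rw [h] at hs2; simp at hs2; linarith
  set w := b j - α₀ • v with hw
  have hvw : inner ℝ v w = 0 := by
    rw [hw, inner_sub_right, inner_smul_right, real_inner_self_eq_norm_sq, hv, ← hα₀]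
    ring
  have hw1 : ‖w‖ ≤ 1 := by
    have h1 : ‖w‖ ^ 2 = 1 - α₀ ^ 2 := by
      rw [hw, @norm_sub_sq ℝ, b.norm_eq_one, inner_smul_right, norm_smul, hv,
        real_inner_comm, ← hα₀]
      simp
      ring
    have h2 := sq_nonneg α₀
    nlinarith [norm_nonneg w]
  -- the rest of the basis vector loses a factor `2 ^ m` against that component
  have hAw : ‖(A ^ m) w‖ ≤ lam ^ m * (|α₀| * η) := by
    have h1 := (hpow m w hvw).2
    have h2 : (1 : ℝ) ≤ 2 ^ m * (|α₀| * η) := by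
      have := abs_nonneg α₀
      nlinarith
    calc _ ≤ (lam / 2) ^ m * ‖w‖ := h1
      _ ≤ (lam / 2) ^ m * 1 := by gcongr
      _ ≤ (lam / 2) ^ m * (2 ^ m * (|α₀| * η)) := by gcongr
      _ = lam ^ m * (|α₀| * η) := by rw [div_pow]; field_simp
  refine ⟨j, α₀ * lam ^ m * s, by positivity, ?_⟩
  have e : (A ^ m) (b j) - (α₀ * lam ^ m * s) • u
      = (α₀ * lam ^ m) • (v - s • u) + (A ^ m) w := by
    have : b j = α₀ • v + w := by rw [hw]; abel
    rw [this, map_add, map_smul, hpowv, smul_sub, smul_smul, smul_smul]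
    abel
  rw [e]
  calc _ ≤ |α₀| * lam ^ m * (2 * η) + lam ^ m * (|α₀| * η) := by
        refine (norm_add_le _ _).trans (add_le_add ?_ hAw)
        rw [norm_smul, Real.norm_eq_abs, abs_mul, abs_of_pos hlm]
        gcongr
    _ = |α₀| * lam ^ m * (3 * η) := by ring
    _ ≤ |α₀| * lam ^ m * (6 * η * |s|) := by
        have h6 : 3 * η ≤ 6 * η * |s| := by nlinarith
        exact mul_le_mul_of_nonneg_left h6 (by positivity)
    _ = 6 * η * |α₀ * lam ^ m * s| := by
        rw [abs_mul, abs_mul, abs_of_pos hlm]; ring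

/-- The Neumann series approximately inverts a coercive operator; the right-hand side may itself be
an approximation. -/
theorem neumann_approx {N : E →L[ℝ] E} {tr lam : ℝ} (htr : 0 < tr) (hlam : 0 < lam)
    (hco : ∀ y, lam * ‖y‖ ^ 2 ≤ inner ℝ (N y) y) (hN : ∀ y, ‖N y‖ ^ 2 ≤ tr * inner ℝ (N y) y)
    {u v r : E} (hu : ‖u‖ = 1) {α η₁ η₂ : ℝ} (hη₁ : η₁ ≤ 1) (hv : ‖v - α • u‖ ≤ η₁ * |α|)
    (hr : ‖N r - u‖ ≤ η₂) {T : ℕ} (hT : Real.exp (-(T * (lam / tr))) ≤ (η₁ / 2) ^ 2) :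
    ‖∑ t ∈ Finset.range T, ((1 - tr⁻¹ • N) ^ t) v - (tr * α) • r‖
      ≤ |tr * α| * ((2 * η₁ + η₂) / lam) := by
  set R : E →L[ℝ] E := 1 - tr⁻¹ • N with hR
  set x := ∑ t ∈ Finset.range T, (R ^ t) v with hx
  -- geometric series
  have hNx : N x = tr • (v - (R ^ T) v) := by
    have h1 : tr⁻¹ • N = 1 - R := by rw [hR]; abel
    have h2 : (1 - R) * ∑ t ∈ Finset.range T, R ^ t = 1 - R ^ T := mul_neg_geom_sum R T
    have h3 : (tr⁻¹ • N) x = v - (R ^ T) v := by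
      rw [h1]
      have := congrArg (fun L : E →L[ℝ] E => L v) h2
      simpa [mul_apply_eq_comp, hx, sum_apply] using this
    rw [← h3, smul_apply, smul_smul, mul_inv_cancel₀ htr.ne', one_smul]
  have hη₁0 : 0 ≤ η₁ * |α| := (norm_nonneg _).trans hv
  -- `R` contracts
  have hstep : ∀ y, ‖R y‖ ^ 2 ≤ (1 - lam / tr) * ‖y‖ ^ 2 := by
    intro y
    have e : R y = y - tr⁻¹ • N y := by rw [hR, sub_apply, one_apply_eq_self, smul_apply]
    rw [e, @norm_sub_sq ℝ, inner_smul_right, norm_smul, real_inner_comm, mul_pow]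
    have h1 := hco y
    have h2 := hN y
    simp only [RCLike.re_to_real, norm_inv, Real.norm_eq_abs, abs_of_pos htr]
    have h3 : tr⁻¹ ^ 2 * ‖N y‖ ^ 2 ≤ tr⁻¹ * inner ℝ (N y) y := by
      calc tr⁻¹ ^ 2 * ‖N y‖ ^ 2 ≤ tr⁻¹ ^ 2 * (tr * inner ℝ (N y) y) := by gcongr
        _ = _ := by field_simp
    have h4 : tr⁻¹ * (lam * ‖y‖ ^ 2) ≤ tr⁻¹ * inner ℝ (N y) y := by gcongr
    have h5 : (1 - lam / tr) * ‖y‖ ^ 2 = ‖y‖ ^ 2 - tr⁻¹ * (lam * ‖y‖ ^ 2) := by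
      field_simp
    rw [h5]
    linarith
  have hRT : ∀ (t : ℕ) (y : E), ‖(R ^ t) y‖ ^ 2 ≤ Real.exp (-(t * (lam / tr))) * ‖y‖ ^ 2 := by
    intro t y
    induction t with
    | zero => simp
    | succ t ih =>
      rw [pow_succ' R, mul_apply_eq_comp]
      calc _ ≤ (1 - lam / tr) * ‖(R ^ t) y‖ ^ 2 := hstep _
        _ ≤ Real.exp (-(lam / tr)) * ‖(R ^ t) y‖ ^ 2 := by
          gcongr
          linarith [Real.add_one_le_exp (-(lam / tr))]
        _ ≤ Real.exp (-(lam / tr)) * (Real.exp (-(t * (lam / tr))) * ‖y‖ ^ 2) := by gcongr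
        _ = _ := by
          rw [← mul_assoc, ← Real.exp_add]
          congr 2
          push_cast
          ring
  rcases eq_or_ne α 0 with rfl | hα
  · have hv0 : v = 0 := by simpa using hv
    simp [hx, hv0]
  have hαp : 0 < |α| := abs_pos.2 hα
  have hη₁' : 0 ≤ η₁ := nonneg_of_mul_nonneg_left hη₁0 hαp
  have hvn : ‖v‖ ≤ 2 * |α| := by
    have h1 : ‖v‖ ≤ ‖v - α • u‖ + ‖α • u‖ := by simpa using norm_add_le (v - α • u) (α • u)
    rw [norm_smul, hu, mul_one, Real.norm_eq_abs] at h1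
    nlinarith
  have hRv : ‖(R ^ T) v‖ ≤ η₁ * |α| := by
    refine abs_le_of_sq_le_sq' ?_ hη₁0 |>.2
    calc _ ≤ Real.exp (-(T * (lam / tr))) * ‖v‖ ^ 2 := hRT T v
      _ ≤ (η₁ / 2) ^ 2 * (2 * |α|) ^ 2 := by gcongr
      _ = _ := by ring
  set z := x - (tr * α) • r with hz
  have hNz : ‖N z‖ ≤ |tr * α| * (2 * η₁ + η₂) := by
    have e : N z = tr • ((v - α • u) - (R ^ T) v - α • (N r - u)) := by
      rw [hz, map_sub, hNx, map_smul, mul_smul, ← smul_sub]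
      congr 1
      rw [smul_sub]
      abel
    rw [e, norm_smul, abs_mul, Real.norm_eq_abs, mul_assoc]
    refine mul_le_mul_of_nonneg_left ?_ (abs_nonneg _)
    calc _ ≤ ‖v - α • u‖ + ‖(R ^ T) v‖ + ‖α • (N r - u)‖ :=
          (norm_sub_le _ _).trans (by gcongr; exact norm_sub_le _ _)
      _ ≤ η₁ * |α| + η₁ * |α| + |α| * η₂ := by
          rw [norm_smul, Real.norm_eq_abs]
          gcongr
      _ = _ := by ring
  -- coercivity turns the bound for `N z` into one for `z`
  have hlz : lam * ‖z‖ ≤ ‖N z‖ := by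
    rcases eq_or_ne z 0 with h0 | h0
    · simp [h0]
    have hpos : 0 < ‖z‖ := norm_pos_iff.2 h0
    have h1 := (hco z).trans (real_inner_le_norm _ _)
    have h2 : lam * ‖z‖ * ‖z‖ ≤ ‖N z‖ * ‖z‖ := by linarith [sq ‖z‖]
    exact le_of_mul_le_mul_right h2 hpos
  rw [← mul_div_assoc, le_div_iff₀ hlam]
  linarith

end

/-! ### The standard Gaussian law on the line, conditioned on a half-line -/

/-- The mass of the standard Gaussian law above `t`. -/
def tail (t : ℝ) : ℝ := (gaussianReal 0 1).real (Set.Ioi t)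

/-- The logarithmic factor `log (√2 / (Φ(t) (1 - Φ(t))))` by which conditioning worsens the
exponential moments of the square of a Gaussian variable. -/
def logMass (t : ℝ) : ℝ := Real.log (√2 / (tail t * tail (-t)))

instance : NullSingletonClass (gaussianReal 0 1) := nullSingletonClass_gaussianReal one_ne_zero

theorem tail_pos (t : ℝ) : 0 < tail t := by
  rw [tail, measureReal_def, ENNReal.toReal_pos_iff]
  refine ⟨?_, measure_lt_top _ _⟩
  rw [pos_iff_ne_zero]
  intro h
  have := gaussianReal_absolutelyContinuous' 0 (one_ne_zero : (1 : NNReal) ≠ 0) h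
  simp at this

theorem gaussian_Iic (t : ℝ) : (gaussianReal 0 1).real (Set.Iic t) = tail (-t) := by
  have h : (gaussianReal 0 1).map (fun x => -x) = gaussianReal 0 1 := by
    rw [gaussianReal_map_neg, neg_zero]
  have h2 : (gaussianReal 0 1) (Set.Iic t) = gaussianReal 0 1 (Set.Ici (-t)) := by
    conv_lhs => rw [← h]
    rw [Measure.map_apply measurable_neg measurableSet_Iic]
    congr 1
    ext x
    simp
  rw [tail, measureReal_def, measureReal_def, h2, measure_congr Ioi_ae_eq_Ici]

theorem tail_add_tail_neg (t : ℝ) : tail t + tail (-t) = 1 := by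
  rw [← gaussian_Iic, tail, ← Set.compl_Iic, measureReal_compl measurableSet_Iic]
  simp

theorem Phi_eq (t : ℝ) : Phi t = tail (-t) := by
  rw [Phi, cdf_eq_real, gaussian_Iic]

theorem mass_le (t : ℝ) : tail t * tail (-t) ≤ 1 / 4 := by
  nlinarith [tail_add_tail_neg t, sq_nonneg (tail t - tail (-t))]

theorem one_lt_logMass (t : ℝ) : 1 < logMass t := by
  have h0 : 0 < tail t * tail (-t) := mul_pos (tail_pos _) (tail_pos _)
  rw [logMass, Real.lt_log_iff_exp_lt (by positivity), lt_div_iff₀ h0]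
  have h1 := mass_le t
  have h2 : (1 : ℝ) ≤ √2 := by rw [Real.one_le_sqrt]; norm_num
  nlinarith [Real.exp_one_lt_d9]

theorem tail_antitone : Antitone tail := fun _ _ h => measureReal_mono (Set.Ioi_subset_Ioi h)

/-- The Gaussian density is an antiderivative of `- x` times itself. -/
theorem integral_Ioi_gaussian (t : ℝ) :
    ∫ x in Set.Ioi t, x ∂(gaussianReal 0 1) = gaussianPDFReal 0 1 t := by
  rw [gaussianReal_of_var_ne_zero _ one_ne_zero, restrict_withDensity measurableSet_Ioi,
    integral_withDensity_eq_integral_toReal_smul (measurable_gaussianPDF _ _)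
      (ae_of_all _ fun _ => gaussianPDF_lt_top)]
  simp only [toReal_gaussianPDF, smul_eq_mul]
  have hd : ∀ x, HasDerivAt (fun x => -gaussianPDFReal 0 1 x) (gaussianPDFReal 0 1 x * x) x := by
    intro x
    have e : (fun x => -gaussianPDFReal 0 1 x)
        = fun x => -((√(2 * Real.pi * 1))⁻¹ * Real.exp (-(x ^ 2) / 2)) := by
      funext y; simp [gaussianPDFReal]
    rw [e]
    have h1 : HasDerivAt (fun x : ℝ => -(x ^ 2) / 2) (-(2 * x) / 2) x := by
      have := ((hasDerivAt_pow 2 x).neg).div_const 2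
      simpa using this
    convert! ((h1.exp).const_mul ((√(2 * Real.pi * 1))⁻¹)).neg using 1
    simp [gaussianPDFReal]
    ring
  have hint : IntegrableOn (fun x => gaussianPDFReal 0 1 x * x) (Set.Ioi t) := by
    have h := (memLp_id_gaussianReal (μ := 0) (v := 1) 1).integrable le_rfl
    rw [gaussianReal_of_var_ne_zero _ one_ne_zero, integrable_withDensity_iff_integrable_smul'
      (measurable_gaussianPDF _ _) (ae_of_all _ fun _ => gaussianPDF_lt_top)] at h
    simpa [toReal_gaussianPDF] using h.integrableOn
  have hlim : Filter.Tendsto (fun x => -gaussianPDFReal 0 1 x) Filter.atTop (nhds 0) := by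
    have h1 : Filter.Tendsto (fun x : ℝ => Real.exp (-x)) Filter.atTop (nhds 0) :=
      Real.tendsto_exp_neg_atTop_nhds_zero
    have h2 : Filter.Tendsto (fun x : ℝ => x ^ 2 / 2) Filter.atTop Filter.atTop :=
      (Filter.tendsto_pow_atTop two_ne_zero).atTop_div_const two_pos
    have h3 := ((h1.comp h2).const_mul ((√(2 * Real.pi * 1))⁻¹)).neg
    simp only [mul_zero, neg_zero] at h3
    refine h3.congr fun x => ?_
    simp [gaussianPDFReal, neg_div]
  have := integral_Ioi_of_hasDerivAt_of_tendsto' (fun x _ => hd x) hint hlim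
  simpa using this

theorem gaussianPDF_le (x : ℝ) : gaussianPDFReal 0 1 x ≤ 1 / 2 := by
  have h1 : gaussianPDFReal 0 1 x = (√(2 * Real.pi))⁻¹ * Real.exp (-(x ^ 2) / 2) := by
    simp [gaussianPDFReal]
  have h2 : 2 ≤ √(2 * Real.pi) := by
    rw [show (2 : ℝ) = √(2 ^ 2) by rw [Real.sqrt_sq]; norm_num]
    apply Real.sqrt_le_sqrt
    have := Real.pi_gt_three
    rw [Real.sqrt_sq (by norm_num)]
    linarith
  have h3 : Real.exp (-(x ^ 2) / 2) ≤ 1 := Real.exp_le_one_iff.2 (by nlinarith [sq_nonneg x])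
  rw [h1]
  have h4 : (√(2 * Real.pi))⁻¹ ≤ 2⁻¹ := inv_anti₀ two_pos h2
  nlinarith [Real.exp_pos (-(x ^ 2) / 2), inv_pos.2 (two_pos.trans_le h2)]

theorem gaussianPDF_anti {x y : ℝ} (hx : 0 ≤ x) (hxy : x ≤ y) :
    gaussianPDFReal 0 1 y ≤ gaussianPDFReal 0 1 x := by
  simp only [gaussianPDFReal, sub_zero]
  gcongr

theorem le_gaussianPDF {x : ℝ} (hx : |x| ≤ 1) : 1 / 8 ≤ gaussianPDFReal 0 1 x := by
  have h1 : gaussianPDFReal 0 1 x = (√(2 * Real.pi))⁻¹ * Real.exp (-(x ^ 2) / 2) := by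
    simp [gaussianPDFReal]
  have h2 : √(2 * Real.pi) ≤ 3 := by
    rw [Real.sqrt_le_left (by norm_num)]
    linarith [Real.pi_lt_four]
  have h3 : 1 / 2 ≤ Real.exp (-(x ^ 2) / 2) := by
    have h4 : x ^ 2 ≤ 1 := by nlinarith [abs_nonneg x, sq_abs x]
    linarith [Real.add_one_le_exp (-(x ^ 2) / 2)]
  have h5 : 3⁻¹ ≤ (√(2 * Real.pi))⁻¹ := inv_anti₀ (by positivity) h2
  rw [h1]
  nlinarith

/-- Gaussian law conditioned on the half-line above `t`. -/
def gaussianAbove (t : ℝ) : Measure ℝ := (gaussianReal 0 1)[|Set.Ioi t]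

/-- Gaussian law conditioned on the half-line below `t`. -/
def gaussianBelow (t : ℝ) : Measure ℝ := (gaussianReal 0 1)[|Set.Iic t]

theorem gaussian_Ioi_ne (t : ℝ) : (gaussianReal 0 1) (Set.Ioi t) ≠ 0 := by
  have := tail_pos t
  rw [tail, measureReal_def, ENNReal.toReal_pos_iff] at this
  exact this.1.ne'

theorem gaussian_Iic_ne (t : ℝ) : (gaussianReal 0 1) (Set.Iic t) ≠ 0 := by
  have := tail_pos (-t)
  rw [← gaussian_Iic, measureReal_def, ENNReal.toReal_pos_iff] at this
  exact this.1.ne'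

instance (t : ℝ) : IsProbabilityMeasure (gaussianAbove t) :=
  cond_isProbabilityMeasure (gaussian_Ioi_ne t)

instance (t : ℝ) : IsProbabilityMeasure (gaussianBelow t) :=
  cond_isProbabilityMeasure (gaussian_Iic_ne t)

theorem integral_cond {Ω : Type*} [MeasurableSpace Ω] (μ : Measure Ω) (s : Set Ω) (f : Ω → ℝ) :
    ∫ x, f x ∂μ[|s] = (μ.real s)⁻¹ * ∫ x in s, f x ∂μ := by
  rw [ProbabilityTheory.cond, integral_smul_measure, ENNReal.toReal_inv, smul_eq_mul,
    measureReal_def]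

theorem integral_gaussianAbove (t : ℝ) :
    ∫ x, x ∂(gaussianAbove t) = gaussianPDFReal 0 1 t / tail t := by
  rw [gaussianAbove, integral_cond, integral_Ioi_gaussian, ← tail, div_eq_inv_mul]

theorem integral_gaussianBelow (t : ℝ) :
    ∫ x, x ∂(gaussianBelow t) = -(gaussianPDFReal 0 1 t / tail (-t)) := by
  have hi : Integrable (fun x : ℝ => x) (gaussianReal 0 1) :=
    (memLp_id_gaussianReal (μ := 0) (v := 1) 1).integrable le_rfl
  have h := integral_add_compl (measurableSet_Iic (a := t)) hi
  rw [Set.compl_Iic, integral_Ioi_gaussian, integral_id_gaussianReal] at h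
  rw [gaussianBelow, integral_cond, gaussian_Iic, eq_neg_of_add_eq_zero_left h]
  ring

theorem le_integral_gaussianAbove (t : ℝ) : t ≤ ∫ x, x ∂(gaussianAbove t) := by
  have hi : Integrable (fun x : ℝ => x) (gaussianReal 0 1) :=
    (memLp_id_gaussianReal (μ := 0) (v := 1) 1).integrable le_rfl
  have h2 : Integrable (fun x : ℝ => x) (gaussianAbove t) := by
    rw [gaussianAbove, ProbabilityTheory.cond]
    exact hi.restrict.smul_measure (ENNReal.inv_ne_top.2 (gaussian_Ioi_ne t))
  have h := integral_mono_ae (integrable_const t) h2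
    ((ae_cond_mem measurableSet_Ioi).mono fun x hx => (Set.mem_Ioi.1 hx).le)
  simpa using h

theorem gaussianPDF_even (t : ℝ) : gaussianPDFReal 0 1 (-t) = gaussianPDFReal 0 1 t := by
  simp [gaussianPDFReal]

/-- The means of the two conditioned laws are at least `1 / 2` apart. -/
theorem half_le_gap (t : ℝ) :
    1 / 2 ≤ ∫ x, x ∂(gaussianAbove t) - ∫ x, x ∂(gaussianBelow t) := by
  have key : ∀ t : ℝ, 0 ≤ t →
      1 / 2 ≤ gaussianPDFReal 0 1 t / tail t + gaussianPDFReal 0 1 t / tail (-t) := by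
    intro t ht
    have p1 := tail_pos t
    have p0 := tail_pos (-t)
    have ps := tail_add_tail_neg t
    have hφ := gaussianPDFReal_nonneg 0 1 t
    have h1 : 0 ≤ gaussianPDFReal 0 1 t / tail t := by positivity
    have h0 : 0 ≤ gaussianPDFReal 0 1 t / tail (-t) := by positivity
    -- for `t ≤ 1` the density at `t` is bounded below; for `t ≥ 1` the upper mean alone is at least `t`
    rcases le_total t 1 with h | h
    · have h2 := le_gaussianPDF (abs_le.2 ⟨by linarith, h⟩)
      have e : gaussianPDFReal 0 1 t / tail t + gaussianPDFReal 0 1 t / tail (-t)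
          = gaussianPDFReal 0 1 t / (tail t * tail (-t)) := by
        field_simp
        rw [add_comm, ps]
      rw [e, le_div_iff₀ (by positivity)]
      linarith [mass_le t]
    · have := le_integral_gaussianAbove t
      rw [integral_gaussianAbove] at this
      linarith
  rw [integral_gaussianAbove, integral_gaussianBelow, sub_neg_eq_add]
  rcases le_total 0 t with h | h
  · exact key t h
  · have := key (-t) (by linarith)
    rw [gaussianPDF_even, neg_neg] at this
    linarith

/-- Conditioning on an event of mass at least the product of the two tails multiplies the scale of
exponential moments by at most `logMass`. -/
theorem lintegral_exp_div_logMass {Ω : Type*} [MeasurableSpace Ω] {P : Measure Ω}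
    [IsProbabilityMeasure P] {s : Set Ω} {t : ℝ} (hs : tail t * tail (-t) ≤ P.real s)
    {f : Ω → ℝ} (hf : Measurable f)
    (h : ∫⁻ x, ENNReal.ofReal (Real.exp (f x)) ∂P ≤ ENNReal.ofReal √2) :
    ∫⁻ x, ENNReal.ofReal (Real.exp (f x / logMass t)) ∂P[|s] ≤ ENNReal.ofReal (Real.exp 1) := by
  have hL := one_lt_logMass t
  have hL0 : 0 < logMass t := by linarith
  have hw : 0 < tail t * tail (-t) := mul_pos (tail_pos _) (tail_pos _)
  have hs0 : P s ≠ 0 := fun h0 => by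
    rw [measureReal_def, h0] at hs
    simp at hs
    linarith
  have := cond_isProbabilityMeasure hs0
  have h1 : ∫⁻ x, ENNReal.ofReal (Real.exp (f x)) ∂P[|s]
      ≤ ENNReal.ofReal (√2 / (tail t * tail (-t))) := by
    rw [ProbabilityTheory.cond, lintegral_smul_measure, smul_eq_mul, div_eq_inv_mul,
      ENNReal.ofReal_mul (by positivity), ENNReal.ofReal_inv_of_pos hw]
    refine mul_le_mul' (ENNReal.inv_le_inv.2 ?_) ((lintegral_mono' Measure.restrict_le_self
      le_rfl).trans h)
    rw [← ENNReal.ofReal_toReal (measure_ne_top P s)]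
    exact ENNReal.ofReal_le_ofReal hs
  -- Jensen's inequality: the power `1 / logMass t` of the exponential moment bounds the moment of
  -- the scaled variable, and `logMass t` is chosen to bring the bound down to `e`
  have h2 := eLpNorm'_le_eLpNorm'_of_exponent_le (μ := P[|s]) (p := 1) (q := logMass t)
    (f := fun x => Real.exp (f x / logMass t)) one_pos hL.le (by fun_prop)
  simp only [eLpNorm', ENNReal.rpow_one, div_one, one_div] at h2
  have e : ∀ x, ‖Real.exp (f x / logMass t)‖ₑ = ENNReal.ofReal (Real.exp (f x / logMass t)) :=
    fun x => by rw [← ofReal_norm, Real.norm_eq_abs, abs_of_pos (Real.exp_pos _)]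
  have e2 : ∀ x, ENNReal.ofReal (Real.exp (f x / logMass t)) ^ logMass t
      = ENNReal.ofReal (Real.exp (f x)) := fun x => by
    rw [ENNReal.ofReal_rpow_of_pos (Real.exp_pos _), ← Real.exp_mul, div_mul_cancel₀ _ hL0.ne']
  simp only [e, e2] at h2
  refine h2.trans ?_
  calc _ ≤ ENNReal.ofReal (√2 / (tail t * tail (-t))) ^ (logMass t)⁻¹ := by gcongr
    _ = ENNReal.ofReal (Real.exp 1) := by
      rw [ENNReal.ofReal_rpow_of_pos (by positivity)]
      congr 1
      rw [Real.rpow_def_of_pos (by positivity), ← logMass, mul_inv_cancel₀ hL0.ne']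

/-- The exponential moment of a quarter of a squared Gaussian variable. -/
theorem lintegral_exp_sq_gaussian :
    ∫⁻ x, ENNReal.ofReal (Real.exp (x ^ 2 / 4)) ∂(gaussianReal 0 1) = ENNReal.ofReal √2 := by
  rw [gaussianReal_of_var_ne_zero _ one_ne_zero,
    lintegral_withDensity_eq_lintegral_mul _ (measurable_gaussianPDF _ _) (by fun_prop)]
  have e : ∀ x, (gaussianPDF 0 1 * fun x => ENNReal.ofReal (Real.exp (x ^ 2 / 4))) x
      = ENNReal.ofReal ((√(2 * Real.pi))⁻¹ * Real.exp (-(1 / 4) * x ^ 2)) := fun x => by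
    rw [Pi.mul_apply, gaussianPDF, ← ENNReal.ofReal_mul (gaussianPDFReal_nonneg _ _ _)]
    congr 1
    simp only [gaussianPDFReal, NNReal.coe_one, mul_one, sub_zero]
    rw [mul_assoc, ← Real.exp_add]
    congr 2
    ring
  simp only [e]
  rw [← ofReal_integral_eq_lintegral_ofReal
    ((integrable_exp_neg_mul_sq (by norm_num)).const_mul _) (ae_of_all _ fun x => by positivity),
    integral_const_mul, integral_gaussian]
  congr 1
  rw [← Real.sqrt_inv, ← Real.sqrt_mul (by positivity)]
  congr 1
  field_simp
  norm_num

/-- The Gaussian mass just above `t`, bounded so that it can be compared with the mass above `t`: by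
the density at `t` if `t` is positive, and by a constant, hence by `tail t`, otherwise. -/
theorem gaussian_Ioc_le {s : ℝ} (t : ℝ) (hs : 0 ≤ s) :
    (gaussianReal 0 1).real (Set.Ioc t (t + s))
      ≤ s * (gaussianPDFReal 0 1 t + tail t) := by
  have hφ : ∀ x ∈ Set.Ioc t (t + s), gaussianPDFReal 0 1 x ≤ gaussianPDFReal 0 1 t + tail t := by
    intro x hx
    rcases le_total 0 t with h | h
    · have := gaussianPDF_anti h hx.1.le
      linarith [tail_pos t]
    · have h1 := gaussianPDF_le x
      have h2 := tail_antitone h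
      have h3 := tail_add_tail_neg 0
      rw [neg_zero] at h3
      linarith [gaussianPDFReal_nonneg 0 1 t]
  rw [measureReal_def, gaussianReal_apply_eq_integral _ one_ne_zero,
    ENNReal.toReal_ofReal (integral_nonneg fun x => gaussianPDFReal_nonneg _ _ _)]
  calc _ ≤ ∫ _x in Set.Ioc t (t + s), (gaussianPDFReal 0 1 t + tail t) :=
        setIntegral_mono_on (integrable_gaussianPDFReal _ _).integrableOn (by simp)
          measurableSet_Ioc hφ
    _ = _ := by
      rw [setIntegral_const, measureReal_def, Real.volume_Ioc, smul_eq_mul, add_sub_cancel_left,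
        ENNReal.toReal_ofReal hs]

theorem gaussian_Ioc_le' {s : ℝ} (t : ℝ) (hs : 0 ≤ s) :
    (gaussianReal 0 1).real (Set.Ioc (t - s) t)
      ≤ s * (gaussianPDFReal 0 1 t + tail (-t)) := by
  have h : (gaussianReal 0 1).map (fun x => -x) = gaussianReal 0 1 := by
    rw [gaussianReal_map_neg, neg_zero]
  have h2 : (gaussianReal 0 1) (Set.Ioc (t - s) t) = gaussianReal 0 1 (Set.Ioc (-t) (-t + s)) := by
    conv_lhs => rw [← h]
    rw [Measure.map_apply measurable_neg measurableSet_Ioc, ← measure_congr Ico_ae_eq_Ioc]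
    congr 1
    ext x
    simp only [Set.mem_preimage, Set.mem_Ioc, Set.mem_Ico]
    constructor <;> rintro ⟨h1, h2⟩ <;> constructor <;> linarith
  have h3 := gaussian_Ioc_le (-t) hs
  rwa [measureReal_def, ← h2, ← measureReal_def, gaussianPDF_even] at h3

theorem mass_le_tail (t : ℝ) : tail t * tail (-t) ≤ tail t := by
  nlinarith [tail_add_tail_neg t, tail_pos t, tail_pos (-t)]

theorem mass_le_tail_neg (t : ℝ) : tail t * tail (-t) ≤ tail (-t) := by
  nlinarith [tail_add_tail_neg t, tail_pos t, tail_pos (-t)]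

/-- First and second moments of a law on the line with a Gaussian tail. -/
theorem moments_of_exp_sq {P : Measure ℝ} [IsProbabilityMeasure P] {L : ℝ} (hL : 0 < L)
    (h : ∫⁻ x, ENNReal.ofReal (Real.exp (x ^ 2 / 4 / L)) ∂P ≤ ENNReal.ofReal (Real.exp 1)) :
    MemLp (fun x => x) 2 P ∧ ∫ x, x ^ 2 ∂P ≤ 8 * L ∧ (∫ x, x ∂P) ^ 2 ≤ ∫ x, x ^ 2 ∂P := by
  have h' : ∫⁻ x, ENNReal.ofReal (Real.exp |x ^ 2 / 4 / L|) ∂P ≤ ENNReal.ofReal (Real.exp 1) := by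
    have e : ∀ x : ℝ, |x ^ 2 / 4 / L| = x ^ 2 / 4 / L := fun x => abs_of_nonneg (by positivity)
    simpa only [e] using h
  have hm : Measurable fun x : ℝ => x ^ 2 / 4 / L := by fun_prop
  have i1 := integrable_exp_abs hm h'
  have i2 : Integrable (fun x : ℝ => x ^ 2) P := by
    have := (integrable_of_exp_abs hm h').const_mul (4 * L)
    refine this.congr (ae_of_all _ fun x => ?_)
    simp only
    field_simp
  have hmem : MemLp (fun x : ℝ => x) 2 P := (memLp_two_iff_integrable_sq (by fun_prop)).2 i2
  refine ⟨hmem, ?_, ?_⟩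
  · have h1 : ∫ x, (1 + x ^ 2 / 4 / L) ∂P ≤ ∫ x, Real.exp |x ^ 2 / 4 / L| ∂P := by
      refine integral_mono ((integrable_const _).add (integrable_of_exp_abs hm h')) i1 fun x => ?_
      have := Real.add_one_le_exp |x ^ 2 / 4 / L|
      linarith [le_abs_self (x ^ 2 / 4 / L)]
    have h2 : ∫ x, Real.exp |x ^ 2 / 4 / L| ∂P ≤ Real.exp 1 := by
      rw [integral_eq_lintegral_of_nonneg_ae (ae_of_all _ fun x => (Real.exp_pos _).le)
        i1.aestronglyMeasurable]
      exact ENNReal.toReal_le_of_le_ofReal (Real.exp_pos 1).le h'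
    rw [integral_add (integrable_const _) (integrable_of_exp_abs hm h'), integral_div,
      integral_div] at h1
    simp only [integral_const, probReal_univ, smul_eq_mul, mul_one] at h1
    have h3 := Real.exp_one_lt_d9
    have h4 : (∫ x, x ^ 2 ∂P) / 4 / L ≤ 2 := by linarith
    rw [div_le_iff₀ hL] at h4
    linarith
  · have := variance_nonneg (fun x : ℝ => x) P
    rw [variance_eq_sub hmem] at this
    simpa using this

theorem exp_sq_gaussianAbove (t : ℝ) :
    ∫⁻ x, ENNReal.ofReal (Real.exp (x ^ 2 / 4 / logMass t)) ∂(gaussianAbove t)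
      ≤ ENNReal.ofReal (Real.exp 1) :=
  lintegral_exp_div_logMass (mass_le_tail t) (f := fun x : ℝ => x ^ 2 / 4) (by fun_prop)
    lintegral_exp_sq_gaussian.le

theorem exp_sq_gaussianBelow (t : ℝ) :
    ∫⁻ x, ENNReal.ofReal (Real.exp (x ^ 2 / 4 / logMass t)) ∂(gaussianBelow t)
      ≤ ENNReal.ofReal (Real.exp 1) :=
  lintegral_exp_div_logMass (by rw [gaussian_Iic]; exact mass_le_tail_neg t)
    (f := fun x : ℝ => x ^ 2 / 4) (by fun_prop) lintegral_exp_sq_gaussian.le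

/-- The form in which the ratio `a` of density and tail enters: that ratio is the mean of the
conditioned law. -/
theorem hazard_bound {L a : ℝ} (hL : 1 ≤ L) (h : a ^ 2 ≤ 8 * L) : a + 1 ≤ 4 * √L := by
  have h1 : 1 ≤ √L := Real.one_le_sqrt.2 hL
  have h2 : √L ^ 2 = L := Real.sq_sqrt (by linarith)
  have h3 : a ≤ 3 * √L := by nlinarith
  linarith

/-- The Gaussian law conditioned above `t` has little mass just above `t`. -/
theorem gaussianAbove_near {s : ℝ} (t : ℝ) (hs : 0 ≤ s) :
    (gaussianAbove t) (Set.Iic (t + s)) ≤ ENNReal.ofReal (4 * √(logMass t) * s) := by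
  have hL := one_lt_logMass t
  obtain ⟨-, hb, ha⟩ := moments_of_exp_sq (by linarith) (exp_sq_gaussianAbove t)
  have hz := hazard_bound hL.le (ha.trans hb)
  rw [integral_gaussianAbove] at hz
  have h1 := gaussian_Ioc_le t hs
  have ht := tail_pos t
  rw [gaussianAbove, cond_apply measurableSet_Ioi, Set.Ioi_inter_Iic,
    ← ENNReal.ofReal_toReal (measure_ne_top (gaussianReal 0 1) (Set.Ioi t)),
    ← ENNReal.ofReal_toReal (measure_ne_top (gaussianReal 0 1) (Set.Ioc _ _)),
    ← measureReal_def, ← measureReal_def, ← tail, ← ENNReal.ofReal_inv_of_pos ht,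
    ← ENNReal.ofReal_mul (by positivity)]
  refine ENNReal.ofReal_le_ofReal ?_
  rw [inv_mul_le_iff₀ ht]
  calc _ ≤ s * (gaussianPDFReal 0 1 t + tail t) := h1
    _ = tail t * ((gaussianPDFReal 0 1 t / tail t + 1) * s) := by field_simp
    _ ≤ _ := by gcongr

theorem gaussianBelow_near {s : ℝ} (t : ℝ) (hs : 0 ≤ s) :
    (gaussianBelow t) (Set.Ioi (t - s)) ≤ ENNReal.ofReal (4 * √(logMass t) * s) := by
  have hL := one_lt_logMass t
  obtain ⟨-, hb, ha⟩ := moments_of_exp_sq (by linarith) (exp_sq_gaussianBelow t)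
  rw [← neg_sq] at ha
  have hz := hazard_bound hL.le (ha.trans hb)
  rw [integral_gaussianBelow, neg_neg] at hz
  have h1 := gaussian_Ioc_le' t hs
  have ht := tail_pos (-t)
  rw [gaussianBelow, cond_apply measurableSet_Iic, Set.inter_comm, Set.Ioi_inter_Iic,
    ← ENNReal.ofReal_toReal (measure_ne_top (gaussianReal 0 1) (Set.Iic t)),
    ← ENNReal.ofReal_toReal (measure_ne_top (gaussianReal 0 1) (Set.Ioc _ _)),
    ← measureReal_def, ← measureReal_def, gaussian_Iic, ← ENNReal.ofReal_inv_of_pos ht,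
    ← ENNReal.ofReal_mul (by positivity)]
  refine ENNReal.ofReal_le_ofReal ?_
  rw [inv_mul_le_iff₀ ht]
  calc _ ≤ s * (gaussianPDFReal 0 1 t + tail (-t)) := h1
    _ = tail (-t) * ((gaussianPDFReal 0 1 t / tail (-t) + 1) * s) := by field_simp
    _ ≤ _ := by gcongr

section

/-! ### Gaussian vectors, conditioned on a half-space -/

variable {d : ℕ}

theorem stdGaussian_map_inner (v : Vec d) :
    (stdGaussian (Vec d)).map (fun g => inner ℝ v g) = gaussianReal 0 (‖v‖₊ ^ 2) := by
  have h := IsGaussian.map_eq_gaussianReal (μ := stdGaussian (Vec d)) (innerSL ℝ v)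
  rw [integral_strongDual_stdGaussian, variance_dual_stdGaussian, innerSL_apply_norm] at h
  convert! h using 2
  ext
  simp

/-- Components of a standard Gaussian vector in orthogonal directions are independent. -/
theorem stdGaussian_map_inner_pair {e v : Vec d} (he : ‖e‖ = 1) (hv : inner ℝ e v = 0) :
    (stdGaussian (Vec d)).map (fun g => (inner ℝ e g, inner ℝ v g))
      = (gaussianReal 0 1).prod (gaussianReal 0 (‖v‖₊ ^ 2)) := by
  have hg : HasGaussianLaw (fun g : Vec d => (inner ℝ e g, inner ℝ v g)) (stdGaussian (Vec d)) :=
    ⟨by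
      have := isGaussian_map (μ := stdGaussian (Vec d)) ((innerSL ℝ e).prod (innerSL ℝ v))
      exact this⟩
  have hc : cov[fun g : Vec d => inner ℝ e g, fun g => inner ℝ v g; stdGaussian (Vec d)] = 0 := by
    rw [← covarianceBilin_apply_eq_cov IsGaussian.memLp_two_id, covarianceBilin_stdGaussian,
      innerSL_apply_apply, hv]
  have h := hg.indepFun_of_covariance_eq_zero hc
  rw [indepFun_iff_map_prod_eq_prod_map_map (by fun_prop) (by fun_prop), stdGaussian_map_inner,
    stdGaussian_map_inner] at h
  rw [h]
  congr 2
  ext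
  simp [he]

theorem map_cond {Ω Ω' : Type*} [MeasurableSpace Ω] [MeasurableSpace Ω'] {P : Measure Ω}
    {f : Ω → Ω'} (hf : Measurable f) {s : Set Ω'} (hs : MeasurableSet s) :
    (P.map f)[|s] = (P[|f ⁻¹' s]).map f := by
  rw [ProbabilityTheory.cond, ProbabilityTheory.cond, Measure.map_smul, Measure.map_apply hf hs,
    Measure.restrict_map hf hs]

theorem prod_cond_fst {Ω Ω' : Type*} [MeasurableSpace Ω] [MeasurableSpace Ω'] {P : Measure Ω}
    {P' : Measure Ω'} [SFinite P] [IsProbabilityMeasure P'] {s : Set Ω} :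
    (P.prod P')[|Prod.fst ⁻¹' s] = (P[|s]).prod P' := by
  have e : (Prod.fst ⁻¹' s : Set (Ω × Ω')) = s ×ˢ Set.univ := by ext; simp
  rw [ProbabilityTheory.cond, ProbabilityTheory.cond, e, Measure.prod_smul_left, Measure.prod_prod,
    measure_univ, mul_one, ← Measure.prod_restrict, Measure.restrict_univ]

/-- Conditioning a standard Gaussian vector on its component in direction `e` does not affect the
components orthogonal to `e`. -/
theorem stdGaussian_cond_map_pair {e v : Vec d} (he : ‖e‖ = 1) (hv : inner ℝ e v = 0) {s : Set ℝ}
    (hs : MeasurableSet s) :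
    ((stdGaussian (Vec d))[|(fun g => inner ℝ e g) ⁻¹' s]).map (fun g => (inner ℝ e g, inner ℝ v g))
      = ((gaussianReal 0 1)[|s]).prod (gaussianReal 0 (‖v‖₊ ^ 2)) := by
  have h : (fun g : Vec d => inner ℝ e g) ⁻¹' s
      = (fun g : Vec d => (inner ℝ e g, inner ℝ v g)) ⁻¹' (Prod.fst ⁻¹' s : Set (ℝ × ℝ)) := rfl
  rw [h, ← map_cond (by fun_prop) (hs.preimage measurable_fst), stdGaussian_map_inner_pair he hv,
    prod_cond_fst]

/-- Data describing the law `P` of a vector `μ + T g`, where the component of `g` in direction `e`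
has mean `a` and second moment `b`, and the rest of `g` is standard Gaussian. `L` is a scale for the
exponential moments of squares. -/
structure HasClassMoments (μ : Vec d) (T : Vec d →L[ℝ] Vec d) (e : Vec d) (L a b : ℝ)
    (P : Measure (Vec d)) : Prop where
  isProb : IsProbabilityMeasure P
  integrable : ∀ w, Integrable (fun x => (inner ℝ w (x - μ) : ℝ)) P
  integrable_sq : ∀ w, Integrable (fun x => (inner ℝ w (x - μ) : ℝ) ^ 2) P
  mean : ∀ w, ∫ x, inner ℝ w (x - μ) ∂P = inner ℝ (T w) e * a
  sq : ∀ w, ∫ x, (inner ℝ w (x - μ) : ℝ) ^ 2 ∂P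
    = ‖T w‖ ^ 2 + (b - 1) * (inner ℝ (T w) e : ℝ) ^ 2
  exp_sq : ∀ w, ∫⁻ x, ENNReal.ofReal (Real.exp ((inner ℝ w (x - μ) : ℝ) ^ 2 / (4 * L * ‖T w‖ ^ 2)))
    ∂P ≤ ENNReal.ofReal (Real.exp 1)

theorem lintegral_exp_sq_stdGaussian (v : Vec d) :
    ∫⁻ g, ENNReal.ofReal (Real.exp ((inner ℝ v g : ℝ) ^ 2 / (4 * ‖v‖ ^ 2))) ∂(stdGaussian (Vec d))
      ≤ ENNReal.ofReal √2 := by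
  rcases eq_or_ne v 0 with rfl | hv
  · simp
  · have hn : 0 < ‖v‖ := norm_pos_iff.2 hv
    have h1 : ‖(‖v‖⁻¹ • v)‖ = 1 := norm_smul_inv_norm hv
    have h2 := stdGaussian_map_inner (‖v‖⁻¹ • v)
    have h3 : ‖(‖v‖⁻¹ • v)‖₊ ^ 2 = 1 := by
      ext; simp only [NNReal.coe_pow, coe_nnnorm, h1]; norm_num
    rw [h3] at h2
    rw [← lintegral_exp_sq_gaussian, ← h2, lintegral_map (by fun_prop) (by fun_prop)]
    refine le_of_eq (lintegral_congr fun g => ?_)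
    congr 2
    rw [inner_smul_left]
    simp only [conj_trivial]
    field_simp

/-- The affine image of a standard Gaussian vector conditioned by its component in direction `e`. -/
theorem hasClassMoments_cond (μ : Vec d) {T : Vec d →L[ℝ] Vec d}
    (hT : ∀ x y, inner ℝ (T x) y = inner ℝ x (T y)) {e : Vec d} (he : ‖e‖ = 1) {t : ℝ} {s : Set ℝ}
    (hs : MeasurableSet s) (hst : tail t * tail (-t) ≤ (gaussianReal 0 1).real s) :
    HasClassMoments μ T e (logMass t) (∫ x, x ∂(gaussianReal 0 1)[|s])
      (∫ x, x ^ 2 ∂(gaussianReal 0 1)[|s])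
      (((stdGaussian (Vec d))[|(fun g => inner ℝ e g) ⁻¹' s]).map fun g => μ + T g) := by
  set ν := (gaussianReal 0 1)[|s] with hν
  set Q := (stdGaussian (Vec d))[|(fun g => inner ℝ e g) ⁻¹' s] with hQ
  have hL := one_lt_logMass t
  have hw : 0 < tail t * tail (-t) := mul_pos (tail_pos _) (tail_pos _)
  have hs0 : gaussianReal 0 1 s ≠ 0 := fun h0 => by
    rw [measureReal_def, h0] at hst
    simp at hst
    linarith
  have hpre : (stdGaussian (Vec d)) ((fun g => inner ℝ e g) ⁻¹' s) = gaussianReal 0 1 s := by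
    have := stdGaussian_map_inner e
    rw [show ‖e‖₊ ^ 2 = 1 by ext; simp [he]] at this
    rw [← this, Measure.map_apply (by fun_prop) hs]
  have hνp : IsProbabilityMeasure ν := cond_isProbabilityMeasure hs0
  have hQp : IsProbabilityMeasure Q := cond_isProbabilityMeasure (by rwa [hpre])
  have hνe : ∫⁻ x, ENNReal.ofReal (Real.exp (x ^ 2 / 4 / logMass t)) ∂ν
      ≤ ENNReal.ofReal (Real.exp 1) :=
    lintegral_exp_div_logMass hst (f := fun x : ℝ => x ^ 2 / 4) (by fun_prop)
      lintegral_exp_sq_gaussian.le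
  obtain ⟨hν2, -, -⟩ := moments_of_exp_sq (by linarith) hνe
  have hmT : Measurable fun g : Vec d => μ + T g := by fun_prop
  have hin : ∀ w g, (inner ℝ w (μ + T g - μ) : ℝ) = inner ℝ (T w) g := fun w g => by
    rw [add_sub_cancel_left, hT]
  -- for `v = T w`, split `v` along `e`
  have key : ∀ v : Vec d, ∃ τ : NNReal, (τ : ℝ) = ‖v‖ ^ 2 - (inner ℝ v e : ℝ) ^ 2 ∧
      Q.map (fun g => (inner ℝ v g : ℝ))
        = (ν.prod (gaussianReal 0 τ)).map fun p => inner ℝ v e * p.1 + p.2 := by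
    intro v
    set ρ : ℝ := inner ℝ v e with hρ
    have ho : inner ℝ e (v - ρ • e) = 0 := by
      rw [inner_sub_right, inner_smul_right, real_inner_self_eq_norm_sq, he, hρ, real_inner_comm]
      ring
    refine ⟨‖v - ρ • e‖₊ ^ 2, ?_, ?_⟩
    · rw [NNReal.coe_pow, coe_nnnorm, @norm_sub_sq ℝ, inner_smul_right, norm_smul, he, ← hρ]
      simp
      ring
    · rw [← stdGaussian_cond_map_pair he ho hs, Measure.map_map (by fun_prop) (by fun_prop)]
      congr 1
      funext g
      simp only [Function.comp, inner_sub_left, inner_smul_left, conj_trivial]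
      ring
  have hmem : ∀ v : Vec d, MemLp (fun g => (inner ℝ v g : ℝ)) 2 Q := by
    intro v
    obtain ⟨τ, -, h⟩ := key v
    have h1 : MemLp (fun p : ℝ × ℝ => inner ℝ v e * p.1 + p.2) 2 (ν.prod (gaussianReal 0 τ)) :=
      ((hν2.comp_measurePreserving measurePreserving_fst).const_mul _).add
        ((memLp_id_gaussianReal' 2 (by simp)).comp_measurePreserving measurePreserving_snd)
    have h2 : MemLp (fun x : ℝ => x) 2 (Q.map fun g => (inner ℝ v g : ℝ)) := by
      rw [h, memLp_map_measure_iff (by fun_prop) (by fun_prop)]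
      exact h1
    rwa [memLp_map_measure_iff (by fun_prop) (by fun_prop)] at h2
  refine ⟨Measure.isProbabilityMeasure_map (by fun_prop), fun w => ?_, fun w => ?_, fun w => ?_,
    fun w => ?_, fun w => ?_⟩
  · rw [integrable_map_measure (by fun_prop) (by fun_prop)]
    simp only [Function.comp_def, hin]
    exact (hmem _).integrable (by simp)
  · rw [integrable_map_measure (by fun_prop) (by fun_prop)]
    simp only [Function.comp_def, hin]
    exact (hmem _).integrable_sq
  · rw [integral_map (by fun_prop) (by fun_prop)]
    simp only [hin]
    obtain ⟨τ, -, h⟩ := key (T w)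
    have h1 : ∫ g, (inner ℝ (T w) g : ℝ) ∂Q = ∫ x, x ∂(Q.map fun g => (inner ℝ (T w) g : ℝ)) := by
      rw [integral_map (by fun_prop) (by fun_prop)]
    have i1 : Integrable (fun p : ℝ × ℝ => inner ℝ (T w) e * p.1) (ν.prod (gaussianReal 0 τ)) :=
      ((hν2.integrable (by simp)).comp_fst _).const_mul _
    have i2 : Integrable (fun p : ℝ × ℝ => p.2) (ν.prod (gaussianReal 0 τ)) :=
      ((memLp_id_gaussianReal' 1 (by simp)).integrable le_rfl).comp_snd _
    rw [h1, h, integral_map (by fun_prop) (by fun_prop), integral_add i1 i2, integral_const_mul,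
      integral_fun_fst (fun x : ℝ => x), integral_fun_snd (fun x : ℝ => x),
      integral_id_gaussianReal]
    simp
  · rw [integral_map (by fun_prop) (by fun_prop)]
    simp only [hin]
    obtain ⟨τ, hτ, h⟩ := key (T w)
    have h1 : ∫ g, (inner ℝ (T w) g : ℝ) ^ 2 ∂Q
        = ∫ x, x ^ 2 ∂(Q.map fun g => (inner ℝ (T w) g : ℝ)) := by
      rw [integral_map (by fun_prop) (by fun_prop)]
    set ρ : ℝ := inner ℝ (T w) e with hρ
    have m2 := memLp_id_gaussianReal' (μ := 0) (v := τ) 2 (by simp)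
    have i1 : Integrable (fun p : ℝ × ℝ => ρ ^ 2 * p.1 ^ 2) (ν.prod (gaussianReal 0 τ)) :=
      (hν2.integrable_sq.comp_fst _).const_mul _
    have i2 : Integrable (fun p : ℝ × ℝ => p.2 ^ 2) (ν.prod (gaussianReal 0 τ)) :=
      m2.integrable_sq.comp_snd _
    have i3 : Integrable (fun p : ℝ × ℝ => 2 * ρ * (p.1 * p.2)) (ν.prod (gaussianReal 0 τ)) :=
      ((hν2.integrable (by simp)).mul_prod (m2.integrable (by simp))).const_mul _
    have h2 : ∫ x : ℝ, x ^ 2 ∂(gaussianReal 0 τ) = τ := by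
      have := variance_id_gaussianReal (μ := 0) (v := τ)
      rw [variance_eq_sub m2] at this
      simpa using this
    have e1 : ∀ p : ℝ × ℝ, (ρ * p.1 + p.2) ^ 2
        = ρ ^ 2 * p.1 ^ 2 + p.2 ^ 2 + 2 * ρ * (p.1 * p.2) := fun p => by ring
    rw [h1, h, integral_map (by fun_prop) (by fun_prop)]
    simp only [e1]
    have i4 : Integrable (fun p : ℝ × ℝ => ρ ^ 2 * p.1 ^ 2 + p.2 ^ 2)
      (ν.prod (gaussianReal 0 τ)) := i1.add i2
    rw [integral_add i4 i3, integral_add i1 i2, integral_const_mul, integral_const_mul,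
      integral_fun_fst (fun x : ℝ => x ^ 2), integral_fun_snd (fun x : ℝ => x ^ 2),
      integral_prod_mul (fun x : ℝ => x) (fun x : ℝ => x), integral_id_gaussianReal, h2, hτ]
    simp
    ring
  · rw [lintegral_map (by fun_prop) (by fun_prop)]
    simp only [hin]
    have := lintegral_exp_div_logMass (P := stdGaussian (Vec d))
      (s := (fun g => inner ℝ e g) ⁻¹' s) (t := t)
      (by rwa [measureReal_def, hpre, ← measureReal_def])
      (f := fun g => (inner ℝ (T w) g : ℝ) ^ 2 / (4 * ‖T w‖ ^ 2)) (by fun_prop)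
      (lintegral_exp_sq_stdGaussian (T w))
    refine le_trans (le_of_eq ?_) this
    refine lintegral_congr fun g => ?_
    congr 2
    rw [div_div]
    ring_nf

theorem lintegral_abs_gaussian (τ : NNReal) :
    ∫⁻ y, ENNReal.ofReal |y| ∂(gaussianReal 0 (τ ^ 2)) ≤ ENNReal.ofReal τ := by
  have h := eLpNorm'_le_eLpNorm'_of_exponent_le (μ := gaussianReal 0 (τ ^ 2)) (p := 1) (q := 2)
    (f := fun x : ℝ => x) one_pos one_le_two (by fun_prop)
  simp only [eLpNorm', ENNReal.rpow_one, div_one] at h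
  have e : ∀ x : ℝ, ‖x‖ₑ = ENNReal.ofReal |x| := fun x => by
    rw [← ofReal_norm, Real.norm_eq_abs]
  have e2 : ∀ x : ℝ, ENNReal.ofReal |x| ^ (2 : ℝ) = ENNReal.ofReal (x ^ 2) := fun x => by
    rw [ENNReal.ofReal_rpow_of_nonneg (abs_nonneg x) two_pos.le]
    congr 1
    rw [Real.rpow_two, sq_abs]
  have m2 := memLp_id_gaussianReal' (μ := 0) (v := τ ^ 2) 2 (by simp)
  have h2 : ∫ x : ℝ, x ^ 2 ∂(gaussianReal 0 (τ ^ 2)) = (τ : ℝ) ^ 2 := by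
    have := variance_id_gaussianReal (μ := 0) (v := τ ^ 2)
    rw [variance_eq_sub m2] at this
    simpa using this
  have i2 : Integrable (fun x : ℝ => x ^ 2) (gaussianReal 0 (τ ^ 2)) := m2.integrable_sq
  simp only [e, e2] at h
  refine h.trans (le_of_eq ?_)
  rw [← ofReal_integral_eq_lintegral_ofReal i2 (ae_of_all _ fun x => sq_nonneg _), h2, ENNReal.ofReal_rpow_of_nonneg (by positivity) (by norm_num), ← Real.sqrt_eq_rpow,
    Real.sqrt_sq τ.coe_nonneg]

/-- If `ν` has little mass near a point, so has the sum of a variable with law `ν` and an independent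
small Gaussian variable; the sets `B s` play the role of neighbourhoods of size `s`. -/
theorem prod_gaussian_near {ν : Measure ℝ} [SFinite ν] {B : ℝ → Set ℝ} {K ρ : ℝ} (hK : 0 ≤ K)
    (hρ : 0 < ρ) (hB : ∀ s, 0 ≤ s → ν (B s) ≤ ENNReal.ofReal (K * s)) (τ : NNReal)
    {A : Set (ℝ × ℝ)} (hA : MeasurableSet A) (hAB : ∀ z y, (z, y) ∈ A → z ∈ B (|y| / ρ)) :
    (ν.prod (gaussianReal 0 (τ ^ 2))) A ≤ ENNReal.ofReal (K * (τ / ρ)) := by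
  rw [Measure.prod_apply_symm hA]
  calc _ ≤ ∫⁻ y, ENNReal.ofReal (K / ρ) * ENNReal.ofReal |y| ∂(gaussianReal 0 (τ ^ 2)) := by
        refine lintegral_mono fun y => ?_
        refine (measure_mono fun z hz => hAB z y hz).trans ((hB _ (by positivity)).trans ?_)
        rw [← ENNReal.ofReal_mul (by positivity)]
        refine ENNReal.ofReal_le_ofReal (le_of_eq ?_)
        ring
    _ = ENNReal.ofReal (K / ρ) * ∫⁻ y, ENNReal.ofReal |y| ∂(gaussianReal 0 (τ ^ 2)) :=
        lintegral_const_mul _ (by fun_prop)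
    _ ≤ ENNReal.ofReal (K / ρ) * ENNReal.ofReal τ := by
        gcongr
        exact lintegral_abs_gaussian τ
    _ = _ := by
        rw [← ENNReal.ofReal_mul (by positivity)]
        congr 1
        ring

/-- A half-space whose normal vector is nearly that of the conditioning half-space, and which has
the matching offset, contains little of the other class. -/
theorem halfspace_error {μ : Vec d} {T : Vec d →L[ℝ] Vec d}
    (hT : ∀ x y, inner ℝ (T x) y = inner ℝ x (T y)) {e : Vec d} (he : ‖e‖ = 1) {t : ℝ} {w : Vec d}
    (hρ : 0 < (inner ℝ (T w) e : ℝ)) {s : Set ℝ} (hs : MeasurableSet s) {B : ℝ → Set ℝ} {K : ℝ}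
    (hK : 0 ≤ K) (hB : ∀ s', 0 ≤ s' → ((gaussianReal 0 1)[|s]) (B s') ≤ ENNReal.ofReal (K * s'))
    {A : Set ℝ} (hA : MeasurableSet A)
    (hAB : ∀ z y, z + y - t ∈ A → z ∈ B |y|) :
    (((stdGaussian (Vec d))[|(fun g => inner ℝ e g) ⁻¹' s]).map fun g => μ + T g)
      {x | (inner ℝ w (x - μ) : ℝ) / inner ℝ (T w) e - t ∈ A}
      ≤ ENNReal.ofReal (K * (‖T w - (inner ℝ (T w) e : ℝ) • e‖ / inner ℝ (T w) e)) := by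
  set ρ : ℝ := inner ℝ (T w) e with hρd
  have ho : inner ℝ e (T w - ρ • e) = 0 := by
    rw [inner_sub_right, inner_smul_right, real_inner_self_eq_norm_sq, he, hρd, real_inner_comm]
    ring
  have hm : Measurable fun x : Vec d => (inner ℝ w (x - μ) : ℝ) / ρ - t := by fun_prop
  have hm2 : Measurable fun p : ℝ × ℝ => p.1 + p.2 / ρ - t := by fun_prop
  -- divided by `ρ`, the component along `w` is that along `e` plus an independent error
  have key := prod_gaussian_near hK hρ hB ‖T w - ρ • e‖₊ (hA.preimage hm2) fun z y hzy => by
    have := hAB z (y / ρ) hzy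
    rwa [abs_div, abs_of_pos hρ] at this
  rw [← stdGaussian_cond_map_pair he ho hs, Measure.map_apply (by fun_prop) (hA.preimage hm2)] at key
  refine le_trans (le_of_eq ?_) key
  have e3 : {x : Vec d | (inner ℝ w (x - μ) : ℝ) / ρ - t ∈ A}
      = (fun x : Vec d => (inner ℝ w (x - μ) : ℝ) / ρ - t) ⁻¹' A := rfl
  rw [e3, Measure.map_apply (by fun_prop) (hA.preimage hm)]
  congr 1
  ext g
  simp only [Set.mem_preimage]
  rw [add_sub_cancel_left, ← hT]
  simp only [inner_sub_left, inner_smul_left, conj_trivial]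
  rw [show (inner ℝ (T w) g : ℝ) / ρ = inner ℝ e g + (inner ℝ (T w) g - ρ * inner ℝ e g) / ρ by
    field_simp; ring]

end

/-! ### The statistics of a pair of bags -/

section

variable {Ω : Type*} {q : ℕ}

/-- The sum of the `(f x - f x') ^ 2` over the pairs of elements of two bags. -/
def pairForm (f : Ω → ℝ) (p : (Fin q → Ω) × (Fin q → Ω)) : ℝ :=
  ∑ i, ∑ i', (f (p.1 i) - f (p.2 i')) ^ 2

/-- The square of the difference of the sums of `f` over two bags. -/
def sumForm (f : Ω → ℝ) (p : (Fin q → Ω) × (Fin q → Ω)) : ℝ :=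
  (∑ i, (f (p.1 i) - f (p.2 i))) ^ 2

theorem pairForm_eq (f : Ω → ℝ) (p : (Fin q → Ω) × (Fin q → Ω)) :
    pairForm f p = q * ∑ i, f (p.1 i) ^ 2 + q * ∑ i, f (p.2 i) ^ 2
      - 2 * ((∑ i, f (p.1 i)) * ∑ i, f (p.2 i)) := by
  have e : ∀ i i', (f (p.1 i) - f (p.2 i')) ^ 2
      = f (p.1 i) ^ 2 + f (p.2 i') ^ 2 - 2 * (f (p.1 i) * f (p.2 i')) := fun i i' => by ring
  simp only [pairForm, e, Finset.sum_sub_distrib, Finset.sum_add_distrib, Finset.sum_const,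
    Finset.card_univ, Fintype.card_fin, nsmul_eq_mul, ← Finset.mul_sum, Finset.sum_mul_sum]

theorem sumForm_eq (f : Ω → ℝ) (p : (Fin q → Ω) × (Fin q → Ω)) :
    sumForm f p = (∑ i, f (p.1 i)) ^ 2 + (∑ i, f (p.2 i)) ^ 2
      - 2 * ((∑ i, f (p.1 i)) * ∑ i, f (p.2 i)) := by
  rw [sumForm, Finset.sum_sub_distrib]
  ring

theorem pairForm_le (f : Ω → ℝ) (p : (Fin q → Ω) × (Fin q → Ω)) :
    pairForm f p ≤ 2 * q * (∑ i, f (p.1 i) ^ 2 + ∑ i, f (p.2 i) ^ 2) := by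
  have h : ∀ i i', (f (p.1 i) - f (p.2 i')) ^ 2 ≤ 2 * f (p.1 i) ^ 2 + 2 * f (p.2 i') ^ 2 :=
    fun i i' => by nlinarith [sq_nonneg (f (p.1 i) + f (p.2 i'))]
  refine (Finset.sum_le_sum fun i _ => Finset.sum_le_sum fun i' _ => h i i').trans (le_of_eq ?_)
  simp only [Finset.sum_add_distrib, Finset.sum_const, Finset.card_univ, Fintype.card_fin,
    nsmul_eq_mul, ← Finset.mul_sum]
  ring

theorem sumForm_le (f : Ω → ℝ) (p : (Fin q → Ω) × (Fin q → Ω)) :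
    sumForm f p ≤ 2 * q * (∑ i, f (p.1 i) ^ 2 + ∑ i, f (p.2 i) ^ 2) := by
  have h : ∀ i, (f (p.1 i) - f (p.2 i)) ^ 2 ≤ 2 * f (p.1 i) ^ 2 + 2 * f (p.2 i) ^ 2 :=
    fun i => by nlinarith [sq_nonneg (f (p.1 i) + f (p.2 i))]
  have h1 := sq_sum_le_card_mul_sum_sq (s := Finset.univ) (f := fun i => f (p.1 i) - f (p.2 i))
  rw [Finset.card_univ, Fintype.card_fin] at h1
  have h2 := Finset.sum_le_sum fun i (_ : i ∈ Finset.univ) => h i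
  simp only [Finset.sum_add_distrib, ← Finset.mul_sum] at h2
  refine h1.trans ?_
  calc _ ≤ (q : ℝ) * (2 * ∑ i, f (p.1 i) ^ 2 + 2 * ∑ i, f (p.2 i) ^ 2) := by gcongr
    _ = _ := by ring

theorem pairForm_nonneg (f : Ω → ℝ) (p : (Fin q → Ω) × (Fin q → Ω)) : 0 ≤ pairForm f p :=
  Finset.sum_nonneg fun _ _ => Finset.sum_nonneg fun _ _ => sq_nonneg _

theorem sumForm_nonneg (f : Ω → ℝ) (p : (Fin q → Ω) × (Fin q → Ω)) : 0 ≤ sumForm f p :=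
  sq_nonneg _

variable [MeasurableSpace Ω]

/-- The law of a bag with `k` vectors of one class and `q - k` vectors of the other. -/
def bagLaw (q k : ℕ) (P₁ P₀ : Measure Ω) : Measure (Fin q → Ω) :=
  Measure.pi fun i => if (i : ℕ) < k then P₁ else P₀

instance {c : Prop} [Decidable c] {P₁ P₀ : Measure Ω} [IsProbabilityMeasure P₁]
    [IsProbabilityMeasure P₀] : IsProbabilityMeasure (if c then P₁ else P₀) := by
  split_ifs <;> infer_instance

instance (k : ℕ) {P₁ P₀ : Measure Ω} [IsProbabilityMeasure P₁] [IsProbabilityMeasure P₀] :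
    IsProbabilityMeasure (bagLaw q k P₁ P₀) := by
  unfold bagLaw; infer_instance

theorem sum_ite_lt {k : ℕ} (hk : k ≤ q) (a b : ℝ) :
    (∑ i : Fin q, if (i : ℕ) < k then a else b) = k * a + (q - k) * b := by
  rw [← Finset.sum_range (fun i => if i < k then a else b), Finset.sum_ite, Finset.sum_const,
    Finset.sum_const]
  have h1 : (Finset.range q).filter (fun i => i < k) = Finset.range k := by
    ext i; simp; omega
  have h2 : (Finset.range q).filter (fun i => ¬ i < k) = Finset.Ico k q := by
    ext i; simp; omega
  rw [h1, h2, Finset.card_range, Nat.card_Ico, nsmul_eq_mul, nsmul_eq_mul, Nat.cast_sub hk]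

theorem memLp_sum_eval {M : Fin q → Measure Ω} [∀ i, IsProbabilityMeasure (M i)] {f : Ω → ℝ}
    (hf : ∀ i, MemLp f 2 (M i)) :
    MemLp (fun x : Fin q → Ω => ∑ i, f (x i)) 2 (Measure.pi M) :=
  memLp_finsetSum _ fun i _ => (hf i).comp_measurePreserving (measurePreserving_eval M i)

theorem integral_sum_eval {M : Fin q → Measure Ω} [∀ i, IsProbabilityMeasure (M i)] {f : Ω → ℝ}
    (hf : ∀ i, Integrable f (M i)) :
    ∫ x, ∑ i, f (x i) ∂(Measure.pi M) = ∑ i, ∫ x, f x ∂(M i) := by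
  have h : ∀ i, Integrable (fun x : Fin q → Ω => f (x i)) (Measure.pi M) := fun i =>
    (measurePreserving_eval M i).integrable_comp_of_integrable (hf i)
  rw [integral_finsetSum _ fun i _ => h i]
  exact Finset.sum_congr rfl fun i _ => integral_comp_eval (hf i).1

/-- The second moment of a sum of independent variables. -/
theorem integral_sum_eval_sq {M : Fin q → Measure Ω} [∀ i, IsProbabilityMeasure (M i)] {f : Ω → ℝ}
    (hf : ∀ i, MemLp f 2 (M i)) :
    ∫ x, (∑ i, f (x i)) ^ 2 ∂(Measure.pi M)
      = ∑ i, (∫ x, f x ^ 2 ∂(M i) - (∫ x, f x ∂(M i)) ^ 2) + (∑ i, ∫ x, f x ∂(M i)) ^ 2 := by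
  have h1 := variance_eq_sub (memLp_sum_eval hf)
  have h2 := variance_sum_pi (μ := M) (X := fun _ => f) hf
  have h3 : ∀ i, Var[f; M i] = ∫ x, f x ^ 2 ∂(M i) - (∫ x, f x ∂(M i)) ^ 2 := fun i => by
    rw [variance_eq_sub (hf i)]
    rfl
  have e : (∑ i, fun ω : Fin q → Ω => f (ω i)) = fun x => ∑ i, f (x i) := by
    funext x; simp
  rw [e, h1] at h2
  simp only [h3, Pi.pow_apply, integral_sum_eval fun i => (hf i).integrable one_le_two] at h2
  linarith

/-- The expectations of the two forms. The second contains only the variances within the classes,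
because the number of elements of each class in a bag is fixed; this is what tells the classes apart. -/
theorem integral_forms {M : Fin q → Measure Ω} [∀ i, IsProbabilityMeasure (M i)] {f : Ω → ℝ}
    (hf : ∀ i, MemLp f 2 (M i)) :
    Integrable (pairForm f) ((Measure.pi M).prod (Measure.pi M)) ∧
    Integrable (sumForm f) ((Measure.pi M).prod (Measure.pi M)) ∧
    ∫ p, pairForm f p ∂((Measure.pi M).prod (Measure.pi M))
      = 2 * q * ∑ i, ∫ x, f x ^ 2 ∂(M i) - 2 * (∑ i, ∫ x, f x ∂(M i)) ^ 2 ∧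
    ∫ p, sumForm f p ∂((Measure.pi M).prod (Measure.pi M))
      = 2 * ∑ i, (∫ x, f x ^ 2 ∂(M i) - (∫ x, f x ∂(M i)) ^ 2) := by
  have hfi : ∀ i, MemLp (fun x : Fin q → Ω => f (x i)) 2 (Measure.pi M) := fun i =>
    (hf i).comp_measurePreserving (measurePreserving_eval M i)
  have hX := memLp_sum_eval hf
  have hXi := hX.integrable one_le_two
  have m2 : ∀ i, ∫ x, f (x i) ^ 2 ∂(Measure.pi M) = ∫ x, f x ^ 2 ∂(M i) := fun i =>
    integral_comp_eval (μ := M) (i := i) (f := fun x => f x ^ 2) ((hf i).1.pow 2)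
  have hS := integral_sum_eval fun i => (hf i).integrable one_le_two
  have hS2 : ∫ x, ∑ i, f (x i) ^ 2 ∂(Measure.pi M) = ∑ i, ∫ x, f x ^ 2 ∂(M i) := by
    rw [integral_finsetSum _ fun i _ => (hfi i).integrable_sq]
    exact Finset.sum_congr rfl fun i _ => m2 i
  have hV := integral_sum_eval_sq hf
  have iS2 : Integrable (fun x : Fin q → Ω => ∑ i, f (x i) ^ 2) (Measure.pi M) :=
    integrable_finsetSum _ fun i _ => (hfi i).integrable_sq
  have iX2 := hX.integrable_sq
  have j1 := (iS2.comp_fst (Measure.pi M)).const_mul (q : ℝ)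
  have j2 := (iS2.comp_snd (Measure.pi M)).const_mul (q : ℝ)
  have j3 := (hXi.mul_prod hXi).const_mul 2
  have j4 := iX2.comp_fst (Measure.pi M)
  have j5 := iX2.comp_snd (Measure.pi M)
  have j12 : Integrable (fun p : (Fin q → Ω) × (Fin q → Ω) =>
      (q : ℝ) * ∑ i, f (p.1 i) ^ 2 + q * ∑ i, f (p.2 i) ^ 2)
      ((Measure.pi M).prod (Measure.pi M)) := j1.add j2
  have j45 : Integrable (fun p : (Fin q → Ω) × (Fin q → Ω) =>
      (∑ i, f (p.1 i)) ^ 2 + (∑ i, f (p.2 i)) ^ 2)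
      ((Measure.pi M).prod (Measure.pi M)) := j4.add j5
  have hpX : ∫ p : (Fin q → Ω) × (Fin q → Ω), 2 * ((∑ i, f (p.1 i)) * ∑ i, f (p.2 i))
      ∂((Measure.pi M).prod (Measure.pi M)) = 2 * (∑ i, ∫ x, f x ∂(M i)) ^ 2 := by
    rw [integral_const_mul, integral_prod_mul (fun x : Fin q → Ω => ∑ i, f (x i))
      (fun x : Fin q → Ω => ∑ i, f (x i)), hS, sq]
  refine ⟨?_, ?_, ?_, ?_⟩
  · exact (j12.sub j3).congr (ae_of_all _ fun p => (pairForm_eq f p).symm)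
  · exact (j45.sub j3).congr (ae_of_all _ fun p => (sumForm_eq f p).symm)
  · simp only [pairForm_eq]
    rw [integral_sub j12 j3, integral_add j1 j2, hpX, integral_const_mul, integral_const_mul,
      integral_fun_fst (fun x : Fin q → Ω => ∑ i, f (x i) ^ 2),
      integral_fun_snd (fun x : Fin q → Ω => ∑ i, f (x i) ^ 2), hS2]
    simp
    ring
  · simp only [sumForm_eq]
    rw [integral_sub j45 j3, integral_add j4 j5, hpX,
      integral_fun_fst (fun x : Fin q → Ω => (∑ i, f (x i)) ^ 2),
      integral_fun_snd (fun x : Fin q → Ω => (∑ i, f (x i)) ^ 2), hV]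
    simp
    ring

/-- A function of two bags that is dominated by an average over their elements inherits exponential
moments. -/
theorem lintegral_exp_le_of_le_average {M : Fin q → Measure Ω}
    [∀ i, IsProbabilityMeasure (M i)] (hq : 0 < q) {g : Ω → ℝ} (hg : Measurable g)
    (h : ∀ i, ∫⁻ x, ENNReal.ofReal (Real.exp (g x)) ∂(M i) ≤ ENNReal.ofReal (Real.exp 1))
    {F : (Fin q → Ω) × (Fin q → Ω) → ℝ}
    (hF : ∀ p, |F p| ≤ 1 / (2 * q) * (∑ i, g (p.1 i) + ∑ i, g (p.2 i))) :
    ∫⁻ p, ENNReal.ofReal (Real.exp |F p|) ∂((Measure.pi M).prod (Measure.pi M))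
      ≤ ENNReal.ofReal (Real.exp 1) := by
  have hq' : (0 : ℝ) < q := by exact_mod_cast hq
  have hav : ∀ p : (Fin q → Ω) × (Fin q → Ω), ENNReal.ofReal (Real.exp |F p|)
      ≤ ENNReal.ofReal (1 / (2 * q)) * (∑ i, ENNReal.ofReal (Real.exp (g (p.1 i)))
        + ∑ i, ENNReal.ofReal (Real.exp (g (p.2 i)))) := by
    intro p
    -- convexity of the exponential function
    have h1 := convexOn_exp.map_sum_le (t := (Finset.univ : Finset (Fin q ⊕ Fin q)))
      (w := fun _ => 1 / (2 * (q : ℝ))) (p := Sum.elim (fun i => g (p.1 i)) fun i => g (p.2 i))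
      (fun _ _ => by positivity) (by simp; field_simp; norm_num) (fun _ _ => Set.mem_univ _)
    simp only [Fintype.sum_sum_type, Sum.elim_inl, Sum.elim_inr, smul_eq_mul,
      ← Finset.mul_sum] at h1
    have h2 : Real.exp |F p| ≤ 1 / (2 * q) * (∑ i, Real.exp (g (p.1 i))
        + ∑ i, Real.exp (g (p.2 i))) := (Real.exp_le_exp.2 (hF p)).trans h1
    refine (ENNReal.ofReal_le_ofReal h2).trans (le_of_eq ?_)
    rw [ENNReal.ofReal_mul (by positivity), ENNReal.ofReal_add (by positivity) (by positivity),
      ENNReal.ofReal_sum_of_nonneg fun _ _ => (Real.exp_pos _).le,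
      ENNReal.ofReal_sum_of_nonneg fun _ _ => (Real.exp_pos _).le]
  have e1 : ∀ i, ∫⁻ p : (Fin q → Ω) × (Fin q → Ω), ENNReal.ofReal (Real.exp (g (p.1 i)))
      ∂((Measure.pi M).prod (Measure.pi M)) ≤ ENNReal.ofReal (Real.exp 1) := fun i => by
    have := ((measurePreserving_eval M i).comp (measurePreserving_fst (μ := Measure.pi M)
      (ν := Measure.pi M))).lintegral_comp (f := fun x => ENNReal.ofReal (Real.exp (g x)))
      (by fun_prop)
    simp only [Function.comp, Function.eval] at this
    rw [this]
    exact h i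
  have e2 : ∀ i, ∫⁻ p : (Fin q → Ω) × (Fin q → Ω), ENNReal.ofReal (Real.exp (g (p.2 i)))
      ∂((Measure.pi M).prod (Measure.pi M)) ≤ ENNReal.ofReal (Real.exp 1) := fun i => by
    have := ((measurePreserving_eval M i).comp (measurePreserving_snd (μ := Measure.pi M)
      (ν := Measure.pi M))).lintegral_comp (f := fun x => ENNReal.ofReal (Real.exp (g x)))
      (by fun_prop)
    simp only [Function.comp, Function.eval] at this
    rw [this]
    exact h i
  refine (lintegral_mono hav).trans ?_
  rw [lintegral_const_mul _ (by fun_prop), lintegral_add_left (by fun_prop),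
    lintegral_finsetSum _ (fun i _ => by fun_prop), lintegral_finsetSum _ (fun i _ => by fun_prop)]
  calc _ ≤ ENNReal.ofReal (1 / (2 * q)) * (∑ _i : Fin q, ENNReal.ofReal (Real.exp 1)
        + ∑ _i : Fin q, ENNReal.ofReal (Real.exp 1)) := by
        gcongr
        · exact e1 _
        · exact e2 _
    _ = _ := by
        rw [← ENNReal.ofReal_sum_of_nonneg fun _ _ => (Real.exp_pos _).le,
          ← ENNReal.ofReal_add (by positivity) (by positivity), ← ENNReal.ofReal_mul (by positivity)]
        congr 1
        simp
        field_simp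
        norm_num

end

/-! ### Concentration of the operators computed by the learner -/

section

variable {d q n : ℕ}

/-- The expectation of `pairOp`, where `β` is the variance within the mixture of the two classes in
the direction that separates them. -/
def covMean (q : ℕ) (T : Vec d →L[ℝ] Vec d) (e : Vec d) (β : ℝ) : Vec d →L[ℝ] Vec d :=
  (2 * (q : ℝ) ^ 2) • (T * T + (β - 1) • rankOne (T e))

/-- The expectation of `pairOp - q • sumOp`, where `g` is the distance between the means of the two
classes in the direction that separates them. -/
def gapMean (q k : ℕ) (T : Vec d →L[ℝ] Vec d) (e : Vec d) (g : ℝ) : Vec d →L[ℝ] Vec d :=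
  (2 * k * (q - k) * g ^ 2 : ℝ) • rankOne (T e)

/-- The operators built from differences do not depend on the choice of the origin `μ`. -/
theorem inner_pairOp (μ w : Vec d) (p : (Fin q → Vec d) × (Fin q → Vec d)) :
    inner ℝ (pairOp p.1 p.2 w) w = pairForm (fun x => (inner ℝ w (x - μ) : ℝ)) p := by
  simp only [pairOp, pairForm, sum_apply, sum_inner, rankOne_apply, inner_smul_left, conj_trivial]
  refine Finset.sum_congr rfl fun i _ => Finset.sum_congr rfl fun i' _ => ?_
  rw [← inner_sub_right, sub_sub_sub_cancel_right, real_inner_comm w, sq]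

theorem inner_sumOp (μ w : Vec d) (p : (Fin q → Vec d) × (Fin q → Vec d)) :
    inner ℝ (sumOp p.1 p.2 w) w = sumForm (fun x => (inner ℝ w (x - μ) : ℝ)) p := by
  simp only [sumOp, sumForm, rankOne_apply, inner_smul_left, conj_trivial]
  rw [real_inner_comm w, ← sq, inner_sum]
  congr 1
  refine Finset.sum_congr rfl fun i _ => ?_
  rw [← inner_sub_right, sub_sub_sub_cancel_right]

theorem rankOne_symm (v x y : Vec d) : inner ℝ (rankOne v x) y = inner ℝ x (rankOne v y) := by
  simp only [rankOne_apply, inner_smul_left, inner_smul_right, conj_trivial]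
  rw [real_inner_comm x v]
  ring

theorem pairOp_symm (p : (Fin q → Vec d) × (Fin q → Vec d)) (x y : Vec d) :
    inner ℝ (pairOp p.1 p.2 x) y = inner ℝ x (pairOp p.1 p.2 y) := by
  simp only [pairOp, sum_apply, sum_inner, inner_sum, rankOne_symm]

theorem covOp_symm (X X' : Fin n → Fin q → Vec d) (x y : Vec d) :
    inner ℝ (covOp X X' x) y = inner ℝ x (covOp X X' y) := by
  simp only [covOp, sum_apply, sum_inner, inner_sum]
  exact Finset.sum_congr rfl fun j _ => pairOp_symm (X j, X' j) x y

theorem gapOp_symm (X X' : Fin n → Fin q → Vec d) (x y : Vec d) :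
    inner ℝ (gapOp X X' x) y = inner ℝ x (gapOp X X' y) := by
  simp only [gapOp, sum_apply, sum_inner, inner_sum]
  refine Finset.sum_congr rfl fun j _ => ?_
  simp only [sub_apply, smul_apply, inner_sub_left, inner_sub_right, inner_smul_left,
    inner_smul_right, conj_trivial, sumOp, rankOne_symm]
  rw [pairOp_symm (X j, X' j)]

theorem inner_covMean {T : Vec d →L[ℝ] Vec d} (hT : ∀ x y, inner ℝ (T x) y = inner ℝ x (T y))
    (e : Vec d) (β : ℝ) (w : Vec d) :
    inner ℝ (covMean q T e β w) w
      = 2 * (q : ℝ) ^ 2 * (‖T w‖ ^ 2 + (β - 1) * (inner ℝ (T w) e : ℝ) ^ 2) := by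
  simp only [covMean, smul_apply, add_apply, mul_apply_eq_comp, inner_smul_left, inner_add_left,
    rankOne_apply, conj_trivial]
  rw [hT (T w) w, real_inner_self_eq_norm_sq, hT e w, real_inner_comm e]
  ring

theorem inner_gapMean {T : Vec d →L[ℝ] Vec d} (hT : ∀ x y, inner ℝ (T x) y = inner ℝ x (T y))
    (k : ℕ) (e : Vec d) (g : ℝ) (w : Vec d) :
    inner ℝ (gapMean q k T e g w) w
      = 2 * k * (q - k) * g ^ 2 * (inner ℝ (T w) e : ℝ) ^ 2 := by
  simp only [gapMean, smul_apply, inner_smul_left, rankOne_apply, conj_trivial]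
  rw [hT e w, real_inner_comm e]
  ring

theorem covMean_symm {T : Vec d →L[ℝ] Vec d} (hT : ∀ x y, inner ℝ (T x) y = inner ℝ x (T y))
    (e : Vec d) (β : ℝ) (x y : Vec d) :
    inner ℝ (covMean q T e β x) y = inner ℝ x (covMean q T e β y) := by
  simp only [covMean, smul_apply, add_apply, mul_apply_eq_comp, inner_smul_left, inner_add_left,
    inner_add_right, inner_smul_right, rankOne_symm, conj_trivial, hT]

theorem gapMean_symm (k : ℕ) (T : Vec d →L[ℝ] Vec d) (e : Vec d) (g : ℝ) (x y : Vec d) :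
    inner ℝ (gapMean q k T e g x) y = inner ℝ x (gapMean q k T e g y) := by
  simp only [gapMean, smul_apply, inner_smul_left, inner_smul_right, rankOne_symm, conj_trivial]

theorem HasClassMoments.memLp {μ : Vec d} {T : Vec d →L[ℝ] Vec d} {e : Vec d} {L a b : ℝ}
    {P : Measure (Vec d)} (h : HasClassMoments μ T e L a b P) (w : Vec d) :
    MemLp (fun x => (inner ℝ w (x - μ) : ℝ)) 2 P :=
  (memLp_two_iff_integrable_sq (by fun_prop)).2 (h.integrable_sq w)

variable {k : ℕ} {μ : Vec d} {T : Vec d →L[ℝ] Vec d} {e : Vec d} {L a₁ b₁ a₀ b₀ β : ℝ}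
  {P₁ P₀ : Measure (Vec d)}

/-- The expectations of the operators, as quadratic forms. The covariances within the classes
cancel in the second one, which leaves a multiple of the projection to the line of `T e`. -/
theorem integral_pairForm_sumForm (hk : k ≤ q) (h₁ : HasClassMoments μ T e L a₁ b₁ P₁)
    (h₀ : HasClassMoments μ T e L a₀ b₀ P₀) (hT : ∀ x y, inner ℝ (T x) y = inner ℝ x (T y))
    (hβ : q ^ 2 * β = q * (k * b₁ + (q - k) * b₀) - (k * a₁ + (q - k) * a₀) ^ 2) (w : Vec d) :
    Integrable (pairForm (fun x => (inner ℝ w (x - μ) : ℝ)))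
      ((bagLaw q k P₁ P₀).prod (bagLaw q k P₁ P₀)) ∧
    Integrable (sumForm (fun x => (inner ℝ w (x - μ) : ℝ)))
      ((bagLaw q k P₁ P₀).prod (bagLaw q k P₁ P₀)) ∧
    ∫ p, pairForm (fun x => (inner ℝ w (x - μ) : ℝ)) p
      ∂((bagLaw q k P₁ P₀).prod (bagLaw q k P₁ P₀)) = inner ℝ (covMean q T e β w) w ∧
    ∫ p, (pairForm (fun x => (inner ℝ w (x - μ) : ℝ)) p
        - q * sumForm (fun x => (inner ℝ w (x - μ) : ℝ)) p)
      ∂((bagLaw q k P₁ P₀).prod (bagLaw q k P₁ P₀)) = inner ℝ (gapMean q k T e (a₁ - a₀) w) w := by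
  have := h₁.isProb
  have := h₀.isProb
  have hmem : ∀ i : Fin q, MemLp (fun x => (inner ℝ w (x - μ) : ℝ)) 2
      (if (i : ℕ) < k then P₁ else P₀) := fun i => by
    split_ifs
    · exact h₁.memLp w
    · exact h₀.memLp w
  obtain ⟨i1, i2, e1, e2⟩ := integral_forms hmem
  have s1 : ∀ i : Fin q, ∫ x, (inner ℝ w (x - μ) : ℝ) ∂(if (i : ℕ) < k then P₁ else P₀)
      = if (i : ℕ) < k then inner ℝ (T w) e * a₁ else inner ℝ (T w) e * a₀ := fun i => by
    split_ifs
    · exact h₁.mean w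
    · exact h₀.mean w
  have s2 : ∀ i : Fin q, ∫ x, (inner ℝ w (x - μ) : ℝ) ^ 2 ∂(if (i : ℕ) < k then P₁ else P₀)
      = if (i : ℕ) < k then ‖T w‖ ^ 2 + (b₁ - 1) * (inner ℝ (T w) e : ℝ) ^ 2
        else ‖T w‖ ^ 2 + (b₀ - 1) * (inner ℝ (T w) e : ℝ) ^ 2 := fun i => by
    split_ifs
    · exact h₁.sq w
    · exact h₀.sq w
  have s3 : ∀ i : Fin q, (if (i : ℕ) < k then (inner ℝ (T w) e : ℝ) * a₁
      else inner ℝ (T w) e * a₀) ^ 2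
      = if (i : ℕ) < k then ((inner ℝ (T w) e : ℝ) * a₁) ^ 2
        else ((inner ℝ (T w) e : ℝ) * a₀) ^ 2 := fun i => by split_ifs <;> rfl
  simp only [s1, s2, s3, Finset.sum_sub_distrib, sum_ite_lt hk] at e1 e2
  refine ⟨i1, i2, ?_, ?_⟩
  · rw [bagLaw, e1, inner_covMean hT]
    linear_combination (-2 * (inner ℝ (T w) e : ℝ) ^ 2) * hβ
  · rw [bagLaw, integral_sub i1 (i2.const_mul _), integral_const_mul, e1, e2, inner_gapMean hT]
    ring

theorem measurable_pairForm {Ω : Type*} [MeasurableSpace Ω] {f : Ω → ℝ} (hf : Measurable f) :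
    Measurable (pairForm (q := q) f) := by
  unfold pairForm; fun_prop

theorem measurable_sumForm {Ω : Type*} [MeasurableSpace Ω] {f : Ω → ℝ} (hf : Measurable f) :
    Measurable (sumForm (q := q) f) := by
  unfold sumForm; fun_prop

/-- The deviation of a quadratic form of the data, for a fixed vector. -/
theorem form_deviation (hq : 0 < q) (h₁ : HasClassMoments μ T e L a₁ b₁ P₁)
    (h₀ : HasClassMoments μ T e L a₀ b₀ P₀) (hL : 0 < L) {w : Vec d} (hw : 0 < ‖T w‖) {K : ℝ}
    (hK : 0 < K) {F : (Fin q → Vec d) × (Fin q → Vec d) → ℝ} (hF : Measurable F)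
    (hFK : ∀ p, |F p| ≤ K * (∑ i, (inner ℝ w (p.1 i - μ) : ℝ) ^ 2
      + ∑ i, (inner ℝ w (p.2 i - μ) : ℝ) ^ 2)) {t : ℝ} (ht0 : 0 ≤ t) (ht : t ≤ 22) (n : ℕ) :
    (Measure.pi fun _ : Fin n => (bagLaw q k P₁ P₀).prod (bagLaw q k P₁ P₀))
      {Z | n * t * (8 * q * K * L * ‖T w‖ ^ 2)
        < |∑ j, F (Z j) - n * ∫ p, F p ∂((bagLaw q k P₁ P₀).prod (bagLaw q k P₁ P₀))|}
      ≤ ENNReal.ofReal (2 * Real.exp (-(n * t ^ 2 / 88))) := by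
  have := h₁.isProb
  have := h₀.isProb
  have hq' : (0 : ℝ) < q := by exact_mod_cast hq
  set c := 8 * q * K * L * ‖T w‖ ^ 2 with hc
  have hc0 : 0 < c := by positivity
  have hexp : ∫⁻ p, ENNReal.ofReal (Real.exp |F p / c|)
      ∂((bagLaw q k P₁ P₀).prod (bagLaw q k P₁ P₀)) ≤ ENNReal.ofReal (Real.exp 1) := by
    refine lintegral_exp_le_of_le_average hq
      (g := fun x => (inner ℝ w (x - μ) : ℝ) ^ 2 / (4 * L * ‖T w‖ ^ 2)) (by fun_prop)
      (fun i => ?_) fun p => ?_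
    · split_ifs
      · exact h₁.exp_sq w
      · exact h₀.exp_sq w
    · rw [abs_div, abs_of_pos hc0, div_le_iff₀ hc0]
      refine (hFK p).trans (le_of_eq ?_)
      rw [← Finset.sum_div, ← Finset.sum_div, hc]
      field_simp
      ring
  refine le_trans (measure_mono fun Z hZ => ?_)
    (sum_deviation (f := fun p => F p / c) (by fun_prop) hexp ht0 ht n)
  simp only [Set.mem_ofPred_eq] at hZ ⊢
  rw [← Finset.sum_div, integral_div, ← mul_div_assoc, ← sub_div, abs_div, abs_of_pos hc0,
    lt_div_iff₀ hc0]
  exact hZ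

/-- Closeness of two operators from closeness of their quadratic forms on a norming set. -/
theorem op_deviation_of_forms {W : Finset (Vec d)} (hW2 : ∀ w ∈ W, ‖w‖ ≤ 2)
    (hW : ∀ T : Vec d →L[ℝ] Vec d, (∀ x y, inner ℝ (T x) y = inner ℝ x (T y)) → ∀ B : ℝ, 0 ≤ B →
      (∀ w ∈ W, |inner ℝ (T w) w| ≤ B) → ‖T‖ ≤ 2 * B) {lam : ℝ} (hlam : ∀ w, ‖T w‖ ^ 2 ≤ lam * ‖w‖ ^ 2)
    (hlam0 : 0 ≤ lam) {c : ℝ} (hc : 0 ≤ c) {A B : Vec d →L[ℝ] Vec d}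
    (hA : ∀ x y, inner ℝ (A x) y = inner ℝ x (A y)) (hB : ∀ x y, inner ℝ (B x) y = inner ℝ x (B y))
    (h : ∀ w ∈ W, w ≠ 0 → |inner ℝ (A w) w - inner ℝ (B w) w| ≤ c * ‖T w‖ ^ 2) :
    ‖A - B‖ ≤ 8 * (c * lam) := by
  have := hW (A - B) (fun x y => by
    rw [sub_apply, sub_apply, inner_sub_left, inner_sub_right, hA, hB]) (c * (lam * 4))
    (by positivity) fun w hw => by
    rcases eq_or_ne w 0 with rfl | h0
    · simp; positivity
    rw [sub_apply, inner_sub_left]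
    have h2 := hW2 w hw
    calc _ ≤ c * ‖T w‖ ^ 2 := h w hw h0
      _ ≤ c * (lam * ‖w‖ ^ 2) := by gcongr; exact hlam w
      _ ≤ c * (lam * 4) := by
        have : ‖w‖ ^ 2 ≤ 4 := by nlinarith [norm_nonneg w]
        gcongr
  linarith

/-- With high probability, the two operators computed from the data are close to their means. -/
theorem operator_concentration (hq : 0 < q) (hk : k ≤ q)
    (h₁ : HasClassMoments μ T e L a₁ b₁ P₁) (h₀ : HasClassMoments μ T e L a₀ b₀ P₀)
    (hL : 0 < L) (hT : ∀ x y, inner ℝ (T x) y = inner ℝ x (T y)) (hTi : ∀ w, w ≠ 0 → 0 < ‖T w‖)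
    {lam : ℝ} (hlam : ∀ w, ‖T w‖ ^ 2 ≤ lam * ‖w‖ ^ 2) (hlam0 : 0 ≤ lam)
    (hβ : q ^ 2 * β = q * (k * b₁ + (q - k) * b₀) - (k * a₁ + (q - k) * a₀) ^ 2)
    {t : ℝ} (ht0 : 0 ≤ t) (ht : t ≤ 22) (n : ℕ) :
    ((Measure.pi fun _ : Fin n => bagLaw q k P₁ P₀).prod
      (Measure.pi fun _ : Fin n => bagLaw q k P₁ P₀))
      {Z | ¬ (‖covOp Z.1 Z.2 - (n : ℝ) • covMean q T e β‖ ≤ n * (128 * t * q ^ 2 * L * lam) ∧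
        ‖gapOp Z.1 Z.2 - (n : ℝ) • gapMean q k T e (a₁ - a₀)‖ ≤ n * (128 * t * q ^ 3 * L * lam))}
      ≤ ENNReal.ofReal (8 * 25 ^ d * Real.exp (-(n * t ^ 2 / 88))) := by
  have := h₁.isProb
  have := h₀.isProb
  have hq' : (0 : ℝ) < q := by exact_mod_cast hq
  have hq1 : (1 : ℝ) ≤ q := by exact_mod_cast hq
  obtain ⟨W, hWc, hW2, hW⟩ := exists_norming_set (E := Vec d)
  rw [finrank_euclideanSpace_fin] at hWc
  set α : Vec d → Vec d → ℝ := fun w x => inner ℝ w (x - μ) with hα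
  have hαm : ∀ w, Measurable (α w) := fun w => by fun_prop
  set F : Vec d → (Fin q → Vec d) × (Fin q → Vec d) → ℝ := fun w => pairForm (α w) with hF
  set G : Vec d → (Fin q → Vec d) × (Fin q → Vec d) → ℝ :=
    fun w p => pairForm (α w) p - q * sumForm (α w) p with hG
  set ν := (bagLaw q k P₁ P₀).prod (bagLaw q k P₁ P₀) with hν
  -- the bad events for the two quadratic forms at the vector `w`
  set b₁ : Vec d → Set (Fin n → (Fin q → Vec d) × (Fin q → Vec d)) := fun w =>
    {Z | n * t * (8 * q * (2 * q) * L * ‖T w‖ ^ 2) < |∑ j, F w (Z j) - n * ∫ p, F w p ∂ν|} with hb1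
  set b₂ : Vec d → Set (Fin n → (Fin q → Vec d) × (Fin q → Vec d)) := fun w =>
    {Z | n * t * (8 * q * (2 * q ^ 2) * L * ‖T w‖ ^ 2) < |∑ j, G w (Z j) - n * ∫ p, G w p ∂ν|}
    with hb2
  have hb₁ : ∀ w, w ≠ 0 → (Measure.pi fun _ : Fin n => ν) (b₁ w)
      ≤ ENNReal.ofReal (2 * Real.exp (-(n * t ^ 2 / 88))) := fun w hw => by
    refine form_deviation hq h₁ h₀ hL (hTi w hw) (K := 2 * q) (by positivity)
      (F := F w) (measurable_pairForm (hαm w)) (fun p => ?_) ht0 ht n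
    rw [abs_of_nonneg (pairForm_nonneg _ _)]
    exact pairForm_le _ _
  have hb₂ : ∀ w, w ≠ 0 → (Measure.pi fun _ : Fin n => ν) (b₂ w)
      ≤ ENNReal.ofReal (2 * Real.exp (-(n * t ^ 2 / 88))) := fun w hw => by
    refine form_deviation hq h₁ h₀ hL (hTi w hw) (K := 2 * q ^ 2) (by positivity)
      (F := G w) ((measurable_pairForm (hαm w)).sub ((measurable_sumForm (hαm w)).const_mul _))
      (fun p => ?_) ht0 ht n
    have p1 := pairForm_le (α w) p
    have p2 := sumForm_le (α w) p
    have p3 := pairForm_nonneg (α w) p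
    have p4 := sumForm_nonneg (α w) p
    have p5 : 0 ≤ ∑ i, α w (p.1 i) ^ 2 + ∑ i, α w (p.2 i) ^ 2 := by positivity
    have p6 : (q : ℝ) * sumForm (α w) p
        ≤ q * (2 * q * (∑ i, α w (p.1 i) ^ 2 + ∑ i, α w (p.2 i) ^ 2)) := by gcongr
    have p7 : 1 * (2 * q * (∑ i, α w (p.1 i) ^ 2 + ∑ i, α w (p.2 i) ^ 2))
        ≤ q * (2 * q * (∑ i, α w (p.1 i) ^ 2 + ∑ i, α w (p.2 i) ^ 2)) := by gcongr
    have p8 : 0 ≤ (q : ℝ) * sumForm (α w) p := by positivity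
    rw [abs_le]
    constructor <;> nlinarith
  have hmp := measurePreserving_arrowProdEquivProdArrow (Fin q → Vec d) (Fin q → Vec d) (Fin n)
    (fun _ => bagLaw q k P₁ P₀) (fun _ => bagLaw q k P₁ P₀)
  set W' := W.filter (· ≠ 0) with hW'
  -- outside the bad events for the vectors of the norming set, both operators are close
  have hsub : {Z : (Fin n → Fin q → Vec d) × (Fin n → Fin q → Vec d) |
      ¬ (‖covOp Z.1 Z.2 - (n : ℝ) • covMean q T e β‖ ≤ n * (128 * t * q ^ 2 * L * lam) ∧
        ‖gapOp Z.1 Z.2 - (n : ℝ) • gapMean q k T e (a₁ - a₀)‖ ≤ n * (128 * t * q ^ 3 * L * lam))}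
      ⊆ (MeasurableEquiv.arrowProdEquivProdArrow (Fin q → Vec d) (Fin q → Vec d) (Fin n)).symm ⁻¹'
        ⋃ w ∈ W', (b₁ w ∪ b₂ w) := by
    intro Z hZ
    by_contra hcon
    apply hZ
    simp only [Set.mem_preimage, Set.mem_iUnion, Set.mem_union, not_exists, not_or] at hcon
    have hI := fun w => integral_pairForm_sumForm hk h₁ h₀ hT hβ w
    have e1 : ∀ w, inner ℝ (covOp Z.1 Z.2 w) w = ∑ j, F w (Z.1 j, Z.2 j) := fun w => by
      rw [covOp, sum_apply, sum_inner]
      exact Finset.sum_congr rfl fun j _ => inner_pairOp μ w (Z.1 j, Z.2 j)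
    have e2 : ∀ w, inner ℝ (gapOp Z.1 Z.2 w) w = ∑ j, G w (Z.1 j, Z.2 j) := fun w => by
      rw [gapOp, sum_apply, sum_inner]
      refine Finset.sum_congr rfl fun j _ => ?_
      rw [sub_apply, smul_apply, inner_sub_left, inner_smul_left, inner_pairOp μ w (Z.1 j, Z.2 j),
        inner_sumOp μ w (Z.1 j, Z.2 j)]
      simp [hG, hα]
    constructor
    · refine (op_deviation_of_forms hW2 hW hlam hlam0 (c := n * t * (8 * q * (2 * q) * L))
        (by positivity) (covOp_symm _ _) (fun x y => ?_) fun w hw h0 => ?_).trans (le_of_eq (by ring))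
      · rw [smul_apply, smul_apply, inner_smul_left, inner_smul_right, covMean_symm hT]
        simp
      · have := (hcon w (Finset.mem_filter.2 ⟨hw, h0⟩)).1
        simp only [hb1, Set.mem_ofPred_eq, not_lt] at this
        rw [e1, smul_apply, inner_smul_left, ← (hI w).2.2.1]
        refine this.trans (le_of_eq (by ring))
    · refine (op_deviation_of_forms hW2 hW hlam hlam0 (c := n * t * (8 * q * (2 * q ^ 2) * L))
        (by positivity) (gapOp_symm _ _) (fun x y => ?_) fun w hw h0 => ?_).trans (le_of_eq (by ring))
      · rw [smul_apply, smul_apply, inner_smul_left, inner_smul_right, gapMean_symm]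
        simp
      · have := (hcon w (Finset.mem_filter.2 ⟨hw, h0⟩)).2
        simp only [hb2, Set.mem_ofPred_eq, not_lt] at this
        rw [e2, smul_apply, inner_smul_left, ← (hI w).2.2.2]
        refine this.trans (le_of_eq (by ring))
  refine (measure_mono hsub).trans ?_
  rw [hmp.symm.measure_preimage_equiv]
  refine (measure_biUnion_finset_le _ _).trans ?_
  calc _ ≤ ∑ _w ∈ W', ENNReal.ofReal (4 * Real.exp (-(n * t ^ 2 / 88))) := by
        refine Finset.sum_le_sum fun w hw => ?_
        have h0 := (Finset.mem_filter.1 hw).2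
        refine (measure_union_le _ _).trans ((add_le_add (hb₁ w h0) (hb₂ w h0)).trans ?_)
        rw [← ENNReal.ofReal_add (by positivity) (by positivity)]
        exact ENNReal.ofReal_le_ofReal (by linarith)
    _ = ENNReal.ofReal (W'.card * (4 * Real.exp (-(n * t ^ 2 / 88)))) := by
        rw [Finset.sum_const, nsmul_eq_mul, ENNReal.ofReal_mul (p := (W'.card : ℝ)) (by positivity),
          ENNReal.ofReal_natCast]
    _ ≤ _ := by
        refine ENNReal.ofReal_le_ofReal ?_
        have hc : (W'.card : ℝ) ≤ 2 * 25 ^ d := by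
          exact_mod_cast (Finset.card_filter_le _ _).trans hWc
        calc _ ≤ 2 * 25 ^ d * (4 * Real.exp (-(n * t ^ 2 / 88))) := by gcongr
          _ = _ := by ring

end

section

/-! ### Recovery of the normal direction -/

variable {d q n : ℕ}

/-- A sum of the operators `v vᵀ` is at most its trace; a form of this bound that suits the Neumann
series. -/
theorem norm_sum_rankOne_sq_le {ι : Type*} [Fintype ι] (v : ι → Vec d) (y : Vec d) :
    ‖(∑ i, rankOne (v i)) y‖ ^ 2
      ≤ (∑ i, ‖v i‖ ^ 2) * inner ℝ ((∑ i, rankOne (v i)) y) y := by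
  have e : inner ℝ ((∑ i, rankOne (v i)) y) y = ∑ i, (inner ℝ (v i) y : ℝ) ^ 2 := by
    simp only [sum_apply, sum_inner, rankOne_apply, inner_smul_left, conj_trivial, sq]
  rw [e]
  have h1 : ‖(∑ i, rankOne (v i)) y‖ ≤ ∑ i, ‖v i‖ * |(inner ℝ (v i) y : ℝ)| := by
    rw [sum_apply]
    refine (norm_sum_le _ _).trans (le_of_eq ?_)
    refine Finset.sum_congr rfl fun i _ => ?_
    rw [rankOne_apply, norm_smul, Real.norm_eq_abs, mul_comm]
  calc _ ≤ (∑ i, ‖v i‖ * |(inner ℝ (v i) y : ℝ)|) ^ 2 := by gcongr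
    _ ≤ (∑ i, ‖v i‖ ^ 2) * ∑ i, |(inner ℝ (v i) y : ℝ)| ^ 2 :=
      Finset.sum_mul_sq_le_sq_mul_sq _ _ _
    _ = _ := by simp only [sq_abs]

/-- The trace of a sum of the operators `v vᵀ` is at most the dimension times the operator norm. -/
theorem sum_norm_sq_le {ι : Type*} [Fintype ι] (v : ι → Vec d) :
    ∑ i, ‖v i‖ ^ 2 ≤ d * ‖∑ i, rankOne (v i)‖ := by
  set b := EuclideanSpace.basisFun (Fin d) ℝ with hb
  have e : ∑ i, ‖v i‖ ^ 2 = ∑ l, inner ℝ ((∑ i, rankOne (v i)) (b l)) (b l) := by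
    simp only [sum_apply, sum_inner, rankOne_apply, inner_smul_left, conj_trivial]
    rw [Finset.sum_comm]
    refine Finset.sum_congr rfl fun i _ => ?_
    rw [← b.sum_sq_inner_left (v i)]
    simp only [sq]
  rw [e]
  calc _ ≤ ∑ _l : Fin d, ‖∑ i, rankOne (v i)‖ := by
        refine Finset.sum_le_sum fun l _ => ?_
        refine (real_inner_le_norm _ _).trans ?_
        have := (∑ i, rankOne (v i)).le_opNorm (b l)
        rw [b.norm_eq_one, mul_one] at *
        exact this
    _ = _ := by simp

theorem covOp_eq_sum (X X' : Fin n → Fin q → Vec d) :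
    covOp X X' = ∑ p : Fin n × Fin q × Fin q, rankOne (X p.1 p.2.1 - X' p.1 p.2.2) := by
  simp only [Fintype.sum_prod_type, covOp, pairOp]

theorem covTrace_eq_sum (X X' : Fin n → Fin q → Vec d) :
    covTrace X X' = ∑ p : Fin n × Fin q × Fin q, ‖X p.1 p.2.1 - X' p.1 p.2.2‖ ^ 2 := by
  simp only [Fintype.sum_prod_type, covTrace]

/-- An upper bound for the mean of `pairOp`, when the variance `β` is at most `K`. -/
theorem norm_covMean_le {T : Vec d →L[ℝ] Vec d} (hT : ∀ x y, inner ℝ (T x) y = inner ℝ x (T y))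
    {e : Vec d} (he : ‖e‖ = 1) {β lam : ℝ} (hlam : ∀ w, ‖T w‖ ^ 2 ≤ lam * ‖w‖ ^ 2)
    (hlam0 : 0 ≤ lam) {K : ℝ} (h1K : 1 ≤ K) (hβ0 : 0 ≤ β) (hβ : β ≤ K) :
    ‖covMean q T e β‖ ≤ 2 * q ^ 2 * (K * lam) := by
  have hTn : ∀ w, ‖T w‖ ≤ √lam * ‖w‖ := fun w => by
    rw [← Real.sqrt_sq (norm_nonneg (T w)), ← Real.sqrt_sq (norm_nonneg w), ← Real.sqrt_mul hlam0]
    exact Real.sqrt_le_sqrt (hlam w)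
  have hs : √lam * √lam = lam := Real.mul_self_sqrt hlam0
  refine ContinuousLinearMap.opNorm_le_bound _ (by positivity) fun w => ?_
  have e1 : covMean q T e β w = (2 * (q : ℝ) ^ 2) • T (T w + ((β - 1) * inner ℝ e (T w)) • e) := by
    simp only [covMean, smul_apply, add_apply, mul_apply_eq_comp, rankOne_apply, map_add, map_smul]
    rw [hT e w, smul_smul]
  have h2 : ‖T w + ((β - 1) * inner ℝ e (T w)) • e‖ ≤ K * ‖T w‖ := by
    -- the component of `T w` along `e` is multiplied by `β`, the rest is unchanged
    have h3 : ‖T w + ((β - 1) * inner ℝ e (T w)) • e‖ ^ 2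
        = (‖T w‖ ^ 2 - (inner ℝ e (T w) : ℝ) ^ 2) + β ^ 2 * (inner ℝ e (T w) : ℝ) ^ 2 := by
      rw [@norm_add_sq ℝ, inner_smul_right, norm_smul, he, real_inner_comm]
      simp only [Real.norm_eq_abs, mul_one, sq_abs, RCLike.re_to_real]
      ring
    have h4 : (inner ℝ e (T w) : ℝ) ^ 2 ≤ ‖T w‖ ^ 2 := by
      have := abs_real_inner_le_norm e (T w)
      rw [he, one_mul] at this
      rw [← sq_abs]
      gcongr
    have h5 : ‖T w + ((β - 1) * inner ℝ e (T w)) • e‖ ^ 2 ≤ (K * ‖T w‖) ^ 2 := by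
      rw [h3, mul_pow]
      have h6 : β ^ 2 ≤ K ^ 2 := by gcongr
      have h7 : 1 ≤ K ^ 2 := by nlinarith
      nlinarith [sq_nonneg (inner ℝ e (T w) : ℝ)]
    exact abs_le_of_sq_le_sq' h5 (by positivity) |>.2
  rw [e1, norm_smul, Real.norm_eq_abs, abs_of_nonneg (by positivity)]
  calc _ ≤ 2 * (q : ℝ) ^ 2 * (√lam * (K * (√lam * ‖w‖))) := by
        gcongr
        exact (hTn _).trans (by gcongr; exact h2.trans (by gcongr; exact hTn w))
    _ = 2 * (q : ℝ) ^ 2 * (K * (√lam * √lam)) * ‖w‖ := by ring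
    _ = _ := by rw [hs]

/-- The mean of `pairOp` is coercive when the variance `β` in the separating direction is bounded
below. -/
theorem le_inner_covMean {T : Vec d →L[ℝ] Vec d}
    (hT : ∀ x y, inner ℝ (T x) y = inner ℝ x (T y)) {e : Vec d} (he : ‖e‖ = 1) {β c l : ℝ}
    (hl : ∀ w, l * ‖w‖ ^ 2 ≤ ‖T w‖ ^ 2) (hc0 : 0 ≤ c) (hc1 : c ≤ 1) (hcβ : c ≤ β) (w : Vec d) :
    2 * q ^ 2 * (c * l) * ‖w‖ ^ 2 ≤ inner ℝ (covMean q T e β w) w := by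
  rw [inner_covMean hT]
  have h4 : (inner ℝ (T w) e : ℝ) ^ 2 ≤ ‖T w‖ ^ 2 := by
    have := abs_real_inner_le_norm (T w) e
    rw [he, mul_one] at this
    rw [← sq_abs]
    gcongr
  have h5 : c * (l * ‖w‖ ^ 2) ≤ c * ‖T w‖ ^ 2 := by gcongr; exact hl w
  have h6 : c * ‖T w‖ ^ 2 ≤ ‖T w‖ ^ 2 + (β - 1) * (inner ℝ (T w) e : ℝ) ^ 2 := by
    nlinarith [sq_nonneg (inner ℝ (T w) e : ℝ)]
  calc _ = 2 * (q : ℝ) ^ 2 * (c * (l * ‖w‖ ^ 2)) := by ring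
    _ ≤ _ := by gcongr; linarith

theorem norm_le_sqrt_mul {T : Vec d →L[ℝ] Vec d} {lam : ℝ} (hlam0 : 0 ≤ lam)
    (hhi : ∀ w, ‖T w‖ ^ 2 ≤ lam * ‖w‖ ^ 2) (w : Vec d) : ‖T w‖ ≤ √lam * ‖w‖ := by
  rw [← Real.sqrt_sq (norm_nonneg (T w)), ← Real.sqrt_sq (norm_nonneg w), ← Real.sqrt_mul hlam0]
  exact Real.sqrt_le_sqrt (hhi w)

theorem sqrt_mul_le_norm {T : Vec d →L[ℝ] Vec d} {l : ℝ} (hl : 0 ≤ l)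
    (hlo : ∀ w, l * ‖w‖ ^ 2 ≤ ‖T w‖ ^ 2) (w : Vec d) : √l * ‖w‖ ≤ ‖T w‖ := by
  rw [← Real.sqrt_sq (norm_nonneg (T w)), ← Real.sqrt_sq (norm_nonneg w), ← Real.sqrt_mul hl]
  exact Real.sqrt_le_sqrt (hlo w)

/-- The power iteration for `gapOp` finds the direction of `T e`. -/
theorem exists_gapOp_pow_near {T : Vec d →L[ℝ] Vec d} {e u : Vec d} {ρ : ℝ}
    (hTe : T e = ρ • u) (hu1 : ‖u‖ = 1) {l : ℝ} (hl : 0 < l) (hlρ : l ≤ ρ ^ 2) {g : ℝ}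
    (hg : 1 / 2 ≤ g) {k : ℕ} (hk0 : 1 ≤ k) (hkq : k + 1 ≤ q) (hn : 0 < n) {η : ℝ} (hη0 : 0 < η)
    (hη : η ≤ 1 / 20) {m : ℕ} (hm : √d ≤ 2 ^ m * η) {X X' : Fin n → Fin q → Vec d}
    (hA : ‖gapOp X X' - (n : ℝ) • gapMean q k T e g‖ ≤ η * (n * (q * l / 4))) :
    ∃ (j : Fin d) (α : ℝ), α ≠ 0 ∧
      ‖(gapOp X X' ^ m) (EuclideanSpace.basisFun (Fin d) ℝ j) - α • u‖ ≤ 6 * η * |α| := by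
  have hn' : (0 : ℝ) < n := by exact_mod_cast hn
  have hk0' : (1 : ℝ) ≤ k := by exact_mod_cast hk0
  have hkq' : (k : ℝ) + 1 ≤ q := by exact_mod_cast hkq
  have hq0 : (0 : ℝ) < q := by linarith
  -- `G` is the nonzero eigenvalue of the mean
  set G : ℝ := n * (2 * k * (q - k) * g ^ 2 * ρ ^ 2) with hG
  have hkk : (q : ℝ) / 2 ≤ k * (q - k) := by nlinarith
  have hgl : 1 / 4 * l ≤ g ^ 2 * ρ ^ 2 := by
    have h1 : (1 / 2 : ℝ) ^ 2 ≤ g ^ 2 := by gcongr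
    calc (1 / 4 : ℝ) * l = (1 / 2) ^ 2 * l := by ring
      _ ≤ _ := by gcongr
  have hGl : n * (q * l / 4) ≤ G := by
    rw [hG]
    refine mul_le_mul_of_nonneg_left ?_ hn'.le
    have h0 : 0 ≤ (k : ℝ) * (q - k) := by linarith
    calc q * l / 4 = 2 * (q / 2) * (1 / 4 * l) := by ring
      _ ≤ 2 * (k * (q - k)) * (g ^ 2 * ρ ^ 2) :=
        mul_le_mul (by linarith) hgl (by positivity) (by linarith)
      _ = _ := by ring
  have hG0 : 0 < G := lt_of_lt_of_le (by positivity) hGl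
  have hgap : ∀ x, ((n : ℝ) • gapMean q k T e g) x = (G * inner ℝ u x) • u := fun x => by
    rw [smul_apply, gapMean, smul_apply, rankOne_apply, hTe, inner_smul_left, smul_smul, smul_smul,
      smul_smul, hG]
    congr 1
    simp only [conj_trivial]
    ring
  refine exists_power_iteration (EuclideanSpace.basisFun (Fin d) ℝ)
    (gapOp_symm X X') hu1 hG0 hη (fun x => ?_) (by simpa using hm)
  rw [← hgap x, ← sub_apply]
  calc _ ≤ ‖gapOp X X' - (n : ℝ) • gapMean q k T e g‖ * ‖x‖ := ContinuousLinearMap.le_opNorm _ _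
    _ ≤ η * G * ‖x‖ := by gcongr; exact hA.trans (by gcongr)

/-- Coercivity passes from the mean to an operator at half the distance. -/
theorem le_inner_covOp {T : Vec d →L[ℝ] Vec d}
    (hT : ∀ x y, inner ℝ (T x) y = inner ℝ x (T y)) {e : Vec d} (he : ‖e‖ = 1) {β l : ℝ}
    (hlo : ∀ w, l * ‖w‖ ^ 2 ≤ ‖T w‖ ^ 2) (hq : 1 < q) (hβ : 1 / (8 * q) ≤ β)
    {X X' : Fin n → Fin q → Vec d}
    (hN : ‖covOp X X' - (n : ℝ) • covMean q T e β‖ ≤ n * (q * l / 8)) (y : Vec d) :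
    n * (q * l / 8) * ‖y‖ ^ 2 ≤ inner ℝ (covOp X X' y) y := by
  have hq' : (1 : ℝ) < q := by exact_mod_cast hq
  have h1 := le_inner_covMean (q := q) hT he (β := β) (c := 1 / (8 * q)) hlo (by positivity)
    (by rw [div_le_one (by positivity)]; linarith) hβ y
  have h2 : |inner ℝ ((covOp X X' - (n : ℝ) • covMean q T e β) y) y| ≤ n * (q * l / 8) * ‖y‖ ^ 2 := by
    refine (abs_real_inner_le_norm _ _).trans ?_
    calc _ ≤ ‖covOp X X' - (n : ℝ) • covMean q T e β‖ * ‖y‖ * ‖y‖ := by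
          gcongr; exact ContinuousLinearMap.le_opNorm _ _
      _ ≤ n * (q * l / 8) * ‖y‖ * ‖y‖ := by gcongr
      _ = _ := by ring
  have h3 := (abs_le.1 h2).1
  rw [sub_apply, inner_sub_left, smul_apply, inner_smul_left] at h3
  simp only [conj_trivial] at h3
  have h4 : (n : ℝ) * (2 * q ^ 2 * (1 / (8 * q) * l) * ‖y‖ ^ 2)
      ≤ n * inner ℝ (covMean q T e β y) y := by gcongr
  have h5 : (n : ℝ) * (2 * q ^ 2 * (1 / (8 * q) * l) * ‖y‖ ^ 2)
      = 2 * (n * (q * l / 8) * ‖y‖ ^ 2) := by field_simp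
  linarith

theorem norm_covOp_sq_le (X X' : Fin n → Fin q → Vec d) (y : Vec d) :
    ‖covOp X X' y‖ ^ 2 ≤ covTrace X X' * inner ℝ (covOp X X' y) y := by
  rw [covTrace_eq_sum, covOp_eq_sum]
  exact norm_sum_rankOne_sq_le _ _

/-- The trace, which the Neumann series is scaled by, is at most `d` times the operator norm. -/
theorem covTrace_le {T : Vec d →L[ℝ] Vec d} (hT : ∀ x y, inner ℝ (T x) y = inner ℝ x (T y))
    {e : Vec d} (he : ‖e‖ = 1) {β lam L : ℝ} (hhi : ∀ w, ‖T w‖ ^ 2 ≤ lam * ‖w‖ ^ 2)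
    (hlam0 : 0 ≤ lam) (hL : 1 ≤ L) (hβ0 : 0 ≤ β) (hβ1 : β ≤ 8 * L) {X X' : Fin n → Fin q → Vec d}
    (hN : ‖covOp X X' - (n : ℝ) • covMean q T e β‖ ≤ n * (q ^ 2 * L * lam)) :
    covTrace X X' ≤ d * (n * (17 * q ^ 2 * L * lam)) := by
  have h1 : covTrace X X' ≤ d * ‖covOp X X'‖ := by
    rw [covTrace_eq_sum, covOp_eq_sum]
    exact sum_norm_sq_le _
  refine h1.trans (mul_le_mul_of_nonneg_left ?_ (Nat.cast_nonneg d))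
  have h2 := norm_covMean_le (q := q) hT he hhi hlam0 (K := 8 * L) (by linarith) hβ0 hβ1
  calc ‖covOp X X'‖ = ‖(covOp X X' - (n : ℝ) • covMean q T e β) + (n : ℝ) • covMean q T e β‖ := by
        rw [sub_add_cancel]
    _ ≤ n * (q ^ 2 * L * lam) + n * (2 * q ^ 2 * (8 * L * lam)) := by
        refine (norm_add_le _ _).trans (add_le_add hN ?_)
        rw [norm_smul, Real.norm_eq_abs, Nat.abs_cast]
        gcongr
    _ = _ := by ring

/-- `r` is, up to a scalar, almost a preimage of the direction of `T e` under `covOp`. -/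
theorem covOp_near {T : Vec d →L[ℝ] Vec d} (hT : ∀ x y, inner ℝ (T x) y = inner ℝ x (T y))
    {e u r : Vec d} (he : ‖e‖ = 1) {ρ s : ℝ} (hρ0 : 0 < ρ) (hs0 : 0 < s) (hTe : T e = ρ • u)
    (hTr : T r = s • e) {l β η : ℝ} (hl : 0 < l) (hβp : 0 < β) (hrl : l * ‖r‖ ≤ s * ρ) (hq : 0 < q)
    (hn : 0 < n) {X X' : Fin n → Fin q → Vec d}
    (hN : ‖covOp X X' - (n : ℝ) • covMean q T e β‖ ≤ η * (n * (2 * q ^ 2 * β * l))) :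
    ‖covOp X X' ((n * (2 * q ^ 2 * β * (s * ρ)) : ℝ)⁻¹ • r) - u‖ ≤ η := by
  have hq0 : (0 : ℝ) < q := by exact_mod_cast hq
  have hn' : (0 : ℝ) < n := by exact_mod_cast hn
  set c : ℝ := n * (2 * q ^ 2 * β * (s * ρ)) with hc
  have hc0 : 0 < c := by positivity
  -- at `r` the rank one correction just rescales: `T r` is parallel to `e`
  have h0 : covMean q T e β r = (2 * q ^ 2 * β * (s * ρ)) • u := by
    rw [covMean, smul_apply, add_apply, smul_apply, mul_apply_eq_comp, rankOne_apply, hT e r, hTr,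
      inner_smul_right, real_inner_self_eq_norm_sq, he, map_smul, hTe]
    module
  have h1 : ((n : ℝ) • covMean q T e β) (c⁻¹ • r) = u := by
    rw [map_smul, smul_apply, h0, smul_smul, smul_smul, mul_assoc, ← hc, inv_mul_cancel₀ hc0.ne', one_smul]
  have h2 : covOp X X' (c⁻¹ • r) - u
      = (covOp X X' - (n : ℝ) • covMean q T e β) (c⁻¹ • r) := by rw [sub_apply, h1]
  have h3 : ‖c⁻¹ • r‖ ≤ (n * (2 * q ^ 2 * β * l))⁻¹ := by
    rw [norm_smul, norm_inv, Real.norm_eq_abs, abs_of_pos hc0, inv_mul_le_iff₀ hc0,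
      ← div_eq_mul_inv, le_div_iff₀ (by positivity), hc]
    calc ‖r‖ * (n * (2 * q ^ 2 * β * l)) = n * (2 * q ^ 2 * β * (l * ‖r‖)) := by ring
      _ ≤ _ := by gcongr
  have h4 : 0 < (n * (2 * q ^ 2 * β * l) : ℝ) := by positivity
  rw [h2]
  calc _ ≤ ‖covOp X X' - (n : ℝ) • covMean q T e β‖ * ‖c⁻¹ • r‖ :=
        ContinuousLinearMap.le_opNorm _ _
    _ ≤ η * (n * (2 * q ^ 2 * β * l)) * (n * (2 * q ^ 2 * β * l))⁻¹ := by
        have := (norm_nonneg _).trans hN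
        gcongr
    _ = η := by field_simp

set_option maxHeartbeats 1600000 in
/-- If the operators computed from the data are close to their means, then one of the vectors
`dirVec` is nearly parallel to `r`. -/
theorem exists_dirVec_near {T : Vec d →L[ℝ] Vec d}
    (hT : ∀ x y, inner ℝ (T x) y = inner ℝ x (T y)) {lam l κ : ℝ}
    (hhi : ∀ w, ‖T w‖ ^ 2 ≤ lam * ‖w‖ ^ 2) (hlo : ∀ w, l * ‖w‖ ^ 2 ≤ ‖T w‖ ^ 2) (hl : 0 < l)
    (hκ : lam = κ * l) (hκ1 : 1 ≤ κ) {r e : Vec d} (he1 : ‖e‖ = 1) (hTr0 : T r ≠ 0)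
    (hTr : T r = ‖T r‖ • e)
    {L β g t : ℝ} (hL : 1 ≤ L) (hβ0 : 1 / (8 * q) ≤ β) (hβ1 : β ≤ 8 * L) (hg : 1 / 2 ≤ g)
    {k : ℕ} (hk0 : 1 ≤ k) (hkq : k + 1 ≤ q) (hn : 0 < n) (ht : 0 < t)
    (hη : 512 * t * q ^ 2 * L * κ ≤ 1 / 20) {m : ℕ}
    (hm1 : √d ≤ 2 ^ m * (512 * t * q ^ 2 * L * κ))
    (hm2 : Real.exp (-(m / (136 * d * q * L * κ))) ≤ (3 * (512 * t * q ^ 2 * L * κ)) ^ 2)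
    {X X' : Fin n → Fin q → Vec d}
    (hN : ‖covOp X X' - (n : ℝ) • covMean q T e β‖ ≤ n * (128 * t * q ^ 2 * L * lam))
    (hA : ‖gapOp X X' - (n : ℝ) • gapMean q k T e g‖ ≤ n * (128 * t * q ^ 3 * L * lam)) :
    ∃ (j : Fin d) (a : ℝ), a ≠ 0 ∧
      ‖T (dirVec m X X' j - a • r)‖ ≤ 2 ^ 20 * t * q ^ 3 * L ^ 2 * κ ^ 2 * (|a| * ‖T r‖) := by
  have hq : 1 < q := by omega
  have hq' : (1 : ℝ) < q := by exact_mod_cast hq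
  have hq0 : (0 : ℝ) < q := by linarith
  have hn' : (0 : ℝ) < n := by exact_mod_cast hn
  have hL0 : 0 < L := by linarith
  have hκ0 : 0 < κ := by linarith
  have hlam0 : 0 < lam := by rw [hκ]; positivity
  have hβp : 0 < β := lt_of_lt_of_le (by positivity) hβ0
  have hsl2 : √l * √l = l := Real.mul_self_sqrt hl.le
  have hslam2 : √lam * √lam = lam := Real.mul_self_sqrt hlam0.le
  have hs0 : 0 < ‖T r‖ := norm_pos_iff.2 hTr0
  have hrl := sqrt_mul_le_norm hl.le hlo r
  generalize ‖T r‖ = s at *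
  have hρl : √l ≤ ‖T e‖ := by simpa [he1] using sqrt_mul_le_norm hl.le hlo e
  have hρu : ‖T e‖ ≤ √lam := by simpa [he1] using norm_le_sqrt_mul hlam0.le hhi e
  have hρ0 : 0 < ‖T e‖ := (Real.sqrt_pos.2 hl).trans_le hρl
  obtain ⟨u, hu1, hTe⟩ : ∃ u : Vec d, ‖u‖ = 1 ∧ T e = ‖T e‖ • u :=
    ⟨‖T e‖⁻¹ • T e, norm_smul_inv_norm (norm_pos_iff.1 hρ0),
      by rw [smul_smul, mul_inv_cancel₀ hρ0.ne', one_smul]⟩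
  generalize ‖T e‖ = ρ at *
  -- the relative error of both operators
  obtain ⟨η, hηd⟩ : ∃ η, η = 512 * t * q ^ 2 * L * κ := ⟨_, rfl⟩
  rw [← hηd] at hη hm1 hm2
  have hη0 : 0 < η := by rw [hηd]; positivity
  obtain ⟨j, α, hα, hj⟩ := exists_gapOp_pow_near hTe hu1 hl
    (by rw [← hsl2, sq]; gcongr) hg hk0 hkq hn hη0 hη hm1
    (hA.trans (le_of_eq (by rw [hηd, hκ]; ring)))
  have htq : 1024 * t * q * L * κ ≤ 1 := by
    have h2 : 1024 * t * q * L * κ * 1 ≤ 1024 * t * q * L * κ * q := by gcongr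
    have h3 : 1024 * t * q * L * κ * q = 2 * η := by rw [hηd]; ring
    linarith
  -- the bound for `covOp` in the three forms that coercivity, trace and solution need
  have hN1 : ‖covOp X X' - (n : ℝ) • covMean q T e β‖ ≤ n * (q * l / 8) := by
    refine hN.trans (mul_le_mul_of_nonneg_left ?_ hn'.le)
    calc 128 * t * q ^ 2 * L * lam = (1024 * t * q * L * κ) * (q * l / 8) := by rw [hκ]; ring
      _ ≤ 1 * (q * l / 8) := by gcongr
      _ = _ := one_mul _
  have hN2 : ‖covOp X X' - (n : ℝ) • covMean q T e β‖ ≤ n * (q ^ 2 * L * lam) := by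
    refine hN1.trans (mul_le_mul_of_nonneg_left ?_ hn'.le)
    have h1 : 1 ≤ q * L * κ := by
      have : 1 ≤ (q : ℝ) * L := by nlinarith
      nlinarith
    calc q * l / 8 ≤ q * l * 1 := by
          have : 0 < q * l := by positivity
          linarith
      _ ≤ q * l * (q * L * κ) := by gcongr
      _ = _ := by rw [hκ]; ring
  have hN3 : ‖covOp X X' - (n : ℝ) • covMean q T e β‖ ≤ η * (n * (2 * q ^ 2 * β * l)) := by
    refine hN.trans ?_
    calc n * (128 * t * q ^ 2 * L * lam)
        = 512 * t * q * 1 * L * κ * (n * (2 * q ^ 2 * (1 / (8 * q)) * l)) := by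
          rw [hκ]; field_simp; norm_num
      _ ≤ 512 * t * q * q * L * κ * (n * (2 * q ^ 2 * β * l)) := by gcongr
      _ = _ := by rw [hηd]; ring
  have hco := le_inner_covOp hT he1 hlo hq hβ0 hN1
  have htru := covTrace_le hT he1 hhi hlam0.le hL hβp.le hβ1 hN2
  have hgram := norm_covOp_sq_le X X'
  have hNr := covOp_near hT he1 hρ0 hs0 hTe hTr hl hβp (by
    calc l * ‖r‖ = √l * ‖r‖ * √l := by rw [mul_right_comm, hsl2]
      _ ≤ s * ρ := by gcongr) (by omega) hn hN3
  -- `lamN` is the coercivity constant of `covOp`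
  generalize htrd : covTrace X X' = tr at *
  obtain ⟨lamN, hlamN⟩ : ∃ lamN : ℝ, lamN = n * (q * l / 8) := ⟨_, rfl⟩
  rw [← hlamN] at hco
  have hlamN0 : 0 < lamN := by rw [hlamN]; positivity
  have htr0 : 0 < tr := by
    have h1 := hco u
    have h2 := hgram u
    rw [hu1] at h1
    have h3 : 0 < inner ℝ (covOp X X' u) u := lt_of_lt_of_le (by positivity) h1
    have h4 : covOp X X' u ≠ 0 := fun h => by rw [h] at h3; simp at h3
    have h5 : 0 < ‖covOp X X' u‖ ^ 2 := by positivity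
    by_contra hcon
    nlinarith
  -- `covOp` maps `r / c` nearly to `u`
  obtain ⟨c, hc⟩ : ∃ c : ℝ, c = n * (2 * q ^ 2 * β * (s * ρ)) := ⟨_, rfl⟩
  rw [← hc] at hNr
  have hc0 : 0 < c := by rw [hc]; positivity
  have hd0 : (0 : ℝ) < d := by exact_mod_cast (Fin.pos j)
  have hexp : Real.exp (-(m * (lamN / tr))) ≤ (6 * η / 2) ^ 2 := by
    have h1 : 1 / (136 * d * q * L * κ) ≤ lamN / tr := by
      rw [div_le_div_iff₀ (by positivity) htr0, one_mul]
      refine htru.trans (le_of_eq ?_)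
      rw [hlamN, hκ]
      ring
    calc _ ≤ Real.exp (-(m / (136 * d * q * L * κ))) := by
          apply Real.exp_le_exp.2
          rw [neg_le_neg_iff, div_eq_mul_one_div]
          gcongr
      _ ≤ _ := hm2.trans (le_of_eq (by ring))
  have key := neumann_approx htr0 hlamN0 hco hgram hu1 (α := α) (η₁ := 6 * η) (by linarith) hj
    hNr hexp
  -- the multiple of `r` that the Neumann series approximates
  refine ⟨j, tr * α * c⁻¹, by positivity, ?_⟩
  have e1 : (tr * α * c⁻¹) • r = (tr * α) • (c⁻¹ • r) := mul_smul _ _ _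
  have e2 : √lam * (n * (2 * q ^ 2 * (8 * L) * √lam) * (13 * η / lamN))
      = 13 * 2 ^ 16 * t * q ^ 3 * L ^ 2 * κ ^ 2 := by
    calc _ = (√lam * √lam) * (n * (2 * q ^ 2 * (8 * L)) * (13 * η / lamN)) := by ring
      _ = _ := by
        rw [hslam2, hηd, hlamN, hκ]
        field_simp
        norm_num
  rw [dirVec, ← EuclideanSpace.basisFun_apply, e1]
  rw [htrd]
  refine (norm_le_sqrt_mul hlam0.le hhi _).trans ?_
  calc _ ≤ √lam * (|tr * α| * ((2 * (6 * η) + η) / lamN)) :=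
        mul_le_mul_of_nonneg_left key (Real.sqrt_nonneg _)
    _ = |tr * α * c⁻¹| * s * (√lam * (n * (2 * q ^ 2 * β * ρ) * (13 * η / lamN))) := by
        rw [abs_mul _ c⁻¹, abs_inv, abs_of_pos hc0, hc]
        field_simp
        ring
    _ ≤ |tr * α * c⁻¹| * s * (√lam * (n * (2 * q ^ 2 * (8 * L) * √lam) * (13 * η / lamN))) := by
        gcongr
    _ = |tr * α * c⁻¹| * s * (13 * 2 ^ 16 * t * q ^ 3 * L ^ 2 * κ ^ 2) := by rw [e2]
    _ ≤ |tr * α * c⁻¹| * s * (2 ^ 4 * 2 ^ 16 * t * q ^ 3 * L ^ 2 * κ ^ 2) := by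
        gcongr
        norm_num
    _ = _ := by ring

end

/-! ### The error of a hypothesis and the counts in the bags -/

section

variable {d q k : ℕ}

/-- The expectation of `(N - k) ^ 2`, where `N` is the number of positively classified vectors in a
bag, and `y₁`, `y₀` are the probabilities that a vector of either class is positively classified. -/
def countErr (q k : ℕ) (y₁ y₀ : ℝ) : ℝ :=
  k * (y₁ * (1 - y₁)) + (q - k) * (y₀ * (1 - y₀)) + (k * y₁ + (q - k) * y₀ - k) ^ 2

/-- Few expected misclassified vectors in a bag make the expectation of `(N - k) ^ 2` small. -/
theorem countErr_le (hkq : k ≤ q) {y₁ y₀ : ℝ} (h₁' : y₁ ≤ 1) (h₀ : 0 ≤ y₀)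
    {ζ : ℝ} (hζ : ζ ≤ 1) (h : k * (1 - y₁) + (q - k) * y₀ ≤ ζ) : countErr q k y₁ y₀ ≤ 2 * ζ := by
  have hk : (0 : ℝ) ≤ k := Nat.cast_nonneg k
  have hkq' : (k : ℝ) ≤ q := by exact_mod_cast hkq
  unfold countErr
  set A := k * (1 - y₁) with hA
  set B := (q - k) * y₀ with hB
  have hA0 : 0 ≤ A := mul_nonneg hk (by linarith)
  have hB0 : 0 ≤ B := mul_nonneg (by linarith) h₀
  have e1 : k * (y₁ * (1 - y₁)) ≤ A := by
    calc k * (y₁ * (1 - y₁)) = y₁ * A := by rw [hA]; ring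
      _ ≤ 1 * A := by gcongr
      _ = A := one_mul _
  have e2 : (q - k) * (y₀ * (1 - y₀)) ≤ B := by
    calc (q - k) * (y₀ * (1 - y₀)) = B - B * y₀ := by rw [hB]; ring
      _ ≤ B := by nlinarith
  have e3 : k * y₁ + (q - k) * y₀ - k = B - A := by rw [hA, hB]; ring
  rw [e3]
  have e4 : (B - A) ^ 2 ≤ (A + B) ^ 2 := by nlinarith
  nlinarith

/-- If the count error is small, the hypothesis is right on both classes, or wrong on both; the latter
is possible for balanced bags only. -/
theorem small_of_countErr (hk : 1 ≤ k) (hkq : k + 1 ≤ q) {y₁ y₀ : ℝ} (h₁ : 0 ≤ y₁) (h₁' : y₁ ≤ 1)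
    (h₀ : 0 ≤ y₀) (h₀' : y₀ ≤ 1) {ζ : ℝ} (hζ : ζ ≤ 1 / 64) (h : countErr q k y₁ y₀ ≤ ζ) :
    (1 - y₁ ≤ 2 * ζ ∧ y₀ ≤ 2 * ζ) ∨ (2 * k = q ∧ y₁ ≤ 2 * ζ ∧ 1 - y₀ ≤ 2 * ζ) := by
  have hk' : (1 : ℝ) ≤ k := by exact_mod_cast hk
  have hkq' : (k : ℝ) + 1 ≤ q := by exact_mod_cast hkq
  unfold countErr at h
  set K : ℝ := (k : ℝ) with hK
  obtain ⟨Z, hZ⟩ : ∃ Z : ℝ, Z = q - K := ⟨_, rfl⟩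
  have hZ1 : 1 ≤ Z := by linarith
  rw [← hZ] at h
  have p1 : 0 ≤ y₁ * (1 - y₁) := mul_nonneg h₁ (by linarith)
  have p0 : 0 ≤ y₀ * (1 - y₀) := mul_nonneg h₀ (by linarith)
  have q1 : 0 ≤ K * (y₁ * (1 - y₁)) := by positivity
  have q0 : 0 ≤ Z * (y₀ * (1 - y₀)) := by positivity
  have hs := sq_nonneg (K * y₁ + Z * y₀ - K)
  have a1 : K * (y₁ * (1 - y₁)) ≤ ζ := by linarith
  have a0 : Z * (y₀ * (1 - y₀)) ≤ ζ := by linarith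
  have as : (K * y₁ + Z * y₀ - K) ^ 2 ≤ (1 / 8) ^ 2 := by linarith
  have ab := abs_le_of_sq_le_sq' as (by norm_num)
  -- small variances force both probabilities near `0` or `1`
  have c1 : K * y₁ ≤ 2 * ζ ∨ K * (1 - y₁) ≤ 2 * ζ := by
    rcases le_total y₁ (1 / 2) with hy | hy
    · left; nlinarith
    · right; nlinarith
  have c0 : Z * y₀ ≤ 2 * ζ ∨ Z * (1 - y₀) ≤ 2 * ζ := by
    rcases le_total y₀ (1 / 2) with hy | hy
    · left; nlinarith
    · right; nlinarith
  have u1 := le_mul_of_one_le_left h₁ hk'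
  have u2 := le_mul_of_one_le_left (sub_nonneg.2 h₁') hk'
  have v1 := le_mul_of_one_le_left h₀ hZ1
  have v2 := le_mul_of_one_le_left (sub_nonneg.2 h₀') hZ1
  rw [mul_one_sub] at c1 u2 c0 v2
  -- the mean count must be close to `k`, which excludes a nearly constant hypothesis, and excludes a
  -- reversed one unless `k = q - k`
  rcases c1 with c1 | c1 <;> rcases c0 with c0 | c0
  · exfalso; linarith [ab.1, ab.2]
  · right
    refine ⟨?_, by linarith, by linarith⟩
    have e1 : K - Z < 1 := by linarith [ab.1, ab.2]
    have e2 : Z - K < 1 := by linarith [ab.1, ab.2]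
    have e3 : 2 * (k : ℝ) < q + 1 := by linarith
    have e4 : (q : ℝ) < 2 * k + 1 := by linarith
    have e5 : 2 * k < q + 1 := by exact_mod_cast e3
    have e6 : q < 2 * k + 1 := by exact_mod_cast e4
    omega
  · left
    exact ⟨by linarith, by linarith⟩
  · exfalso; linarith [ab.1, ab.2]

theorem measurable_pos : Measurable pos := by
  unfold pos
  exact Measurable.ite measurableSet_Ioi measurable_const measurable_const

theorem measurable_ltf (r : Vec d) (c : ℝ) : Measurable (ltf r c) :=
  measurable_pos.comp (by fun_prop)

theorem measurableSet_ltf (r : Vec d) (c : ℝ) (b : Fin 2) : MeasurableSet {x | ltf r c x = b} :=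
  measurable_ltf r c (measurableSet_singleton b)

theorem fin_two_ne_one {b : Fin 2} : b ≠ 1 ↔ b = 0 := by omega

/-- The indicator of the positively classified vectors. -/
def posInd (r : Vec d) (c : ℝ) (x : Vec d) : ℝ := if ltf r c x = 1 then 1 else 0

theorem posInd_eq (r : Vec d) (c : ℝ) :
    posInd r c = Set.indicator {x | ltf r c x = 1} fun _ => (1 : ℝ) := by
  funext x
  simp [posInd, Set.indicator]

theorem measurable_posInd (r : Vec d) (c : ℝ) : Measurable (posInd r c) := by
  rw [posInd_eq]
  exact measurable_const.indicator (measurableSet_ltf r c 1)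

theorem posInd_mem (r : Vec d) (c : ℝ) (x : Vec d) : 0 ≤ posInd r c x ∧ posInd r c x ≤ 1 := by
  unfold posInd; split_ifs <;> norm_num

theorem posCount_eq (r : Vec d) (c : ℝ) (x : Fin q → Vec d) :
    posCount r c x = ∑ i, posInd r c (x i) := rfl

theorem posCount_mem (r : Vec d) (c : ℝ) (x : Fin q → Vec d) :
    0 ≤ posCount r c x ∧ posCount r c x ≤ q := by
  rw [posCount_eq]
  refine ⟨Finset.sum_nonneg fun i _ => (posInd_mem r c _).1, ?_⟩
  refine (Finset.sum_le_sum fun i _ => (posInd_mem r c (x i)).2).trans (le_of_eq ?_)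
  simp

variable {P₁ P₀ : Measure (Vec d)} [IsProbabilityMeasure P₁] [IsProbabilityMeasure P₀]

theorem memLp_posInd (P : Measure (Vec d)) [IsProbabilityMeasure P] (r : Vec d) (c : ℝ) :
    MemLp (posInd r c) 2 P :=
  MemLp.of_bound (measurable_posInd r c).aestronglyMeasurable 1 (ae_of_all _ fun x => by
    rw [Real.norm_eq_abs, abs_of_nonneg (posInd_mem r c x).1]
    exact (posInd_mem r c x).2)

theorem integral_posInd (P : Measure (Vec d)) (r : Vec d) (c : ℝ) :
    ∫ x, posInd r c x ∂P = P.real {x | ltf r c x = 1} := by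
  rw [posInd_eq, integral_indicator (measurableSet_ltf r c 1)]
  simp

theorem integral_posInd_sq (P : Measure (Vec d)) (r : Vec d) (c : ℝ) :
    ∫ x, posInd r c x ^ 2 ∂P = P.real {x | ltf r c x = 1} := by
  rw [← integral_posInd]
  refine integral_congr_ae (ae_of_all _ fun x => ?_)
  simp only [posInd]
  split_ifs <;> norm_num

/-- The expected contribution of a bag to the score. -/
theorem integral_posCount (hk : k ≤ q) (r : Vec d) (c : ℝ) :
    ∫ x, (posCount r c x ^ 2 - 2 * k * posCount r c x) ∂(bagLaw q k P₁ P₀)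
      = countErr q k (P₁.real {x | ltf r c x = 1}) (P₀.real {x | ltf r c x = 1}) - k ^ 2 := by
  have hmem : ∀ i : Fin q, MemLp (posInd r c) 2 (if (i : ℕ) < k then P₁ else P₀) := fun i =>
    memLp_posInd _ r c
  have hs := memLp_sum_eval hmem
  have s1 : ∀ i : Fin q, ∫ x, posInd r c x ∂(if (i : ℕ) < k then P₁ else P₀)
      = if (i : ℕ) < k then P₁.real {x | ltf r c x = 1} else P₀.real {x | ltf r c x = 1} :=
    fun i => by split_ifs <;> exact integral_posInd _ r c
  have s2 : ∀ i : Fin q, ∫ x, posInd r c x ^ 2 ∂(if (i : ℕ) < k then P₁ else P₀)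
      = if (i : ℕ) < k then P₁.real {x | ltf r c x = 1} else P₀.real {x | ltf r c x = 1} :=
    fun i => by split_ifs <;> exact integral_posInd_sq _ r c
  have s3 : ∀ i : Fin q, (if (i : ℕ) < k then P₁.real {x | ltf r c x = 1}
      else P₀.real {x | ltf r c x = 1}) ^ 2
      = if (i : ℕ) < k then P₁.real {x | ltf r c x = 1} ^ 2
        else P₀.real {x | ltf r c x = 1} ^ 2 := fun i => by split_ifs <;> rfl
  have e1 := integral_sum_eval fun i => (hmem i).integrable one_le_two
  have e2 := integral_sum_eval_sq hmem
  simp only [s1, s2, s3, Finset.sum_sub_distrib, sum_ite_lt hk] at e1 e2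
  simp only [posCount_eq]
  rw [bagLaw, integral_sub hs.integrable_sq ((hs.integrable one_le_two).const_mul _),
    integral_const_mul, e1, e2, countErr]
  ring

theorem measurable_posCount (r : Vec d) (c : ℝ) : Measurable (posCount (q := q) r c) := by
  have := measurable_posInd r c
  have e : posCount (q := q) r c = fun x => ∑ i, posInd r c (x i) := rfl
  rw [e]
  fun_prop

/-- The score of a fixed hypothesis concentrates around its count error. -/
theorem score_deviation (hq : 0 < q) (hk : k ≤ q) (r : Vec d) (c : ℝ) {t : ℝ} (ht0 : 0 ≤ t)
    (ht : t ≤ 22) (n : ℕ) :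
    (Measure.pi fun _ : Fin n => bagLaw q k P₁ P₀)
      {X | n * (t * q ^ 2) < |score k r c X - n * (countErr q k (P₁.real {x | ltf r c x = 1})
        (P₀.real {x | ltf r c x = 1}) - k ^ 2)|}
      ≤ ENNReal.ofReal (2 * Real.exp (-(n * t ^ 2 / 88))) := by
  have hq' : (0 : ℝ) < q := by exact_mod_cast hq
  have hk' : (k : ℝ) ≤ q := by exact_mod_cast hk
  have hk0 : (0 : ℝ) ≤ k := Nat.cast_nonneg k
  set F : (Fin q → Vec d) → ℝ := fun x => (posCount r c x ^ 2 - 2 * k * posCount r c x) / q ^ 2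
    with hF
  have hm := measurable_posCount (q := q) r c
  have hFm : Measurable F := by fun_prop
  have hF1 : ∀ x, |F x| ≤ 1 := fun x => by
    obtain ⟨h0, h1⟩ := posCount_mem r c x
    rw [hF]
    simp only
    rw [abs_div, abs_of_pos (by positivity : (0 : ℝ) < (q : ℝ) ^ 2), div_le_one (by positivity),
      abs_le]
    constructor <;> nlinarith
  have hexp : ∫⁻ x, ENNReal.ofReal (Real.exp |F x|) ∂(bagLaw q k P₁ P₀)
      ≤ ENNReal.ofReal (Real.exp 1) := by
    refine (lintegral_mono fun x => ENNReal.ofReal_le_ofReal (Real.exp_le_exp.2 (hF1 x))).trans ?_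
    simp
  refine le_trans (measure_mono fun X hX => ?_) (sum_deviation hFm hexp ht0 ht n)
  simp only [Set.mem_ofPred_eq] at hX ⊢
  rw [hF, integral_div, integral_posCount hk, ← Finset.sum_div, ← mul_div_assoc, ← sub_div, abs_div,
    abs_of_pos (by positivity : (0 : ℝ) < (q : ℝ) ^ 2), lt_div_iff₀ (by positivity), mul_assoc]
  exact hX

end

/-! ### Data points near the right threshold -/

section

theorem continuous_cdf {ν : Measure ℝ} [IsProbabilityMeasure ν] [NullSingletonClass ν] :
    Continuous (cdf ν) := by
  rw [continuous_iff_continuousAt]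
  intro x
  rw [(monotone_cdf ν).continuousAt_iff_leftLim_eq_rightLim, (cdf ν).rightLim_eq]
  have h := (cdf ν).measure_singleton x
  rw [measure_cdf, measure_singleton] at h
  have h2 := ENNReal.ofReal_eq_zero.1 h.symm
  exact le_antisymm ((monotone_cdf ν).leftLim_le le_rfl) (by linarith)

theorem measureReal_Ioc {ν : Measure ℝ} [IsProbabilityMeasure ν] {a b : ℝ} (h : a ≤ b) :
    ν.real (Set.Ioc a b) = cdf ν b - cdf ν a := by
  rw [cdf_eq_real, cdf_eq_real, ← Set.Iic_union_Ioc_eq_Iic h,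
    measureReal_union (Set.Iic_disjoint_Ioc le_rfl) measurableSet_Ioc]
  ring

/-- For a mixture of two atomless laws, the points that are separated from `θ` by mass at most `ζ`
have themselves mass at least `ζ`. -/
theorem le_mass_near {ν₁ ν₀ : Measure ℝ} [IsProbabilityMeasure ν₁] [IsProbabilityMeasure ν₀]
    [NullSingletonClass ν₁] [NullSingletonClass ν₀] {a b : ℝ} (ha : 0 ≤ a) (hb : 0 ≤ b) (θ : ℝ)
    {ζ : ℝ} (hζ : 0 < ζ) (hζ' : 2 * ζ < a + b) :
    ζ ≤ a * ν₁.real {y | |(a * cdf ν₁ y + b * cdf ν₀ y) - (a * cdf ν₁ θ + b * cdf ν₀ θ)| ≤ ζ}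
      + b * ν₀.real {y | |(a * cdf ν₁ y + b * cdf ν₀ y) - (a * cdf ν₁ θ + b * cdf ν₀ θ)| ≤ ζ} := by
  set G : ℝ → ℝ := fun y => a * cdf ν₁ y + b * cdf ν₀ y with hG
  have hc : Continuous G := by
    have h1 := continuous_cdf (ν := ν₁)
    have h0 := continuous_cdf (ν := ν₀)
    fun_prop
  have hmono : Monotone G := fun x y h => by
    have h1 := monotone_cdf ν₁ h
    have h0 := monotone_cdf ν₀ h
    simp only [hG]
    gcongr
  have hbot : Filter.Tendsto G Filter.atBot (nhds 0) := by
    have := ((tendsto_cdf_atBot ν₁).const_mul a).add ((tendsto_cdf_atBot ν₀).const_mul b)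
    simpa using this
  have htop : Filter.Tendsto G Filter.atTop (nhds (a + b)) := by
    have := ((tendsto_cdf_atTop ν₁).const_mul a).add ((tendsto_cdf_atTop ν₀).const_mul b)
    simpa using this
  -- an interval of `G`-length `ζ` that starts or ends at `θ` suffices
  have key : ∀ x y, x ≤ y → G y - G x = ζ → (x = θ ∨ y = θ) →
      ζ ≤ a * ν₁.real {y | |G y - G θ| ≤ ζ} + b * ν₀.real {y | |G y - G θ| ≤ ζ} := by
    intro x y hxy hG2 hθ
    have hsub : Set.Ioc x y ⊆ {y | |G y - G θ| ≤ ζ} := fun z hz => by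
      have h1 := hmono hz.1.le
      have h2 := hmono hz.2
      rw [Set.mem_ofPred_eq, abs_le]
      rcases hθ with rfl | rfl <;> constructor <;> linarith
    calc ζ = a * ν₁.real (Set.Ioc x y) + b * ν₀.real (Set.Ioc x y) := by
          rw [measureReal_Ioc hxy, measureReal_Ioc hxy, ← hG2]
          simp only [hG]
          ring
      _ ≤ _ := by
          have h1 := measureReal_mono (μ := ν₁) hsub
          have h0 := measureReal_mono (μ := ν₀) hsub
          gcongr
  -- as the total mass exceeds `2 ζ`, there is room for such an interval above or below `θ`
  rcases lt_or_ge (G θ + ζ) (a + b) with h | h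
  · obtain ⟨y₁, hy₁⟩ := (htop.eventually (lt_mem_nhds h)).exists
    have hle : θ ≤ y₁ := by
      by_contra hcon
      have := hmono (not_le.1 hcon).le
      linarith
    obtain ⟨y, hy, hyG⟩ := intermediate_value_Icc hle hc.continuousOn
      ⟨by linarith, hy₁.le⟩
    exact key θ y hy.1 (by linarith) (Or.inl rfl)
  · obtain ⟨y₁, hy₁⟩ := (hbot.eventually (gt_mem_nhds (by linarith : 0 < G θ - ζ))).exists
    have hle : y₁ ≤ θ := by
      by_contra hcon
      have := hmono (not_le.1 hcon).le
      linarith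
    obtain ⟨y, hy, hyG⟩ := intermediate_value_Icc hle hc.continuousOn
      ⟨hy₁.le, by linarith⟩
    exact key y θ hy.2 (by linarith) (Or.inr rfl)

/-- If a bag is expected to contain at least `z` vectors of a set, then all of `n` bags miss the set
with probability at most `exp (- n z)`. -/
theorem miss_le {Ω : Type*} [MeasurableSpace Ω] {P₁ P₀ : Measure Ω} [IsProbabilityMeasure P₁]
    [IsProbabilityMeasure P₀] {q k : ℕ} (hk : k ≤ q) {A : Set Ω} (hA : MeasurableSet A) {z : ℝ}
    (hz : z ≤ k * P₁.real A + (q - k) * P₀.real A) (n : ℕ) :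
    (Measure.pi fun _ : Fin n => bagLaw q k P₁ P₀) {X | ∀ b i, X b i ∉ A}
      ≤ ENNReal.ofReal (Real.exp (-(n * z))) := by
  have hset : {X : Fin n → Fin q → Ω | ∀ b i, X b i ∉ A}
      = Set.univ.pi fun _ : Fin n => (Set.univ.pi fun _ : Fin q => Aᶜ) := by
    ext X; simp
  have hP : ∀ (P : Measure Ω) [IsProbabilityMeasure P],
      P Aᶜ ≤ ENNReal.ofReal (Real.exp (-P.real A)) := fun P _ => by
    rw [← ENNReal.ofReal_toReal (measure_ne_top P Aᶜ), ← measureReal_def]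
    refine ENNReal.ofReal_le_ofReal ?_
    rw [probReal_compl_eq_one_sub hA]
    linarith [Real.add_one_le_exp (-P.real A)]
  have hbag : bagLaw q k P₁ P₀ (Set.univ.pi fun _ : Fin q => Aᶜ)
      ≤ ENNReal.ofReal (Real.exp (-z)) := by
    rw [bagLaw, Measure.pi_pi]
    calc _ ≤ ∏ i : Fin q, ENNReal.ofReal (Real.exp (if (i : ℕ) < k then -P₁.real A
          else -P₀.real A)) := by
          refine Finset.prod_le_prod' fun i _ => ?_
          split_ifs <;> exact hP _
      _ = ENNReal.ofReal (Real.exp (k * -P₁.real A + (q - k) * -P₀.real A)) := by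
          rw [← ENNReal.ofReal_prod_of_nonneg fun _ _ => (Real.exp_pos _).le, ← Real.exp_sum,
            sum_ite_lt hk]
      _ ≤ _ := by
          refine ENNReal.ofReal_le_ofReal (Real.exp_le_exp.2 ?_)
          linarith
  rw [hset, Measure.pi_pi, Finset.prod_const, Finset.card_univ, Fintype.card_fin]
  calc _ ≤ ENNReal.ofReal (Real.exp (-z)) ^ n := by gcongr
    _ = _ := by
      rw [← ENNReal.ofReal_pow (Real.exp_pos _).le, ← Real.exp_nat_mul]
      congr 2
      ring

end

/-! ### Measurability of the candidates -/

section

variable {d q n : ℕ}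

theorem continuous_rankOne : Continuous (rankOne : Vec d → Vec d →L[ℝ] Vec d) := by
  have e : (rankOne : Vec d → Vec d →L[ℝ] Vec d)
      = fun v => ContinuousLinearMap.smulRightL ℝ (Vec d) (Vec d) (innerSL ℝ v) v := rfl
  rw [e]
  fun_prop

theorem continuous_pow_apply {X : Type*} [TopologicalSpace X] {A : X → Vec d →L[ℝ] Vec d}
    (hA : Continuous A) {y : X → Vec d} (hy : Continuous y) (t : ℕ) :
    Continuous fun x => (A x ^ t) (y x) := by
  induction t with
  | zero => simpa using hy
  | succ t ih =>
    simp only [pow_succ', mul_apply_eq_comp]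
    exact hA.clm_apply ih

theorem continuous_covOp :
    Continuous fun Z : (Fin n → Fin q → Vec d) × (Fin n → Fin q → Vec d) => covOp Z.1 Z.2 := by
  have hr := continuous_rankOne (d := d)
  unfold covOp pairOp
  fun_prop

theorem continuous_gapOp :
    Continuous fun Z : (Fin n → Fin q → Vec d) × (Fin n → Fin q → Vec d) => gapOp Z.1 Z.2 := by
  have hr := continuous_rankOne (d := d)
  unfold gapOp pairOp sumOp
  fun_prop

theorem measurable_dirVec (m : ℕ) (j : Fin d) :
    Measurable fun Z : (Fin n → Fin q → Vec d) × (Fin n → Fin q → Vec d) =>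
      dirVec m Z.1 Z.2 j := by
  have h3 : Measurable fun Z : (Fin n → Fin q → Vec d) × (Fin n → Fin q → Vec d) =>
      (covTrace Z.1 Z.2)⁻¹ := by
    refine Measurable.inv (Continuous.measurable ?_)
    unfold covTrace
    fun_prop
  -- the inverse of the trace is measurable, the rest is continuous
  set D : ℝ × ((Fin n → Fin q → Vec d) × (Fin n → Fin q → Vec d)) → Vec d := fun p =>
      ∑ t ∈ Finset.range m, ((1 - p.1 • covOp p.2.1 p.2.2) ^ t)
        ((gapOp p.2.1 p.2.2 ^ m) (EuclideanSpace.single j 1)) with hD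
  have h4 : Continuous D := by
    have h5 := (continuous_covOp (d := d) (q := q) (n := n)).comp (continuous_snd (X := ℝ))
    have h6 := (continuous_gapOp (d := d) (q := q) (n := n)).comp (continuous_snd (X := ℝ))
    exact continuous_finsetSum _ fun t _ =>
      continuous_pow_apply (continuous_const.sub (continuous_fst.smul h5))
        (continuous_pow_apply h6 continuous_const m) t
  have e : (fun Z : (Fin n → Fin q → Vec d) × (Fin n → Fin q → Vec d) => dirVec m Z.1 Z.2 j)
      = D ∘ fun Z => ((covTrace Z.1 Z.2)⁻¹, Z) := rfl
  rw [e]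
  exact h4.measurable.comp (h3.prodMk measurable_id)

theorem measurable_candDir (m : ℕ) (j : Bool × Fin d) :
    Measurable fun Z : (Fin n → Fin q → Vec d) × (Fin n → Fin q → Vec d) =>
      candDir m Z.1 Z.2 j := by
  unfold candDir
  split_ifs
  · exact measurable_dirVec m j.2
  · exact (measurable_dirVec m j.2).neg

theorem measurable_measureReal_section {Ω Ω' : Type*} [MeasurableSpace Ω] [MeasurableSpace Ω']
    (P : Measure Ω') [IsProbabilityMeasure P] {s : Set (Ω × Ω')} (hs : MeasurableSet s) :
    Measurable fun x => P.real {y | (x, y) ∈ s} :=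
  (measurable_measure_prodMk_left (ν := P) hs).ennreal_toReal

theorem measurableSet_ltf_uncurry (b : Fin 2) :
    MeasurableSet {p : (Vec d × ℝ) × Vec d | ltf p.1.1 p.1.2 p.2 = b} := by
  have : Measurable fun p : (Vec d × ℝ) × Vec d => ltf p.1.1 p.1.2 p.2 :=
    measurable_pos.comp (by fun_prop)
  exact this (measurableSet_singleton b)

theorem measurable_score (k : ℕ) :
    Measurable fun p : (Vec d × ℝ) × (Fin n → Fin q → Vec d) => score k p.1.1 p.1.2 p.2 := by
  have h : ∀ b i, Measurable fun p : (Vec d × ℝ) × (Fin n → Fin q → Vec d) =>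
      if ltf p.1.1 p.1.2 (p.2 b i) = 1 then (1 : ℝ) else 0 := fun b i => by
    refine Measurable.ite ?_ measurable_const measurable_const
    exact (measurableSet_ltf_uncurry 1).preimage
      (f := fun p : (Vec d × ℝ) × (Fin n → Fin q → Vec d) => (p.1, p.2 b i)) (by fun_prop)
  have h2 : ∀ b, Measurable fun p : (Vec d × ℝ) × (Fin n → Fin q → Vec d) =>
      posCount p.1.1 p.1.2 (p.2 b) := fun b => Finset.measurable_sum _ fun i _ => h b i
  unfold score
  refine Finset.measurable_sum _ fun b _ => ?_
  have := h2 b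
  fun_prop

end

/-! ### Candidates with a good threshold -/

section

variable {d q k n : ℕ}

/-- For the two classes, weighted by their numbers in a bag, the mass of the vectors whose component
along `w` is at most `τ`. -/
def mixMass (q k : ℕ) (P₁ P₀ : Measure (Vec d)) (μ w : Vec d) (τ : ℝ) : ℝ :=
  k * P₁.real {x | (inner ℝ w (x - μ) : ℝ) ≤ τ} + (q - k) * P₀.real {x | (inner ℝ w (x - μ) : ℝ) ≤ τ}

/-- The expectation of `(N - k) ^ 2`, where `N` is the number of vectors in a bag classified as
positive by the threshold function with coefficients `w` and `c`. -/
def bagErr (q k : ℕ) (P₁ P₀ : Measure (Vec d)) (w : Vec d) (c : ℝ) : ℝ :=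
  countErr q k (P₁.real {x | ltf w c x = 1}) (P₀.real {x | ltf w c x = 1})

variable {P₁ P₀ : Measure (Vec d)} [IsProbabilityMeasure P₁] [IsProbabilityMeasure P₀] {μ : Vec d}

theorem measurable_mixMass (P₁ P₀ : Measure (Vec d)) [IsProbabilityMeasure P₁]
    [IsProbabilityMeasure P₀] (μ : Vec d) :
    Measurable fun p : Vec d × ℝ => mixMass q k P₁ P₀ μ p.1 p.2 := by
  have hs : MeasurableSet {p : (Vec d × ℝ) × Vec d | (inner ℝ p.1.1 (p.2 - μ) : ℝ) ≤ p.1.2} :=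
    measurableSet_le (by fun_prop) (by fun_prop)
  have h1 := measurable_measureReal_section P₁ hs
  have h0 := measurable_measureReal_section P₀ hs
  exact (h1.const_mul _).add (h0.const_mul _)

theorem measurable_bagErr (P₁ P₀ : Measure (Vec d)) [IsProbabilityMeasure P₁]
    [IsProbabilityMeasure P₀] :
    Measurable fun p : Vec d × ℝ => bagErr q k P₁ P₀ p.1 p.2 := by
  have h1 := measurable_measureReal_section P₁ (measurableSet_ltf_uncurry (d := d) 1)
  have h0 := measurable_measureReal_section P₀ (measurableSet_ltf_uncurry (d := d) 1)
  have e : (fun p : Vec d × ℝ => bagErr q k P₁ P₀ p.1 p.2) = fun p : Vec d × ℝ =>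
    countErr q k (P₁.real {y | (p, y) ∈ {p : (Vec d × ℝ) × Vec d | ltf p.1.1 p.1.2 p.2 = 1}})
      (P₀.real {y | (p, y) ∈ {p : (Vec d × ℝ) × Vec d | ltf p.1.1 p.1.2 p.2 = 1}}) := rfl
  rw [e]
  unfold countErr
  fun_prop

theorem real_ltf_data (P : Measure (Vec d)) [IsProbabilityMeasure P] (μ w x : Vec d) :
    P.real {y | ltf w (-inner ℝ w x) y = 1}
      = 1 - P.real {y | (inner ℝ w (y - μ) : ℝ) ≤ inner ℝ w (x - μ)} := by
  rw [← probReal_compl_eq_one_sub (measurableSet_le (by fun_prop) (by fun_prop))]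
  congr 1
  ext y
  simp only [Set.mem_ofPred_eq, ltf_eq_one, Set.mem_compl_iff, not_le, inner_sub_right]
  constructor <;> intro h <;> linarith

/-- A threshold that is separated by little mass from one that errs little errs little itself. -/
theorem bagErr_le (hk : k ≤ q) {w x : Vec d} {τ E ζ : ℝ}
    (h₁ : P₁.real {y | (inner ℝ w (y - μ) : ℝ) ≤ τ} ≤ E)
    (h₀ : P₀.real {y | τ < (inner ℝ w (y - μ) : ℝ)} ≤ E)
    (hx : |mixMass q k P₁ P₀ μ w (inner ℝ w (x - μ)) - mixMass q k P₁ P₀ μ w τ| ≤ ζ)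
    (hζ : q * E + ζ ≤ 1) : bagErr q k P₁ P₀ w (-inner ℝ w x) ≤ 2 * (q * E + ζ) := by
  have hk0 : (0 : ℝ) ≤ k := Nat.cast_nonneg k
  have hk' : (0 : ℝ) ≤ q - k := by
    have : (k : ℝ) ≤ q := by exact_mod_cast hk
    linarith
  have h0' : 1 - P₀.real {y | (inner ℝ w (y - μ) : ℝ) ≤ τ} ≤ E := by
    rw [← probReal_compl_eq_one_sub (measurableSet_le (by fun_prop) (by fun_prop))]
    convert h₀ using 2
    ext y
    simp
  have hmono : ∀ (P : Measure (Vec d)) [IsProbabilityMeasure P] (s s' : ℝ), s ≤ s' →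
      P.real {y | (inner ℝ w (y - μ) : ℝ) ≤ s} ≤ P.real {y | (inner ℝ w (y - μ) : ℝ) ≤ s'} :=
    fun P _ s s' h => measureReal_mono fun y (hy : _ ≤ s) => hy.trans h
  rw [bagErr, real_ltf_data P₁ μ, real_ltf_data P₀ μ]
  have n1 : 0 ≤ P₁.real {y | (inner ℝ w (y - μ) : ℝ) ≤ inner ℝ w (x - μ)} := measureReal_nonneg
  have n0 : P₀.real {y | (inner ℝ w (y - μ) : ℝ) ≤ inner ℝ w (x - μ)} ≤ 1 := measureReal_le_one
  refine countErr_le hk (by linarith) (by linarith) hζ ?_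
  have hx' := abs_le.1 hx
  unfold mixMass at hx'
  have m1 := mul_le_mul_of_nonneg_left h₁ hk0
  have m0 := mul_le_mul_of_nonneg_left h0' hk'
  rcases le_total τ (inner ℝ w (x - μ)) with h | h
  · have := mul_le_mul_of_nonneg_left (hmono P₀ _ _ h) hk'
    linarith
  · have := mul_le_mul_of_nonneg_left (hmono P₁ _ _ h) hk0
    linarith

theorem mixMass_eq_cdf (P₁ P₀ : Measure (Vec d)) [IsProbabilityMeasure P₁]
    [IsProbabilityMeasure P₀] (μ w : Vec d) (τ : ℝ) :
    mixMass q k P₁ P₀ μ w τ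
      = k * cdf (P₁.map fun x : Vec d => (inner ℝ w (x - μ) : ℝ)) τ
        + (q - k) * cdf (P₀.map fun x : Vec d => (inner ℝ w (x - μ) : ℝ)) τ := by
  have hY : Measurable fun x : Vec d => (inner ℝ w (x - μ) : ℝ) := by fun_prop
  have hcdf : ∀ (P : Measure (Vec d)) [IsProbabilityMeasure P],
      cdf (P.map fun x : Vec d => (inner ℝ w (x - μ) : ℝ)) τ
        = P.real {x | (inner ℝ w (x - μ) : ℝ) ≤ τ} := fun P _ => by
    have := Measure.isProbabilityMeasure_map (μ := P) hY.aemeasurable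
    rw [cdf_eq_real, map_measureReal_apply hY measurableSet_Iic]
    rfl
  rw [hcdf P₁, hcdf P₀, mixMass]

/-- `le_mass_near` for the laws of a function `Y` without atoms. -/
theorem le_mass_near_map {Ω : Type*} [MeasurableSpace Ω] {P₁ P₀ : Measure Ω}
    [IsProbabilityMeasure P₁] [IsProbabilityMeasure P₀] {Y : Ω → ℝ} (hY : Measurable Y)
    (h₁ : ∀ c, P₁ {x | Y x = c} = 0) (h₀ : ∀ c, P₀ {x | Y x = c} = 0) {a b : ℝ} (ha : 0 ≤ a)
    (hb : 0 ≤ b) {G : ℝ → ℝ} (hG : ∀ y, G y = a * cdf (P₁.map Y) y + b * cdf (P₀.map Y) y) (θ : ℝ)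
    {ζ : ℝ} (hζ : 0 < ζ) (hζ' : 2 * ζ < a + b) :
    ζ ≤ a * P₁.real {x | |G (Y x) - G θ| ≤ ζ} + b * P₀.real {x | |G (Y x) - G θ| ≤ ζ} := by
  obtain rfl : G = _ := funext hG
  have i1 := Measure.isProbabilityMeasure_map (μ := P₁) hY.aemeasurable
  have i0 := Measure.isProbabilityMeasure_map (μ := P₀) hY.aemeasurable
  have j1 : NullSingletonClass (P₁.map Y) :=
    ⟨fun c => by rw [Measure.map_apply hY (measurableSet_singleton c)]; exact h₁ c⟩
  have j0 : NullSingletonClass (P₀.map Y) :=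
    ⟨fun c => by rw [Measure.map_apply hY (measurableSet_singleton c)]; exact h₀ c⟩
  have key := le_mass_near (ν₁ := P₁.map Y) (ν₀ := P₀.map Y) ha hb θ hζ hζ'
  have hset : MeasurableSet {y | |(a * cdf (P₁.map Y) y + b * cdf (P₀.map Y) y)
      - (a * cdf (P₁.map Y) θ + b * cdf (P₀.map Y) θ)| ≤ ζ} := by
    have m1 := (monotone_cdf (P₁.map Y)).measurable
    have m0 := (monotone_cdf (P₀.map Y)).measurable
    exact measurableSet_le (by fun_prop) measurable_const
  rw [map_measureReal_apply hY hset, map_measureReal_apply hY hset] at key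
  exact key

theorem le_mass_mixMass (hk : k ≤ q) {w : Vec d}
    (h₁ : ∀ c, P₁ {x | (inner ℝ w (x - μ) : ℝ) = c} = 0)
    (h₀ : ∀ c, P₀ {x | (inner ℝ w (x - μ) : ℝ) = c} = 0) (θ : ℝ) {ζ : ℝ} (hζ : 0 < ζ)
    (hζq : 2 * ζ < q) :
    ζ ≤ k * P₁.real {x | |mixMass q k P₁ P₀ μ w (inner ℝ w (x - μ)) - mixMass q k P₁ P₀ μ w θ| ≤ ζ}
      + (q - k) * P₀.real {x | |mixMass q k P₁ P₀ μ w (inner ℝ w (x - μ))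
        - mixMass q k P₁ P₀ μ w θ| ≤ ζ} := by
  have hY : Measurable fun x : Vec d => (inner ℝ w (x - μ) : ℝ) := by fun_prop
  have hk' : (k : ℝ) ≤ q := by exact_mod_cast hk
  exact le_mass_near_map hY h₁ h₀ (Nat.cast_nonneg k) (by linarith)
    (mixMass_eq_cdf P₁ P₀ μ w) θ hζ (by linarith)

theorem measurableSet_forall_far {F : Vec d × ℝ → ℝ} (hF : Measurable F) {H : Vec d → ℝ}
    (hH : Measurable H) (μ : Vec d) (ζ : ℝ) :
    MeasurableSet {p : Vec d × (Fin n → Fin q → Vec d) | p.1 ≠ 0 ∧ ∀ b i,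
      ¬ |F (p.1, inner ℝ p.1 (p.2 b i - μ)) - H p.1| ≤ ζ} := by
  have m1 : ∀ b i, Measurable fun p : Vec d × (Fin n → Fin q → Vec d) =>
      F (p.1, inner ℝ p.1 (p.2 b i - μ)) := fun b i =>
    hF.comp (measurable_fst.prodMk (by fun_prop))
  have m2 : Measurable fun p : Vec d × (Fin n → Fin q → Vec d) => H p.1 := hH.comp measurable_fst
  have e : {p : Vec d × (Fin n → Fin q → Vec d) | p.1 ≠ 0 ∧ ∀ b i,
      ¬ |F (p.1, inner ℝ p.1 (p.2 b i - μ)) - H p.1| ≤ ζ}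
      = {p | p.1 ≠ 0} ∩ ⋂ b, ⋂ i, {p | |F (p.1, inner ℝ p.1 (p.2 b i - μ)) - H p.1| ≤ ζ}ᶜ := by
    ext p
    simp
  rw [e]
  refine MeasurableSet.inter (measurable_fst (measurableSet_singleton (0 : Vec d)).compl) ?_
  refine MeasurableSet.iInter fun b => MeasurableSet.iInter fun i => MeasurableSet.compl ?_
  exact measurableSet_le ((m1 b i).sub m2).abs measurable_const

theorem measurable_threshold_data {F : Vec d × ℝ → ℝ} (hF : Measurable F) (w μ : Vec d) :
    Measurable fun x : Vec d => F (w, inner ℝ w (x - μ)) :=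
  hF.comp (by fun_prop)

/-- For a fixed direction, the bags are unlikely to contain no data point near the target `θ`. -/
theorem miss_mixMass_le (hk : k ≤ q) {w : Vec d}
    (h₁ : ∀ c, P₁ {x | (inner ℝ w (x - μ) : ℝ) = c} = 0)
    (h₀ : ∀ c, P₀ {x | (inner ℝ w (x - μ) : ℝ) = c} = 0) (θ : ℝ) {ζ : ℝ} (hζ : 0 < ζ)
    (hζq : 2 * ζ < q) :
    (Measure.pi fun _ : Fin n => bagLaw q k P₁ P₀)
      {X | ∀ b i, ¬ |mixMass q k P₁ P₀ μ w (inner ℝ w (X b i - μ)) - mixMass q k P₁ P₀ μ w θ| ≤ ζ}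
      ≤ ENNReal.ofReal (Real.exp (-(n * ζ))) := by
  have m1 := measurable_threshold_data (measurable_mixMass (q := q) (k := k) P₁ P₀ μ) w μ
  have key := le_mass_mixMass hk h₁ h₀ θ hζ hζq
  generalize mixMass q k P₁ P₀ μ w θ = M at *
  have hA : MeasurableSet {x | |mixMass q k P₁ P₀ μ w (inner ℝ w (x - μ)) - M| ≤ ζ} :=
    measurableSet_le (m1.sub_const _).abs measurable_const
  have h := miss_le hk hA key n
  simpa only [Set.mem_ofPred_eq] using h

/-- The passage from fixed to random directions, independent of the bags. -/
theorem measure_forall_far_le {Q : Measure (Fin n → Fin q → Vec d)} [IsProbabilityMeasure Q]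
    {F : Vec d × ℝ → ℝ} (hF : Measurable F) {H : Vec d → ℝ} (hH : Measurable H) {ζ : ℝ}
    {η : ENNReal}
    (h : ∀ w, w ≠ 0 → Q {X | ∀ b i, ¬ |F (w, inner ℝ w (X b i - μ)) - H w| ≤ ζ} ≤ η)
    {Ω : Type*} [MeasurableSpace Ω] (ν : Measure Ω) [IsProbabilityMeasure ν] {W : Ω → Vec d}
    (hW : Measurable W) :
    (ν.prod Q) {p | W p.1 ≠ 0 ∧
      ∀ b i, ¬ |F (W p.1, inner ℝ (W p.1) (p.2 b i - μ)) - H (W p.1)| ≤ ζ} ≤ η := by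
  have hTm := measurableSet_forall_far (q := q) (n := n) hF hH μ ζ
  set T : Set (Vec d × (Fin n → Fin q → Vec d)) := {p | p.1 ≠ 0 ∧ ∀ b i,
    ¬ |F (p.1, inner ℝ p.1 (p.2 b i - μ)) - H p.1| ≤ ζ} with hT
  have hmem : ∀ w X, (w, X) ∈ T ↔ (w ≠ 0 ∧ ∀ b i, ¬ |F (w, inner ℝ w (X b i - μ)) - H w| ≤ ζ) :=
    fun w X => by rw [hT, Set.mem_ofPred_eq]
  have key := prod_measure_le_of_section_le (μ := ν) (ν := Q) hW hTm η
  refine (measure_mono fun p hp => ?_).trans key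
  rw [Set.mem_ofPred_eq] at hp
  rw [Set.mem_ofPred_eq]
  refine And.intro ((hmem _ _).2 hp) ((measure_mono fun X hX => ?_).trans (h _ hp.1))
  rw [Set.mem_ofPred_eq]
  exact ((hmem _ _).1 hX).2

/-- For each candidate direction, some data point provides a threshold close to the target `θ`. -/
theorem exists_threshold (hk : k ≤ q)
    (h₁ : ∀ w, w ≠ 0 → ∀ c, P₁ {x | (inner ℝ w (x - μ) : ℝ) = c} = 0)
    (h₀ : ∀ w, w ≠ 0 → ∀ c, P₀ {x | (inner ℝ w (x - μ) : ℝ) = c} = 0) {θ : Vec d → ℝ}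
    (hθ : Measurable θ) {ζ : ℝ} (hζ : 0 < ζ) (hζq : 2 * ζ < q) {Ω : Type*} [MeasurableSpace Ω]
    (ν : Measure Ω) [IsProbabilityMeasure ν] {W : Ω → Vec d} (hW : Measurable W) :
    (ν.prod (Measure.pi fun _ : Fin n => bagLaw q k P₁ P₀))
      {p | W p.1 ≠ 0 ∧ ∀ b i, ¬ |mixMass q k P₁ P₀ μ (W p.1) (inner ℝ (W p.1) (p.2 b i - μ))
        - mixMass q k P₁ P₀ μ (W p.1) (θ (W p.1))| ≤ ζ}
      ≤ ENNReal.ofReal (Real.exp (-(n * ζ))) := by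
  have hM := measurable_mixMass (q := q) (k := k) P₁ P₀ μ
  exact measure_forall_far_le hM (hM.comp (measurable_id.prodMk hθ))
    (fun w hw => miss_mixMass_le hk (h₁ w hw) (h₀ w hw) (θ w) hζ hζq) ν hW

/-- The score of a random hypothesis, independent of the sample, concentrates. -/
theorem score_deviation_random (hq : 0 < q) (hk : k ≤ q) {t : ℝ} (ht0 : 0 ≤ t) (ht : t ≤ 22)
    {Ω : Type*} [MeasurableSpace Ω] (ν : Measure Ω) [IsProbabilityMeasure ν] {W : Ω → Vec d × ℝ}
    (hW : Measurable W) :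
    (ν.prod (Measure.pi fun _ : Fin n => bagLaw q k P₁ P₀))
      {p | n * (t * q ^ 2) < |score k (W p.1).1 (W p.1).2 p.2
        - n * (bagErr q k P₁ P₀ (W p.1).1 (W p.1).2 - k ^ 2)|}
      ≤ ENNReal.ofReal (2 * Real.exp (-(n * t ^ 2 / 88))) := by
  set T : Set ((Vec d × ℝ) × (Fin n → Fin q → Vec d)) := {p | n * (t * q ^ 2) < |score k p.1.1 p.1.2 p.2
        - n * (bagErr q k P₁ P₀ p.1.1 p.1.2 - k ^ 2)|} with hT
  have hTm : MeasurableSet T := by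
    have m1 := measurable_score (d := d) (q := q) (n := n) k
    have m2 : Measurable fun p : (Vec d × ℝ) × (Fin n → Fin q → Vec d) =>
        bagErr q k P₁ P₀ p.1.1 p.1.2 := (measurable_bagErr P₁ P₀).comp measurable_fst
    exact measurableSet_lt measurable_const (m1.sub ((m2.sub_const _).const_mul _)).abs
  refine le_trans (measure_mono fun p hp => ?_)
    (prod_measure_le_of_section_le (μ := ν) (ν := Measure.pi fun _ : Fin n => bagLaw q k P₁ P₀) hW hTm
      (ENNReal.ofReal (2 * Real.exp (-(n * t ^ 2 / 88)))))
  exact ⟨hp, score_deviation hq hk (W p.1).1 (W p.1).2 ht0 ht n⟩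

end

/-! ### The two classes -/

section

variable {d q k n : ℕ}

/-- The law of `μ + T g` for a standard Gaussian vector `g` conditioned on `⟪e, g⟫ > ℓ`. -/
def posLaw (μ : Vec d) (T : Vec d →L[ℝ] Vec d) (e : Vec d) (ℓ : ℝ) : Measure (Vec d) :=
  ((stdGaussian (Vec d))[|(fun g => inner ℝ e g) ⁻¹' Set.Ioi ℓ]).map fun g => μ + T g

/-- The law of `μ + T g` for a standard Gaussian vector `g` conditioned on `⟪e, g⟫ ≤ ℓ`. -/
def negLaw (μ : Vec d) (T : Vec d →L[ℝ] Vec d) (e : Vec d) (ℓ : ℝ) : Measure (Vec d) :=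
  ((stdGaussian (Vec d))[|(fun g => inner ℝ e g) ⁻¹' Set.Iic ℓ]).map fun g => μ + T g

/-- The mean of the component of `g` in direction `e`, for the positive class. -/
def posMean (ℓ : ℝ) : ℝ := ∫ x, x ∂gaussianAbove ℓ

/-- The mean of the component of `g` in direction `e`, for the negative class. -/
def negMean (ℓ : ℝ) : ℝ := ∫ x, x ∂gaussianBelow ℓ

/-- The variance of the component of `g` in direction `e`, for the mixture of the two classes. -/
def mixVar (q k : ℕ) (ℓ : ℝ) : ℝ :=
  (k * ∫ x, x ^ 2 ∂gaussianAbove ℓ + (q - k) * ∫ x, x ^ 2 ∂gaussianBelow ℓ) / q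
    - ((k * posMean ℓ + (q - k) * negMean ℓ) / q) ^ 2

variable {μ : Vec d} {T : Vec d →L[ℝ] Vec d} {e : Vec d}

theorem hasClassMoments_posLaw (μ : Vec d) (hT : ∀ x y, inner ℝ (T x) y = inner ℝ x (T y))
    (he : ‖e‖ = 1) (ℓ : ℝ) :
    HasClassMoments μ T e (logMass ℓ) (posMean ℓ) (∫ x, x ^ 2 ∂gaussianAbove ℓ)
      (posLaw μ T e ℓ) :=
  hasClassMoments_cond μ hT he measurableSet_Ioi (mass_le_tail ℓ)

theorem hasClassMoments_negLaw (μ : Vec d) (hT : ∀ x y, inner ℝ (T x) y = inner ℝ x (T y))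
    (he : ‖e‖ = 1) (ℓ : ℝ) :
    HasClassMoments μ T e (logMass ℓ) (negMean ℓ) (∫ x, x ^ 2 ∂gaussianBelow ℓ)
      (negLaw μ T e ℓ) :=
  hasClassMoments_cond μ hT he measurableSet_Iic (by rw [gaussian_Iic]; exact mass_le_tail_neg ℓ)

/-- The half-space with normal vector `w` and the offset that matches `ℓ` misses little of the
positive class, when `T w` is nearly parallel to `e`. -/
theorem posLaw_le (hT : ∀ x y, inner ℝ (T x) y = inner ℝ x (T y)) (he : ‖e‖ = 1) (ℓ : ℝ)
    {w : Vec d} (hρ : 0 < (inner ℝ (T w) e : ℝ)) :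
    (posLaw μ T e ℓ).real {x | (inner ℝ w (x - μ) : ℝ) ≤ inner ℝ (T w) e * ℓ}
      ≤ 4 * √(logMass ℓ) * (‖T w - (inner ℝ (T w) e : ℝ) • e‖ / inner ℝ (T w) e) := by
  refine ENNReal.toReal_le_of_le_ofReal (by positivity) ?_
  have h := halfspace_error (μ := μ) hT he (t := ℓ) hρ measurableSet_Ioi (K := 4 * √(logMass ℓ))
    (B := fun s => Set.Iic (ℓ + s)) (by positivity) (fun s hs => gaussianAbove_near ℓ hs)
    (A := Set.Iic 0) measurableSet_Iic fun z y h => by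
      simp only [Set.mem_Iic] at h ⊢
      linarith [neg_abs_le y]
  refine le_trans (le_of_eq ?_) h
  rw [posLaw]
  congr 1
  ext x
  simp only [Set.mem_ofPred_eq, Set.mem_Iic, sub_nonpos]
  rw [div_le_iff₀ hρ, mul_comm]

theorem negLaw_le (hT : ∀ x y, inner ℝ (T x) y = inner ℝ x (T y)) (he : ‖e‖ = 1) (ℓ : ℝ)
    {w : Vec d} (hρ : 0 < (inner ℝ (T w) e : ℝ)) :
    (negLaw μ T e ℓ).real {x | inner ℝ (T w) e * ℓ < (inner ℝ w (x - μ) : ℝ)}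
      ≤ 4 * √(logMass ℓ) * (‖T w - (inner ℝ (T w) e : ℝ) • e‖ / inner ℝ (T w) e) := by
  refine ENNReal.toReal_le_of_le_ofReal (by positivity) ?_
  have h := halfspace_error (μ := μ) hT he (t := ℓ) hρ measurableSet_Iic (K := 4 * √(logMass ℓ))
    (B := fun s => Set.Ioi (ℓ - s)) (by positivity) (fun s hs => gaussianBelow_near ℓ hs)
    (A := Set.Ioi 0) measurableSet_Ioi fun z y h => by
      simp only [Set.mem_Ioi] at h ⊢
      linarith [le_abs_self y]
  refine le_trans (le_of_eq ?_) h
  rw [negLaw]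
  congr 1
  ext x
  simp only [Set.mem_ofPred_eq, Set.mem_Ioi, sub_pos]
  rw [lt_div_iff₀ hρ, mul_comm]

/-- The two classes give no mass to hyperplanes. -/
theorem cond_map_hyperplane (μ : Vec d) (hT : ∀ x y, inner ℝ (T x) y = inner ℝ x (T y))
    {w : Vec d} (hw : T w ≠ 0) (s : Set (Vec d)) (c : ℝ) :
    (((stdGaussian (Vec d))[|s]).map fun g => μ + T g) {x | (inner ℝ w (x - μ) : ℝ) = c} = 0 := by
  rw [Measure.map_apply (by fun_prop) (measurableSet_eq_fun (by fun_prop) measurable_const)]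
  refine cond_absolutelyContinuous ?_
  have h := stdGaussian_map_inner (T w)
  have hne : ‖T w‖₊ ^ 2 ≠ 0 := pow_ne_zero _ (nnnorm_ne_zero_iff.2 hw)
  have := nullSingletonClass_gaussianReal (μ := 0) hne
  have h2 : ((stdGaussian (Vec d)).map fun g => inner ℝ (T w) g) {c} = 0 := by
    rw [h]; exact measure_singleton c
  rw [Measure.map_apply (by fun_prop) (measurableSet_singleton c)] at h2
  convert h2 using 2
  ext g
  simp [hT]

/-- By the law of total variance: the means of the two classes are at least `1 / 2` apart, and each
class has at least one vector in a bag. -/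
theorem le_mixVar (hk : 1 ≤ k) (hkq : k + 1 ≤ q) (ℓ : ℝ) : 1 / (8 * q) ≤ mixVar q k ℓ := by
  have hL := one_lt_logMass ℓ
  obtain ⟨-, -, v1⟩ := moments_of_exp_sq (by linarith) (exp_sq_gaussianAbove ℓ)
  obtain ⟨-, -, v0⟩ := moments_of_exp_sq (by linarith) (exp_sq_gaussianBelow ℓ)
  have hg := half_le_gap ℓ
  have hk' : (1 : ℝ) ≤ k := by exact_mod_cast hk
  have hkq' : (k : ℝ) + 1 ≤ q := by exact_mod_cast hkq
  rw [mixVar, posMean, negMean]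
  generalize (∫ x, x ∂gaussianAbove ℓ) = a₁ at *
  generalize (∫ x, x ∂gaussianBelow ℓ) = a₀ at *
  generalize (∫ x, x ^ 2 ∂gaussianAbove ℓ) = b₁ at *
  generalize (∫ x, x ^ 2 ∂gaussianBelow ℓ) = b₀ at *
  have hq : (0 : ℝ) < q := by linarith
  generalize (k : ℝ) = K at *
  generalize (q : ℝ) = Q at *
  obtain ⟨Z, rfl⟩ : ∃ Z, Q = K + Z := ⟨Q - K, by ring⟩
  have hZ : 1 ≤ Z := by linarith
  have h1 : (K * b₁ + (K + Z - K) * b₀) / (K + Z) - ((K * a₁ + (K + Z - K) * a₀) / (K + Z)) ^ 2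
      = (K * (b₁ - a₁ ^ 2) + Z * (b₀ - a₀ ^ 2)) / (K + Z)
        + K * Z * (a₁ - a₀) ^ 2 / (K + Z) ^ 2 := by
    field_simp
    ring
  rw [h1]
  have h2 : 0 ≤ (K * (b₁ - a₁ ^ 2) + Z * (b₀ - a₀ ^ 2)) / (K + Z) := by
    have := mul_nonneg (by linarith : 0 ≤ K) (sub_nonneg.2 v1)
    have := mul_nonneg (by linarith : 0 ≤ Z) (sub_nonneg.2 v0)
    positivity
  have h3 : 1 / (8 * (K + Z)) ≤ K * Z * (a₁ - a₀) ^ 2 / (K + Z) ^ 2 := by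
    rw [div_le_div_iff₀ (by positivity) (by positivity)]
    have h4 : 1 / 4 ≤ (a₁ - a₀) ^ 2 := by nlinarith
    have h5 : (K + Z) / 2 ≤ K * Z := by nlinarith
    have h6 : (K + Z) / 2 * (1 / 4) ≤ K * Z * (a₁ - a₀) ^ 2 :=
      mul_le_mul h5 h4 (by norm_num) (by positivity)
    nlinarith
  linarith

theorem mixVar_le (hq : 0 < q) (hkq : k ≤ q) (ℓ : ℝ) : mixVar q k ℓ ≤ 8 * logMass ℓ := by
  have hL := one_lt_logMass ℓ
  obtain ⟨-, v1, -⟩ := moments_of_exp_sq (by linarith) (exp_sq_gaussianAbove ℓ)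
  obtain ⟨-, v0, -⟩ := moments_of_exp_sq (by linarith) (exp_sq_gaussianBelow ℓ)
  have hk' : (0 : ℝ) ≤ k := Nat.cast_nonneg k
  have hkq' : (k : ℝ) ≤ q := by exact_mod_cast hkq
  have hq' : (0 : ℝ) < q := by exact_mod_cast hq
  rw [mixVar]
  have h1 : (k * ∫ x, x ^ 2 ∂gaussianAbove ℓ + (q - k) * ∫ x, x ^ 2 ∂gaussianBelow ℓ) / q
      ≤ 8 * logMass ℓ := by
    rw [div_le_iff₀ hq']
    have m1 := mul_le_mul_of_nonneg_left v1 hk'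
    have m0 := mul_le_mul_of_nonneg_left v0 (sub_nonneg.2 hkq')
    linarith
  linarith [sq_nonneg ((k * posMean ℓ + (q - k) * negMean ℓ) / q)]

theorem mixVar_spec (hq : 0 < q) (ℓ : ℝ) : (q : ℝ) ^ 2 * mixVar q k ℓ
    = q * (k * ∫ x, x ^ 2 ∂gaussianAbove ℓ + (q - k) * ∫ x, x ^ 2 ∂gaussianBelow ℓ)
      - (k * posMean ℓ + (q - k) * negMean ℓ) ^ 2 := by
  have hq' : (0 : ℝ) < q := by exact_mod_cast hq
  rw [mixVar]
  field_simp

/-! ### Selection of a candidate -/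

/-- A direction nearly parallel to `r`, or its opposite, makes a small angle with `r`. -/
theorem exists_candDir_angle {r : Vec d} (he : ‖e‖ = 1) (hTr0 : T r ≠ 0) (hTr : T r = ‖T r‖ • e)
    {m : ℕ} {X X' : Fin n → Fin q → Vec d} {θ : ℝ} (hθ : θ ≤ 1 / 2)
    (h : ∃ (j : Fin d) (a : ℝ), a ≠ 0 ∧ ‖T (dirVec m X X' j - a • r)‖ ≤ θ * (|a| * ‖T r‖)) :
    ∃ j : Bool × Fin d, 0 < (inner ℝ (T (candDir m X X' j)) e : ℝ) ∧
      ‖T (candDir m X X' j) - (inner ℝ (T (candDir m X X' j)) e : ℝ) • e‖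
        / inner ℝ (T (candDir m X X' j)) e ≤ 2 * θ := by
  obtain ⟨j, a, ha, hj⟩ := h
  have hs : 0 < ‖T r‖ := norm_pos_iff.2 hTr0
  -- the sign is chosen so that the multiple of `r` is positive
  obtain ⟨j', hj'⟩ : ∃ j' : Bool × Fin d,
      ‖T (candDir m X X' j') - (|a| * ‖T r‖) • e‖ ≤ θ * (|a| * ‖T r‖) := by
    rcases lt_or_gt_of_ne ha with h0 | h0
    · refine ⟨(false, j), ?_⟩
      rw [abs_of_neg h0] at hj ⊢
      rw [← norm_neg, mul_smul, ← hTr]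
      refine le_trans (le_of_eq (congrArg _ ?_)) hj
      simp only [candDir, Bool.false_eq_true, if_false, map_neg, map_sub, map_smul, neg_smul]
      abel
    · refine ⟨(true, j), ?_⟩
      rw [abs_of_pos h0] at hj ⊢
      rw [mul_smul, ← hTr]
      refine le_trans (le_of_eq (congrArg _ ?_)) hj
      simp only [candDir, if_true, map_sub, map_smul]
  have hp : 0 < |a| * ‖T r‖ := mul_pos (abs_pos.2 ha) hs
  refine ⟨j', ?_⟩
  generalize T (candDir m X X' j') = v at *
  generalize |a| * ‖T r‖ = p at *
  have h1 : (inner ℝ v e : ℝ) - p = inner ℝ (v - p • e) e := by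
    rw [inner_sub_left, inner_smul_left, real_inner_self_eq_norm_sq, he]
    simp
  have h2 := abs_real_inner_le_norm (v - p • e) e
  rw [← h1, he, mul_one] at h2
  have h3 := abs_le.1 (h2.trans hj')
  have h4 : p / 2 ≤ inner ℝ v e := by nlinarith
  have h5 : (0 : ℝ) < inner ℝ v e := by linarith
  refine ⟨h5, ?_⟩
  have h6 : ‖v - (inner ℝ v e : ℝ) • e‖ ^ 2 ≤ ‖v - p • e‖ ^ 2 := by
    rw [norm_sub_sq_real, norm_sub_sq_real, norm_smul, norm_smul, he, inner_smul_right,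
      inner_smul_right, mul_one, mul_one, Real.norm_eq_abs, Real.norm_eq_abs, sq_abs, sq_abs]
    nlinarith [sq_nonneg ((inner ℝ v e : ℝ) - p)]
  have h7 : ‖v - (inner ℝ v e : ℝ) • e‖ ≤ ‖v - p • e‖ :=
    (sq_le_sq₀ (norm_nonneg _) (norm_nonneg _)).1 h6
  rw [div_le_iff₀ h5]
  have h8 : 0 ≤ θ := by
    by_contra hneg
    nlinarith [norm_nonneg (v - p • e)]
  nlinarith

/-- However the vectors of the bags are ordered, the output is a candidate of least score for the
same set of candidates; the order changes only the indices of the data points that give the thresholds. -/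
theorem learner_output_perm {m : ℕ} (hd : 0 < d) (hq : 0 < q) (hm : 3 < m)
    (bags : Fin m → Fin q → Vec d) (σ : Fin m → Equiv.Perm (Fin q)) {w : Vec d} {c : ℝ}
    (hw : w = learner.outVec k fun j i => bags j (σ j i))
    (hc : c = learner.outOffset k fun j i => bags j (σ j i)) :
    ∃ (j : Bool × Fin d) (b : Fin (m / 4)) (i : Fin q),
      w = candDir m (quarter 0 bags) (quarter 1 bags) j ∧
      c = -inner ℝ (candDir m (quarter 0 bags) (quarter 1 bags) j) (quarter 2 bags b i) ∧
      ∀ (j' : Bool × Fin d) (b' : Fin (m / 4)) (i' : Fin q),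
        score k w c (quarter 3 bags)
          ≤ score k (candDir m (quarter 0 bags) (quarter 1 bags) j')
            (-inner ℝ (candDir m (quarter 0 bags) (quarter 1 bags) j') (quarter 2 bags b' i'))
            (quarter 3 bags) := by
  obtain ⟨j, b, i, h1, h2, h3⟩ :=
    learner_output (k := k) (fun j i => bags j (σ j i)) hd hq hm
  rw [← hw] at h1
  rw [← hc] at h2
  rw [← hw, ← hc] at h3
  have hp : ∀ a : Fin 4, quarter a (fun j i => bags j (σ j i))
      = fun (b : Fin (m / 4)) i => quarter a bags b
        (σ ⟨4 * b + a, by have := b.2; have := a.2; omega⟩ i) := fun a => rfl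
  rw [hp 0, hp 1, candDir_perm] at h1 h2
  refine ⟨j, b, _, h1, h2, fun j' b' i' => ?_⟩
  have h4 := h3 j' b' ((σ ⟨4 * b' + (2 : Fin 4), by have := b'.2; have := (2 : Fin 4).2; omega⟩).symm i')
  rw [hp 0, hp 1, hp 3, candDir_perm, score_perm, score_perm] at h4
  convert h4 using 4
  simp [quarter]

end

/-! ### The failure probability -/

section

variable {d q k n m : ℕ}

/-- Comparison of scores compares errors, up to twice the accuracy of the scores. -/
theorem bagErr_le_of_score_le {P₁ P₀ : Measure (Vec d)} (hn : 0 < n) {w w' : Vec d} {c c' D : ℝ}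
    {X : Fin n → Fin q → Vec d} (h : score k w c X ≤ score k w' c' X)
    (hw : |score k w c X - n * (bagErr q k P₁ P₀ w c - k ^ 2)| ≤ n * D)
    (hw' : |score k w' c' X - n * (bagErr q k P₁ P₀ w' c' - k ^ 2)| ≤ n * D) :
    bagErr q k P₁ P₀ w c ≤ bagErr q k P₁ P₀ w' c' + 2 * D := by
  have hn' : (0 : ℝ) < n := by exact_mod_cast hn
  have h1 := (abs_le.1 hw).1
  have h2 := (abs_le.1 hw').2
  have h3 : n * (bagErr q k P₁ P₀ w c) ≤ n * (bagErr q k P₁ P₀ w' c' + 2 * D) := by linarith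
  exact le_of_mul_le_mul_left h3 hn'

/-- A sample for which the learner succeeds: the operators computed from the first two parts are
close to their means, the third part contains good thresholds for all candidate directions, and
the scores computed from the last part are close to their means for all candidate hypotheses. -/
structure GoodSample (m q k : ℕ) (μ : Vec d) (T : Vec d →L[ℝ] Vec d) (e : Vec d)
    (ℓ lam t ζ s : ℝ) (X₁ X₂ X₃ X₄ : Fin n → Fin q → Vec d) : Prop where
  cov : ‖covOp X₁ X₂ - (n : ℝ) • covMean q T e (mixVar q k ℓ)‖
    ≤ n * (128 * t * q ^ 2 * logMass ℓ * lam)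
  gap : ‖gapOp X₁ X₂ - (n : ℝ) • gapMean q k T e (posMean ℓ - negMean ℓ)‖
    ≤ n * (128 * t * q ^ 3 * logMass ℓ * lam)
  threshold : ∀ j, candDir m X₁ X₂ j ≠ 0 → ∃ b i,
    |mixMass q k (posLaw μ T e ℓ) (negLaw μ T e ℓ) μ (candDir m X₁ X₂ j)
        (inner ℝ (candDir m X₁ X₂ j) (X₃ b i - μ))
      - mixMass q k (posLaw μ T e ℓ) (negLaw μ T e ℓ) μ (candDir m X₁ X₂ j)
        (inner ℝ (T (candDir m X₁ X₂ j)) e * ℓ)| ≤ ζ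
  score : ∀ j b i,
    |score k (candDir m X₁ X₂ j) (-inner ℝ (candDir m X₁ X₂ j) (X₃ b i)) X₄
      - n * (bagErr q k (posLaw μ T e ℓ) (negLaw μ T e ℓ) (candDir m X₁ X₂ j)
        (-inner ℝ (candDir m X₁ X₂ j) (X₃ b i)) - k ^ 2)| ≤ n * (s * q ^ 2)

variable {μ : Vec d} {T : Vec d →L[ℝ] Vec d} {e : Vec d}

/-- On a good sample, some candidate has a small error in a bag. -/
theorem GoodSample.exists_bagErr_le
    (hT : ∀ x y, inner ℝ (T x) y = inner ℝ x (T y)) {lam l κ : ℝ}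
    (hhi : ∀ w, ‖T w‖ ^ 2 ≤ lam * ‖w‖ ^ 2) (hlo : ∀ w, l * ‖w‖ ^ 2 ≤ ‖T w‖ ^ 2) (hl : 0 < l)
    (hκ : lam = κ * l) (hκ1 : 1 ≤ κ) {r : Vec d} (he : ‖e‖ = 1) (hTr0 : T r ≠ 0)
    (hTr : T r = ‖T r‖ • e) (hk : 1 ≤ k) (hkq : k + 1 ≤ q) (hn : 0 < n) {ℓ ε t s : ℝ}
    (hε : 0 < ε) (hε1 : ε < 1)
    (ht : t * (2 ^ 32 * q ^ 4 * logMass ℓ ^ 3 * κ ^ 2) = ε)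
    (hm1 : √d ≤ 2 ^ m * (512 * t * q ^ 2 * logMass ℓ * κ))
    (hm2 : Real.exp (-(m / (136 * d * q * logMass ℓ * κ)))
      ≤ (3 * (512 * t * q ^ 2 * logMass ℓ * κ)) ^ 2)
    {X₁ X₂ X₃ X₄ : Fin n → Fin q → Vec d}
    (h : GoodSample m q k μ T e ℓ lam t (ε / 512) s X₁ X₂ X₃ X₄) :
    ∃ j b i, bagErr q k (posLaw μ T e ℓ) (negLaw μ T e ℓ) (candDir m X₁ X₂ j)
      (-inner ℝ (candDir m X₁ X₂ j) (X₃ b i)) ≤ ε / 128 := by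
  have hL := one_lt_logMass ℓ
  have hp1 := (hasClassMoments_posLaw μ hT he ℓ).isProb
  have hp0 := (hasClassMoments_negLaw μ hT he ℓ).isProb
  obtain ⟨L, hLd⟩ : ∃ L, L = logMass ℓ := ⟨_, rfl⟩
  rw [← hLd] at ht hm1 hm2 hL
  have hq : (2 : ℝ) ≤ q := by exact_mod_cast (by omega : 2 ≤ q)
  have hq0 : (0 : ℝ) < q := by linarith
  have hκ0 : 0 < κ := by linarith
  have hL0 : 0 < L := by linarith
  have ht0 : 0 < t := by
    have : 0 < 2 ^ 32 * (q : ℝ) ^ 4 * L ^ 3 * κ ^ 2 := by positivity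
    exact pos_of_mul_pos_left (by rw [ht]; exact hε) this.le
  -- the choice of `t` makes the relative error of the operators small
  have hη : 512 * t * q ^ 2 * L * κ ≤ 1 / 20 := by
    have h1 : 512 * t * q ^ 2 * L * κ * (2 ^ 23 * ((q : ℝ) ^ 2 * L ^ 2 * κ)) = ε := by
      rw [← ht]; ring
    have h2 : 1 ≤ (q : ℝ) ^ 2 * L ^ 2 * κ := by
      have := one_le_pow₀ (by linarith : (1 : ℝ) ≤ q) (n := 2)
      have := one_le_pow₀ hL.le (n := 2)
      exact one_le_mul_of_one_le_of_one_le (one_le_mul_of_one_le_of_one_le ‹_› ‹_›) hκ1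
    have h3 : 0 < 512 * t * q ^ 2 * L * κ := by positivity
    nlinarith
  -- `θ` bounds the angle between the computed direction and `r`
  obtain ⟨θ, hθd⟩ : ∃ θ, θ = 2 ^ 20 * t * q ^ 3 * L ^ 2 * κ ^ 2 := ⟨_, rfl⟩
  have hθε : θ * (2 ^ 12 * (q * L)) = ε := by rw [← ht, hθd]; ring
  have hqL : 1 ≤ q * L := one_le_mul_of_one_le_of_one_le (by linarith) hL.le
  have hθ0 : 0 < θ := by rw [hθd]; positivity
  have hθ : θ ≤ 1 / 2 := by nlinarith
  have hdir := exists_dirVec_near (m := m) hT hhi hlo hl hκ hκ1 he hTr0 hTr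
    (by rw [← hLd]; exact hL.le : 1 ≤ logMass ℓ) (le_mixVar hk hkq ℓ)
    (mixVar_le (by omega) (by omega) ℓ) (half_le_gap ℓ) hk hkq hn ht0
    (by rw [← hLd]; exact hη) (by rw [← hLd]; exact hm1) (by rw [← hLd]; exact hm2) h.cov h.gap
  rw [← hLd, ← hθd] at hdir
  obtain ⟨j, hj0, hj⟩ := exists_candDir_angle he hTr0 hTr hθ hdir
  have hne : candDir m X₁ X₂ j ≠ 0 := by
    intro h0
    rw [h0, map_zero, inner_zero_left] at hj0
    exact lt_irrefl _ hj0
  obtain ⟨b, i, hbi⟩ := h.threshold j hne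
  refine ⟨j, b, i, ?_⟩
  generalize candDir m X₁ X₂ j = w at *
  have h1 := posLaw_le (μ := μ) hT he ℓ hj0
  have h0 := negLaw_le (μ := μ) hT he ℓ hj0
  -- each class is misclassified with probability at most `8 L θ`
  have hE : 4 * √(logMass ℓ) * (‖T w - (inner ℝ (T w) e : ℝ) • e‖ / inner ℝ (T w) e)
      ≤ 8 * L * θ := by
    rw [← hLd]
    have h2 : √L ≤ L := by
      rw [Real.sqrt_le_left hL0.le]
      nlinarith
    calc _ ≤ 4 * L * (2 * θ) := by gcongr
      _ = _ := by ring
  have h2 : q * (8 * L * θ) = ε / 512 := by rw [← hθε]; ring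
  refine (bagErr_le (by omega) (h1.trans hE) (h0.trans hE) hbi ?_).trans (le_of_eq ?_)
  · rw [h2]; linarith
  · rw [h2]; ring

theorem prod_fst_le {Ω Ω' : Type*} [MeasurableSpace Ω] [MeasurableSpace Ω'] {ν : Measure Ω}
    [SFinite ν] {ν' : Measure Ω'} [IsProbabilityMeasure ν'] {S : Set Ω} {η : ENNReal} (h : ν S ≤ η) :
    (ν.prod ν') {p | p.1 ∈ S} ≤ η := by
  have e : {p : Ω × Ω' | p.1 ∈ S} = S ×ˢ Set.univ := by ext; simp
  rw [e, Measure.prod_prod, measure_univ, mul_one]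
  exact h

end

section

variable {d q k n m : ℕ} {μ : Vec d} {T : Vec d →L[ℝ] Vec d} {e : Vec d}

theorem measure_not_cov_gap_le (hT : ∀ x y, inner ℝ (T x) y = inner ℝ x (T y)) {lam l : ℝ}
    (hhi : ∀ w, ‖T w‖ ^ 2 ≤ lam * ‖w‖ ^ 2) (hlo : ∀ w, l * ‖w‖ ^ 2 ≤ ‖T w‖ ^ 2) (hl : 0 < l)
    (hlam : 0 ≤ lam) (he : ‖e‖ = 1) (hq : 0 < q) (hkq : k ≤ q) (ℓ : ℝ) {t : ℝ} (ht0 : 0 ≤ t)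
    (ht : t ≤ 22) {π : Measure (Fin n → Fin q → Vec d)}
    (hπ : π = Measure.pi fun _ : Fin n => bagLaw q k (posLaw μ T e ℓ) (negLaw μ T e ℓ)) :
    (π.prod π) {Z | ¬ (‖covOp Z.1 Z.2 - (n : ℝ) • covMean q T e (mixVar q k ℓ)‖
        ≤ n * (128 * t * q ^ 2 * logMass ℓ * lam) ∧
      ‖gapOp Z.1 Z.2 - (n : ℝ) • gapMean q k T e (posMean ℓ - negMean ℓ)‖
        ≤ n * (128 * t * q ^ 3 * logMass ℓ * lam))}
      ≤ ENNReal.ofReal (8 * 25 ^ d * Real.exp (-(n * t ^ 2 / 88))) := by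
  have hL := one_lt_logMass ℓ
  rw [hπ]
  refine operator_concentration hq hkq (hasClassMoments_posLaw μ hT he ℓ)
    (hasClassMoments_negLaw μ hT he ℓ) (by linarith) hT (fun w hw => ?_) hhi hlam (mixVar_spec hq ℓ)
    ht0 ht n
  have h1 : 0 < ‖w‖ := norm_pos_iff.2 hw
  have h2 : 0 < ‖T w‖ ^ 2 := lt_of_lt_of_le (by positivity) (hlo w)
  exact lt_of_pow_lt_pow_left₀ 2 (norm_nonneg _) (by simpa using h2)

theorem measure_not_threshold_le (hT : ∀ x y, inner ℝ (T x) y = inner ℝ x (T y))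
    (hTi : ∀ w, w ≠ 0 → T w ≠ 0) (he : ‖e‖ = 1) (hkq : k ≤ q) (ℓ : ℝ) {ζ : ℝ} (hζ : 0 < ζ)
    (hζq : 2 * ζ < q) {π : Measure (Fin n → Fin q → Vec d)}
    (hπ : π = Measure.pi fun _ : Fin n => bagLaw q k (posLaw μ T e ℓ) (negLaw μ T e ℓ))
    (j : Bool × Fin d) :
    ((π.prod π).prod π) {p | ¬ (candDir m p.1.1 p.1.2 j ≠ 0 → ∃ b i,
      |mixMass q k (posLaw μ T e ℓ) (negLaw μ T e ℓ) μ (candDir m p.1.1 p.1.2 j)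
          (inner ℝ (candDir m p.1.1 p.1.2 j) (p.2 b i - μ))
        - mixMass q k (posLaw μ T e ℓ) (negLaw μ T e ℓ) μ (candDir m p.1.1 p.1.2 j)
          (inner ℝ (T (candDir m p.1.1 p.1.2 j)) e * ℓ)| ≤ ζ)}
      ≤ ENNReal.ofReal (Real.exp (-(n * ζ))) := by
  have hp1 := (hasClassMoments_posLaw μ hT he ℓ).isProb
  have hp0 := (hasClassMoments_negLaw μ hT he ℓ).isProb
  have hπp : IsProbabilityMeasure π := by rw [hπ]; infer_instance
  have key := exists_threshold (n := n) (μ := μ) hkq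
    (fun w hw c => cond_map_hyperplane μ hT (hTi w hw) _ c)
    (fun w hw c => cond_map_hyperplane μ hT (hTi w hw) _ c)
    (P₁ := posLaw μ T e ℓ) (P₀ := negLaw μ T e ℓ)
    (θ := fun w => inner ℝ (T w) e * ℓ) (by fun_prop) hζ hζq (π.prod π)
    (measurable_candDir (d := d) (q := q) (n := n) m j)
  rw [← hπ] at key
  refine (measure_mono fun p hp => ?_).trans key
  rw [Set.mem_ofPred_eq] at hp ⊢
  push Not at hp
  exact ⟨hp.1, fun b i => not_le.2 (hp.2 b i)⟩

theorem measure_not_score_le (hT : ∀ x y, inner ℝ (T x) y = inner ℝ x (T y)) (he : ‖e‖ = 1)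
    (hq : 0 < q) (hkq : k ≤ q) (ℓ : ℝ) {s : ℝ} (hs0 : 0 ≤ s) (hs : s ≤ 22)
    {π : Measure (Fin n → Fin q → Vec d)}
    (hπ : π = Measure.pi fun _ : Fin n => bagLaw q k (posLaw μ T e ℓ) (negLaw μ T e ℓ))
    (j : Bool × Fin d) (b : Fin n) (i : Fin q) :
    (((π.prod π).prod π).prod π) {p | ¬
      |score k (candDir m p.1.1.1 p.1.1.2 j)
          (-inner ℝ (candDir m p.1.1.1 p.1.1.2 j) (p.1.2 b i)) p.2
        - n * (bagErr q k (posLaw μ T e ℓ) (negLaw μ T e ℓ) (candDir m p.1.1.1 p.1.1.2 j)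
          (-inner ℝ (candDir m p.1.1.1 p.1.1.2 j) (p.1.2 b i)) - k ^ 2)| ≤ n * (s * q ^ 2)}
      ≤ ENNReal.ofReal (2 * Real.exp (-(n * s ^ 2 / 88))) := by
  have hp1 := (hasClassMoments_posLaw μ hT he ℓ).isProb
  have hp0 := (hasClassMoments_negLaw μ hT he ℓ).isProb
  have hπp : IsProbabilityMeasure π := by rw [hπ]; infer_instance
  have hc : Measurable fun p : ((Fin n → Fin q → Vec d) × (Fin n → Fin q → Vec d)) ×
      (Fin n → Fin q → Vec d) => candDir m p.1.1 p.1.2 j :=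
    (measurable_candDir (d := d) (q := q) (n := n) m j).comp measurable_fst
  have hX : Measurable fun p : ((Fin n → Fin q → Vec d) × (Fin n → Fin q → Vec d)) ×
      (Fin n → Fin q → Vec d) => p.2 b i := by fun_prop
  have key := score_deviation_random (n := n) (P₁ := posLaw μ T e ℓ) (P₀ := negLaw μ T e ℓ) hq hkq
    hs0 hs ((π.prod π).prod π) (hc.prodMk (hc.inner hX).neg)
  rw [← hπ] at key
  refine (measure_mono fun p hp => ?_).trans key
  rw [Set.mem_ofPred_eq] at hp ⊢
  exact not_le.1 hp

theorem measure_le_of_union_bound {Ω ι ι' : Type*} [MeasurableSpace Ω] {ρ : Measure Ω} [Fintype ι]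
    [Fintype ι'] {S S₁ : Set Ω} {S₂ : ι → Set Ω} {S₃ : ι' → Set Ω}
    (hS : ∀ p ∈ S, p ∈ S₁ ∨ (∃ j, p ∈ S₂ j) ∨ ∃ x, p ∈ S₃ x) {a b c : ℝ} (ha : 0 ≤ a) (hb : 0 ≤ b)
    (hc : 0 ≤ c) (h₁ : ρ S₁ ≤ ENNReal.ofReal a) (h₂ : ∀ j, ρ (S₂ j) ≤ ENNReal.ofReal b)
    (h₃ : ∀ x, ρ (S₃ x) ≤ ENNReal.ofReal c) :
    ρ S ≤ ENNReal.ofReal (a + Fintype.card ι * b + Fintype.card ι' * c) := by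
  have hsub : S ⊆ S₁ ∪ (⋃ j, S₂ j) ∪ ⋃ x, S₃ x := fun p hp => by
    simpa only [Set.mem_union, Set.mem_iUnion, or_assoc] using hS p hp
  rw [ENNReal.ofReal_add (by positivity) (by positivity), ENNReal.ofReal_add ha (by positivity)]
  have h2 : ρ (⋃ j, S₂ j) ≤ ENNReal.ofReal (Fintype.card ι * b) := by
    refine (measure_iUnion_fintype_le ρ S₂).trans ((Finset.sum_le_sum fun j _ => h₂ j).trans ?_)
    rw [Finset.sum_const, Finset.card_univ, ENNReal.ofReal_mul (Nat.cast_nonneg _),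
      ENNReal.ofReal_natCast, nsmul_eq_mul]
  have h3 : ρ (⋃ x, S₃ x) ≤ ENNReal.ofReal (Fintype.card ι' * c) := by
    refine (measure_iUnion_fintype_le ρ S₃).trans ((Finset.sum_le_sum fun j _ => h₃ j).trans ?_)
    rw [Finset.sum_const, Finset.card_univ, ENNReal.ofReal_mul (Nat.cast_nonneg _),
      ENNReal.ofReal_natCast, nsmul_eq_mul]
  exact (measure_mono hsub).trans ((measure_union_le _ _).trans
    (add_le_add ((measure_union_le _ _).trans (add_le_add h₁ h2)) h3))

/-- The union bound: one event for the operators, one for each of the `2 d` directions, and one for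
each of the `2 d n q` candidate hypotheses. -/
theorem measure_not_goodSample_le (hT : ∀ x y, inner ℝ (T x) y = inner ℝ x (T y)) {lam l : ℝ}
    (hhi : ∀ w, ‖T w‖ ^ 2 ≤ lam * ‖w‖ ^ 2) (hlo : ∀ w, l * ‖w‖ ^ 2 ≤ ‖T w‖ ^ 2) (hl : 0 < l)
    (hlam : 0 ≤ lam) (he : ‖e‖ = 1) (hq : 0 < q) (hkq : k ≤ q) (ℓ : ℝ) {t ζ s : ℝ} (ht0 : 0 ≤ t)
    (ht : t ≤ 22) (hζ : 0 < ζ) (hζq : 2 * ζ < q) (hs0 : 0 ≤ s) (hs : s ≤ 22)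
    {π : Measure (Fin n → Fin q → Vec d)}
    (hπ : π = Measure.pi fun _ : Fin n => bagLaw q k (posLaw μ T e ℓ) (negLaw μ T e ℓ)) :
    (((π.prod π).prod π).prod π)
      {p | ¬ GoodSample m q k μ T e ℓ lam t ζ s p.1.1.1 p.1.1.2 p.1.2 p.2}
      ≤ ENNReal.ofReal (8 * 25 ^ d * Real.exp (-(n * t ^ 2 / 88))
        + 2 * d * Real.exp (-(n * ζ))
        + 2 * d * n * q * (2 * Real.exp (-(n * s ^ 2 / 88)))) := by
  have hp1 := (hasClassMoments_posLaw μ hT he ℓ).isProb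
  have hp0 := (hasClassMoments_negLaw μ hT he ℓ).isProb
  have hπp : IsProbabilityMeasure π := by rw [hπ]; infer_instance
  have hTi : ∀ w, w ≠ 0 → T w ≠ 0 := fun w hw h0 => by
    have h1 : 0 < ‖w‖ := norm_pos_iff.2 hw
    have h2 : 0 < l * ‖w‖ ^ 2 := by positivity
    have h3 := hlo w
    rw [h0] at h3
    simp only [norm_zero] at h3
    linarith
  have e1 := prod_fst_le (ν' := π) (prod_fst_le (ν' := π)
    (measure_not_cov_gap_le hT hhi hlo hl hlam he hq hkq ℓ ht0 ht hπ))
  have e2 := fun j => prod_fst_le (ν' := π)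
    (measure_not_threshold_le (m := m) hT hTi he hkq ℓ hζ hζq hπ j)
  have e3 := fun (x : (Bool × Fin d) × Fin n × Fin q) =>
    measure_not_score_le (m := m) hT he hq hkq ℓ hs0 hs hπ x.1 x.2.1 x.2.2
  have key := measure_le_of_union_bound (ρ := ((π.prod π).prod π).prod π)
    (S := {p | ¬ GoodSample m q k μ T e ℓ lam t ζ s p.1.1.1 p.1.1.2 p.1.2 p.2}) (fun p hp => ?_)
    (by positivity) (by positivity) (by positivity) e1 e2 e3
  · refine key.trans (le_of_eq (congrArg _ ?_))
    simp only [Fintype.card_prod, Fintype.card_bool, Fintype.card_fin]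
    push_cast
    ring
  · by_contra hcon
    rw [not_or, not_or, not_exists, not_exists] at hcon
    obtain ⟨c1, c2, c3⟩ := hcon
    have c1' := by_contra fun hx => c1 hx
    exact hp ⟨c1'.1, c1'.2, fun j => by_contra fun hx => c2 j hx,
      fun j b i => by_contra fun hx => c3 (j, b, i) hx⟩

end

/-! ### The sample size suffices -/

section

/-- The three failure probabilities add up to at most `δ`, given large enough exponents. The number of
candidates grows with the sample, so half of the third exponent is spent on it. -/
theorem failure_sum_le {d n q : ℕ} (hd : 0 < d) {δ x₁ x₂ u : ℝ} (hδ : 0 < δ) (hδ1 : δ < 1)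
    (h₁ : 20 * d * Real.log (2 * d / δ) ≤ x₁) (h₂ : 20 * Real.log (2 * d / δ) ≤ x₂)
    (hu : 20 * Real.log (2 * d / δ) ≤ u) (hn : n * q ≤ Real.exp u) :
    8 * 25 ^ d * Real.exp (-x₁) + 2 * d * Real.exp (-x₂)
      + 2 * d * n * q * (2 * Real.exp (-(2 * u))) ≤ δ := by
  have hd' : (1 : ℝ) ≤ d := by exact_mod_cast hd
  have hd0 : (0 : ℝ) < d := by linarith
  -- `y` is the exponential of minus the logarithm in the hypotheses
  obtain ⟨y, hy⟩ : ∃ y, y = δ / (2 * d) := ⟨_, rfl⟩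
  have hy0 : 0 < y := by rw [hy]; positivity
  have hyd : 2 * d * y = δ := by rw [hy]; field_simp
  have hy1 : y ≤ 1 / 2 := by nlinarith
  have hlog : Real.exp (-(20 * Real.log (2 * d / δ))) = y ^ 20 := by
    rw [hy, ← inv_div, Real.log_inv, mul_neg, neg_neg, show (20 : ℝ) = ((20 : ℕ) : ℝ) by norm_num,
      Real.exp_nat_mul, Real.exp_log (by positivity)]
  have hy20 : y ^ 20 ≤ y * (1 / 2) ^ 19 := by
    rw [pow_succ']
    gcongr
  have e1 : Real.exp (-x₁) ≤ (y ^ 20) ^ d := by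
    rw [← hlog, ← Real.exp_nat_mul]
    exact Real.exp_le_exp.2 (by linarith)
  have e2 : Real.exp (-x₂) ≤ y ^ 20 := by
    rw [← hlog]
    exact Real.exp_le_exp.2 (by linarith)
  have e3 : Real.exp (-u) ≤ y ^ 20 := by
    rw [← hlog]
    exact Real.exp_le_exp.2 (by linarith)
  have t1 : 8 * 25 ^ d * Real.exp (-x₁) ≤ δ / 4 := by
    have h25 : 25 * y ^ 20 ≤ 1 := by norm_num at hy20; linarith
    have h3 : (25 * y ^ 20) ^ d ≤ 25 * y ^ 20 := by
      have := pow_le_pow_of_le_one (by positivity) h25 hd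
      simpa using this
    calc 8 * 25 ^ d * Real.exp (-x₁) ≤ 8 * 25 ^ d * (y ^ 20) ^ d := by gcongr
      _ = 8 * (25 * y ^ 20) ^ d := by rw [mul_pow]; ring
      _ ≤ 8 * (25 * (y * (1 / 2) ^ 19)) := by
        have : 25 * y ^ 20 ≤ 25 * (y * (1 / 2) ^ 19) := by linarith
        linarith
      _ ≤ δ / 4 := by
        have : y ≤ δ := by nlinarith
        norm_num
        linarith
  have t2 : 2 * d * Real.exp (-x₂) ≤ δ / 4 := by
    calc 2 * d * Real.exp (-x₂) ≤ 2 * d * (y * (1 / 2) ^ 19) := by gcongr; exact e2.trans hy20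
      _ = (2 * d * y) * (1 / 2) ^ 19 := by ring
      _ ≤ δ / 4 := by rw [hyd]; norm_num; linarith
  have t3 : 2 * d * n * q * (2 * Real.exp (-(2 * u))) ≤ δ / 4 := by
    have h4 : n * q * Real.exp (-u) ≤ 1 := by
      rw [Real.exp_neg, ← div_eq_mul_inv, div_le_one (Real.exp_pos u)]
      exact hn
    calc 2 * d * n * q * (2 * Real.exp (-(2 * u)))
        = 4 * d * (n * q * Real.exp (-u)) * Real.exp (-u) := by
          rw [show -(2 * u) = -u + -u by ring, Real.exp_add]; ring
      _ ≤ 4 * d * 1 * (y * (1 / 2) ^ 19) := by gcongr; exact e3.trans hy20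
      _ = (2 * d * y) * (2 * (1 / 2) ^ 19) := by ring
      _ ≤ δ / 4 := by rw [hyd]; norm_num; linarith
  linarith

/-- The number of candidates, polynomial in the sample size `n`, is at most exponential in it; the
cubic term of the exponential series suffices. -/
theorem mul_le_exp_of_le {n q z : ℝ} (hz : 0 < z) (hzq : q * z ≤ 1)
    (hn : 2 ^ 96 ≤ n * z ^ 2) : n * q ≤ Real.exp (n * z / 2 ^ 24) := by
  have hn0 : 0 < n := by
    by_contra h
    push Not at h
    nlinarith [sq_nonneg z]
  have h1 : q ≤ n * z := by
    have h2 : q * z ≤ n * z * z := by nlinarith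
    exact le_of_mul_le_mul_right h2 hz
  have h2 := Real.pow_div_factorial_le_exp (x := n * z / 2 ^ 24) (by positivity) 3
  refine le_trans ?_ h2
  have h3 : (n * z / 2 ^ 24) ^ 3 / ((Nat.factorial 3 : ℕ) : ℝ)
      = n * (n * z ^ 2) * (n * z) / (6 * 2 ^ 72) := by
    norm_num [Nat.factorial]
    ring
  rw [h3, le_div_iff₀ (by norm_num)]
  calc n * q * (6 * 2 ^ 72) ≤ n * (n * z) * (6 * 2 ^ 72) := by gcongr
    _ = n * (6 * 2 ^ 72) * (n * z) := by ring
    _ ≤ n * (n * z ^ 2) * (n * z) := by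
      have h4 : (6 * 2 ^ 72 : ℝ) ≤ n * z ^ 2 := le_trans (by norm_num) hn
      exact mul_le_mul_of_nonneg_right (mul_le_mul_of_nonneg_left h4 hn0.le) (by positivity)

theorem half_le_log {d : ℕ} (hd : 0 < d) {δ : ℝ} (hδ : 0 < δ) (hδ1 : δ < 1) :
    1 / 2 ≤ Real.log (2 * d / δ) := by
  have hd' : (1 : ℝ) ≤ d := by exact_mod_cast hd
  have h1 : (2 : ℝ) ≤ 2 * d / δ := by
    rw [le_div_iff₀ hδ]
    nlinarith
  have h2 := Real.log_le_log (by norm_num) h1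
  linarith [Real.log_two_gt_d9]

/-- The iterations of the learner suffice, with as many of them as there are bags. -/
theorem iterations_suffice {d q m : ℕ} (hd : 0 < d) (hq : 0 < q) {ε κ L η : ℝ} (hε : 0 < ε)
    (hκ : 1 ≤ κ) (hL : 1 ≤ L) (hη : η * (2 ^ 23 * q ^ 2 * L ^ 2 * κ) = ε)
    (hm : 2 ^ 40 * (d * q ^ 3 * L ^ 3 * κ ^ 2) ≤ m * ε) :
    √d ≤ 2 ^ m * η ∧ Real.exp (-(m / (136 * d * q * L * κ))) ≤ (3 * η) ^ 2 := by
  have hd' : (1 : ℝ) ≤ d := by exact_mod_cast hd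
  have hq' : (1 : ℝ) ≤ q := by exact_mod_cast hq
  have hd0 : (0 : ℝ) < d := by linarith
  have hq0 : (0 : ℝ) < q := by linarith
  have hκ0 : 0 < κ := by linarith
  have hL0 : 0 < L := by linarith
  have hη0 : 0 < η := by
    have : 0 < 2 ^ 23 * (q : ℝ) ^ 2 * L ^ 2 * κ := by positivity
    exact pos_of_mul_pos_left (by rw [hη]; exact hε) this.le
  -- `x` is the exponent in the claim, and the hypothesis says that `x η` is at least `1`
  obtain ⟨x, hx⟩ : ∃ x, x = m / (136 * d * q * L * κ) := ⟨_, rfl⟩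
  have hxm : x * (136 * d * q * L * κ) = m := by rw [hx]; field_simp
  have hxη : 1 ≤ x * η := by
    have h1 : (x * η) * (136 * 2 ^ 23 * (d * q ^ 3 * L ^ 3 * κ ^ 2)) = m * ε := by
      rw [← hxm, ← hη]; ring
    have h2 : 0 < d * (q : ℝ) ^ 3 * L ^ 3 * κ ^ 2 := by positivity
    generalize d * (q : ℝ) ^ 3 * L ^ 3 * κ ^ 2 = y at *
    by_contra h3
    push Not at h3
    have h4 : (x * η) * (136 * 2 ^ 23 * y) < 1 * (136 * 2 ^ 23 * y) := by gcongr
    norm_num at h4 h1 hm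
    linarith
  have hx0 : 0 < x := pos_of_mul_pos_left (by linarith) hη0.le
  constructor
  · have h1 : √(d : ℝ) ≤ d := by
      rw [Real.sqrt_le_left hd0.le]
      nlinarith
    have h2 : (m : ℝ) ≤ 2 ^ m := by exact_mod_cast (Nat.lt_two_pow_self (n := m)).le
    have h3 : (d : ℝ) ≤ m * η := by
      have h4 : d * 1 ≤ (136 * d * q * L * κ) * (x * η) := by
        have h5 : 1 ≤ 136 * q * L * κ :=
          one_le_mul_of_one_le_of_one_le (one_le_mul_of_one_le_of_one_le (by linarith) hL) hκ
        calc (d : ℝ) * 1 ≤ d * (136 * q * L * κ) * 1 := by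
              rw [mul_one, mul_one]
              exact le_mul_of_one_le_right hd0.le h5
          _ ≤ d * (136 * q * L * κ) * (x * η) := by gcongr
          _ = _ := by ring
      rw [← hxm]
      linarith
    calc √(d : ℝ) ≤ m * η := h1.trans h3
      _ ≤ _ := by gcongr
  · rw [← hx, Real.exp_neg]
    have h1 := Real.pow_div_factorial_le_exp (x := x) hx0.le 2
    norm_num [Nat.factorial] at h1
    rw [inv_le_comm₀ (Real.exp_pos x) (by positivity)]
    refine le_trans ?_ h1
    rw [inv_le_comm₀ (by positivity) (by positivity), inv_div, div_le_iff₀ (by positivity)]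
    have h2 : 1 ≤ (x * η) ^ 2 := one_le_pow₀ hxη
    nlinarith

end

section

variable {d q k m : ℕ}

/-- With `t`, `ε / 512` and `s` the accuracies demanded of a good sample, the probabilities that the
three demands are not met add up to at most `δ`. -/
theorem failure_le (hd : 0 < d) (hq : 0 < q) {n : ℕ} {ε δ κ L t s : ℝ} (hε : 0 < ε) (hε1 : ε < 1)
    (hδ : 0 < δ) (hδ1 : δ < 1) (hκ : 1 ≤ κ) (hL : 1 ≤ L)
    (hn : 2 ^ 97 * (d * Real.log (2 * d / δ) * (q ^ 8 * κ ^ 4 * L ^ 6)) ≤ n * ε ^ 4)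
    (ht : t * (2 ^ 32 * q ^ 4 * L ^ 3 * κ ^ 2) = ε) (hs : s * (2 ^ 8 * q ^ 2) = ε) :
    8 * 25 ^ d * Real.exp (-(n * t ^ 2 / 88)) + 2 * d * Real.exp (-(n * (ε / 512)))
      + 2 * d * n * q * (2 * Real.exp (-(n * s ^ 2 / 88))) ≤ δ := by
  have hd' : (1 : ℝ) ≤ d := by exact_mod_cast hd
  have hq' : (1 : ℝ) ≤ q := by exact_mod_cast hq
  have hq0 : (0 : ℝ) < q := by linarith
  have hκ0 : 0 < κ := by linarith
  have hL0 : 0 < L := by linarith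
  have hn0 : (0 : ℝ) ≤ n := Nat.cast_nonneg n
  have hΛ := half_le_log hd hδ hδ1
  -- as `ε < 1`, the hypothesis with `ε ^ 4` implies those with `ε ^ 2` and `ε`; only the count of
  -- candidates needs the fourth power
  have h4 : (n : ℝ) * ε ^ 4 ≤ n * ε ^ 2 :=
    mul_le_mul_of_nonneg_left (pow_le_pow_of_le_one hε.le hε1.le (by norm_num)) hn0
  have h41 : (n : ℝ) * ε ^ 4 ≤ n * ε := by
    have := mul_le_mul_of_nonneg_left (pow_le_pow_of_le_one hε.le hε1.le (by norm_num : 1 ≤ 4)) hn0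
    simpa using this
  have hq8 : 1 ≤ (q : ℝ) ^ 8 := one_le_pow₀ hq'
  have hκL : 1 ≤ κ ^ 4 * L ^ 6 := one_le_mul_of_one_le_of_one_le (one_le_pow₀ hκ) (one_le_pow₀ hL)
  have ht2 : t ^ 2 * (2 ^ 64 * (q ^ 8 * κ ^ 4 * L ^ 6)) = ε ^ 2 := by rw [← ht]; ring
  have hs2 : s ^ 2 * (2 ^ 16 * q ^ 4) = ε ^ 2 := by rw [← hs]; ring
  obtain ⟨Λ, hΛd⟩ : ∃ Λ, Λ = Real.log (2 * d / δ) := ⟨_, rfl⟩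
  rw [← hΛd] at hn hΛ
  have hΛ0 : 0 < Λ := by linarith
  have hdΛ : Λ ≤ d * Λ := le_mul_of_one_le_left hΛ0.le hd'
  have hu : n * s ^ 2 / 88 = 2 * (n * s ^ 2 / 176) := by ring
  rw [hu]
  have hQ : 1 ≤ (q : ℝ) ^ 8 * κ ^ 4 * L ^ 6 := by
    rw [mul_assoc]; exact one_le_mul_of_one_le_of_one_le hq8 hκL
  have hbig : 2 ^ 97 * (d * Λ) ≤ n * ε ^ 4 := by
    refine le_trans ?_ hn
    exact mul_le_mul_of_nonneg_left (le_mul_of_one_le_right (by positivity) hQ) (by norm_num)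
  refine failure_sum_le hd hδ hδ1 ?_ ?_ ?_ ?_
  · rw [← hΛd]
    have h1 : n * t ^ 2 * (2 ^ 64 * (q ^ 8 * κ ^ 4 * L ^ 6))
        ≥ 2 ^ 33 * (d * Λ) * (2 ^ 64 * (q ^ 8 * κ ^ 4 * L ^ 6)) := by
      rw [mul_assoc, ht2]
      refine le_trans (le_of_eq ?_) (hn.trans h4)
      ring
    have h2 := le_of_mul_le_mul_right h1 (by positivity)
    linarith
  · rw [← hΛd]
    linarith
  · rw [← hΛd]
    have h1 : 2 ^ 81 * Λ * (2 ^ 16 * (q : ℝ) ^ 4) ≤ n * s ^ 2 * (2 ^ 16 * q ^ 4) := by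
      rw [mul_assoc (n : ℝ), hs2]
      refine le_trans ?_ (hn.trans h4)
      have h3 : (q : ℝ) ^ 4 ≤ q ^ 8 * κ ^ 4 * L ^ 6 := by
        calc (q : ℝ) ^ 4 ≤ q ^ 8 := pow_le_pow_right₀ hq' (by norm_num)
          _ ≤ q ^ 8 * (κ ^ 4 * L ^ 6) := le_mul_of_one_le_right (by positivity) hκL
          _ = _ := by ring
      calc 2 ^ 81 * Λ * (2 ^ 16 * (q : ℝ) ^ 4) = 2 ^ 97 * (Λ * q ^ 4) := by ring
        _ ≤ _ := by gcongr
    have h2 := le_of_mul_le_mul_right h1 (by positivity)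
    linarith
  · have hz : 0 < ε ^ 2 / q ^ 4 := by positivity
    have key := mul_le_exp_of_le (n := n) (q := q) (z := ε ^ 2 / q ^ 4) hz ?_ ?_
    · refine key.trans (Real.exp_le_exp.2 ?_)
      have h1 : n * s ^ 2 / 176 = n * (ε ^ 2 / q ^ 4) / (2 ^ 16 * 176) := by
        rw [← hs2]
        field_simp
      rw [h1]
      exact div_le_div_of_nonneg_left (by positivity) (by norm_num) (by norm_num)
    · rw [← mul_div_assoc, div_le_one (by positivity)]
      calc (q : ℝ) * ε ^ 2 ≤ q * 1 := by gcongr; exact pow_le_one₀ hε.le hε1.le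
        _ = q ^ 1 := by ring
        _ ≤ q ^ 4 := pow_le_pow_right₀ hq' (by norm_num)
    · have e1 : n * (ε ^ 2 / q ^ 4) ^ 2 = n * ε ^ 4 / (q : ℝ) ^ 8 := by
        field_simp
      rw [e1, le_div_iff₀ (by positivity)]
      refine le_trans ?_ hn
      have h5 : (1 : ℝ) / 2 ≤ d * Λ := hΛ.trans hdΛ
      calc (2 : ℝ) ^ 96 * q ^ 8 = 2 ^ 97 * (1 / 2 * (q ^ 8 * 1)) := by ring
        _ ≤ 2 ^ 97 * (d * Λ * (q ^ 8 * (κ ^ 4 * L ^ 6))) := by gcongr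
        _ = _ := by ring

theorem measurable_quarters : Measurable fun bags : Fin m → Fin q → Vec d =>
    (((quarter 0 bags, quarter 1 bags), quarter 2 bags), quarter 3 bags) := by
  have h : ∀ a : Fin 4, Measurable fun bags : Fin m → Fin q → Vec d => quarter a bags := fun a =>
    measurable_pi_lambda _ fun b => measurable_pi_apply _
  exact (((h 0).prodMk (h 1)).prodMk (h 2)).prodMk (h 3)

/-- With high probability, the output of the learner, for all orders in which the vectors of the
bags may be presented, has a small error in a bag. -/
theorem learner_bagErr_le {μ : Vec d} {T : Vec d →L[ℝ] Vec d} {e : Vec d}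
    (hT : ∀ x y, inner ℝ (T x) y = inner ℝ x (T y)) {lam l κ : ℝ}
    (hhi : ∀ w, ‖T w‖ ^ 2 ≤ lam * ‖w‖ ^ 2) (hlo : ∀ w, l * ‖w‖ ^ 2 ≤ ‖T w‖ ^ 2) (hl : 0 < l)
    (hκ : lam = κ * l) (hκ1 : 1 ≤ κ) {r : Vec d} (he : ‖e‖ = 1) (hTr0 : T r ≠ 0)
    (hTr : T r = ‖T r‖ • e) (hd : 0 < d) (hk : 1 ≤ k) (hkq : k + 1 ≤ q) {ℓ ε δ : ℝ}
    (hε : 0 < ε) (hε1 : ε < 1) (hδ : 0 < δ) (hδ1 : δ < 1)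
    (hm : 2 ^ 100 * (d * Real.log (2 * d / δ) * (q ^ 8 * κ ^ 4 * logMass ℓ ^ 6)) ≤ m * ε ^ 4) :
    (Measure.pi fun _ : Fin m => bagLaw q k (posLaw μ T e ℓ) (negLaw μ T e ℓ))
      {bags | ¬ ∀ σ : Fin m → Equiv.Perm (Fin q),
        bagErr q k (posLaw μ T e ℓ) (negLaw μ T e ℓ)
          (learner.outVec k fun j i => bags j (σ j i))
          (learner.outOffset k fun j i => bags j (σ j i)) ≤ ε / 64} ≤ ENNReal.ofReal δ := by
  have hp1 := (hasClassMoments_posLaw μ hT he ℓ).isProb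
  have hp0 := (hasClassMoments_negLaw μ hT he ℓ).isProb
  have hL := (one_lt_logMass ℓ).le
  have hq : 0 < q := by omega
  have hd' : (1 : ℝ) ≤ d := by exact_mod_cast hd
  have hq' : (1 : ℝ) ≤ q := by exact_mod_cast hq
  have hq0 : (0 : ℝ) < q := by linarith
  have hκ0 : 0 < κ := by linarith
  have hL0 : 0 < logMass ℓ := by linarith
  have hΛ := half_le_log hd hδ hδ1
  have hlam : 0 ≤ lam := by rw [hκ]; positivity
  have hε4 : ε ^ 4 ≤ ε := by
    simpa using pow_le_pow_of_le_one hε.le hε1.le (by norm_num : 1 ≤ 4)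
  have hm0 : (0 : ℝ) ≤ m := Nat.cast_nonneg m
  have hdΛ : (d : ℝ) * (1 / 2) ≤ d * Real.log (2 * d / δ) := by gcongr
  have hmε : 2 ^ 40 * (d * q ^ 3 * logMass ℓ ^ 3 * κ ^ 2) ≤ m * ε := by
    refine le_trans ?_ (hm.trans (mul_le_mul_of_nonneg_left hε4 hm0))
    have h1 : (q : ℝ) ^ 3 * κ ^ 2 * logMass ℓ ^ 3 ≤ q ^ 8 * κ ^ 4 * logMass ℓ ^ 6 := by
      gcongr <;> first | assumption | norm_num
    calc 2 ^ 40 * (d * q ^ 3 * logMass ℓ ^ 3 * κ ^ 2)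
        = 2 ^ 41 * (d * (1 / 2) * (q ^ 3 * κ ^ 2 * logMass ℓ ^ 3)) := by ring
      _ ≤ 2 ^ 100 * (d * Real.log (2 * d / δ) * (q ^ 8 * κ ^ 4 * logMass ℓ ^ 6)) := by
        gcongr
        · norm_num
        · norm_num
  have hm8 : 8 ≤ m := by
    have h1 : (1 : ℝ) ≤ d * q ^ 3 * logMass ℓ ^ 3 * κ ^ 2 := by
      refine one_le_mul_of_one_le_of_one_le (one_le_mul_of_one_le_of_one_le
        (one_le_mul_of_one_le_of_one_le hd' ?_) ?_) ?_ <;> exact one_le_pow₀ (by assumption)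
    have h2 : (m : ℝ) * ε ≤ m * 1 := by gcongr
    have h3 : (8 : ℝ) ≤ m := by linarith
    exact_mod_cast h3
  -- each quarter of the sample has `n` bags
  obtain ⟨n, hn⟩ : ∃ n, n = m / 4 := ⟨_, rfl⟩
  have hn8 : m ≤ 8 * n := by omega
  have hn0 : 0 < n := by omega
  obtain ⟨t, ht⟩ : ∃ t, t = ε / (2 ^ 32 * q ^ 4 * logMass ℓ ^ 3 * κ ^ 2) := ⟨_, rfl⟩
  obtain ⟨s, hs⟩ : ∃ s, s = ε / (2 ^ 8 * q ^ 2) := ⟨_, rfl⟩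
  have ht0 : 0 ≤ t := by rw [ht]; positivity
  have hs0 : 0 ≤ s := by rw [hs]; positivity
  have ht1 : t ≤ 22 := by
    rw [ht]
    refine (div_le_self hε.le ?_).trans (by linarith)
    refine one_le_mul_of_one_le_of_one_le (one_le_mul_of_one_le_of_one_le
        (one_le_mul_of_one_le_of_one_le (by norm_num) ?_) ?_) ?_ <;> exact one_le_pow₀ (by assumption)
  have hs1 : s ≤ 22 := by
    rw [hs]
    refine (div_le_self hε.le ?_).trans (by linarith)
    exact one_le_mul_of_one_le_of_one_le (by norm_num) (one_le_pow₀ hq')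
  have ht' : t * (2 ^ 32 * q ^ 4 * logMass ℓ ^ 3 * κ ^ 2) = ε := by rw [ht]; field_simp
  have hs' : s * (2 ^ 8 * q ^ 2) = ε := by rw [hs]; field_simp
  obtain ⟨hm1, hm2⟩ := iterations_suffice (η := 512 * t * q ^ 2 * logMass ℓ * κ) hd hq hε hκ1 hL
    (by rw [← ht']; ring) hmε
  have hbad := measure_not_goodSample_le (m := m) (n := n) (μ := μ) (k := k) hT hhi hlo hl hlam he hq
    (by omega) ℓ ht0 ht1 (ζ := ε / 512) (by positivity) (by linarith) hs0 hs1 rfl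
  have hnε : 2 ^ 97 * (d * Real.log (2 * d / δ) * (q ^ 8 * κ ^ 4 * logMass ℓ ^ 6)) ≤ n * ε ^ 4 := by
    have h1 : (m : ℝ) ≤ 8 * n := by exact_mod_cast hn8
    have h2 : (m : ℝ) * ε ^ 4 ≤ 8 * n * ε ^ 4 := by gcongr
    linarith
  have hfail := hbad.trans (ENNReal.ofReal_le_ofReal
    (failure_le hd hq hε hε1 hδ hδ1 hκ1 hL hnε ht' hs'))
  subst hn
  rw [← map_quarters] at hfail
  refine (measure_mono fun bags hbags => ?_).trans
    ((Measure.le_map_apply measurable_quarters.aemeasurable _).trans hfail)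
  rw [Set.mem_preimage, Set.mem_ofPred_eq]
  -- a good sample contains a good candidate, and the selected one has no larger score
  intro hgood
  refine hbags fun σ => ?_
  obtain ⟨j, b, i, hw, hc, hsel⟩ := learner_output_perm (k := k) hd hq (by omega) bags σ rfl rfl
  obtain ⟨j', b', i', hgd⟩ := hgood.exists_bagErr_le hT hhi hlo hl hκ hκ1 he hTr0 hTr hk hkq hn0 hε
    hε1 ht' hm1 hm2
  have h1 := hgood.score j b i
  have h2 := hgood.score j' b' i'
  have h3 := hsel j' b' i'
  rw [hw, hc] at h3 ⊢
  have h4 := bagErr_le_of_score_le hn0 h3 h1 h2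
  have h5 : s * q ^ 2 = ε / 256 := by
    rw [← hs']; ring
  rw [h5] at h4
  linarith

end

/-! ### From the error in a bag to the error of the hypothesis -/

section

variable {d q k : ℕ}

/-- A hypothesis that errs little on each class errs little in total, since each class has mass at
most one. -/
theorem measure_ne_le {D : Measure (Vec d)} [IsProbabilityMeasure D] {f h : Vec d → Fin 2}
    (hf : Measurable f) {ζ : ℝ}
    (h₁ : (D[|{x | f x = 1}]).real {x | h x ≠ 1} ≤ ζ)
    (h₀ : (D[|{x | f x = 0}]).real {x | h x = 1} ≤ ζ) :
    D {x | f x ≠ h x} ≤ ENNReal.ofReal (2 * ζ) := by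
  have hcond : ∀ s A : Set (Vec d), MeasurableSet s → (D[|s]).real A ≤ ζ →
      D (s ∩ A) ≤ ENNReal.ofReal ζ := fun s A hs h => by
    have h2 : D (s ∩ A) ≤ D[|s] A := by
      rw [cond_apply hs]
      exact le_mul_of_one_le_left' (ENNReal.one_le_inv.2 prob_le_one)
    refine h2.trans ?_
    rw [← ofReal_measureReal]
    exact ENNReal.ofReal_le_ofReal h
  have hζ : 0 ≤ ζ := measureReal_nonneg.trans h₁
  have hsub : {x | f x ≠ h x} ⊆ ({x | f x = 1} ∩ {x | h x ≠ 1}) ∪ ({x | f x = 0} ∩ {x | h x = 1}) := by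
    intro x hx
    simp only [Set.mem_ofPred_eq, Set.mem_union, Set.mem_inter_iff] at hx ⊢
    revert hx
    generalize f x = a
    generalize h x = b
    revert a b
    decide
  refine (measure_mono hsub).trans ((measure_union_le _ _).trans ?_)
  rw [two_mul, ENNReal.ofReal_add hζ hζ]
  exact add_le_add (hcond _ _ (hf (measurableSet_singleton 1)) h₁)
    (hcond _ _ (hf (measurableSet_singleton 0)) h₀)

/-- A hypothesis with a small error in a bag is accurate, or, for balanced bags, its complement is. The
complement of `ltf r c` differs from `ltf (-r) (-c)` only on a hyperplane, which has measure zero. -/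
theorem accurate_of_bagErr_le {D : Measure (Vec d)} [IsProbabilityMeasure D] {f : Vec d → Fin 2}
    (hf : Measurable f) {P₁ P₀ : Measure (Vec d)} [IsProbabilityMeasure P₁] [IsProbabilityMeasure P₀]
    (h₁ : D[|{x | f x = 1}] = P₁) (h₀ : D[|{x | f x = 0}] = P₀) {μ : Vec d}
    (hP₁ : ∀ w, w ≠ 0 → ∀ c, P₁ {x | (inner ℝ w (x - μ) : ℝ) = c} = 0)
    (hk : 1 ≤ k) (hkq : k + 1 ≤ q) {ε : ℝ} (hε : 0 < ε) (hε1 : ε < 1) {r : Vec d} {c : ℝ}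
    (h : bagErr q k P₁ P₀ r c ≤ ε / 64) : Accurate f D q k ε r c := by
  have hle : ENNReal.ofReal (2 * (2 * (ε / 64))) ≤ ENNReal.ofReal ε :=
    ENNReal.ofReal_le_ofReal (by linarith)
  have hms := measurableSet_ltf r c 1
  rcases small_of_countErr hk hkq measureReal_nonneg measureReal_le_one measureReal_nonneg
    measureReal_le_one (by linarith) h with ⟨e1, e0⟩ | ⟨hkq2, e1, e0⟩
  · have key : D {x | f x ≠ ltf r c x} ≤ ENNReal.ofReal ε := by
      refine (measure_ne_le (ζ := 2 * (ε / 64)) hf ?_ ?_).trans hle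
      · rw [h₁]
        rw [← probReal_compl_eq_one_sub hms] at e1
        exact e1
      · rw [h₀]
        exact e0
    exact ⟨fun _ => key, fun _ => (min_le_left _ _).trans key⟩
  · refine ⟨fun hne => absurd hkq2 hne, fun _ => (min_le_right _ _).trans ?_⟩
    -- for `r = 0` the hypothesis would be constant, and right on one of the classes
    have hr : r ≠ 0 := by
      rintro rfl
      have hconst : ∀ P : Measure (Vec d), IsProbabilityMeasure P →
          P.real {x | ltf (0 : Vec d) c x = 1} = if 0 < c then 1 else 0 := fun P _ => by
        simp only [ltf_eq_one, inner_zero_left, zero_add]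
        split_ifs with hc <;> simp [hc]
      rw [hconst P₁ inferInstance] at e1
      rw [hconst P₀ inferInstance] at e0
      split_ifs at e1 e0 <;> linarith
    refine (measure_ne_le (ζ := 2 * (ε / 64)) hf ?_ ?_).trans hle
    · rw [h₁]
      refine le_trans (ENNReal.toReal_mono (measure_ne_top _ _) ?_) e1
      have hsub : {x | ltf (-r) (-c) x ≠ 1}
          ⊆ {x | ltf r c x = 1} ∪ {x | (inner ℝ r (x - μ) : ℝ) = -c - inner ℝ r μ} := by
        intro x hx
        simp only [Set.mem_ofPred_eq, Set.mem_union, ne_eq, ltf_eq_one, inner_neg_left, not_lt,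
          inner_sub_right] at hx ⊢
        rcases eq_or_lt_of_le hx with h | h
        · right; linarith
        · left; linarith
      refine (measure_mono hsub).trans ((measure_union_le _ _).trans ?_)
      rw [hP₁ r hr, add_zero]
    · rw [h₀]
      rw [← probReal_compl_eq_one_sub hms] at e0
      refine le_trans (measureReal_mono fun x hx => ?_) e0
      simp only [Set.mem_ofPred_eq, Set.mem_compl_iff, ltf_eq_one, inner_neg_left] at hx ⊢
      linarith

end

/-! ### Gaussian feature vectors -/

section

variable {d q k m : ℕ}

open scoped MatrixOrder

/-- The square root of the covariance matrix, as an operator. -/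
def sqrtOp (S : Matrix (Fin d) (Fin d) ℝ) : Vec d →L[ℝ] Vec d :=
  Matrix.toEuclideanCLM (𝕜 := ℝ) (CFC.sqrt S)

variable {S : Matrix (Fin d) (Fin d) ℝ}

theorem sqrtOp_symm (S : Matrix (Fin d) (Fin d) ℝ) (x y : Vec d) :
    inner ℝ (sqrtOp S x) y = inner ℝ x (sqrtOp S y) := by
  have h : IsSelfAdjoint (sqrtOp S) := (CFC.sqrt_nonneg S).isSelfAdjoint.map _
  rw [← ContinuousLinearMap.adjoint_inner_right, h.adjoint_eq]

theorem norm_sqrtOp_sq (hS : S.PosDef) (w : Vec d) :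
    ‖sqrtOp S w‖ ^ 2 = inner ℝ w (Matrix.toEuclideanCLM (𝕜 := ℝ) S w) := by
  rw [← real_inner_self_eq_norm_sq, sqrtOp_symm, sqrtOp, ← ContinuousLinearMap.comp_apply,
    ← ContinuousLinearMap.mul_def, ← map_mul, CFC.sqrt_mul_sqrt_self _ hS.posSemidef.nonneg]

/-- The quadratic form of the covariance matrix in a basis of eigenvectors. -/
theorem norm_sqrtOp_sq_eq_sum (hS : S.PosDef) (w : Vec d) :
    ‖sqrtOp S w‖ ^ 2 = ∑ i, hS.isHermitian.eigenvalues i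
      * (inner ℝ (hS.isHermitian.eigenvectorBasis i) w) ^ 2 := by
  have hsym : ∀ x y : Vec d, inner ℝ (Matrix.toEuclideanCLM (𝕜 := ℝ) S x) y
      = inner ℝ x (Matrix.toEuclideanCLM (𝕜 := ℝ) S y) := fun x y => by
    have h : IsSelfAdjoint (Matrix.toEuclideanCLM (𝕜 := ℝ) S) :=
      IsSelfAdjoint.map (hS.isHermitian : IsSelfAdjoint S) _
    rw [← ContinuousLinearMap.adjoint_inner_right, h.adjoint_eq]
  have heig : ∀ i, Matrix.toEuclideanCLM (𝕜 := ℝ) S (hS.isHermitian.eigenvectorBasis i)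
      = hS.isHermitian.eigenvalues i • hS.isHermitian.eigenvectorBasis i := fun i => by
    ext l
    have := congrFun (hS.isHermitian.mulVec_eigenvectorBasis i) l
    simpa using this
  rw [norm_sqrtOp_sq hS, ← hS.isHermitian.eigenvectorBasis.sum_inner_mul_inner]
  refine Finset.sum_congr rfl fun i _ => ?_
  rw [← hsym, heig, inner_smul_left, real_inner_comm]
  simp only [conj_trivial]
  ring

theorem norm_sqrtOp_sq_le (hS : S.PosDef) (w : Vec d) :
    ‖sqrtOp S w‖ ^ 2 ≤ lamMax hS * ‖w‖ ^ 2 := by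
  rw [norm_sqrtOp_sq_eq_sum hS, ← hS.isHermitian.eigenvectorBasis.sum_sq_inner_right w,
    Finset.mul_sum]
  exact Finset.sum_le_sum fun i _ => mul_le_mul_of_nonneg_right
    (le_ciSup (Finite.bddAbove_range _) i) (sq_nonneg _)

theorem le_norm_sqrtOp_sq (hS : S.PosDef) (w : Vec d) :
    lamMin hS * ‖w‖ ^ 2 ≤ ‖sqrtOp S w‖ ^ 2 := by
  rw [norm_sqrtOp_sq_eq_sum hS, ← hS.isHermitian.eigenvectorBasis.sum_sq_inner_right w,
    Finset.mul_sum]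
  exact Finset.sum_le_sum fun i _ => mul_le_mul_of_nonneg_right
    (ciInf_le (Finite.bddBelow_range _) i) (sq_nonneg _)

theorem lamMin_pos (hS : S.PosDef) (hd : 0 < d) : 0 < lamMin hS := by
  have : Nonempty (Fin d) := ⟨⟨0, hd⟩⟩
  obtain ⟨i, hi⟩ := exists_eq_ciInf_of_finite (f := hS.isHermitian.eigenvalues)
  rw [lamMin, ← hi]
  exact hS.eigenvalues_pos i

theorem lamMin_le_lamMax (hS : S.PosDef) (hd : 0 < d) : lamMin hS ≤ lamMax hS :=
  (ciInf_le (f := hS.isHermitian.eigenvalues) (Finite.bddBelow_range _) ⟨0, hd⟩).trans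
    (le_ciSup (f := hS.isHermitian.eigenvalues) (Finite.bddAbove_range _) ⟨0, hd⟩)

theorem multivariateGaussian_eq (μ : Vec d) (S : Matrix (Fin d) (Fin d) ℝ) :
    multivariateGaussian μ S = (stdGaussian (Vec d)).map fun g => μ + sqrtOp S g := rfl

/-- The direction in which the two classes differ, for the standard Gaussian vector. -/
def gaussDir (S : Matrix (Fin d) (Fin d) ℝ) (r : Vec d) : Vec d := ‖sqrtOp S r‖⁻¹ • sqrtOp S r

theorem ltf_affine {r : Vec d} (hr : sqrtOp S r ≠ 0) (μ : Vec d) (c : ℝ) (g : Vec d) :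
    ltf r c (μ + sqrtOp S g) = 1 ↔ normOffset μ S r c < inner ℝ (gaussDir S r) g := by
  have h : 0 < ‖sqrtOp S r‖ := norm_pos_iff.2 hr
  have e : normOffset μ S r c = -(c + inner ℝ r μ) / ‖sqrtOp S r‖ := rfl
  rw [ltf_eq_one, e, gaussDir, inner_smul_left, inner_add_right, ← sqrtOp_symm, div_lt_iff₀ h]
  simp only [conj_trivial]
  rw [mul_comm, ← mul_assoc, mul_inv_cancel₀ h.ne', one_mul]
  constructor <;> intro h <;> linarith

/-- The positive class is an affine image of a standard Gaussian vector conditioned on a half-space. -/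
theorem cond_pos {r : Vec d} (hr : sqrtOp S r ≠ 0) (μ : Vec d) (c : ℝ) :
    (multivariateGaussian μ S)[|{x | ltf r c x = 1}]
      = posLaw μ (sqrtOp S) (gaussDir S r) (normOffset μ S r c) := by
  rw [multivariateGaussian_eq, map_cond (by fun_prop) (measurableSet_ltf r c 1), posLaw]
  congr 2
  ext g
  exact ltf_affine hr μ c g

theorem cond_neg {r : Vec d} (hr : sqrtOp S r ≠ 0) (μ : Vec d) (c : ℝ) :
    (multivariateGaussian μ S)[|{x | ltf r c x = 0}]
      = negLaw μ (sqrtOp S) (gaussDir S r) (normOffset μ S r c) := by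
  rw [multivariateGaussian_eq, map_cond (by fun_prop) (measurableSet_ltf r c 0), negLaw]
  congr 2
  ext g
  have := ltf_affine hr μ c g
  simp only [Set.mem_preimage, Set.mem_ofPred_eq, Set.mem_Iic, ← not_lt, ← this, ← fin_two_ne_one]

end

section

variable {d q k m : ℕ}

/-- Powers of the logarithmic factor are absorbed in the mass factor of the sample complexity, by
`x ^ 6 / 6! ≤ exp x`. -/
theorem logMass_pow_le (ℓ : ℝ) : logMass ℓ ^ 6 ≤ 2 ^ 10 / (Phi ℓ * (1 - Phi ℓ)) ^ 2 := by
  have hP : Phi ℓ * (1 - Phi ℓ) = tail ℓ * tail (-ℓ) := by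
    rw [Phi_eq, ← tail_add_tail_neg ℓ]
    ring
  rw [hP]
  have hL := one_lt_logMass ℓ
  have hw0 : 0 < tail ℓ * tail (-ℓ) := mul_pos (tail_pos _) (tail_pos _)
  have hw1 := mass_le ℓ
  have h1 := Real.pow_div_factorial_le_exp (x := logMass ℓ) (by linarith) 6
  rw [logMass, Real.exp_log (by positivity), ← logMass] at h1
  generalize logMass ℓ = L at *
  generalize tail ℓ * tail (-ℓ) = w at *
  have h2 : L ^ 6 / 720 ≤ √2 / w := by
    have e : ((Nat.factorial 6 : ℕ) : ℝ) = 720 := by norm_num [Nat.factorial]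
    rwa [e] at h1
  have h3 : √2 ≤ 1.42 := by
    rw [Real.sqrt_le_left (by norm_num)]
    norm_num
  rw [div_le_div_iff₀ (by norm_num) hw0] at h2
  rw [le_div_iff₀ (by positivity)]
  have h4 : L ^ 6 * w ^ 2 = L ^ 6 * w * w := by ring
  rw [h4]
  have h5 : L ^ 6 * w ≤ 1023 := by linarith
  nlinarith

/-- The sample complexity dominates the quantity that the analysis of the learner demands. -/
theorem le_of_sampleBound_le (hd : 0 < d) {μ : Vec d} {S : Matrix (Fin d) (Fin d) ℝ}
    (hS : S.PosDef) {ℓ ε δ : ℝ} (hε : 0 < ε) (hδ : 0 < δ) (hδ1 : δ < 1)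
    (hm : 2 ^ 110 * sampleBound q μ hS ℓ ε δ ≤ m) :
    2 ^ 100 * (d * Real.log (2 * d / δ)
      * (q ^ 8 * (lamMax hS / lamMin hS) ^ 4 * logMass ℓ ^ 6)) ≤ m * ε ^ 4 := by
  have hl := lamMin_pos hS hd
  have hlam := lamMin_le_lamMax hS hd
  have hΛ := half_le_log hd hδ hδ1
  have hL := logMass_pow_le ℓ
  have hκ : 0 < lamMax hS / lamMin hS := div_pos (by linarith) hl
  have hX : 1 ≤ ((√(lamMax hS) + ‖μ‖) / √(lamMin hS)) ^ 4 := by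
    refine one_le_pow₀ ?_
    rw [one_le_div (Real.sqrt_pos.2 hl)]
    linarith [Real.sqrt_le_sqrt hlam, norm_nonneg μ]
  rw [sampleBound] at hm
  generalize lamMax hS / lamMin hS = κ at *
  generalize ((√(lamMax hS) + ‖μ‖) / √(lamMin hS)) ^ 4 = X at *
  generalize Real.log (2 * d / δ) = Λ at *
  generalize logMass ℓ ^ 6 = L at *
  have hW : 0 ≤ (Phi ℓ * (1 - Phi ℓ)) ^ 2 := sq_nonneg _
  generalize (Phi ℓ * (1 - Phi ℓ)) ^ 2 = W at *
  have h1 : L ≤ 2 ^ 10 * (max 1 (ℓ ^ 2) / W) := by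
    refine hL.trans ?_
    rw [← mul_div_assoc]
    gcongr
    exact le_mul_of_one_le_right (by norm_num) (le_max_left _ _)
  have h2 : 0 ≤ max 1 (ℓ ^ 2) / W := by positivity
  generalize max 1 (ℓ ^ 2) / W = Y at *
  calc 2 ^ 100 * (d * Λ * (q ^ 8 * κ ^ 4 * L))
      ≤ 2 ^ 100 * (d * Λ * (q ^ 8 * κ ^ 4 * (2 ^ 10 * Y))) * X :=
        (by gcongr : _ ≤ 2 ^ 100 * (d * Λ * (q ^ 8 * κ ^ 4 * (2 ^ 10 * Y)))).trans
          (le_mul_of_one_le_right (by positivity) hX)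
    _ = 2 ^ 110 * (d / ε ^ 4 * Y * Λ * κ ^ 4 * X * q ^ 8) * ε ^ 4 := by
      field_simp
    _ ≤ m * ε ^ 4 := by gcongr

/-- The sample is at least as large as the dimension and the bags, so that a running time polynomial
in all three is polynomial in `m`. -/
theorem le_of_sample {κ L Λ ε : ℝ} (hd : 0 < d) (hq : 0 < q) (hε : 0 < ε) (hε1 : ε < 1)
    (hκ : 1 ≤ κ) (hL : 1 ≤ L) (hΛ : 1 / 2 ≤ Λ)
    (hm : 2 ^ 100 * (d * Λ * (q ^ 8 * κ ^ 4 * L ^ 6)) ≤ m * ε ^ 4) : d ≤ m ∧ q ≤ m := by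
  have hd' : (1 : ℝ) ≤ d := by exact_mod_cast hd
  have hq' : (1 : ℝ) ≤ q := by exact_mod_cast hq
  have h1 : (m : ℝ) * ε ^ 4 ≤ m :=
    mul_le_of_le_one_right (Nat.cast_nonneg m) (pow_le_one₀ hε.le hε1.le)
  have hκL : 1 ≤ κ ^ 4 * L ^ 6 := one_le_mul_of_one_le_of_one_le (one_le_pow₀ hκ) (one_le_pow₀ hL)
  have h2 : (d : ℝ) * q ≤ 2 ^ 100 * (d * Λ * (q ^ 8 * κ ^ 4 * L ^ 6)) := by
    calc (d : ℝ) * q = 2 * (d * (1 / 2) * (q ^ 1 * 1)) := by ring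
      _ ≤ 2 ^ 100 * (d * Λ * (q ^ 8 * (κ ^ 4 * L ^ 6))) := by
        gcongr <;> first | assumption | norm_num
      _ = _ := by ring
  have h3 : (d : ℝ) ≤ d * q := le_mul_of_one_le_right (by linarith) hq'
  have h4 : (q : ℝ) ≤ d * q := le_mul_of_one_le_left (by linarith) hd'
  exact ⟨by exact_mod_cast h3.trans (h2.trans (hm.trans h1)),
    by exact_mod_cast h4.trans (h2.trans (hm.trans h1))⟩

/-- The guarantee of the learner for Gaussian feature vectors. -/
theorem learner_accurate (hd : 0 < d) (hk : 1 ≤ k) (hkq : k + 1 ≤ q) (μ : Vec d)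
    {S : Matrix (Fin d) (Fin d) ℝ} (hS : S.PosDef) {r : Vec d} {c : ℝ} (hr : r ≠ 0) {ε δ : ℝ}
    (hε : 0 < ε) (hε1 : ε < 1) (hδ : 0 < δ) (hδ1 : δ < 1)
    (hm : 2 ^ 100 * (d * Real.log (2 * d / δ) * (q ^ 8 * (lamMax hS / lamMin hS) ^ 4
      * logMass (normOffset μ S r c) ^ 6)) ≤ m * ε ^ 4) :
    bagSample (ltf r c) (multivariateGaussian μ S) q k m
      {bags | ¬ ∀ σ : Fin m → Equiv.Perm (Fin q), Accurate (ltf r c) (multivariateGaussian μ S) q k ε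
        (learner.outVec k fun j i => bags j (σ j i))
        (learner.outOffset k fun j i => bags j (σ j i))} ≤ ENNReal.ofReal δ := by
  have hl := lamMin_pos hS hd
  have hlam := lamMin_le_lamMax hS hd
  have hTi : ∀ w, w ≠ 0 → sqrtOp S w ≠ 0 := fun w hw h0 => by
    have h1 : 0 < ‖w‖ := norm_pos_iff.2 hw
    have h2 : 0 < lamMin hS * ‖w‖ ^ 2 := by positivity
    have h3 := le_norm_sqrtOp_sq hS w
    rw [h0] at h3
    simp only [norm_zero] at h3
    linarith
  have hTr := hTi r hr
  have hn : 0 < ‖sqrtOp S r‖ := norm_pos_iff.2 hTr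
  have he : ‖gaussDir S r‖ = 1 := norm_smul_inv_norm hTr
  have hp1 := (hasClassMoments_posLaw μ (sqrtOp_symm S) he (normOffset μ S r c)).isProb
  have hp0 := (hasClassMoments_negLaw μ (sqrtOp_symm S) he (normOffset μ S r c)).isProb
  have key := learner_bagErr_le (μ := μ) (m := m) (ℓ := normOffset μ S r c) (sqrtOp_symm S)
    (norm_sqrtOp_sq_le hS) (le_norm_sqrtOp_sq hS) hl
    (div_mul_cancel₀ _ hl.ne').symm ((one_le_div hl).2 hlam) he hTr
    (by rw [gaussDir, smul_smul, mul_inv_cancel₀ hn.ne', one_smul]) hd hk hkq hε hε1 hδ hδ1 hm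
  have hlaw : bagSample (ltf r c) (multivariateGaussian μ S) q k m
      = Measure.pi fun _ : Fin m => bagLaw q k
        (posLaw μ (sqrtOp S) (gaussDir S r) (normOffset μ S r c))
        (negLaw μ (sqrtOp S) (gaussDir S r) (normOffset μ S r c)) := by
    rw [bagSample, bagOracle, cond_pos hTr, cond_neg hTr]
    rfl
  rw [hlaw]
  refine (measure_mono fun bags hb => ?_).trans key
  rw [Set.mem_ofPred_eq] at hb ⊢
  exact fun h => hb fun σ => accurate_of_bagErr_le (measurable_ltf r c) (cond_pos hTr μ c)
    (cond_neg hTr μ c) (fun w hw c => cond_map_hyperplane μ (sqrtOp_symm S) (hTi w hw) _ c) hk hkq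
    hε hε1 (h σ)

end

end LLP

end

theorem theorem3 :
    ∃ (A : LLP.Prog) (C K : ℝ) (p : ℕ), 0 < C ∧ 0 < K ∧
      ∀ (d q k m : ℕ), 2 < q → 1 ≤ k → k ≤ q - 1 →
      ∀ (μ : LLP.Vec d) (S : Matrix (Fin d) (Fin d) ℝ) (hS : S.PosDef)
        (r : LLP.Vec d) (c : ℝ), r ≠ 0 →
      ∀ (ε δ : ℝ), 0 < ε → ε < 1 → 0 < δ → δ < 1 →
      C * LLP.sampleBound q μ hS (LLP.normOffset μ S r c) ε δ ≤ m →
        -- the running time is polynomial in `m`, on every input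
        (∀ bags : Fin m → Fin q → LLP.Vec d, (A.steps k bags : ℝ) ≤ K * (m : ℝ) ^ p) ∧
        -- with probability at least `1 - δ` over the bags, the output is accurate,
        -- in whatever order the vectors of each bag are presented
        LLP.bagSample (LLP.ltf r c) (multivariateGaussian μ S) q k m
          {bags | ¬ ∀ σ : Fin m → Equiv.Perm (Fin q),
            LLP.Accurate (LLP.ltf r c) (multivariateGaussian μ S) q k ε
              (A.outVec k fun j i => bags j (σ j i))
              (A.outOffset k fun j i => bags j (σ j i))} ≤ ENNReal.ofReal δ := by
  obtain ⟨c₀, p, hsteps⟩ := LLP.learner_steps_le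
  refine ⟨LLP.learner, 2 ^ 110, c₀ * 2 ^ p + 1, p, by positivity, by positivity, ?_⟩
  intro d q k m hq hk hkq μ S hS r c hr ε δ hε hε1 hδ hδ1 hm
  have hd : 0 < d := by
    rcases Nat.eq_zero_or_pos d with rfl | h
    · exact absurd (Subsingleton.elim r 0) hr
    · exact h
  have hm' := LLP.le_of_sampleBound_le hd hS hε hδ hδ1 hm
  refine ⟨fun bags => ?_,
    LLP.learner_accurate hd hk (by omega) μ hS hr hε hε1 hδ hδ1 hm'⟩
  -- The sample bound dominates `d` and `q`, so a bound in terms of `m` alone suffices.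
  obtain ⟨hdm, hqm⟩ := LLP.le_of_sample hd (by omega) hε hε1
    ((one_le_div (LLP.lamMin_pos hS hd)).2 (LLP.lamMin_le_lamMax hS hd))
    (LLP.one_lt_logMass _).le (LLP.half_le_log hd hδ hδ1) hm'
  have h1 : (LLP.learner.steps k bags : ℝ) ≤ c₀ * ((m : ℝ) + 1) ^ p := by
    exact_mod_cast hsteps d q k m m bags hdm hqm (by omega) le_rfl
  have hm1 : (1 : ℝ) ≤ m := by exact_mod_cast (by omega : 1 ≤ m)
  calc (LLP.learner.steps k bags : ℝ) ≤ c₀ * ((m : ℝ) + 1) ^ p := h1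
    _ ≤ c₀ * (2 * (m : ℝ)) ^ p := by
      gcongr
      linarith
    _ = c₀ * 2 ^ p * (m : ℝ) ^ p := by rw [mul_pow]; ring
    _ ≤ (c₀ * 2 ^ p + 1) * (m : ℝ) ^ p := by
      gcongr
      linarith
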